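/- **Setting.** A market $\mathcal I$ consists of finite disjoint sets $U$ (men) and $W$ (women), a set $E\subseteq U\times W$ of acceptable edges, and, for each person $v$, a set $\mathcal R_v$ of ordered pairs of neighbours of $v$, where $(a,b)\in\mathcal R_v$ means that $v$ prefers $a$ to $b$. Write $a\prec_v b$ if $(a,b)\in\mathcal R_v$ and $(b,a)\notin\mathcal R_v$, and $a\sim_v b$ if neither pair is in $\mathcal R_v$. The men have preference lists with ties: the neighbours of $u$ are partitioned into sets $N_1,\dots,N_k$ such that $a\sim_u b$ for $a,b$ in the same set and $a\prec_u b$ if the set of $a$ has the lower index. The women have asymmetric preferences: $(a,b)$ and $(b,a)$ are never both in $\mathcal R_w$ (longer cycles are allowed). Let $n=|U|+|W|$ and $m=|E|$. For a matching $M\subseteq E$, let $M(v)$ be the partner of $v$; every neighbour of $v$ is strictly preferred by $v$ to being unmatched. An edge $uw\in E\setminus M$ blocks $M$ if one of $u,w$ strictly prefers the other to its partner in $M$, and the other one strictly prefers $uw$ to its own partner or finds the two incomparable ($\sim$). $M$ is strongly stable if no edge blocks it. **Algorithm.** Let $\mathcal I'$ arise from $\mathcal I$ by adding for each man $u$ a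 dummy woman $w_u$, acceptable only to $u$ and strictly last on his list. An edge is active if it has carried a proposal and has not been rejected (before or after the proposal). $G_A$ is the graph of active edges. The algorithm works on $\mathcal I'$, starting with no proposals and no rejections. * *Phase 1.* While some man has no active edge: each man without an active edge proposes along all edges in the next tie on his list (his proposal tie); for each new proposal edge $uw$, all edges $u'w$ with $u\prec_w u'$ are rejected; then STRONG\_REJECT is called. * *Phase 2.* Let $U'$ be the critical set of $G_A$, that is, the intersection of all $X\subseteq U$ that maximize $|X|-|\mathcal N_{G_A}(X)|$. If $U'\neq\emptyset$, reject all active edges of all $u\in U'$, call STRONG\_REJECT, and go to Phase 1. * *Output.* Otherwise let $M$ be any maximum matching in $G_A$. If $M$ covers all women who have ever had an active edge, output $M\cap E$; otherwise output "there is no strongly stable matching". * *STRONG\_REJECT.* Let $R=U$. While $R\ne\emptyset$, pick any $u\in R$. If $u$ has exactly one active edge $uw$, reject all $u'w$ with $u'\ne u$, $u'\sim_w u$; if $u$ has no active edge, do this for every $w$ in the proposal tie of $u$. Add to $R$ all men who thereby lost an active edge, and remove $u$ from $R$. **Theorem.** Let one side have preference lists with ties and the other side asymmetric pairwise preferences.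 Then the following hold, for every execution of the algorithm (with any admissible choices). 1. A matching in $\mathcal I'$ is strongly stable if and only if its restriction to $\mathcal I$ is strongly stable and it covers all men. 2. The execution terminates, with an output. 3. No edge that belongs to a strongly stable matching of $\mathcal I'$ is ever rejected. 4. Every woman who has ever had an active edge is matched in all strongly stable matchings of $\mathcal I'$. 5. If the algorithm reaches its output with a maximum matching $M$ that covers all women who have ever had an active edge, then $M$ is strongly stable in $\mathcal I'$ and the output $M\cap E$ is strongly stable in $\mathcal I$. 6. If $\mathcal I'$ admits a strongly stable matching, then any maximum matching in the final $G_A$ covers all women who have ever held a proposal. 7. If $\mathcal I$ admits a strongly stable matching, then the output is a strongly stable matching of $\mathcal I$. 8. Deciding whether $\mathcal I$ admits a strongly stable matching, and finding one if it does, takes $\mathcal O(mn^2+m^2)$ time: there are a single program for a word RAM (words of $O(\log (n+2))$ bits; unit cost for assignment of constants, addition, truncated subtraction, multiplication, array access and comparison) and a constant $C$ such that, on every such instance, given by adjacency lists (the men's with marks between ties) and, for each woman $w$, a list of the pairs in $\mathcal R_w$ in any order, the program halts after at most $C(mn^2+m^2+1)$ steps. It then answers correctly whether a strongly stable matching exists,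 and if so it returns one; its answer is the output of some execution of the algorithm. -/

import Mathlib

/-! # Two-sided markets with pairwise preferences and strong stability -/

namespace PairwiseMarket

/-! ## Pairwise comparisons

A set `R` of ordered pairs is a binary relation; `R a b` reads "`a` is preferred to `b`". -/

/-- `a ≺ b`: `a` is preferred to `b` and `b` is not preferred to `a`. -/
def Prec {α : Type*} (R : α → α → Prop) (a b : α) : Prop := R a b ∧ ¬ R b a

/-- `a ∼ b`: neither of `a`, `b` is preferred to the other. -/
def Incomp {α : Type*} (R : α → α → Prop) (a b : α) : Prop := ¬ R a b ∧ ¬ R b a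

/-- A market: a bipartite graph between men `U` and women `W`, given by its set of edges, and for
each person a set of pairwise comparisons between the neighbours of this person. -/
structure Market (U W : Type*) where
  edges : Set (U × W)
  prefM : U → W → W → Prop
  prefW : W → U → U → Prop
  prefM_edges : ∀ u w w', prefM u w w' → (u, w) ∈ edges ∧ (u, w') ∈ edges
  prefW_edges : ∀ w u u', prefW w u u' → (u, w) ∈ edges ∧ (u', w) ∈ edges

namespace Market

variable {U W : Type*}

/-- Each man has a preference list with ties: his neighbours are clustered into numbered sets;
those in the same set are incomparable, and those in a set with a lower number are strictly
preferred to those in a set with a higher number. -/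
def MenTied (I : Market U W) : Prop :=
  ∀ u, ∃ tie : W → ℕ, ∀ w w', (u, w) ∈ I.edges → (u, w') ∈ I.edges →
    (tie w = tie w' → Incomp (I.prefM u) w w') ∧ (tie w < tie w' → Prec (I.prefM u) w w')

/-- Each woman has asymmetric pairwise preferences. -/
def WomenAsymmetric (I : Market U W) : Prop :=
  ∀ w u u', ¬ (I.prefW w u u' ∧ I.prefW w u' u)

end Market

/-- `M` is a matching that consists of edges of the bipartite graph `G`. -/
def IsMatching {U W : Type*} (G M : Set (U × W)) : Prop :=
  M ⊆ G ∧ (∀ u w w', (u, w) ∈ M → (u, w') ∈ M → w = w') ∧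
    ∀ u u' w, (u, w) ∈ M → (u', w) ∈ M → u = u'

/-- `M` is a matching of maximum cardinality in `G`. -/
def IsMaximumMatching {U W : Type*} (G M : Set (U × W)) : Prop :=
  IsMatching G M ∧ ∀ N, IsMatching G N → N.ncard ≤ M.ncard

/-- `M` covers the man `u`. -/
def CoversMan {U W : Type*} (M : Set (U × W)) (u : U) : Prop := ∃ w, (u, w) ∈ M

/-- `M` covers the woman `w`. -/
def CoversWoman {U W : Type*} (M : Set (U × W)) (w : W) : Prop := ∃ u, (u, w) ∈ M

namespace Market

variable {U W : Type*}

/-- `w ≺_u M(u)`; this holds in particular if `u` is unmatched. -/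
def ManPrefers (I : Market U W) (M : Set (U × W)) (u : U) (w : W) : Prop :=
  ∀ w', (u, w') ∈ M → Prec (I.prefM u) w w'

/-- `w ∼_u M(u)`. -/
def ManIncomp (I : Market U W) (M : Set (U × W)) (u : U) (w : W) : Prop :=
  ∃ w', (u, w') ∈ M ∧ Incomp (I.prefM u) w w'

/-- `u ≺_w M(w)`; this holds in particular if `w` is unmatched. -/
def WomanPrefers (I : Market U W) (M : Set (U × W)) (w : W) (u : U) : Prop :=
  ∀ u', (u', w) ∈ M → Prec (I.prefW w) u u'

/-- `u ∼_w M(w)`. -/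
def WomanIncomp (I : Market U W) (M : Set (U × W)) (w : W) (u : U) : Prop :=
  ∃ u', (u', w) ∈ M ∧ Incomp (I.prefW w) u u'

/-- The edge `uw` blocks `M` in the sense of strong stability. -/
def Blocks (I : Market U W) (M : Set (U × W)) (u : U) (w : W) : Prop :=
  (u, w) ∈ I.edges ∧ (u, w) ∉ M ∧
    (((I.ManPrefers M u w ∨ I.ManIncomp M u w) ∧ I.WomanPrefers M w u) ∨
      (I.ManPrefers M u w ∧ (I.WomanPrefers M w u ∨ I.WomanIncomp M w u)))

/-- `M` is a strongly stable matching. -/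
def StronglyStable (I : Market U W) (M : Set (U × W)) : Prop :=
  IsMatching I.edges M ∧ ∀ u w, ¬ I.Blocks M u w

/-- The market in which each man `u` has received an additional woman `Sum.inr u`, who is
acceptable to `u` only and stands strictly at the end of his list. -/
def withDummies (I : Market U W) : Market U (W ⊕ U) where
  edges := {e | match e.2 with
    | Sum.inl w => (e.1, w) ∈ I.edges
    | Sum.inr v => v = e.1}
  prefM u x y := match x, y with
    | Sum.inl w, Sum.inl w' => I.prefM u w w'
    | Sum.inl w, Sum.inr v => (u, w) ∈ I.edges ∧ v = u
    | Sum.inr _, _ => False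
  prefW x u u' := match x with
    | Sum.inl w => I.prefW w u u'
    | Sum.inr _ => False
  prefM_edges := by
    rintro u (w | v) (w' | v') h
    · exact I.prefM_edges u w w' h
    · exact h
    · exact h.elim
    · exact h.elim
  prefW_edges := by
    rintro (w | v) u u' h
    · exact I.prefW_edges w u u' h
    · exact h.elim

end Market

/-- `M ∩ E`: the restriction to the original market of a matching of the market with dummies. -/
def restrict {U W : Type*} (M : Set (U × (W ⊕ U))) : Set (U × W) :=
  {e | (e.1, Sum.inl e.2) ∈ M}

/-! ## The critical set -/

/-- The deficiency `|X| - |N(X)|` of a set `X` of men in the bipartite graph `G`. -/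
noncomputable def deficiency {U V : Type*} (G : Set (U × V)) (X : Set U) : ℤ :=
  (X.ncard : ℤ) - ({w | ∃ u ∈ X, (u, w) ∈ G} : Set V).ncard

/-- The critical set of `G`: the intersection of all sets of men of maximum deficiency. -/
def criticalSet {U V : Type*} (G : Set (U × V)) : Set U :=
  {u | ∀ X : Set U, (∀ Y : Set U, deficiency G Y ≤ deficiency G X) → u ∈ X}

/-! ## The proposal algorithm -/

/-- The point that an execution has reached: the head of the loop of the first phase, the head of
the loop of the routine STRONG_REJECT with its current set `R`, the beginning of the second phase,
or the end, where the output is a matching or, for `none`, "there is no strongly stable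
matching". -/
inductive Loc (U V : Type*) where
  | phase1 : Loc U V
  | strongReject (R : Set U) : Loc U V
  | phase2 : Loc U V
  | output (o : Option (Set (U × V))) : Loc U V

/-- A configuration of the algorithm: the edges that have carried a proposal, the edges that have
been rejected, the women who have ever had an active edge, and the current location. -/
structure Config (U V : Type*) where
  proposed : Set (U × V)
  rejected : Set (U × V)
  everActive : Set V
  loc : Loc U V

namespace Config

variable {U V : Type*}

/-- The graph `G_A` of active edges: proposal edges that are not rejected (neither before nor after
the proposal). -/
def active (c : Config U V) : Set (U × V) := c.proposed \ c.rejected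

/-- The next tie on the list of `u`: the best women to whom he has not proposed. -/
def nextTie (J : Market U V) (c : Config U V) (u : U) : Set V :=
  {w | (u, w) ∈ J.edges ∧ (u, w) ∉ c.proposed ∧
    ∀ w', (u, w') ∈ J.edges → (u, w') ∉ c.proposed → ¬ Prec (J.prefM u) w' w}

/-- The proposal tie of `u`: the tie along which he has proposed last. -/
def proposalTie (J : Market U V) (c : Config U V) (u : U) : Set V :=
  {w | (u, w) ∈ c.proposed ∧ ∀ w', (u, w') ∈ c.proposed → ¬ Prec (J.prefM u) w w'}

/-- The edges along which the men without active edges are about to propose. -/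
def newProposals (J : Market U V) (c : Config U V) : Set (U × V) :=
  {e | ¬ CoversMan c.active e.1 ∧ e.2 ∈ c.nextTie J e.1}

/-- The edges that are rejected while the man `u` is examined by STRONG_REJECT. -/
def strongRejected (J : Market U V) (c : Config U V) (u : U) : Set (U × V) :=
  {e | e ∈ J.edges ∧ e.1 ≠ u ∧ Incomp (J.prefW e.2) e.1 u ∧
    ((∀ w, (u, w) ∈ c.active ↔ w = e.2) ∨
      (¬ CoversMan c.active u ∧ e.2 ∈ c.proposalTie J u))}

/-- At the start all edges are inactive. -/
def initial (U V : Type*) : Config U V where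
  proposed := ∅
  rejected := ∅
  everActive := ∅
  loc := Loc.phase1

/-- The steps of the algorithm. -/
inductive Step (J : Market U V) : Config U V → Config U V → Prop
  /-- Each man without an active edge proposes along the next tie on his list; the new proposal
  edges that are not rejected become active; then `w` rejects all `u'w` with `u ≺_w u'` for each
  new proposal edge `uw`, and STRONG_REJECT is called. -/
  | propose (c : Config U V) (hloc : c.loc = Loc.phase1) (hu : ∃ u, ¬ CoversMan c.active u) :
      Step J c
        { proposed := c.proposed ∪ c.newProposals J
          rejected := c.rejected ∪
            {e | e ∈ J.edges ∧ ∃ u, (u, e.2) ∈ c.newProposals J ∧ Prec (J.prefW e.2) u e.1}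
          everActive := c.everActive ∪ {w | ∃ u, (u, w) ∈ c.newProposals J \ c.rejected}
          loc := Loc.strongReject Set.univ }
  /-- If each man has an active edge, then the first phase is over. -/
  | endPhase1 (c : Config U V) (hloc : c.loc = Loc.phase1) (hu : ∀ u, CoversMan c.active u) :
      Step J c { c with loc := Loc.phase2 }
  /-- One round of the loop of STRONG_REJECT: a man `u ∈ R` is examined and removed from `R`; the
  men who lose an active edge are added to `R`. -/
  | strongReject (c : Config U V) (R : Set U) (u : U) (hloc : c.loc = Loc.strongReject R)
      (hu : u ∈ R) :
      Step J c
        { c with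
          rejected := c.rejected ∪ c.strongRejected J u
          loc := Loc.strongReject
            ((R ∪ {u' | ∃ w, (u', w) ∈ c.strongRejected J u ∧ (u', w) ∈ c.active}) \ {u}) }
  /-- STRONG_REJECT ends when `R` is empty; both of its calls are followed by the first phase. -/
  | endStrongReject (c : Config U V) (hloc : c.loc = Loc.strongReject ∅) :
      Step J c { c with loc := Loc.phase1 }
  /-- If the critical set is not empty, then all active edges of its members are rejected. -/
  | rejectCritical (c : Config U V) (hloc : c.loc = Loc.phase2)
      (hcrit : (criticalSet c.active).Nonempty) :
      Step J c
        { c with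
          rejected := c.rejected ∪ {e | e ∈ c.active ∧ e.1 ∈ criticalSet c.active}
          loc := Loc.strongReject Set.univ }
  /-- If the critical set is empty, take any maximum matching `M` of active edges; if it covers all
  women who have ever had an active edge, it is the output. -/
  | outputMatching (c : Config U V) (M : Set (U × V)) (hloc : c.loc = Loc.phase2)
      (hcrit : criticalSet c.active = ∅) (hM : IsMaximumMatching c.active M)
      (hcov : ∀ w ∈ c.everActive, CoversWoman M w) :
      Step J c { c with loc := Loc.output (some M) }
  /-- If it does not cover all of them, the output is negative. -/
  | outputNone (c : Config U V) (M : Set (U × V)) (hloc : c.loc = Loc.phase2)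
      (hcrit : criticalSet c.active = ∅) (hM : IsMaximumMatching c.active M)
      (hcov : ¬ ∀ w ∈ c.everActive, CoversWoman M w) :
      Step J c { c with loc := Loc.output none }

end Config

/-- `c` occurs in some execution of the algorithm on the market `I`; the initialization adds the
dummy women. -/
def Reachable {U W : Type*} (I : Market U W) (c : Config U (W ⊕ U)) : Prop :=
  Relation.ReflTransGen (Config.Step I.withDummies) (Config.initial U (W ⊕ U)) c

/-! ## A word RAM

Programs are structured (sequence, branching, loops) and use finitely many registers and arrays,
all of them addressed by number; registers and array cells hold natural numbers. -/

/-- Programs. -/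
inductive Prog where
  | skip : Prog
  /-- `x := k` -/
  | const (x k : ℕ) : Prog
  /-- `x := y + z` -/
  | add (x y z : ℕ) : Prog
  /-- `x := y - z`, truncated at zero -/
  | sub (x y z : ℕ) : Prog
  /-- `x := y * z` -/
  | mul (x y z : ℕ) : Prog
  /-- `x := A_a[y]` -/
  | load (x a y : ℕ) : Prog
  /-- `A_a[y] := x` -/
  | store (a y x : ℕ) : Prog
  | seq (p q : Prog) : Prog
  /-- if `x < y` then `p` else `q` -/
  | ifLt (x y : ℕ) (p q : Prog) : Prog
  /-- while `x < y` do `p` -/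
  | whileLt (x y : ℕ) (p : Prog) : Prog

/-- The contents of the registers and of the arrays. -/
structure Memory where
  reg : ℕ → ℕ
  arr : ℕ → ℕ → ℕ

/-- Write `v` into register `x`. -/
def Memory.setReg (s : Memory) (x v : ℕ) : Memory :=
  { s with reg := Function.update s.reg x v }

/-- Write `v` into cell `i` of array `a`. -/
def Memory.setArr (s : Memory) (a i v : ℕ) : Memory :=
  { s with arr := Function.update s.arr a (Function.update (s.arr a) i v) }

/-- `Exec B p s t s'`: started in memory `s`, the program `p` halts in memory `s'` after exactly `t`
steps, and no value above `B` is ever computed (an operation whose result exceeds `B` cannot be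
carried out). Each elementary operation and each test is one step. -/
inductive Exec (B : ℕ) : Prog → Memory → ℕ → Memory → Prop
  | skip (s : Memory) : Exec B Prog.skip s 1 s
  | const (s : Memory) (x k : ℕ) (h : k ≤ B) : Exec B (Prog.const x k) s 1 (s.setReg x k)
  | add (s : Memory) (x y z : ℕ) (h : s.reg y + s.reg z ≤ B) :
      Exec B (Prog.add x y z) s 1 (s.setReg x (s.reg y + s.reg z))
  | sub (s : Memory) (x y z : ℕ) :
      Exec B (Prog.sub x y z) s 1 (s.setReg x (s.reg y - s.reg z))
  | mul (s : Memory) (x y z : ℕ) (h : s.reg y * s.reg z ≤ B) :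
      Exec B (Prog.mul x y z) s 1 (s.setReg x (s.reg y * s.reg z))
  | load (s : Memory) (x a y : ℕ) :
      Exec B (Prog.load x a y) s 1 (s.setReg x (s.arr a (s.reg y)))
  | store (s : Memory) (a y x : ℕ) :
      Exec B (Prog.store a y x) s 1 (s.setArr a (s.reg y) (s.reg x))
  | seq (p q : Prog) (s s₁ s₂ : Memory) (t₁ t₂ : ℕ) (h₁ : Exec B p s t₁ s₁)
      (h₂ : Exec B q s₁ t₂ s₂) : Exec B (Prog.seq p q) s (t₁ + t₂) s₂
  | ifTrue (x y : ℕ) (p q : Prog) (s s' : Memory) (t : ℕ) (h : s.reg x < s.reg y)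
      (hp : Exec B p s t s') : Exec B (Prog.ifLt x y p q) s (1 + t) s'
  | ifFalse (x y : ℕ) (p q : Prog) (s s' : Memory) (t : ℕ) (h : ¬ s.reg x < s.reg y)
      (hq : Exec B q s t s') : Exec B (Prog.ifLt x y p q) s (1 + t) s'
  | whileTrue (x y : ℕ) (p : Prog) (s s₁ s₂ : Memory) (t₁ t₂ : ℕ) (h : s.reg x < s.reg y)
      (h₁ : Exec B p s t₁ s₁) (h₂ : Exec B (Prog.whileLt x y p) s₁ t₂ s₂) :
      Exec B (Prog.whileLt x y p) s (1 + t₁ + t₂) s₂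
  | whileFalse (x y : ℕ) (p : Prog) (s : Memory) (h : ¬ s.reg x < s.reg y) :
      Exec B (Prog.whileLt x y p) s 1 s

/-! ## Representation of the input and of the output -/

/-- A presentation of a market by lists: the list of each man is the list of his ties, best tie
first; a woman has the list of her neighbours and the list of her pairwise comparisons. Apart from
this the order of the lists is arbitrary. -/
structure Presentation {a b : ℕ} (I : Market (Fin a) (Fin b)) where
  ties : Fin a → List (List (Fin b))
  nbrs : Fin b → List (Fin a)
  comps : Fin b → List (Fin a × Fin a)
  ties_ne : ∀ u, ∀ T ∈ ties u, T ≠ []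
  ties_nodup : ∀ u, (ties u).flatten.Nodup
  mem_ties : ∀ u w, w ∈ (ties u).flatten ↔ (u, w) ∈ I.edges
  ties_same : ∀ u, ∀ T ∈ ties u, ∀ w ∈ T, ∀ w' ∈ T, Incomp (I.prefM u) w w'
  ties_lt : ∀ u, (ties u).Pairwise fun T T' => ∀ w ∈ T, ∀ w' ∈ T', Prec (I.prefM u) w w'
  nbrs_nodup : ∀ w, (nbrs w).Nodup
  mem_nbrs : ∀ w u, u ∈ nbrs w ↔ (u, w) ∈ I.edges
  comps_nodup : ∀ w, (comps w).Nodup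
  mem_comps : ∀ w u u', (u, u') ∈ comps w ↔ I.prefW w u u'

/-- The lists `L 0, L 1, …` written one after another. -/
def concat {k : ℕ} {α : Type*} (L : Fin k → List α) : List α := (List.finRange k).flatMap L

/-- The `k + 1` positions where the lists `L 0, …, L (k - 1)` start in `concat L`, and where the
last one ends. -/
def offsets {k : ℕ} {α : Type*} (L : Fin k → List α) : List ℕ :=
  (List.range (k + 1)).map fun i => (((List.finRange k).take i).flatMap L).length

/-- The delimiters of a list of ties: the mark `1` at the first entry of each tie, `0` elsewhere. -/
def tieMarks {α : Type*} (T : List (List α)) : List ℕ :=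
  T.flatMap fun t => (List.range t.length).map fun i => if i = 0 then 1 else 0

/-- The input. Registers `0` and `1` hold the numbers of men and of women. Arrays `0`, `1`, `2`: the
adjacency lists of the men (where they start, their entries, the delimiters of the ties); arrays
`3`, `4`: the adjacency lists of the women; arrays `5`, `6`, `7`: the comparisons of the women
(where the lists start, first components, second components). Everything else is zero. -/
def Presentation.memory {a b : ℕ} {I : Market (Fin a) (Fin b)} (P : Presentation I) : Memory where
  reg x := match x with
    | 0 => a
    | 1 => b
    | _ => 0
  arr x i := match x with
    | 0 => (offsets fun u => (P.ties u).flatten).getD i 0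
    | 1 => ((concat fun u => (P.ties u).flatten).map fun w => (w : ℕ)).getD i 0
    | 2 => (concat fun u => tieMarks (P.ties u)).getD i 0
    | 3 => (offsets P.nbrs).getD i 0
    | 4 => ((concat P.nbrs).map fun u => (u : ℕ)).getD i 0
    | 5 => (offsets P.comps).getD i 0
    | 6 => ((concat P.comps).map fun p => (p.1 : ℕ)).getD i 0
    | 7 => ((concat P.comps).map fun p => (p.2 : ℕ)).getD i 0
    | _ => 0

/-- The memory `s` holds the positive answer, with the matching `M`: register `2` is `1`, and cell
`u` of array `8` is `w + 1` if `u` is matched to `w`, and `0` if `u` is unmatched. -/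
def AnswersMatching {a b : ℕ} (s : Memory) (M : Set (Fin a × Fin b)) : Prop :=
  s.reg 2 = 1 ∧ ∀ u : Fin a,
    (∀ w : Fin b, (u, w) ∈ M ↔ s.arr 8 u = w + 1) ∧ (¬ CoversMan M u → s.arr 8 u = 0)

/-- The memory `s` holds the negative answer: register `2` is `0`. -/
def AnswersNone (s : Memory) : Prop := s.reg 2 = 0

end PairwiseMarket

/-! Fix a strongly stable matching `M` of the market with dummies. It covers all men, since an
unmatched man and his dummy woman would block.

No edge of `M` is ever rejected (`Config.Invariant.rejected_notMem`). A first such rejection would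
yield a blocking edge `uw` in which `u` has not yet proposed to his partner in `M`, so that this
partner is not better than `w`. If the rejection follows a new proposal `uw`, then `w` strictly
prefers `u` to her partner. If it happens while `u` is examined by STRONG_REJECT, then `w` finds `u`
incomparable to her partner, and the partner of `u` is strictly worse than `w`. If it concerns the
critical set `C`, let `S` be the set of men in `C` whose edges in `M` are active. Some `u` in `C \
S` has an active edge to a partner of `S`; otherwise removing `S` from `C` would lose at least as
many neighbours as men, against the minimality of `C`.

A man who has proposed to `w` has no better partner in `M`, so an unmatched `w` would block with
him. Thus all women with proposals are covered by `M`, there are at most `|U|` of them, and a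
matching of active edges that covers all men must cover all of them
(`Config.Invariant.coversWoman_of_exists`).

At the end the critical set is empty. This is Hall's condition, and every maximum matching of active
edges covers all men. Suppose that it also covers all women who have ever been active, and let `uw`
be an edge that `u` does not like less than his own. Then `u` has proposed to `w`. If `w` strictly
preferred `u`, she would have rejected her partner. If she finds the two incomparable and `u`
strictly prefers `w`, then `u` has moved past the tie of `w`, and her partner was rejected on that
occasion. So nothing blocks (`Config.Invariant.stronglyStable_of_covers`). Termination holds since
every step enlarges the proposals or rejections, shrinks `R`, or advances the location towards the
output.

For the running time, an array program simulates some execution. Each man has an interval of his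
list as proposal tie and a state from `0` to `3`; rejections are kept in a table. The set `R` is not
stored, because an examination of a man outside `R` has no effect (`exists_strongReject`), and
proposals to dummy women leave no trace. The program keeps one matching throughout and searches for
alternating paths by breadth-first search. A search that fails has found exactly the critical set
(`criticalSet_eq`). Every event costs a multiple of `(a + 1) * (b + 1)` steps and, unless it gives
the answer, lowers a potential that starts at no more than five times the number of edges. The
program is written in a small structured language with a calculus for results and step counts, and
is compiled to the word RAM with exact preservation of the number of steps. -/

namespace PairwiseMarket

/-! ### Ranked lists and the invariant of an execution -/

open Config

/-- A market in which every man `u` has the preference list with ties given by the ranks `t u`, the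
women have asymmetric preferences, and `d u` is a neighbour of `u` who has no other neighbours. -/
structure Market.Ranked {U V : Type*} (J : Market U V) (t : U → V → ℕ) (d : U → V) : Prop where
  prec_iff : ∀ {u w w'}, (u, w) ∈ J.edges → (u, w') ∈ J.edges →
    (Prec (J.prefM u) w w' ↔ t u w < t u w')
  incomp_iff : ∀ {u w w'}, (u, w) ∈ J.edges → (u, w') ∈ J.edges →
    (Incomp (J.prefM u) w w' ↔ t u w = t u w')
  asymm : J.WomenAsymmetric
  dummy_mem : ∀ u, (u, d u) ∈ J.edges
  dummy_unique : ∀ {u u'}, (u', d u) ∈ J.edges → u' = u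

namespace Market.Ranked

variable {U V : Type*} {J : Market U V} {t : U → V → ℕ} {d : U → V}

theorem prec_of_not (hJ : J.Ranked t d) {w : V} {u u' : U} (h1 : ¬ Prec (J.prefW w) u u')
    (h2 : ¬ Incomp (J.prefW w) u u') : Prec (J.prefW w) u' u := by
  have := hJ.asymm w u u'
  simp only [Prec, Incomp] at *
  tauto

theorem mem_nextTie (hJ : J.Ranked t d) {c : Config U V} {u : U} {w : V} :
    w ∈ c.nextTie J u ↔ (u, w) ∈ J.edges ∧ (u, w) ∉ c.proposed ∧
      ∀ w', (u, w') ∈ J.edges → (u, w') ∉ c.proposed → t u w ≤ t u w' := by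
  simp only [nextTie, Set.mem_ofPred_eq]
  constructor
  · rintro ⟨h1, h2, h3⟩
    refine ⟨h1, h2, fun w' h h' => ?_⟩
    have := h3 w' h h'
    rw [hJ.prec_iff h h1] at this
    omega
  · rintro ⟨h1, h2, h3⟩
    refine ⟨h1, h2, fun w' h h' => ?_⟩
    rw [hJ.prec_iff h h1]
    have := h3 w' h h'
    omega

theorem mem_proposalTie (hJ : J.Ranked t d) {c : Config U V} (hs : c.proposed ⊆ J.edges) {u : U}
    {w : V} : w ∈ c.proposalTie J u ↔ (u, w) ∈ c.proposed ∧
      ∀ w', (u, w') ∈ c.proposed → t u w' ≤ t u w := by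
  simp only [proposalTie, Set.mem_ofPred_eq]
  refine and_congr_right fun h => forall₂_congr fun w' h' => ?_
  rw [hJ.prec_iff (hs h) (hs h')]
  omega

end Market.Ranked

theorem Config.mem_active {U V : Type*} {c : Config U V} {e : U × V} :
    e ∈ c.active ↔ e ∈ c.proposed ∧ e ∉ c.rejected := Iff.rfl

theorem Prec.ne {α : Type*} {R : α → α → Prop} {a b : α} (h : Prec R a b) : a ≠ b := by
  rintro rfl; exact h.2 h.1

/-- The outcome of an examination depends only on the proposals and on the active edges of the man
examined. This is why STRONG_REJECT has to return only to men who lose an active edge. -/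
theorem Config.strongRejected_congr {U V : Type*} {J : Market U V} {c c' : Config U V} {u : U}
    (hp : c.proposed = c'.proposed) (ha : ∀ w, (u, w) ∈ c.active ↔ (u, w) ∈ c'.active) :
    c.strongRejected J u = c'.strongRejected J u := by
  simp only [strongRejected, proposalTie, CoversMan, ha, hp]

/-- The properties that hold throughout an execution. -/
structure Config.Invariant {U V : Type*} (J : Market U V) (t : U → V → ℕ) (d : U → V)
    (c : Config U V) : Prop where
  proposed_edges : c.proposed ⊆ J.edges
  proposed_up : ∀ {u w w'}, (u, w) ∈ c.proposed → (u, w') ∈ J.edges → t u w' ≤ t u w →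
    (u, w') ∈ c.proposed
  active_last : ∀ {u w w'}, (u, w) ∈ c.active → (u, w') ∈ c.proposed → t u w' ≤ t u w
  rejected_edges : c.rejected ⊆ J.edges
  -- The proposal need not be active: a woman rejects worse men even on behalf of a proposal that is
  -- itself already rejected.
  rejected_worse : ∀ {u u' w}, (u', w) ∈ c.proposed → Prec (J.prefW w) u' u → (u, w) ∈ J.edges →
    (u, w) ∈ c.rejected
  -- A new proposal may run along an edge that is already rejected and then never becomes active.
  -- Its woman has been active before by this clause, which keeps the next one true.
  ever_of_rejected : ∀ {u w}, (u, w) ∈ c.rejected → w ∈ c.everActive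
  ever_of_proposed : ∀ {u w}, (u, w) ∈ c.proposed → w ∈ c.everActive
  proposed_of_ever : ∀ {w}, w ∈ c.everActive → ∃ u, (u, w) ∈ c.proposed
  -- Once `u` has moved past the tie of `w`, all rivals incomparable to him at `w` are gone. This
  -- excludes blocking edges that are strict for the man only.
  rejected_past : ∀ {u u' w w'}, (u, w) ∈ c.proposed → (u, w') ∈ c.proposed → t u w < t u w' →
    u' ≠ u → (u', w) ∈ J.edges → Incomp (J.prefW w) u' u → (u', w) ∈ c.rejected
  -- The head of the first phase counts as STRONG_REJECT with an empty set `R`.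
  strong : ∀ R, (c.loc = Loc.strongReject R ∨ c.loc = Loc.phase1 ∧ R = ∅) → ∀ u, u ∉ R →
    c.strongRejected J u ⊆ c.rejected
  dummy : ∀ u, (u, d u) ∉ c.rejected
  phase2 : c.loc = Loc.phase2 → ∀ u, CoversMan c.active u
  output : ∀ o, c.loc = Loc.output o → criticalSet c.active = ∅ ∧
    ∃ M, IsMaximumMatching c.active M ∧
      ((o = some M ∧ ∀ w ∈ c.everActive, CoversWoman M w) ∨
        (o = none ∧ ¬ ∀ w ∈ c.everActive, CoversWoman M w))

/-! ### Supermodularity of the deficiency, the critical set and Hall's theorem -/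

section Deficiency

variable {U V : Type*} [Finite U] [Finite V]

/-- Cardinality is modular. The neighbourhood of a union is the union of the neighbourhoods, whereas
that of an intersection is merely contained in their intersection. -/
theorem deficiency_supermodular (G : Set (U × V)) (X Y : Set U) :
    deficiency G X + deficiency G Y ≤ deficiency G (X ∪ Y) + deficiency G (X ∩ Y) := by
  set N : Set U → Set V := fun X => {w | ∃ u ∈ X, (u, w) ∈ G} with hN
  have h1 := Set.ncard_union_add_ncard_inter X Y (Set.toFinite _) (Set.toFinite _)
  have h2 := Set.ncard_union_add_ncard_inter (N X) (N Y) (Set.toFinite _) (Set.toFinite _)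
  have h3 : N (X ∪ Y) = N X ∪ N Y := by
    ext w
    simp only [hN, Set.mem_ofPred_eq, Set.mem_union]
    constructor
    · rintro ⟨u, h | h, h'⟩
      exacts [Or.inl ⟨u, h, h'⟩, Or.inr ⟨u, h, h'⟩]
    · rintro (⟨u, h, h'⟩ | ⟨u, h, h'⟩)
      exacts [⟨u, Or.inl h, h'⟩, ⟨u, Or.inr h, h'⟩]
  have h4 : (N (X ∩ Y)).ncard ≤ (N X ∩ N Y).ncard := by
    refine Set.ncard_le_ncard ?_ (Set.toFinite _)
    rintro w ⟨u, h, h'⟩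
    exact ⟨⟨u, h.1, h'⟩, ⟨u, h.2, h'⟩⟩
  simp only [deficiency]
  change _ - ((N X).ncard : ℤ) + (_ - ((N Y).ncard : ℤ)) ≤
    _ - ((N (X ∪ Y)).ncard : ℤ) + (_ - ((N (X ∩ Y)).ncard : ℤ))
  rw [h3]
  omega

/-- By supermodularity the sets of maximum deficiency are closed under intersection. One of minimum
cardinality is therefore contained in all of them, so it is the critical set. -/
theorem deficiency_le_criticalSet (G : Set (U × V)) (Y : Set U) :
    deficiency G Y ≤ deficiency G (criticalSet G) := by
  have hS : {X : Set U | ∀ Y, deficiency G Y ≤ deficiency G X}.Nonempty :=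
    Finite.exists_max (deficiency G)
  obtain ⟨X, hX, hmin⟩ := Set.exists_min_image _ Set.ncard (Set.toFinite _) hS
  have : criticalSet G = X := by
    apply Set.Subset.antisymm
    · intro u hu
      exact hu X hX
    · intro u hu Z hZ
      have hXZ : ∀ Y, deficiency G Y ≤ deficiency G (X ∩ Z) := by
        intro Y
        have h1 := deficiency_supermodular G X Z
        have h2 := hX (X ∪ Z)
        have h3 := hZ Y
        omega
      have hle := hmin _ hXZ
      have := Set.eq_of_subset_of_ncard_le (Set.inter_subset_left (s := X) (t := Z)) hle
      rw [← this] at hu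
      exact hu.2
  rw [this]
  exact hX Y

/-- The minimality of the critical set in the form in which it is applied: no member can be removed
without lowering the deficiency. -/
theorem criticalSet_subset {G : Set (U × V)} {X : Set U}
    (h : deficiency G (criticalSet G) ≤ deficiency G X) : criticalSet G ⊆ X :=
  fun _ hu => hu X fun Y => (deficiency_le_criticalSet G Y).trans h

omit [Finite V] in
theorem IsMatching.ncard_le {G M : Set (U × V)} (hM : IsMatching G M) : M.ncard ≤ Nat.card U := by
  rw [← Set.ncard_univ]
  refine Set.ncard_le_ncard_of_injOn Prod.fst (fun _ _ => Set.mem_univ _) ?_ (Set.toFinite _)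
  rintro ⟨u, w⟩ h ⟨u', w'⟩ h' (rfl : u = u')
  rw [hM.2.1 _ _ _ h h']

theorem ncard_eq_of_coversMan {G M : Set (U × V)} (hM : IsMatching G M)
    (h : ∀ u, CoversMan M u) : M.ncard = Nat.card U := by
  refine le_antisymm hM.ncard_le ?_
  rw [← Set.ncard_univ]
  choose f hf using h
  refine Set.ncard_le_ncard_of_injOn (fun u => (u, f u)) (fun u _ => hf u) ?_ (Set.toFinite _)
  intro u _ u' _ h
  exact congrArg Prod.fst h

omit [Finite V] in
theorem coversMan_of_card {G M : Set (U × V)} (hM : IsMatching G M)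
    (h : Nat.card U ≤ M.ncard) (u : U) : CoversMan M u := by
  have h1 : (Prod.fst '' M).ncard = M.ncard := by
    refine Set.InjOn.ncard_image ?_
    rintro ⟨u, w⟩ h ⟨u', w'⟩ h' (rfl : u = u')
    rw [hM.2.1 _ _ _ h h']
  have h2 : Prod.fst '' M = Set.univ := by
    refine Set.eq_of_subset_of_ncard_le (Set.subset_univ _) ?_ (Set.toFinite _)
    rw [h1, Set.ncard_univ]
    exact h
  obtain ⟨⟨u', w⟩, h, rfl⟩ : u ∈ Prod.fst '' M := h2 ▸ Set.mem_univ u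
  exact ⟨w, h⟩

theorem exists_isMaximumMatching (G : Set (U × V)) : ∃ M, IsMaximumMatching G M := by
  obtain ⟨M, hM, hmax⟩ := Set.exists_max_image {M | IsMatching G M} Set.ncard (Set.toFinite _)
    ⟨∅, Set.empty_subset _, by simp, by simp⟩
  exact ⟨M, hM, hmax⟩

/-- If the critical set is empty, then a maximum matching covers all men. -/
theorem IsMaximumMatching.coversMan {G M : Set (U × V)} (hM : IsMaximumMatching G M)
    (h : criticalSet G = ∅) (u : U) : CoversMan M u := by
  classical
  have := Fintype.ofFinite U
  have := Fintype.ofFinite V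
  have hall : ∀ s : Finset U, s.card ≤ (s.biUnion fun u => {w | (u, w) ∈ G}.toFinset).card := by
    intro s
    -- The empty set has deficiency zero, so the maximality of the critical set is Hall's condition.
    have h1 := deficiency_le_criticalSet G (s : Set U)
    rw [h] at h1
    simp only [deficiency, Set.mem_empty_iff_false, false_and, exists_false, Set.ofPred_false,
      Set.ncard_empty, Set.ncard_coe_finset] at h1
    have h2 : {w | ∃ u ∈ (s : Set U), (u, w) ∈ G} =
        ((s.biUnion fun u => {w | (u, w) ∈ G}.toFinset : Finset V) : Set V) := by
      ext w; simp
    rw [h2, Set.ncard_coe_finset] at h1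
    omega
  obtain ⟨f, hf, hG⟩ := (Finset.all_card_le_biUnion_card_iff_exists_injective _).1 hall
  have hN : IsMatching G (Set.range fun u => (u, f u)) := by
    refine ⟨?_, ?_, ?_⟩
    · rintro _ ⟨u, rfl⟩
      simpa using hG u
    · rintro u w w' ⟨_, h1⟩ ⟨_, h2⟩
      simp only [Prod.mk.injEq] at h1 h2
      rw [← h1.2, ← h2.2, h1.1, h2.1]
    · rintro u u' w ⟨v, h1⟩ ⟨v', h2⟩
      simp only [Prod.mk.injEq] at h1 h2
      rw [← h1.1, ← h2.1]
      exact hf (h1.2.trans h2.2.symm)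
  refine coversMan_of_card hM.1 ?_ u
  rw [← ncard_eq_of_coversMan hN fun u => ⟨f u, u, rfl⟩]
  exact hM.2 _ hN

end Deficiency

/-! ### Preservation of the invariant -/

section Invariance

variable {U V : Type*} {J : Market U V} {t : U → V → ℕ} {d : U → V}

theorem Config.Invariant.initial (J : Market U V) (t : U → V → ℕ) (d : U → V) :
    (Config.initial U V).Invariant J t d where
  proposed_edges := Set.empty_subset _
  proposed_up h := h.elim
  active_last h := h.1.elim
  rejected_edges := Set.empty_subset _
  rejected_worse h := h.elim
  ever_of_rejected h := h.elim
  ever_of_proposed h := h.elim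
  proposed_of_ever h := h.elim
  rejected_past h := h.elim
  strong := by
    rintro R - u - e ⟨_, _, _, h | h⟩
    · exact ((h e.2).2 rfl).1.elim
    · exact h.2.1.elim
  dummy _ h := h.elim
  phase2 h := by cases h
  output _ h := by cases h

theorem Config.strongRejected_proposed {c : Config U V} {u : U} {e : U × V}
    (h : e ∈ c.strongRejected J u) : (u, e.2) ∈ c.proposed := by
  obtain ⟨_, _, _, h | h⟩ := h
  · exact ((h e.2).2 rfl).1
  · exact h.2.1

namespace Config.Invariant

/-- The dummy woman of `u` has no other neighbour. Removing `u` from the critical set thus removes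
at least one woman from its neighbourhood, and the deficiency would not drop. Hence dummy edges
survive the second phase. -/
theorem dummy_notMem_critical [Finite U] [Finite V] (hJ : J.Ranked t d) {c : Config U V}
    (hc : c.Invariant J t d) {u : U} (h : (u, d u) ∈ c.active) : u ∉ criticalSet c.active := by
  intro hu
  set C := criticalSet c.active with hC
  have hle : deficiency c.active C ≤ deficiency c.active (C \ {u}) := by
    have h1 := Set.ncard_sdiff_singleton_add_one hu (Set.toFinite _)
    have h2 : d u ∈ {w | ∃ u ∈ C, (u, w) ∈ c.active} := ⟨u, hu, h⟩
    have h3 := Set.ncard_sdiff_singleton_add_one h2 (Set.toFinite _)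
    have h4 : {w | ∃ v ∈ C \ {u}, (v, w) ∈ c.active}.ncard ≤
        ({w | ∃ u ∈ C, (u, w) ∈ c.active} \ {d u}).ncard := by
      refine Set.ncard_le_ncard ?_ (Set.toFinite _)
      rintro w ⟨v, hv, hvw⟩
      refine ⟨⟨v, hv.1, hvw⟩, ?_⟩
      rintro rfl
      exact hv.2 (hJ.dummy_unique (hc.proposed_edges hvw.1))
    simp only [deficiency]
    omega
  exact (criticalSet_subset hle hu).2 rfl

theorem step [Finite U] [Finite V] (hJ : J.Ranked t d) {c c' : Config U V}
    (hc : c.Invariant J t d) (h : Step J c c') : c'.Invariant J t d := by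
  cases h with
  | propose hloc hu =>
    have hnew : ∀ {u w}, (u, w) ∈ c.newProposals J → (∀ w, (u, w) ∉ c.active) ∧
        (u, w) ∈ J.edges ∧ (u, w) ∉ c.proposed ∧
          ∀ w', (u, w') ∈ J.edges → (u, w') ∉ c.proposed → t u w ≤ t u w' := by
      rintro u w ⟨h1, h2⟩
      exact ⟨fun w hw => h1 ⟨w, hw⟩, hJ.mem_nextTie.1 h2⟩
    have hever : ∀ {u w}, (u, w) ∈ c.proposed ∪ c.newProposals J →
        w ∈ c.everActive ∪ {w | ∃ u, (u, w) ∈ c.newProposals J \ c.rejected} := by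
      rintro u w (h | h)
      · exact Or.inl (hc.ever_of_proposed h)
      · by_cases h' : (u, w) ∈ c.rejected
        · exact Or.inl (hc.ever_of_rejected h')
        · exact Or.inr ⟨u, h, h'⟩
    refine ⟨?_, ?_, ?_, ?_, ?_, ?_, ?_, ?_, ?_, ?_, ?_, ?_, ?_⟩
    · rintro ⟨u, w⟩ (h | h)
      · exact hc.proposed_edges h
      · exact (hnew h).2.1
    · rintro u w w' (h | h) h' hle
      · exact Or.inl (hc.proposed_up h h' hle)
      · by_cases hp : (u, w') ∈ c.proposed
        · exact Or.inl hp
        · refine Or.inr ⟨h.1, hJ.mem_nextTie.2 ⟨h', hp, fun x hx hx' => ?_⟩⟩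
          exact hle.trans ((hnew h).2.2.2 x hx hx')
    · rintro u w w' ⟨h | h, hr⟩ h'
      · have hact : (u, w) ∈ c.active := ⟨h, fun h => hr (Or.inl h)⟩
        rcases h' with h' | h'
        · exact hc.active_last hact h'
        · exact ((hnew h').1 w hact).elim
      · rcases h' with h' | h'
        · by_contra hlt
          exact (hnew h).2.2.1 (hc.proposed_up h' (hnew h).2.1 (by omega))
        · exact (hnew h').2.2.2 _ (hnew h).2.1 (hnew h).2.2.1
    · rintro e (h | h)
      · exact hc.rejected_edges h
      · exact h.1
    · rintro u u' w (h | h) hp he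
      · exact Or.inl (hc.rejected_worse h hp he)
      · exact Or.inr ⟨he, u', h, hp⟩
    · rintro u w (h | ⟨_, u', h, _⟩)
      · exact Or.inl (hc.ever_of_rejected h)
      · exact hever (Or.inr h)
    · exact hever
    · rintro w (h | ⟨u, h, _⟩)
      · obtain ⟨u, h⟩ := hc.proposed_of_ever h
        exact ⟨u, Or.inl h⟩
      · exact ⟨u, Or.inr h⟩
    · rintro u u' w w' h h' hlt hne he hinc
      left
      rcases h with h | h
      · rcases h' with h' | h'
        · exact hc.rejected_past h h' hlt hne he hinc
        -- A new proposal of `u` means that he has no active edge. If the tie of `w` was his last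
        -- one, STRONG_REJECT has already treated it in the form for men without active edges;
        -- otherwise he had moved past it before.
        · by_cases hx : ∀ x, (u, x) ∈ c.proposed → t u x ≤ t u w
          · exact hc.strong ∅ (Or.inr ⟨hloc, rfl⟩) u (Set.notMem_empty _)
              ⟨he, hne, hinc, Or.inr ⟨h'.1, (hJ.mem_proposalTie hc.proposed_edges).2 ⟨h, hx⟩⟩⟩
          · push Not at hx
            obtain ⟨x, hx, hlt⟩ := hx
            exact hc.rejected_past h hx hlt hne he hinc
      · rcases h' with h' | h'
        · exact ((hnew h).2.2.1 (hc.proposed_up h' (hnew h).2.1 hlt.le)).elim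
        · have := (hnew h').2.2.2 _ (hnew h).2.1 (hnew h).2.2.1
          omega
    · rintro R (h | h) u hu
      · cases h
        exact (hu (Set.mem_univ u)).elim
      · cases h.1
    · rintro u (h | ⟨he, u', h, hp⟩)
      · exact hc.dummy u h
      · exact hp.ne (hJ.dummy_unique (hnew h).2.1)
    · intro h; cases h
    · intro o h; cases h
  | endPhase1 hloc hu =>
    refine { hc with strong := ?_, phase2 := fun _ => hu, output := ?_ }
    · rintro R (h | h)
      · cases h
      · cases h.1
    · intro o h; cases h
  | strongReject R u hloc hu =>
    refine ⟨hc.proposed_edges, hc.proposed_up, ?_, ?_, ?_, ?_, hc.ever_of_proposed,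
      hc.proposed_of_ever, ?_, ?_, ?_, ?_, ?_⟩
    · rintro u w w' ⟨h, hr⟩ h'
      exact hc.active_last ⟨h, fun h => hr (Or.inl h)⟩ h'
    · rintro e (h | h)
      · exact hc.rejected_edges h
      · exact h.1
    · rintro u u' w h hp he
      exact Or.inl (hc.rejected_worse h hp he)
    · rintro u' w (h | h)
      · exact hc.ever_of_rejected h
      · exact hc.ever_of_proposed (strongRejected_proposed h)
    · rintro u u' w w' h h' hlt hne he hinc
      exact Or.inl (hc.rejected_past h h' hlt hne he hinc)
    · rintro R' (h | h) v hv
      · cases h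
        -- A man outside the new set is `u` or was outside the old one. In both cases he loses no
        -- active edge now, since an examination never rejects edges of the man examined.
        have key : (v = u ∨ ∀ w, (v, w) ∈ c.active → (v, w) ∉ c.strongRejected J u) ∧
            (v = u ∨ v ∉ R) := by
          by_cases hvu : v = u
          · exact ⟨Or.inl hvu, Or.inl hvu⟩
          · simp only [Set.mem_sdiff, Set.mem_union, Set.mem_ofPred_eq, Set.mem_singleton_iff, hvu,
              not_false_eq_true, and_true, not_or, not_exists, not_and] at hv
            exact ⟨Or.inr fun w h h' => hv.2 w h' h, Or.inr hv.1⟩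
        intro e he
        replace he : e ∈ c.strongRejected J v := by
          refine (Set.ext_iff.1 (strongRejected_congr (c := c) ?_ ?_) e).2 he
          · rfl
          intro w
          simp only [mem_active, Set.mem_union, not_or]
          constructor
          · rintro ⟨h1, h2⟩
            refine ⟨h1, h2, ?_⟩
            rcases key.1 with rfl | h
            · exact fun h => h.2.1 rfl
            · exact h w ⟨h1, h2⟩
          · rintro ⟨h1, h2, -⟩
            exact ⟨h1, h2⟩
        rcases key.2 with rfl | h
        · exact Or.inr he
        · exact Or.inl (hc.strong R (Or.inl hloc) v h he)
      · cases h.1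
    · rintro v (h | h)
      · exact hc.dummy v h
      · exact h.2.1 (hJ.dummy_unique (hc.proposed_edges (strongRejected_proposed h))).symm
    · intro h; cases h
    · intro o h; cases h
  | endStrongReject hloc =>
    refine { hc with strong := ?_, phase2 := ?_, output := ?_ }
    · rintro R (h | h) u hu
      · cases h
      · exact hc.strong ∅ (Or.inl hloc) u (Set.notMem_empty _)
    · intro h; cases h
    · intro o h; cases h
  | rejectCritical hloc hcrit =>
    refine ⟨hc.proposed_edges, hc.proposed_up, ?_, ?_, ?_, ?_, hc.ever_of_proposed,
      hc.proposed_of_ever, ?_, ?_, ?_, ?_, ?_⟩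
    · rintro u w w' ⟨h, hr⟩ h'
      exact hc.active_last ⟨h, fun h => hr (Or.inl h)⟩ h'
    · rintro e (h | h)
      · exact hc.rejected_edges h
      · exact hc.proposed_edges h.1.1
    · rintro u u' w h hp he
      exact Or.inl (hc.rejected_worse h hp he)
    · rintro u' w (h | h)
      · exact hc.ever_of_rejected h
      · exact hc.ever_of_proposed h.1.1
    · rintro u u' w w' h h' hlt hne he hinc
      exact Or.inl (hc.rejected_past h h' hlt hne he hinc)
    · rintro R' (h | h) v hv
      · cases h
        exact (hv (Set.mem_univ v)).elim
      · cases h.1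
    · rintro v (h | h)
      · exact hc.dummy v h
      · exact hc.dummy_notMem_critical hJ h.1 h.2
    · intro h; cases h
    · intro o h; cases h
  | outputMatching M hloc hcrit hM hcov =>
    refine { hc with strong := ?_, phase2 := ?_, output := ?_ }
    · rintro R (h | h)
      · cases h
      · cases h.1
    · intro h; cases h
    · intro o h; cases h
      exact ⟨hcrit, M, hM, Or.inl ⟨rfl, hcov⟩⟩
  | outputNone M hloc hcrit hM hcov =>
    refine { hc with strong := ?_, phase2 := ?_, output := ?_ }
    · rintro R (h | h)
      · cases h
      · cases h.1
    · intro h; cases h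
    · intro o h; cases h
      exact ⟨hcrit, M, hM, Or.inr ⟨rfl, hcov⟩⟩

theorem of_reachable [Finite U] [Finite V] (hJ : J.Ranked t d) {c : Config U V}
    (h : Relation.ReflTransGen (Step J) (Config.initial U V) c) : c.Invariant J t d := by
  induction h with
  | refl => exact initial J t d
  | tail _ h ih => exact ih.step hJ h

end Config.Invariant

end Invariance

/-! ## Strongly stable matchings and the algorithm -/

section Correctness

variable {U V : Type*} [Finite U] [Finite V] {J : Market U V} {t : U → V → ℕ} {d : U → V}
  {c : Config U V} {M : Set (U × V)}

omit [Finite U] [Finite V] in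
theorem Market.Ranked.blocks_of_le (hJ : J.Ranked t d) (hM : M ⊆ J.edges) {u : U} {w w₀ : V}
    (hmat : ∀ w', (u, w') ∈ M → w' = w₀) (h₀ : (u, w₀) ∈ M)
    (he : (u, w) ∈ J.edges) (hn : (u, w) ∉ M) (hle : t u w ≤ t u w₀)
    (hp : J.WomanPrefers M w u) : J.Blocks M u w := by
  refine ⟨he, hn, Or.inl ⟨?_, hp⟩⟩
  rcases hle.lt_or_eq with h | h
  · left
    intro w' hw'
    rw [hmat w' hw']
    exact (hJ.prec_iff he (hM h₀)).2 h
  · right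
    exact ⟨w₀, h₀, (hJ.incomp_iff he (hM h₀)).2 h⟩

omit [Finite U] [Finite V] in
theorem Market.Ranked.blocks_of_lt (hJ : J.Ranked t d) (hM : M ⊆ J.edges) {u : U} {w w₀ : V}
    (hmat : ∀ w', (u, w') ∈ M → w' = w₀) (h₀ : (u, w₀) ∈ M)
    (he : (u, w) ∈ J.edges) (hn : (u, w) ∉ M) (hlt : t u w < t u w₀)
    (hp : J.WomanPrefers M w u ∨ J.WomanIncomp M w u) : J.Blocks M u w := by
  refine ⟨he, hn, Or.inr ⟨?_, hp⟩⟩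
  intro w' hw'
  rw [hmat w' hw']
  exact (hJ.prec_iff he (hM h₀)).2 hlt

omit [Finite U] [Finite V] in
-- The dummy woman of an unmatched man is unmatched too, and the two would block.
theorem Market.Ranked.coversMan (hJ : J.Ranked t d) (hM : J.StronglyStable M) (u : U) :
    CoversMan M u := by
  by_contra h
  refine hM.2 u (d u) ⟨hJ.dummy_mem u, fun h' => h ⟨_, h'⟩, Or.inl ⟨Or.inl ?_, ?_⟩⟩
  · intro w hw
    exact (h ⟨w, hw⟩).elim
  · intro u' hu'
    have := hJ.dummy_unique (hM.1.1 hu')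
    subst this
    exact (h ⟨_, hu'⟩).elim

namespace Config.Invariant

omit [Finite U] [Finite V] in
-- If `w` were worse than `w₀`, then `(u, w₀)` would have carried a proposal as well and, belonging
-- to `M`, would still be active. But active edges lie in the last tie.
theorem le_of_proposed (hc : c.Invariant J t d) (hM : J.StronglyStable M)
    (hr : ∀ e ∈ c.rejected, e ∉ M) {u : U} {w w₀ : V} (hp : (u, w) ∈ c.proposed)
    (h₀ : (u, w₀) ∈ M) : t u w ≤ t u w₀ := by
  by_contra hlt
  have h1 := hc.proposed_up hp (hM.1.1 h₀) (by omega)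
  exact hlt (hc.active_last ⟨h1, fun h => hr _ h h₀⟩ hp)

/-- In each of the three kinds of rejection, the blocking edge comes from a man who has not yet
proposed to his partner in `M`. -/
theorem rejected_notMem_of_step (hJ : J.Ranked t d) {c c' : Config U V} (hc : c.Invariant J t d)
    (h : Step J c c') (hM : J.StronglyStable M) (hr : ∀ e ∈ c.rejected, e ∉ M) :
    ∀ e ∈ c'.rejected, e ∉ M := by
  have hmat : ∀ {u w₀}, (u, w₀) ∈ M → ∀ w', (u, w') ∈ M → w' = w₀ :=
    fun h₀ w' hw' => hM.1.2.1 _ _ _ hw' h₀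
  cases h with
  | propose hloc hu =>
    rintro e (h | ⟨he, u, hnew, hp⟩) heM
    · exact hr e h heM
    · obtain ⟨w₀, h₀⟩ := hJ.coversMan hM u
      obtain ⟨h1, h2⟩ := hnew
      rw [hJ.mem_nextTie] at h2
      have hne : (u, e.2) ∉ M := fun h => hp.ne (hM.1.2.2 _ _ _ h heM)
      refine hM.2 u e.2 (hJ.blocks_of_le hM.1.1 (hmat h₀) h₀ h2.1 hne (h2.2.2 w₀ (hM.1.1 h₀) ?_) ?_)
      · exact fun h => h1 ⟨w₀, h, fun h' => hr _ h' h₀⟩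
      · intro u' hu'
        rwa [hM.1.2.2 _ _ _ hu' heM]
  | endPhase1 hloc hu => exact hr
  | strongReject R u hloc hu =>
    rintro e (h | h) heM
    · exact hr e h heM
    · have hprop := strongRejected_proposed h
      obtain ⟨he, hne, hinc, h⟩ := h
      obtain ⟨w₀, h₀⟩ := hJ.coversMan hM u
      have hn : (u, e.2) ∉ M := fun h => hne (hM.1.2.2 _ _ _ heM h)
      have hw₀ : (u, w₀) ∉ c.proposed := by
        intro hp
        have hact : (u, w₀) ∈ c.active := ⟨hp, fun h' => hr _ h' h₀⟩
        rcases h with h | h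
        · have := (h w₀).1 hact
          subst this
          exact hn h₀
        · exact h.1 ⟨_, hact⟩
      refine hM.2 u e.2 (hJ.blocks_of_lt hM.1.1 (hmat h₀) h₀ (hc.proposed_edges hprop) hn ?_ ?_)
      · by_contra hlt
        exact hw₀ (hc.proposed_up hprop (hM.1.1 h₀) (by omega))
      · exact Or.inr ⟨e.1, heM, hinc.2, hinc.1⟩
  | endStrongReject hloc => exact hr
  | rejectCritical hloc hcrit =>
    rintro ⟨u₀, w₁⟩ (h | h) heM
    · exact hr _ h heM
    set C := criticalSet c.active with hC
    set S : Set U := {u | u ∈ C ∧ ∃ w, (u, w) ∈ M ∧ (u, w) ∈ c.active} with hS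
    have hu₀ : u₀ ∈ S := ⟨h.2, w₁, heM, h.1⟩
    have hSC : S ⊆ C := fun u hu => hu.1
    -- Otherwise the partners of `S`, at least as many as `S` has members, would disappear from the
    -- neighbourhood when `S` is removed from `C`. The smaller set would still have maximum
    -- deficiency.
    have hex : ∃ u ∈ C \ S, ∃ u' ∈ S, ∃ w, (u, w) ∈ c.active ∧ (u', w) ∈ M ∧
        (u', w) ∈ c.active := by
      by_contra hcon
      push Not at hcon
      set N := {w | ∃ u ∈ C, (u, w) ∈ c.active}
      set N' := {w | ∃ u ∈ C \ S, (u, w) ∈ c.active}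
      set T : Set V := {w | ∃ u ∈ S, (u, w) ∈ M ∧ (u, w) ∈ c.active} with hT
      have h1 : N' ⊆ N \ T := by
        rintro w ⟨u, hu, hw⟩
        refine ⟨⟨u, hu.1, hw⟩, ?_⟩
        rintro ⟨u', hu', h1, h2⟩
        exact hcon u hu u' hu' w hw h1 h2
      have h2 : T ⊆ N := by
        rintro w ⟨u, hu, _, hw⟩
        exact ⟨u, hu.1, hw⟩
      have h3 : S.ncard ≤ T.ncard := by
        have : Nonempty V := ⟨w₁⟩
        choose! f hf using fun u (hu : u ∈ S) => hu.2
        refine Set.ncard_le_ncard_of_injOn f (fun u hu => ⟨u, hu, hf u hu⟩) ?_ (Set.toFinite _)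
        intro u hu u' hu' hff
        have h4 := (hf u hu).1
        rw [hff] at h4
        exact hM.1.2.2 _ _ _ h4 (hf u' hu').1
      have h5 := Set.ncard_le_ncard h1 (Set.toFinite _)
      have h6 := Set.ncard_sdiff_add_ncard_of_subset h2 (Set.toFinite _)
      have h7 := Set.ncard_sdiff_add_ncard_of_subset hSC (Set.toFinite _)
      have hle : deficiency c.active C ≤ deficiency c.active (C \ S) := by
        simp only [deficiency]
        change (C.ncard : ℤ) - (N.ncard : ℤ) ≤ ((C \ S).ncard : ℤ) - (N'.ncard : ℤ)
        omega
      exact (criticalSet_subset hle h.2).2 hu₀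
    obtain ⟨u, hu, u', hu', w, hw, hwM, hw'⟩ := hex
    obtain ⟨w₀, h₀⟩ := hJ.coversMan hM u
    -- A proposal to the partner would still be active and put `u` into `S`. So the partner is
    -- strictly worse than `w`.
    have hw₀ : (u, w₀) ∉ c.proposed := fun hp =>
      hu.2 ⟨hu.1, w₀, h₀, hp, fun h' => hr _ h' h₀⟩
    have hne : (u, w) ∉ M := fun h => hu.2 ⟨hu.1, w, h, hw⟩
    have huE := hc.proposed_edges hw.1
    refine hM.2 u w (hJ.blocks_of_lt hM.1.1 (hmat h₀) h₀ huE hne ?_ ?_)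
    · by_contra hlt
      exact hw₀ (hc.proposed_up hw.1 (hM.1.1 h₀) (by omega))
    · by_cases hp : Prec (J.prefW w) u u'
      · left
        intro v hv
        rwa [hM.1.2.2 _ _ _ hv hwM]
      · right
        refine ⟨u', hwM, ?_⟩
        by_contra hi
        -- If `w` strictly preferred `u'`, his proposal would have made her reject `u`, whose edge
        -- is active.
        exact hw.2 (hc.rejected_worse hw'.1 (hJ.prec_of_not hp hi) huE)
  | outputMatching M hloc hcrit hM hcov => exact hr
  | outputNone M hloc hcrit hM hcov => exact hr

theorem rejected_notMem (hJ : J.Ranked t d)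
    (h : Relation.ReflTransGen (Step J) (Config.initial U V) c) (hM : J.StronglyStable M) :
    ∀ e ∈ c.rejected, e ∉ M := by
  induction h with
  | refl => exact fun e he => he.elim
  | tail h₁ h₂ ih => exact (of_reachable hJ h₁).rejected_notMem_of_step hJ h₂ hM ih

omit [Finite U] [Finite V] in
-- An unmatched woman prefers any neighbour to her situation, and the man is not matched better than
-- to a woman to whom he has proposed.
theorem coversWoman_of_proposed (hJ : J.Ranked t d) (hc : c.Invariant J t d)
    (hM : J.StronglyStable M) (hr : ∀ e ∈ c.rejected, e ∉ M) {u : U} {w : V}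
    (hp : (u, w) ∈ c.proposed) : CoversWoman M w := by
  by_contra hw
  obtain ⟨w₀, h₀⟩ := hJ.coversMan hM u
  exact hM.2 u w (hJ.blocks_of_le hM.1.1 (fun w' hw' => hM.1.2.1 _ _ _ hw' h₀) h₀
    (hc.proposed_edges hp) (fun h => hw ⟨u, h⟩) (hc.le_of_proposed hM hr hp h₀)
    fun u' hu' => (hw ⟨u', hu'⟩).elim)

omit [Finite U] [Finite V] in
-- The man of a blocking edge has proposed along it, as it is not worse than his active edge. If the
-- woman strictly prefers him, `rejected_worse` applies to her partner; if she finds them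
-- incomparable, the man has moved past her tie and `rejected_past` applies.
theorem stronglyStable_of_covers (hJ : J.Ranked t d) (hc : c.Invariant J t d)
    (hM : IsMatching c.active M) (hmen : ∀ u, CoversMan M u)
    (hcov : ∀ w ∈ c.everActive, CoversWoman M w) : J.StronglyStable M := by
  have hME : M ⊆ J.edges := fun e he => hc.proposed_edges (hM.1 he).1
  refine ⟨⟨hME, hM.2⟩, ?_⟩
  rintro u w ⟨he, hn, hb⟩
  obtain ⟨w₀, h₀⟩ := hmen u
  have hle : t u w ≤ t u w₀ := by
    have : J.ManPrefers M u w ∨ J.ManIncomp M u w := by tauto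
    rcases this with h | ⟨w', hw', h⟩
    · exact ((hJ.prec_iff he (hME h₀)).1 (h w₀ h₀)).le
    · rw [hM.2.1 _ _ _ hw' h₀] at h
      exact ((hJ.incomp_iff he (hME h₀)).1 h).le
  have hp := hc.proposed_up (hM.1 h₀).1 he hle
  obtain ⟨u', hu'⟩ := hcov w (hc.ever_of_proposed hp)
  have hnp : ¬ J.WomanPrefers M w u := fun h =>
    (hM.1 hu').2 (hc.rejected_worse hp (h u' hu') (hME hu'))
  rcases hb with ⟨_, h⟩ | ⟨h1, h | ⟨u'', hu'', h⟩⟩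
  · exact hnp h
  · exact hnp h
  · have hlt := (hJ.prec_iff he (hME h₀)).1 (h1 w₀ h₀)
    refine (hM.1 hu'').2 (hc.rejected_past hp (hM.1 h₀).1 hlt ?_ (hME hu'') ⟨h.2, h.1⟩)
    rintro rfl
    exact hn hu''

/-- A count: the women with proposals are all covered by `M`, so there are at most `|U|`. The
matching `N` covers `|U|` of them and therefore omits none. -/
theorem coversWoman_of_exists (hJ : J.Ranked t d) (hc : c.Invariant J t d)
    (hN : J.StronglyStable M) (hr : ∀ e ∈ c.rejected, e ∉ M) {N : Set (U × V)}
    (hM : IsMatching c.active N) (hmen : ∀ u, CoversMan N u) {u : U} {w : V}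
    (hp : (u, w) ∈ c.proposed) : CoversWoman N w := by
  set P : Set V := {w | ∃ u, (u, w) ∈ c.proposed} with hP
  have h1 : P.ncard ≤ Nat.card U := by
    rw [← ncard_eq_of_coversMan hN.1 (hJ.coversMan hN)]
    have : Nonempty U := ⟨u⟩
    choose! f hf using fun w (hw : w ∈ P) => hc.coversWoman_of_proposed hJ hN hr hw.choose_spec
    exact Set.ncard_le_ncard_of_injOn (fun w => (f w, w)) hf
      (fun w _ w' _ h => congrArg Prod.snd h) (Set.toFinite _)
  have h2 : Prod.snd '' N ⊆ P := by
    rintro _ ⟨⟨u, w⟩, h, rfl⟩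
    exact ⟨u, (hM.1 h).1⟩
  have h3 : (Prod.snd '' N).ncard = N.ncard := by
    refine Set.InjOn.ncard_image ?_
    rintro ⟨u, w⟩ h ⟨u', w'⟩ h' (rfl : w = w')
    rw [hM.2.2 _ _ _ h h']
  have h4 := Set.eq_of_subset_of_ncard_le h2
    (by rw [h3, ncard_eq_of_coversMan hM hmen]; exact h1) (Set.toFinite _)
  have h5 : w ∈ P := ⟨u, hp⟩
  rw [← h4] at h5
  obtain ⟨⟨u', w'⟩, h, rfl⟩ := h5
  exact ⟨u', h⟩

end Config.Invariant

end Correctness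

/-! ## Termination -/

section Termination

variable {U V : Type*} [Finite U] [Finite V] {J : Market U V} {t : U → V → ℕ} {d : U → V}

/-- The number of rounds that the location leaves until a proposal or a rejection. -/
noncomputable def Loc.rank {U V : Type*} : Loc U V → ℕ
  | phase1 => 2
  | strongReject R => R.ncard + 3
  | phase2 => 1
  | output _ => 0

/-- A quantity that decreases in each step. -/
noncomputable def Config.potential (J : Market U V) (c : Config U V) : ℕ :=
  -- The factor exceeds the largest rank, which is `|U| + 3` for STRONG_REJECT with all men. One new
  -- proposal or rejection outweighs any change of the location.
  ((J.edges \ c.proposed).ncard + (J.edges \ c.rejected).ncard) * (Nat.card U + 4) + c.loc.rank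

theorem ncard_diff_lt_of_mem {α : Type*} [Finite α] {E A B : Set α} (h : A ⊆ B) {x : α}
    (hE : x ∈ E) (hA : x ∉ A) (hB : x ∈ B) : (E \ B).ncard < (E \ A).ncard :=
  Set.ncard_lt_ncard ⟨Set.sdiff_subset_sdiff_right h, fun hs => (hs ⟨hE, hA⟩).2 hB⟩ (Set.toFinite _)

theorem Config.potential_lt (hJ : J.Ranked t d) {c c' : Config U V} (hc : c.Invariant J t d)
    (h : Step J c c') : c'.potential J < c.potential J := by
  have key : ∀ {p r p' r' k k' K : ℕ}, p' ≤ p → r' ≤ r → p' + r' < p + r → k' < K →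
      (p' + r') * K + k' < (p + r) * K + k := by
    intro p r p' r' k k' K _ _ h h'
    have := Nat.mul_le_mul_right K (Nat.succ_le_of_lt h)
    rw [Nat.succ_mul] at this
    omega
  have mono : ∀ {A B : Set (U × V)}, A ⊆ B → (J.edges \ B).ncard ≤ (J.edges \ A).ncard :=
    fun h => Set.ncard_le_ncard (Set.sdiff_subset_sdiff_right h) (Set.toFinite _)
  have huniv : (Set.univ : Set U).ncard = Nat.card U := Set.ncard_univ U
  have hR : ∀ R : Set U, R.ncard ≤ Nat.card U := fun R =>
    huniv ▸ Set.ncard_le_ncard (Set.subset_univ R) (Set.toFinite _)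
  cases h with
  | propose hloc hu =>
    obtain ⟨u, hu⟩ := hu
    -- A dummy edge is never rejected and would be active after its proposal. So the list of a man
    -- without active edges is not exhausted.
    have hd : (u, d u) ∉ c.proposed := fun h => hu ⟨_, h, hc.dummy u⟩
    obtain ⟨w, hw, hmin⟩ := Set.exists_min_image {w | (u, w) ∈ J.edges ∧ (u, w) ∉ c.proposed}
      (t u) (Set.toFinite _) ⟨d u, hJ.dummy_mem u, hd⟩
    have hlt := ncard_diff_lt_of_mem (E := J.edges) (A := c.proposed)
      (B := c.proposed ∪ c.newProposals J) Set.subset_union_left hw.1 hw.2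
      (Or.inr ⟨hu, hJ.mem_nextTie.2 ⟨hw.1, hw.2, fun w' h h' => hmin w' ⟨h, h'⟩⟩⟩)
    have hle := mono (A := c.rejected) (B := c.rejected ∪
            {e | e ∈ J.edges ∧ ∃ u, (u, e.2) ∈ c.newProposals J ∧ Prec (J.prefW e.2) u e.1})
            Set.subset_union_left
    refine key hlt.le hle (by simp only; omega) ?_
    simp only [Loc.rank, huniv]
    omega
  | endPhase1 hloc hu => simp [potential, hloc, Loc.rank]
  | strongReject R u hloc hu =>
    -- If no man loses an active edge, nobody enters `R` and `u` leaves it.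
    by_cases hlost : ∃ u' w, (u', w) ∈ c.strongRejected J u ∧ (u', w) ∈ c.active
    · obtain ⟨u', w, h1, h2⟩ := hlost
      have hlt := ncard_diff_lt_of_mem (E := J.edges) (A := c.rejected)
        (B := c.rejected ∪ c.strongRejected J u) Set.subset_union_left h1.1 h2.2 (Or.inr h1)
      refine key le_rfl hlt.le (by simp only; omega) ?_
      have := hR ((R ∪ {u' | ∃ w, (u', w) ∈ c.strongRejected J u ∧ (u', w) ∈ c.active}) \ {u})
      simp only [Loc.rank]
      omega
    · have hle := mono (A := c.rejected) (B := c.rejected ∪ c.strongRejected J u)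
        Set.subset_union_left
      have : {u' | ∃ w, (u', w) ∈ c.strongRejected J u ∧ (u', w) ∈ c.active} = ∅ := by
        ext u'
        simp only [Set.mem_ofPred_eq, Set.mem_empty_iff_false, iff_false]
        exact fun h => hlost ⟨u', h⟩
      simp only [potential, hloc, Loc.rank, this, Set.union_empty]
      have h1 := Set.ncard_sdiff_singleton_lt_of_mem hu (Set.toFinite R)
      have h2 := Nat.mul_le_mul_right (Nat.card U + 4)
        (Nat.add_le_add_left hle (J.edges \ c.proposed).ncard)
      omega
  | endStrongReject hloc => simp [potential, hloc, Loc.rank]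
  | rejectCritical hloc hcrit =>
    obtain ⟨u, hu⟩ := hcrit
    -- All men have active edges in the second phase, so a nonempty critical set causes a genuine
    -- rejection.
    obtain ⟨w, hw⟩ := hc.phase2 hloc u
    have hlt := ncard_diff_lt_of_mem (E := J.edges) (A := c.rejected)
        (B := c.rejected ∪ {e | e ∈ c.active ∧ e.1 ∈ criticalSet c.active})
        Set.subset_union_left (hc.proposed_edges hw.1) hw.2 (Or.inr ⟨hw, hu⟩)
    refine key le_rfl hlt.le (by simp only; omega) ?_
    simp only [Loc.rank, huniv]
    omega
  | outputMatching M hloc hcrit hM hcov => simp [potential, hloc, Loc.rank]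
  | outputNone M hloc hcrit hM hcov => simp [potential, hloc, Loc.rank]

theorem Config.no_infinite_execution (hJ : J.Ranked t d) (f : ℕ → Config U V)
    (h0 : f 0 = Config.initial U V) (hf : ∀ i, Step J (f i) (f (i + 1))) : False := by
  have hinv : ∀ i, (f i).Invariant J t d := by
    intro i
    induction i with
    | zero => rw [h0]; exact Invariant.initial J t d
    | succ i ih => exact ih.step hJ (hf i)
  have hpot : ∀ i, (f i).potential J + i ≤ (f 0).potential J := by
    intro i
    induction i with
    | zero => rfl
    | succ i ih =>
      have := potential_lt hJ (hinv i) (hf i)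
      omega
  have := hpot ((f 0).potential J + 1)
  omega

theorem Config.exists_step (c : Config U V) :
    (∃ c', Step J c c') ∨ ∃ o, c.loc = Loc.output o := by
  rcases hloc : c.loc with _ | R | _ | o
  · left
    by_cases hu : ∃ u, ¬ CoversMan c.active u
    · exact ⟨_, Step.propose c hloc hu⟩
    · push Not at hu
      exact ⟨_, Step.endPhase1 c hloc hu⟩
  · left
    rcases R.eq_empty_or_nonempty with rfl | ⟨u, hu⟩
    · exact ⟨_, Step.endStrongReject c hloc⟩
    · exact ⟨_, Step.strongReject c R u hloc hu⟩
  · left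
    rcases (criticalSet c.active).eq_empty_or_nonempty with h | h
    · obtain ⟨M, hM⟩ := exists_isMaximumMatching c.active
      by_cases hcov : ∀ w ∈ c.everActive, CoversWoman M w
      · exact ⟨_, Step.outputMatching c M hloc h hM hcov⟩
      · exact ⟨_, Step.outputNone c M hloc h hM hcov⟩
    · exact ⟨_, Step.rejectCritical c hloc h⟩
  · exact Or.inr ⟨o, rfl⟩

theorem Config.exists_output (hJ : J.Ranked t d) {c : Config U V}
    (hr : Relation.ReflTransGen (Step J) (Config.initial U V) c) :
    ∃ c' o, Relation.ReflTransGen (Step J) (Config.initial U V) c' ∧ c'.loc = Loc.output o := by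
  induction hn : c.potential J using Nat.strong_induction_on generalizing c with
  | _ n ih =>
    rcases c.exists_step (J := J) with ⟨c', h⟩ | ⟨o, h⟩
    · exact ih _ (hn ▸ potential_lt hJ (Invariant.of_reachable hJ hr) h) (hr.tail h) rfl
    · exact ⟨c, o, hr, h⟩

end Termination

/-! ## The dummy women -/

section Dummies

variable {U W : Type*} {I : Market U W}

/-- Since `W` is finite, the tie numbers of a man are bounded, and a rank beyond all of them is left
for his dummy woman. -/
theorem Market.withDummies_ranked [Finite W] (hm : I.MenTied) (hw : I.WomenAsymmetric) :
    ∃ t, I.withDummies.Ranked t Sum.inr := by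
  choose tie htie using hm
  have hb : ∀ u, ∃ B, ∀ w, tie u w < B := by
    intro u
    obtain ⟨B, hB⟩ := (Set.finite_range (tie u)).bddAbove
    exact ⟨B + 1, fun w => Nat.lt_succ_of_le (hB ⟨w, rfl⟩)⟩
  choose B hB using hb
  refine ⟨fun u x => Sum.elim (tie u) (fun _ => B u) x, ⟨?_, ?_, ?_, ?_, ?_⟩⟩
  · rintro u (w | v) (w' | v') h h'
    · change Prec (I.prefM u) w w' ↔ tie u w < tie u w'
      refine ⟨fun hp => ?_, (htie u w w' h h').2⟩
      by_contra hlt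
      rcases (not_lt.1 hlt).lt_or_eq with h1 | h1
      · exact hp.2 ((htie u w' w h' h).2 h1).1
      · exact ((htie u w w' h h').1 h1.symm).1 hp.1
    · have h2 : v' = u := h'
      subst h2
      simp only [Prec, withDummies, Sum.elim_inl, Sum.elim_inr, hB, iff_true]
      exact ⟨⟨h, trivial⟩, fun h => h⟩
    · simp only [Prec, withDummies, Sum.elim_inl, Sum.elim_inr, false_and, false_iff, not_lt]
      exact (hB u w').le
    · simp [Prec, withDummies]
  · rintro u (w | v) (w' | v') h h'
    · change Incomp (I.prefM u) w w' ↔ tie u w = tie u w'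
      refine ⟨fun hp => ?_, (htie u w w' h h').1⟩
      by_contra hne
      rcases lt_or_gt_of_ne hne with h1 | h1
      · exact hp.1 ((htie u w w' h h').2 h1).1
      · exact hp.2 ((htie u w' w h' h).2 h1).1
    · have h2 : v' = u := h'
      subst h2
      have := hB v' w
      simp only [Incomp, withDummies, Sum.elim_inl, Sum.elim_inr]
      exact ⟨fun h2 => (h2.1 ⟨h, trivial⟩).elim, fun _ => by omega⟩
    · have h2 : v = u := h
      subst h2
      have := hB v w'
      simp only [Incomp, withDummies, Sum.elim_inl, Sum.elim_inr]
      exact ⟨fun h2 => (h2.2 ⟨h', trivial⟩).elim, fun _ => by omega⟩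
    · simp [Incomp, withDummies]
  · rintro (w | v) u u'
    · exact hw w u u'
    · exact fun h => h.1
  · intro u
    exact rfl
  · rintro u u' h
    exact Eq.symm h

/-- For the blocking of an edge to a real woman, it makes no difference whether the man is matched
to his dummy or unmatched. A dummy edge blocks only if its man is unmatched, because the dummy is
last on his list. -/
theorem Market.stronglyStable_withDummies_iff {M : Set (U × (W ⊕ U))}
    (hM : IsMatching I.withDummies.edges M) :
    I.withDummies.StronglyStable M ↔
      I.StronglyStable (restrict M) ∧ ∀ u, CoversMan M u := by
  have hpW : ∀ u w, I.withDummies.WomanPrefers M (Sum.inl w) u ↔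
      I.WomanPrefers (restrict M) w u := fun u w => Iff.rfl
  have hiW : ∀ u w, I.withDummies.WomanIncomp M (Sum.inl w) u ↔
      I.WomanIncomp (restrict M) w u := fun u w => Iff.rfl
  have hpM : ∀ u w, (u, w) ∈ I.edges → (I.withDummies.ManPrefers M u (Sum.inl w) ↔
      I.ManPrefers (restrict M) u w) := by
    intro u w he
    constructor
    · exact fun h w' hw' => h (Sum.inl w') hw'
    · rintro h (w' | v) hw'
      · exact h w' hw'
      · exact ⟨⟨he, hM.1 hw'⟩, fun h => h⟩
  have hiM : ∀ u w, (u, w) ∈ I.edges → (I.withDummies.ManIncomp M u (Sum.inl w) ↔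
      I.ManIncomp (restrict M) u w) := by
    intro u w he
    constructor
    · rintro ⟨w' | v, hw', h⟩
      · exact ⟨w', hw', h⟩
      · exact (h.1 ⟨he, hM.1 hw'⟩).elim
    · rintro ⟨w', hw', h⟩
      exact ⟨Sum.inl w', hw', h⟩
  have hblock : ∀ u w, I.withDummies.Blocks M u (Sum.inl w) ↔ I.Blocks (restrict M) u w := by
    intro u w
    refine and_congr_right fun he => and_congr_right fun _ => ?_
    rw [hpM u w he, hiM u w he, hpW, hiW]
  have hmat : IsMatching I.edges (restrict M) := by
    refine ⟨fun e he => hM.1 he, fun u w w' h h' => ?_, fun u u' w h h' => ?_⟩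
    · exact Sum.inl_injective (hM.2.1 _ _ _ h h')
    · exact hM.2.2 _ _ _ h h'
  constructor
  · intro h
    refine ⟨⟨hmat, fun u w hb => h.2 u (Sum.inl w) ((hblock u w).2 hb)⟩, fun u => ?_⟩
    by_contra hu
    refine h.2 u (Sum.inr u) ⟨rfl, fun h' => hu ⟨_, h'⟩, Or.inl ⟨Or.inl ?_, ?_⟩⟩
    · intro w hw
      exact (hu ⟨w, hw⟩).elim
    · intro u' hu'
      have h1 : u = u' := hM.1 hu'
      subst h1
      exact (hu ⟨_, hu'⟩).elim
  · rintro ⟨h, hcov⟩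
    refine ⟨hM, ?_⟩
    rintro u (w | v) hb
    · exact h.2 u w ((hblock u w).1 hb)
    · have hv : v = u := hb.1
      subst hv
      obtain ⟨w | v', hw⟩ := hcov v
      · have h1 : I.withDummies.ManPrefers M v (Sum.inr v) ∨
            I.withDummies.ManIncomp M v (Sum.inr v) := by
          have := hb.2.2
          tauto
        rcases h1 with h1 | ⟨w', hw', h1⟩
        · exact (h1 _ hw).1
        · rw [hM.2.1 _ _ _ hw' hw] at h1
          exact h1.2 ⟨hM.1 hw, rfl⟩
      · have h1 : v' = v := hM.1 hw
        subst h1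
        exact hb.2.1 hw

theorem Market.StronglyStable.exists_withDummies {N : Set (U × W)} (hN : I.StronglyStable N) :
    ∃ M, I.withDummies.StronglyStable M := by
  set M : Set (U × (W ⊕ U)) := {e | match e.2 with
    | Sum.inl w => (e.1, w) ∈ N
    | Sum.inr v => v = e.1 ∧ ¬ CoversMan N e.1} with hM
  have hr : restrict M = N := rfl
  have hmat : IsMatching I.withDummies.edges M := by
    refine ⟨?_, ?_, ?_⟩
    · rintro ⟨u, w | v⟩ h
      · exact hN.1.1 h
      · exact h.1
    · rintro u (w | v) (w' | v') h h'
      · exact congrArg Sum.inl (hN.1.2.1 _ _ _ h h')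
      · exact (h'.2 ⟨w, h⟩).elim
      · exact (h.2 ⟨w', h'⟩).elim
      · exact congrArg Sum.inr (h.1.trans h'.1.symm)
    · rintro u u' (w | v) h h'
      · exact hN.1.2.2 _ _ _ h h'
      · exact h.1.symm.trans h'.1
  refine ⟨M, (stronglyStable_withDummies_iff hmat).2 ⟨hr ▸ hN, fun u => ?_⟩⟩
  by_cases h : CoversMan N u
  · exact ⟨Sum.inl h.choose, h.choose_spec⟩
  · exact ⟨Sum.inr u, rfl, h⟩

end Dummies

/-- The properties of all executions of the algorithm. -/
theorem execution_correct {U W : Type*} [Finite U] [Finite W] (I : Market U W) (hm : I.MenTied)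
    (hw : I.WomenAsymmetric) :
    (∀ M, IsMatching I.withDummies.edges M →
      (I.withDummies.StronglyStable M ↔ I.StronglyStable (restrict M) ∧ ∀ u, CoversMan M u)) ∧
    (¬ ∃ f : ℕ → Config U (W ⊕ U), f 0 = Config.initial U (W ⊕ U) ∧
      ∀ i, Config.Step I.withDummies (f i) (f (i + 1))) ∧
    (∀ c, Reachable I c → (∃ c', Config.Step I.withDummies c c') ∨ ∃ o, c.loc = Loc.output o) ∧
    (∀ c, Reachable I c → ∀ M, I.withDummies.StronglyStable M → ∀ e ∈ c.rejected, e ∉ M) ∧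
    (∀ c, Reachable I c → ∀ M, I.withDummies.StronglyStable M →
      ∀ w ∈ c.everActive, CoversWoman M w) ∧
    (∀ c, Reachable I c → ∀ M, c.loc = Loc.output (some M) →
      I.withDummies.StronglyStable M ∧ I.StronglyStable (restrict M)) ∧
    ((∃ M, I.withDummies.StronglyStable M) → ∀ c, Reachable I c → ∀ o, c.loc = Loc.output o →
      ∀ M, IsMaximumMatching c.active M → ∀ u w, (u, w) ∈ c.proposed → CoversWoman M w) ∧
    ((∃ M, I.StronglyStable M) → ∀ c, Reachable I c → ∀ o, c.loc = Loc.output o →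
      ∃ M, o = some M ∧ I.StronglyStable (restrict M)) := by
  obtain ⟨t, hJ⟩ := Market.withDummies_ranked hm hw
  have hout : ∀ c, Reachable I c → ∀ M, c.loc = Loc.output (some M) →
      I.withDummies.StronglyStable M ∧ I.StronglyStable (restrict M) := by
    intro c hc M hloc
    have hi := Config.Invariant.of_reachable hJ hc
    obtain ⟨hcrit, M', hM', h | h⟩ := hi.output _ hloc
    · obtain ⟨h1, h2⟩ := h
      cases h1
      have hss := hi.stronglyStable_of_covers hJ hM'.1 (hM'.coversMan hcrit) h2
      exact ⟨hss, ((Market.stronglyStable_withDummies_iff hss.1).1 hss).1⟩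
    · cases h.1
  have hcov : (∃ M, I.withDummies.StronglyStable M) → ∀ c, Reachable I c → ∀ o,
      c.loc = Loc.output o → ∀ M, IsMaximumMatching c.active M → ∀ u w, (u, w) ∈ c.proposed →
        CoversWoman M w := by
    rintro ⟨N, hN⟩ c hc o hloc M hM u w hp
    have hi := Config.Invariant.of_reachable hJ hc
    exact hi.coversWoman_of_exists hJ hN (Config.Invariant.rejected_notMem hJ hc hN) hM.1
      (hM.coversMan (hi.output _ hloc).1) hp
  refine ⟨fun M => Market.stronglyStable_withDummies_iff, ?_, fun c _ => c.exists_step, ?_, ?_,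
    hout, hcov, ?_⟩
  · rintro ⟨f, h0, hf⟩
    exact Config.no_infinite_execution hJ f h0 hf
  · exact fun c hc M hM => Config.Invariant.rejected_notMem hJ hc hM
  · intro c hc M hM w hw
    have hi := Config.Invariant.of_reachable hJ hc
    obtain ⟨u, hu⟩ := hi.proposed_of_ever hw
    exact hi.coversWoman_of_proposed hJ hM (Config.Invariant.rejected_notMem hJ hc hM) hu
  · rintro ⟨N, hN⟩ c hc o hloc
    have hi := Config.Invariant.of_reachable hJ hc
    obtain ⟨hcrit, M, hM, h | h⟩ := hi.output _ hloc
    · obtain ⟨rfl, -⟩ := h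
      exact ⟨M, rfl, (hout c hc M hloc).2⟩
    · refine (h.2 fun w hw => ?_).elim
      obtain ⟨u, hu⟩ := hi.proposed_of_ever hw
      exact hcov hN.exists_withDummies c hc o hloc M hM u w hu

end PairwiseMarket

namespace PairwiseMarket

open Config

/-! ### The critical set in terms of alternating paths -/

section Critical

variable {U V : Type*} [Finite U] [Finite V]

/-- The critical set consists of the men whom the alternating paths from the unmatched men reach,
if none of these paths is augmenting. -/
theorem criticalSet_eq {G M : Set (U × V)} (hM : IsMatching G M) {Z : Set U}
    (hfree : ∀ u, ¬ CoversMan M u → u ∈ Z)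
    (hclosed : ∀ u ∈ Z, ∀ w, (u, w) ∈ G → ∃ u' ∈ Z, (u', w) ∈ M)
    (hmin : ∀ X : Set U, (∀ u, ¬ CoversMan M u → u ∈ X) →
      (∀ u ∈ X, ∀ w u', (u, w) ∈ G → (u', w) ∈ M → u' ∈ X) → Z ⊆ X) :
    criticalSet G = Z := by
  classical
  -- The number of unmatched men turns out to be the maximum deficiency; all sets are compared with
  -- it.
  set F : Set U := {u | ¬ CoversMan M u} with hF
  have hsplit : ∀ X : Set U, (X ∩ F).ncard + (X \ F).ncard = X.ncard := fun X =>
    Set.ncard_inter_add_ncard_sdiff_eq_ncard X F (Set.toFinite _)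
  have hcov : ∀ u ∉ F, CoversMan M u := fun u hu => by simpa [hF] using hu
  set N : Set U → Set V := fun X => {w | ∃ u ∈ X, (u, w) ∈ G} with hN
  set T : Set U → Set V := fun X => {w | ∃ u ∈ X, (u, w) ∈ M} with hT
  have hTcard : ∀ X : Set U, (X \ F).ncard ≤ (T X).ncard := by
    intro X
    rcases (X \ F).eq_empty_or_nonempty with h | ⟨u₀, h₀⟩
    · simp [h]
    · have : Nonempty V := ⟨(hcov u₀ h₀.2).choose⟩
      choose! f hf using hcov
      refine Set.ncard_le_ncard_of_injOn f (fun u hu => ⟨u, hu.1, hf u hu.2⟩) ?_ (Set.toFinite _)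
      intro u hu u' hu' h
      have h1 := hf u hu.2
      rw [h] at h1
      exact hM.2.2 _ _ _ h1 (hf u' hu'.2)
  have hTN : ∀ X, T X ⊆ N X := by
    rintro X w ⟨u, hu, h⟩
    exact ⟨u, hu, hM.1 h⟩
  have hFle : ∀ X : Set U, (X ∩ F).ncard ≤ F.ncard := fun X =>
    Set.ncard_le_ncard Set.inter_subset_right (Set.toFinite _)
  have hdef : ∀ X : Set U, deficiency G X = (X.ncard : ℤ) - ((N X).ncard : ℤ) := fun X => rfl
  -- The absence of augmenting paths lets `M` inject the neighbours of `Z` into the matched men of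
  -- `Z`.
  have hZ : (F.ncard : ℤ) ≤ deficiency G Z := by
    have h1 : Z ∩ F = F := Set.inter_eq_right.2 fun u hu => hfree u hu
    have h2 := hsplit Z
    rw [h1] at h2
    have h3 : (N Z).ncard ≤ (Z \ F).ncard := by
      rcases (N Z).eq_empty_or_nonempty with h | ⟨w₀, u₀, hu₀, hw₀⟩
      · simp [h]
      · have : Nonempty U := ⟨u₀⟩
        have hex : ∀ w ∈ N Z, ∃ u' ∈ Z, (u', w) ∈ M := fun w ⟨u, hu, h⟩ => hclosed u hu w h
        choose! g hg using hex
        refine Set.ncard_le_ncard_of_injOn g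
          (fun w hw => ⟨(hg w hw).1, fun h => h ⟨w, (hg w hw).2⟩⟩) ?_ (Set.toFinite _)
        intro w hw w' hw' h
        have h1 := (hg w hw).2
        rw [h] at h1
        exact hM.2.1 _ _ _ h1 (hg w' hw').2
    rw [hdef]
    omega
  -- The matched men of `X` have distinct partners among the neighbours of `X`, so the deficiency is
  -- at most `|X ∩ F|`.
  have hub : ∀ X : Set U, deficiency G X ≤ F.ncard := by
    intro X
    have h1 := hsplit X
    have h2 := hTcard X
    have h3 := Set.ncard_le_ncard (hTN X) (Set.toFinite _)
    have h4 := hFle X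
    rw [hdef]
    omega
  apply Set.Subset.antisymm
  · intro u hu
    exact hu Z fun Y => (hub Y).trans hZ
  · intro u hu X hX
    have hX' : (F.ncard : ℤ) ≤ deficiency G X := hZ.trans (hX Z)
    rw [hdef] at hX'
    have h1 := hsplit X
    have h2 := hTcard X
    have h3 := Set.ncard_le_ncard (hTN X) (Set.toFinite _)
    have h4 := hFle X
    -- Maximum deficiency forces equality everywhere: `X` contains all unmatched men, and every
    -- neighbour of `X` has her partner in `X`. Thus `X` is closed under alternating paths.
    have h5 : X ∩ F = F := Set.eq_of_subset_of_ncard_le Set.inter_subset_right (by omega)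
      (Set.toFinite _)
    have h6 : T X = N X := Set.eq_of_subset_of_ncard_le (hTN X) (by omega) (Set.toFinite _)
    refine hmin X (fun u hu => (h5.symm ▸ hu : u ∈ X ∩ F).1) ?_ hu
    intro u hu w u' hw hw'
    have h7 : w ∈ T X := h6.symm ▸ ⟨u, hu, hw⟩
    obtain ⟨v, hv, hvw⟩ := h7
    rwa [hM.2.2 _ _ _ hw' hvw]

end Critical

/-! ## Executions up to steps without effect -/

section Calm

variable {U V : Type*} {J : Market U V} {t : U → V → ℕ} {d : U → V} {c : Config U V}

/-- The execution is at the head of the loop of the first phase or of STRONG_REJECT. -/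
def Config.Calm (c : Config U V) : Prop := c.loc = Loc.phase1 ∨ ∃ R, c.loc = Loc.strongReject R

/-- By the invariant, an examination of a man outside `R` would reject nothing new. Hence a program
may examine any man at any time, without maintaining `R`. -/
theorem exists_strongReject (hc : c.Invariant J t d)
    (hr : Relation.ReflTransGen (Step J) (Config.initial U V) c) (hl : c.Calm) (u : U) :
    ∃ c', Relation.ReflTransGen (Step J) (Config.initial U V) c' ∧ c'.Calm ∧
      c'.proposed = c.proposed ∧ c'.everActive = c.everActive ∧
      c'.rejected = c.rejected ∪ c.strongRejected J u := by
  rcases hl with hl | ⟨R, hl⟩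
  · refine ⟨c, hr, Or.inl hl, rfl, rfl, (Set.union_eq_self_of_subset_right ?_).symm⟩
    exact hc.strong ∅ (Or.inr ⟨hl, rfl⟩) u (Set.notMem_empty _)
  · by_cases hu : u ∈ R
    · exact ⟨_, hr.tail (Step.strongReject c R u hl hu), Or.inr ⟨_, rfl⟩, rfl, rfl, rfl⟩
    · refine ⟨c, hr, Or.inr ⟨R, hl⟩, rfl, rfl, (Set.union_eq_self_of_subset_right ?_).symm⟩
      exact hc.strong R (Or.inl hl) u hu

/-- When no examination has an effect, the remaining members of `R` can be removed one by one and
nobody is added. -/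
theorem exists_phase1 [Finite U]
    (hr : Relation.ReflTransGen (Step J) (Config.initial U V) c) (hl : c.Calm)
    (hs : ∀ u, c.strongRejected J u ⊆ c.rejected) :
    Relation.ReflTransGen (Step J) (Config.initial U V) { c with loc := Loc.phase1 } := by
  rcases hl with hl | ⟨R, hl⟩
  · rwa [← hl]
  · induction hn : R.ncard using Nat.strong_induction_on generalizing c R with
    | _ n ih =>
      rcases R.eq_empty_or_nonempty with rfl | ⟨u, hu⟩
      · exact hr.tail (Step.endStrongReject c hl)
      · have hstep := Step.strongReject c R u hl hu (J := J)
        have h1 : c.rejected ∪ c.strongRejected J u = c.rejected :=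
          Set.union_eq_self_of_subset_right (hs u)
        have h2 : {u' | ∃ w, (u', w) ∈ c.strongRejected J u ∧ (u', w) ∈ c.active} = ∅ := by
          ext u'
          simp only [Set.mem_ofPred_eq, Set.mem_empty_iff_false, iff_false, not_exists, not_and]
          exact fun w h h' => h'.2 (hs u h)
        rw [h1, h2, Set.union_empty] at hstep
        exact ih (c := { c with loc := Loc.strongReject (R \ {u}) }) _
          (hn ▸ Set.ncard_sdiff_singleton_lt_of_mem hu (Set.toFinite R))
          (hr.tail hstep) hs (R \ {u}) rfl rfl

end Calm

/-! ## Simulation of the algorithm by an array program -/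

/-- Arrays with the adjacency lists of the men: `adj i` for `off u ≤ i < off (u + 1)` are the
neighbours of `u`, by weakly decreasing preference, and `mark i ≠ 0` if a new tie starts there. -/
structure Layout {a b : ℕ} (I : Market (Fin a) (Fin b)) (off adj mark : ℕ → ℕ) : Prop where
  off_le : ∀ u < a, off u ≤ off (u + 1)
  off_zero : off 0 = 0
  off_last : off a = I.edges.ncard
  adj_lt : ∀ u < a, ∀ i, off u ≤ i → i < off (u + 1) → adj i < b
  mem_iff : ∀ (u : Fin a) (w : Fin b), (u, w) ∈ I.edges ↔
    ∃ i, off u ≤ i ∧ i < off (u + 1) ∧ adj i = w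
  inj : ∀ u < a, ∀ i j, off u ≤ i → i < off (u + 1) → off u ≤ j → j < off (u + 1) →
    adj i = adj j → i = j
  prec : ∀ (u : Fin a) (w w' : Fin b) i j, off u ≤ i → i < j → j < off (u + 1) → adj i = w →
    adj j = w' → (∃ k, i < k ∧ k ≤ j ∧ mark k ≠ 0) → Prec (I.prefM u) w w'
  incomp : ∀ (u : Fin a) (w w' : Fin b) i j, off u ≤ i → i < j → j < off (u + 1) → adj i = w →
    adj j = w' → (∀ k, i < k → k ≤ j → mark k = 0) → Incomp (I.prefM u) w w'

/-- The variable arrays: the proposal tie of `u` is `adj i` for `lo u ≤ i < hi u`; `st u` is `0` if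
`u` has no active edges and has been examined in this state, `1` if he has been examined with one
active edge, `3` if the women have not yet reacted to his proposals, and `2` otherwise;
`rej (u * b + w)` marks the rejected edges, `ever w` the women who have ever had an active edge. -/
structure Arrays where
  lo : ℕ → ℕ
  hi : ℕ → ℕ
  st : ℕ → ℕ
  rej : ℕ → ℕ
  ever : ℕ → ℕ

namespace Arrays

/-- The proposal tie of `u`. -/
def tie (x : Arrays) (adj : ℕ → ℕ) (u w : ℕ) : Prop :=
  ∃ i, x.lo u ≤ i ∧ i < x.hi u ∧ adj i = w

/-- The arrays describe the configuration `c`. -/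
structure Simulates {a b : ℕ} (I : Market (Fin a) (Fin b)) (off adj mark : ℕ → ℕ) (x : Arrays)
    (c : Config (Fin a) (Fin b ⊕ Fin a)) : Prop where
  off_le_lo : ∀ u < a, off u ≤ x.lo u
  lo_le_hi : ∀ u < a, x.lo u ≤ x.hi u
  hi_le : ∀ u < a, x.hi u ≤ off (u + 1)
  lo_lt_hi : ∀ u < a, x.lo u < x.hi u ∨ x.hi u = off u
  lo_lt_hi_of_st : ∀ u < a, x.st u ≠ 0 → x.lo u < x.hi u
  mark_lo : ∀ u < a, x.lo u = off u ∨ mark (x.lo u) ≠ 0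
  mark_hi : ∀ u < a, x.hi u = off u ∨ x.hi u = off (u + 1) ∨ mark (x.hi u) ≠ 0
  mark_between : ∀ u < a, ∀ k, x.lo u < k → k < x.hi u → mark k = 0
  st_le : ∀ u < a, x.st u ≤ 3
  proposed : ∀ (u : Fin a) (w : Fin b), (u, Sum.inl w) ∈ c.proposed ↔
    ∃ i, off u ≤ i ∧ i < x.hi u ∧ adj i = w
  -- Proposals to dummy women leave no trace in the arrays. Only a consequence is recorded: the list
  -- is exhausted and no active edge to a real woman is left.
  proposed_dummy : ∀ u v : Fin a, (u, Sum.inr v) ∈ c.proposed →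
    x.st u = 0 ∧ x.hi u = off (u + 1)
  -- In the configuration the women react to a proposal at once; in the arrays the reaction is
  -- delayed for the men in state `3`.
  rejected : ∀ (u : Fin a) (w : Fin b), (u, w) ∈ I.edges →
    ((u, Sum.inl w) ∈ c.rejected ↔ x.rej (u * b + w) ≠ 0 ∨
      ∃ v : Fin a, x.st v = 3 ∧ x.tie adj v w ∧ I.prefW w v u)
  ever : ∀ w : Fin b, Sum.inl w ∈ c.everActive ↔ x.ever w ≠ 0
  -- The states `0` and `1` are certificates: whatever an examination of `u` in that state would
  -- reject is already rejected in the configuration.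
  st_zero : ∀ u : Fin a, x.st u = 0 → ∀ w : Fin b, x.tie adj u w → x.rej (u * b + w) ≠ 0 ∧
    ∀ v : Fin a, v ≠ u → (v, w) ∈ I.edges → Incomp (I.prefW w) v u →
      (v, Sum.inl w) ∈ c.rejected
  st_one : ∀ u : Fin a, x.st u = 1 → ∃ w : Fin b, x.tie adj u w ∧
    (∀ w' : Fin b, x.tie adj u w' → w' ≠ w → x.rej (u * b + w') ≠ 0) ∧
    ∀ v : Fin a, v ≠ u → (v, w) ∈ I.edges → Incomp (I.prefW w) v u →
      (v, Sum.inl w) ∈ c.rejected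

end Arrays

section Simulation

variable {a b : ℕ} {I : Market (Fin a) (Fin b)} {off adj mark : ℕ → ℕ}
  {c : Config (Fin a) (Fin b ⊕ Fin a)} {x x' : Arrays} {t : Fin a → Fin b ⊕ Fin a → ℕ}

theorem Layout.rank_lt (hL : Layout I off adj mark) (hJ : I.withDummies.Ranked t Sum.inr)
    {u : Fin a} {w w' : Fin b} {i j : ℕ} (h1 : off u ≤ i) (h2 : i < j) (h3 : j < off (u + 1))
    (hi : adj i = w) (hj : adj j = w') (hk : ∃ k, i < k ∧ k ≤ j ∧ mark k ≠ 0) :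
    t u (Sum.inl w) < t u (Sum.inl w') := by
  have hw : (u, w) ∈ I.edges := (hL.mem_iff u w).2 ⟨i, h1, by omega, hi⟩
  have hw' : (u, w') ∈ I.edges := (hL.mem_iff u w').2 ⟨j, by omega, h3, hj⟩
  exact (hJ.prec_iff (u := u) (w := Sum.inl w) (w' := Sum.inl w') hw hw').1
    (hL.prec u w w' i j h1 h2 h3 hi hj hk)

theorem Layout.rank_eq (hL : Layout I off adj mark) (hJ : I.withDummies.Ranked t Sum.inr)
    {u : Fin a} {w w' : Fin b} {i j : ℕ} (h1 : off u ≤ i) (h2 : i < j) (h3 : j < off (u + 1))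
    (hi : adj i = w) (hj : adj j = w') (hk : ∀ k, i < k → k ≤ j → mark k = 0) :
    t u (Sum.inl w) = t u (Sum.inl w') := by
  have hw : (u, w) ∈ I.edges := (hL.mem_iff u w).2 ⟨i, h1, by omega, hi⟩
  have hw' : (u, w') ∈ I.edges := (hL.mem_iff u w').2 ⟨j, by omega, h3, hj⟩
  exact (hJ.incomp_iff (u := u) (w := Sum.inl w) (w' := Sum.inl w') hw hw').1
    (hL.incomp u w w' i j h1 h2 h3 hi hj hk)

theorem Layout.rank_le (hL : Layout I off adj mark) (hJ : I.withDummies.Ranked t Sum.inr)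
    {u : Fin a} {w w' : Fin b} {i j : ℕ} (h1 : off u ≤ i) (h2 : i ≤ j) (h3 : j < off (u + 1))
    (hi : adj i = w) (hj : adj j = w') : t u (Sum.inl w) ≤ t u (Sum.inl w') := by
  rcases h2.lt_or_eq with h2 | rfl
  · by_cases hk : ∃ k, i < k ∧ k ≤ j ∧ mark k ≠ 0
    · exact (hL.rank_lt hJ h1 h2 h3 hi hj hk).le
    · push Not at hk
      exact (hL.rank_eq hJ h1 h2 h3 hi hj hk).le
  · have : w = w' := Fin.ext (hi.symm.trans hj)
    rw [this]

theorem rank_dummy (hJ : I.withDummies.Ranked t Sum.inr) {u : Fin a} {w : Fin b}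
    (h : (u, w) ∈ I.edges) : t u (Sum.inl w) < t u (Sum.inr u) := by
  refine (hJ.prec_iff (u := u) (w := Sum.inl w) (w' := Sum.inr u) h rfl).1 ?_
  exact ⟨⟨h, rfl⟩, fun h => h⟩

theorem prec_prefW_iff (hw : I.WomenAsymmetric) {w : Fin b} {u v : Fin a} :
    Prec (I.prefW w) u v ↔ I.prefW w u v :=
  ⟨fun h => h.1, fun h => ⟨h, fun h' => hw w u v ⟨h, h'⟩⟩⟩

namespace Arrays.Simulates

theorem tie_edges (hL : Layout I off adj mark) (hx : x.Simulates I off adj mark c) {u : Fin a}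
    {w : Fin b} (h : x.tie adj u w) : (u, w) ∈ I.edges := by
  obtain ⟨i, h1, h2, h3⟩ := h
  have := hx.off_le_lo u u.2
  have := hx.hi_le u u.2
  exact (hL.mem_iff u w).2 ⟨i, by omega, by omega, h3⟩

theorem tie_proposed (hx : x.Simulates I off adj mark c) {u : Fin a}
    {w : Fin b} (h : x.tie adj u w) : (u, Sum.inl w) ∈ c.proposed := by
  obtain ⟨i, h1, h2, h3⟩ := h
  have := hx.off_le_lo u u.2
  exact (hx.proposed u w).2 ⟨i, by omega, h2, h3⟩

theorem rejected_iff (hx : x.Simulates I off adj mark c) (hst : ∀ u < a, x.st u ≤ 2) {u : Fin a}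
    {w : Fin b} (he : (u, w) ∈ I.edges) :
    (u, Sum.inl w) ∈ c.rejected ↔ x.rej (u * b + w) ≠ 0 := by
  rw [hx.rejected u w he, or_iff_left]
  rintro ⟨v, hv, -⟩
  have := hst v v.2
  omega

/-- The dummy edge is excluded because, once proposed, it would itself be the proposal tie, while
the interval still shows the last real one. -/
theorem mem_proposalTie (hL : Layout I off adj mark) (hJ : I.withDummies.Ranked t Sum.inr)
    (hx : x.Simulates I off adj mark c) (hc : c.Invariant I.withDummies t Sum.inr) {u : Fin a}
    (hd : (u, Sum.inr u) ∉ c.proposed) {w : Fin b} :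
    Sum.inl w ∈ c.proposalTie I.withDummies u ↔ x.tie adj u w := by
  rw [hJ.mem_proposalTie hc.proposed_edges, hx.proposed]
  have h1 := hx.off_le_lo u u.2
  have h2 := hx.hi_le u u.2
  constructor
  · rintro ⟨⟨i, h3, h4, h5⟩, h⟩
    refine ⟨i, ?_, h4, h5⟩
    by_contra hlt
    have hlh : x.lo u < x.hi u := by
      have := hx.lo_lt_hi u u.2
      omega
    have hb := hL.adj_lt u u.2 (x.lo u) h1 (by omega)
    have h6 := h (Sum.inl ⟨adj (x.lo u), hb⟩) ((hx.proposed u _).2 ⟨x.lo u, h1, hlh, rfl⟩)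
    have h7 := hL.rank_lt (u := u) (w := w) (w' := ⟨adj (x.lo u), hb⟩) hJ h3 (j := x.lo u)
      (by omega) (by omega) h5 rfl ⟨x.lo u, by omega, le_rfl, by
        have := hx.mark_lo u u.2
        omega⟩
    omega
  · rintro ⟨i, h3, h4, h5⟩
    refine ⟨⟨i, by omega, h4, h5⟩, ?_⟩
    rintro (w' | v) hw'
    · obtain ⟨j, h6, h7, h8⟩ := (hx.proposed u w').1 hw'
      rcases le_or_gt j i with hji | hji
      · exact hL.rank_le hJ h6 hji (by omega) h8 h5
      · refine (hL.rank_eq hJ (by omega) hji (by omega) h5 h8 fun k hk hk' => ?_).ge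
        exact hx.mark_between u u.2 k (by omega) (by omega)
    · have hv : v = u := hc.proposed_edges hw'
      rw [hv] at hw'
      exact (hd hw').elim

/-- Active edges lie in the last tie, and a man who has proposed to his dummy has no active edge to
a real woman. With no reaction pending, the interval and the table therefore determine the active
edges. -/
theorem active_iff (hL : Layout I off adj mark) (hJ : I.withDummies.Ranked t Sum.inr)
    (hx : x.Simulates I off adj mark c) (hc : c.Invariant I.withDummies t Sum.inr)
    (hst : ∀ u < a, x.st u ≤ 2) {u : Fin a} {w : Fin b} :
    (u, Sum.inl w) ∈ c.active ↔ x.tie adj u w ∧ x.rej (u * b + w) = 0 := by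
  constructor
  · intro h
    have he : (u, w) ∈ I.edges := hc.proposed_edges h.1
    have hr := (hx.rejected_iff hst he).not.1 h.2
    refine ⟨?_, by simpa using hr⟩
    have hd : (u, Sum.inr u) ∉ c.proposed := by
      intro hd
      have h1 := hc.active_last h hd
      have h2 := rank_dummy hJ he
      omega
    refine (hx.mem_proposalTie hL hJ hc hd).1 ((hJ.mem_proposalTie hc.proposed_edges).2 ⟨h.1, ?_⟩)
    exact fun w' hw' => hc.active_last h hw'
  · rintro ⟨h1, h2⟩
    exact ⟨hx.tie_proposed h1, (hx.rejected_iff hst (hx.tie_edges hL h1)).not.2 (by simpa using h2)⟩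

theorem active_dummy_iff (hc : c.Invariant I.withDummies t Sum.inr) {u : Fin a} :
    (u, Sum.inr u) ∈ c.active ↔ (u, Sum.inr u) ∈ c.proposed :=
  ⟨fun h => h.1, fun h => ⟨h, hc.dummy u⟩⟩

/-- The reaction of the women to the proposals of `f`. -/
theorem react (hx : x.Simulates I off adj mark c) {f : Fin a} (hf : x.st f = 3)
    (hlo : x'.lo = x.lo) (hhi : x'.hi = x.hi) (hev : x'.ever = x.ever)
    (hst : x'.st = Function.update x.st f 2)
    (hrej : ∀ (v : Fin a) (w : Fin b), x'.rej (v * b + w) ≠ 0 ↔ x.rej (v * b + w) ≠ 0 ∨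
      x.tie adj f w ∧ I.prefW w f v) :
    x'.Simulates I off adj mark c := by
  have htie : x'.tie = x.tie := by
    funext adj u w
    simp only [tie, hlo, hhi]
  have hst' : ∀ u : ℕ, u ≠ f → x'.st u = x.st u := fun u hu => by
    rw [hst, Function.update_of_ne hu]
  have hstf : x'.st f = 2 := by rw [hst, Function.update_self]
  have hfin : ∀ {u : Fin a}, u ≠ f → (u : ℕ) ≠ f := fun h h' => h (Fin.ext h')
  refine ⟨?_, ?_, ?_, ?_, ?_, ?_, ?_, ?_, ?_, ?_, ?_, ?_, ?_, ?_, ?_⟩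
  · rw [hlo]; exact hx.off_le_lo
  · rw [hlo, hhi]; exact hx.lo_le_hi
  · rw [hhi]; exact hx.hi_le
  · rw [hlo, hhi]; exact hx.lo_lt_hi
  · intro u hu h
    rw [hlo, hhi]
    refine hx.lo_lt_hi_of_st u hu ?_
    by_cases huf : u = f
    · rw [huf, hf]; decide
    · rwa [hst' u huf] at h
  · rw [hlo]; exact hx.mark_lo
  · rw [hhi]; exact hx.mark_hi
  · rw [hlo, hhi]; exact hx.mark_between
  · intro u hu
    by_cases huf : u = f
    · rw [huf, hstf]; decide
    · rw [hst' u huf]; exact hx.st_le u hu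
  · rw [hhi]; exact hx.proposed
  · intro u v h
    rw [hhi]
    have h1 := hx.proposed_dummy u v h
    have huf : u ≠ f := by
      rintro rfl
      omega
    rw [hst' u (hfin huf)]
    exact h1
  · intro u w he
    rw [hx.rejected u w he, hrej, htie, or_assoc]
    refine or_congr_right ⟨?_, ?_⟩
    · rintro ⟨v, hv, h1, h2⟩
      by_cases hvf : v = f
      · subst hvf
        exact Or.inl ⟨h1, h2⟩
      · exact Or.inr ⟨v, by rwa [hst' v (hfin hvf)], h1, h2⟩
    · rintro (⟨h1, h2⟩ | ⟨v, hv, h1, h2⟩)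
      · exact ⟨f, hf, h1, h2⟩
      · have hvf : v ≠ f := by
          rintro rfl
          omega
        exact ⟨v, by rwa [hst' v (hfin hvf)] at hv, h1, h2⟩
  · rw [hev]; exact hx.ever
  · intro u hu w hw
    have huf : u ≠ f := by
      rintro rfl
      omega
    rw [hst' u (hfin huf)] at hu
    rw [htie] at hw
    exact ⟨(hrej u w).2 (Or.inl (hx.st_zero u hu w hw).1), (hx.st_zero u hu w hw).2⟩
  · intro u hu
    have huf : u ≠ f := by
      rintro rfl
      omega
    rw [hst' u (hfin huf)] at hu
    rw [htie]
    obtain ⟨w, h1, h2, h3⟩ := hx.st_one u hu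
    exact ⟨w, h1, fun w' h h' => (hrej u w').2 (Or.inl (h2 w' h h')), h3⟩

/-- The effect of an increase of the set of rejected edges. -/
theorem reject (hx : x.Simulates I off adj mark c) (hst2 : ∀ u < a, x.st u ≤ 2)
    {c' : Config (Fin a) (Fin b ⊕ Fin a)}
    (hp : c'.proposed = c.proposed) (he : c'.everActive = c.everActive)
    (hr : c.rejected ⊆ c'.rejected) (hlo : x'.lo = x.lo) (hhi : x'.hi = x.hi)
    (hev : x'.ever = x.ever) (hst : ∀ u < a, x'.st u = x.st u ∨ x'.st u < x.st u)
    (hmono : ∀ (v : Fin a) (w : Fin b), x.rej (v * b + w) ≠ 0 → x'.rej (v * b + w) ≠ 0)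
    (hrej : ∀ (v : Fin a) (w : Fin b), (v, w) ∈ I.edges →
      ((v, Sum.inl w) ∈ c'.rejected ↔ x'.rej (v * b + w) ≠ 0))
    (h0 : ∀ u : Fin a, x'.st u = 0 → x.st u ≠ 0 → ∀ w : Fin b, x.tie adj u w →
      x'.rej (u * b + w) ≠ 0 ∧
      ∀ v : Fin a, v ≠ u → (v, w) ∈ I.edges → Incomp (I.prefW w) v u →
        (v, Sum.inl w) ∈ c'.rejected)
    (h1 : ∀ u : Fin a, x'.st u = 1 → x.st u ≠ 1 → ∃ w : Fin b, x.tie adj u w ∧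
      (∀ w' : Fin b, x.tie adj u w' → w' ≠ w → x'.rej (u * b + w') ≠ 0) ∧
      ∀ v : Fin a, v ≠ u → (v, w) ∈ I.edges → Incomp (I.prefW w) v u →
        (v, Sum.inl w) ∈ c'.rejected) :
    x'.Simulates I off adj mark c' := by
  have htie : x'.tie = x.tie := by
    funext adj u w
    simp only [tie, hlo, hhi]
  refine ⟨?_, ?_, ?_, ?_, ?_, ?_, ?_, ?_, ?_, ?_, ?_, ?_, ?_, ?_, ?_⟩
  · rw [hlo]; exact hx.off_le_lo
  · rw [hlo, hhi]; exact hx.lo_le_hi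
  · rw [hhi]; exact hx.hi_le
  · rw [hlo, hhi]; exact hx.lo_lt_hi
  · intro u hu h
    rw [hlo, hhi]
    refine hx.lo_lt_hi_of_st u hu ?_
    have := hst u hu
    omega
  · rw [hlo]; exact hx.mark_lo
  · rw [hhi]; exact hx.mark_hi
  · rw [hlo, hhi]; exact hx.mark_between
  · intro u hu
    have := hst u hu
    have := hx.st_le u hu
    omega
  · rw [hhi, hp]; exact hx.proposed
  · intro u v h
    rw [hp] at h
    rw [hhi]
    have h2 := hx.proposed_dummy u v h
    have := hst u u.2
    exact ⟨by omega, h2.2⟩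
  · intro u w h
    rw [hrej u w h, or_iff_left]
    rintro ⟨v, hv, -⟩
    have := hst v v.2
    have := hst2 v v.2
    omega
  · rw [hev, he]; exact hx.ever
  · intro u hu w hw
    rw [htie] at hw
    by_cases h : x.st u = 0
    · obtain ⟨h2, h3⟩ := hx.st_zero u h w hw
      exact ⟨hmono u w h2, fun v hv h4 h5 => hr (h3 v hv h4 h5)⟩
    · exact h0 u hu h w hw
  · intro u hu
    rw [htie]
    by_cases h : x.st u = 1
    · obtain ⟨w, h2, h3, h4⟩ := hx.st_one u h
      exact ⟨w, h2, fun w' h5 h6 => hmono u w' (h3 w' h5 h6), fun v hv h5 h6 => hr (h4 v hv h5 h6)⟩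
    · exact h1 u hu h

end Arrays.Simulates

end Simulation

end PairwiseMarket

namespace PairwiseMarket

open Config

/-! ### Events of the array program as steps of an execution -/

section Events

variable {a b : ℕ} {I : Market (Fin a) (Fin b)} {off adj mark : ℕ → ℕ}
  {c : Config (Fin a) (Fin b ⊕ Fin a)} {x x' : Arrays} {t : Fin a → Fin b ⊕ Fin a → ℕ}

namespace Arrays.Simulates

/-- The event that STRONG_REJECT examines a man `f` with at most one active edge. -/
theorem examine (hL : Layout I off adj mark) (hJ : I.withDummies.Ranked t Sum.inr)
    (hr : Reachable I c) (hl : c.Calm) (hx : x.Simulates I off adj mark c)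
    (hst2 : ∀ u < a, x.st u ≤ 2) {f : Fin a} {k : ℕ} (hk : k < x.st f)
    (hcnt : (k = 0 ∧ ∀ w : Fin b, x.tie adj f w → x.rej (f * b + w) ≠ 0) ∨
      (k = 1 ∧ ∃ w : Fin b, x.tie adj f w ∧ x.rej (f * b + w) = 0 ∧
        ∀ w' : Fin b, x.tie adj f w' → x.rej (f * b + w') = 0 → w' = w))
    (hlo : x'.lo = x.lo) (hhi : x'.hi = x.hi) (hev : x'.ever = x.ever)
    (hst : x'.st = Function.update x.st f k)
    (hrej : ∀ (v : Fin a) (w : Fin b), x'.rej (v * b + w) ≠ 0 ↔ x.rej (v * b + w) ≠ 0 ∨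
      x.tie adj f w ∧ (k = 0 ∨ x.rej (f * b + w) = 0) ∧ v ≠ f ∧ Incomp (I.prefW w) v f) :
    ∃ c', Reachable I c' ∧ c'.Calm ∧ x'.Simulates I off adj mark c' := by
  have hc := Invariant.of_reachable hJ hr
  obtain ⟨c', hr', hl', hp', he', hrj'⟩ := exists_strongReject hc hr hl f
  have hd : (f, Sum.inr f) ∉ c.proposed := by
    intro h
    have := hx.proposed_dummy f f h
    omega
  have hact : ∀ y, (f, y) ∈ c.active ↔
      ∃ w, y = Sum.inl w ∧ x.tie adj f w ∧ x.rej (f * b + w) = 0 := by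
    rintro (w | v)
    · rw [hx.active_iff hL hJ hc hst2]
      simp
    · constructor
      · intro h
        have hv : v = f := hc.proposed_edges h.1
        subst hv
        exact (hd h.1).elim
      · rintro ⟨w, h, -⟩
        cases h
  have key : ∀ (v : Fin a) (w : Fin b), (v, w) ∈ I.edges →
      ((v, Sum.inl w) ∈ c.strongRejected I.withDummies f ↔
        x.tie adj f w ∧ (k = 0 ∨ x.rej (f * b + w) = 0) ∧ v ≠ f ∧ Incomp (I.prefW w) v f) := by
    intro v w he
    constructor
    · rintro ⟨h1, h2, h3, h4⟩
      have h5 : x.tie adj f w ∧ (k = 0 ∨ x.rej (f * b + w) = 0) := by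
        rcases h4 with h4 | ⟨h4, h5⟩
        · obtain ⟨w', h6, h7, h8⟩ := (hact (Sum.inl w)).1 ((h4 _).2 rfl)
          cases h6
          exact ⟨h7, Or.inr h8⟩
        · refine ⟨(hx.mem_proposalTie hL hJ hc hd).1 h5, ?_⟩
          rcases hcnt with h6 | ⟨-, w', h6, h7, -⟩
          · exact Or.inl h6.1
          · exact (h4 ⟨Sum.inl w', (hact _).2 ⟨w', rfl, h6, h7⟩⟩).elim
      exact ⟨h5.1, h5.2, h2, h3⟩
    · rintro ⟨h1, h2, h3, h4⟩
      refine ⟨he, h3, h4, ?_⟩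
      rcases hcnt with ⟨h5, h6⟩ | ⟨h5, w', h6, h7, h8⟩
      · right
        refine ⟨?_, (hx.mem_proposalTie hL hJ hc hd).2 h1⟩
        rintro ⟨y, hy⟩
        obtain ⟨w', -, h7, h8⟩ := (hact y).1 hy
        exact h6 w' h7 h8
      · left
        have hw : w = w' := h8 w h1 (by omega)
        intro y
        rw [hact]
        constructor
        · rintro ⟨w'', rfl, h9, h10⟩
          change Sum.inl w'' = Sum.inl w
          rw [h8 w'' h9 h10, hw]
        · rintro rfl
          exact ⟨w, rfl, h1, by omega⟩
  have hmem : ∀ (v : Fin a) (w : Fin b), (v, w) ∈ I.edges →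
      ((v, Sum.inl w) ∈ c'.rejected ↔ x'.rej (v * b + w) ≠ 0) := by
    intro v w he
    rw [hrj', Set.mem_union, key v w he, hx.rejected_iff hst2 he, hrej]
  have hnew : ∀ (v : Fin a) (w : Fin b), x.tie adj f w → (k = 0 ∨ x.rej (f * b + w) = 0) →
      v ≠ f → (v, w) ∈ I.edges → Incomp (I.prefW w) v f → (v, Sum.inl w) ∈ c'.rejected := by
    intro v w h1 h2 h3 h4 h5
    exact (hmem v w h4).2 ((hrej v w).2 (Or.inr ⟨h1, h2, h3, h5⟩))
  have hother : ∀ u : Fin a, x'.st u ≠ x.st u → u = f ∧ x'.st u = k := by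
    intro u hu
    rw [hst] at hu ⊢
    by_cases huf : (u : ℕ) = f
    · have := Fin.ext huf
      subst this
      exact ⟨rfl, Function.update_self ..⟩
    · rw [Function.update_of_ne huf] at hu
      exact (hu rfl).elim
  refine ⟨c', hr', hl', hx.reject hst2 hp' he' (hrj' ▸ Set.subset_union_left) hlo hhi hev ?_ ?_
    hmem ?_ ?_⟩
  · intro u hu
    by_cases h : x'.st u = x.st u
    · exact Or.inl h
    · obtain ⟨h1, h2⟩ := hother ⟨u, hu⟩ h
      subst h1
      simp only at h2 hk
      omega
  · intro v w h
    exact (hrej v w).2 (Or.inl h)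
  · intro u h1 h2 w hw
    obtain ⟨rfl, h3⟩ := hother u (by omega)
    rcases hcnt with ⟨h5, h6⟩ | ⟨h5, -⟩
    · exact ⟨(hrej u w).2 (Or.inl (h6 w hw)), fun v hv he hi => hnew v w hw (Or.inl h5) hv he hi⟩
    · omega
  · intro u h1 h2
    obtain ⟨rfl, h3⟩ := hother u (by omega)
    rcases hcnt with ⟨h5, h6⟩ | ⟨h5, w, h6, h7, h8⟩
    · omega
    · refine ⟨w, h6, fun w' h9 h10 => (hrej u w').2 (Or.inl fun h => h10 (h8 w' h9 h)), ?_⟩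
      exact fun v hv he hi => hnew v w h6 (Or.inr h7) hv he hi

/-- No man has to be examined by STRONG_REJECT, and the women have reacted to all proposals. -/
structure Settled (a b : ℕ) (adj : ℕ → ℕ) (x : Arrays) : Prop where
  st_le : ∀ u < a, x.st u ≤ 2
  of_one : ∀ u : Fin a, x.st u = 1 → ∃ w : Fin b, x.tie adj u w ∧ x.rej (u * b + w) = 0
  of_two : ∀ u : Fin a, x.st u = 2 → ∃ w w' : Fin b, w ≠ w' ∧ x.tie adj u w ∧ x.tie adj u w' ∧
    x.rej (u * b + w) = 0 ∧ x.rej (u * b + w') = 0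

/-- A man in state `2` still has two active edges, so an examination finds nothing to reject. In
states `0` and `1` the certificates of the simulation apply, as the number of active edges has not
fallen below the state. -/
theorem strongRejected_subset (hL : Layout I off adj mark) (hJ : I.withDummies.Ranked t Sum.inr)
    (hc : c.Invariant I.withDummies t Sum.inr) (hx : x.Simulates I off adj mark c)
    (hs : Settled a b adj x) (u : Fin a) : c.strongRejected I.withDummies u ⊆ c.rejected := by
  rintro ⟨v, w | v'⟩ he
  · obtain ⟨h1, h2, h3, h4⟩ := he
    have hle := hs.st_le u u.2
    rcases Nat.lt_or_ge (x.st u) 1 with h | h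
    · have h0 : x.st u = 0 := by omega
      refine (hx.st_zero u h0 w ?_).2 v h2 h1 h3
      rcases h4 with h4 | ⟨h4, h5⟩
      · exact ((hx.active_iff hL hJ hc hs.st_le).1 ((h4 _).2 rfl)).1
      · refine (hx.mem_proposalTie hL hJ hc ?_).1 h5
        exact fun h => h4 ⟨_, h, hc.dummy u⟩
    · have hex : ∃ w' : Fin b, x.tie adj u w' ∧ x.rej (u * b + w') = 0 := by
        rcases h.lt_or_eq with h | h
        · obtain ⟨w', -, -, h5, -, h6, -⟩ := hs.of_two u (by omega)
          exact ⟨w', h5, h6⟩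
        · exact hs.of_one u h.symm
      rcases h4 with h4 | ⟨h4, h5⟩
      · have huniq : ∀ w' : Fin b, x.tie adj u w' → x.rej (u * b + w') = 0 → w' = w := by
          intro w' h5 h6
          exact Sum.inl_injective ((h4 _).1 ((hx.active_iff hL hJ hc hs.st_le).2 ⟨h5, h6⟩))
        rcases h.lt_or_eq with h | h
        · obtain ⟨w', w'', h5, h6, h7, h8, h9⟩ := hs.of_two u (by omega)
          exact (h5 ((huniq w' h6 h8).trans (huniq w'' h7 h9).symm)).elim
        · obtain ⟨w', h5, h6, h7⟩ := hx.st_one u h.symm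
          obtain ⟨w'', h8, h9⟩ := hex
          have h10 : w'' = w' := by
            by_contra hne
            exact h6 w'' h8 hne h9
          rw [← h10, huniq w'' h8 h9] at h7
          exact h7 v h2 h1 h3
      · obtain ⟨w', h6, h7⟩ := hex
        exact (h4 ⟨_, (hx.active_iff hL hJ hc hs.st_le).2 ⟨h6, h7⟩⟩).elim
  -- A dummy woman has no second neighbour whom she could reject.
  · have h1 := strongRejected_proposed he
    have h2 : v' = u := hc.proposed_edges h1
    have h3 : v' = v := he.1
    exact (he.2.1 (h3.symm.trans h2)).elim

theorem not_coversMan_iff (hL : Layout I off adj mark) (hJ : I.withDummies.Ranked t Sum.inr)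
    (hc : c.Invariant I.withDummies t Sum.inr) (hx : x.Simulates I off adj mark c)
    (hs : Settled a b adj x) (u : Fin a) :
    ¬ CoversMan c.active u ↔ x.st u = 0 ∧ (u, Sum.inr u) ∉ c.proposed := by
  constructor
  · intro h
    refine ⟨?_, fun h' => h ⟨_, h', hc.dummy u⟩⟩
    have hle := hs.st_le u u.2
    by_contra h0
    have hex : ∃ w' : Fin b, x.tie adj u w' ∧ x.rej (u * b + w') = 0 := by
      rcases Nat.lt_or_ge 1 (x.st u) with h | h
      · obtain ⟨w', -, -, h5, -, h6, -⟩ := hs.of_two u (by omega)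
        exact ⟨w', h5, h6⟩
      · exact hs.of_one u (by omega)
    obtain ⟨w', h6, h7⟩ := hex
    exact h ⟨_, (hx.active_iff hL hJ hc hs.st_le).2 ⟨h6, h7⟩⟩
  · rintro ⟨h0, h1⟩ ⟨w | v, hw⟩
    · obtain ⟨h2, h3⟩ := (hx.active_iff hL hJ hc hs.st_le).1 hw
      exact (hx.st_zero u h0 w h2).1 h3
    · have hv : v = u := hc.proposed_edges hw.1
      subst hv
      exact h1 hw.1

/-- The man `u` is about to propose along the next tie. -/
def Next (off : ℕ → ℕ) (x : Arrays) (u : ℕ) : Prop := x.st u = 0 ∧ x.hi u < off (u + 1)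

/-- `x'` arises from `x` if the men without active edges propose along the next ties. -/
structure Proposes (a b : ℕ) (off adj mark : ℕ → ℕ) (x x' : Arrays) : Prop where
  lo : ∀ u < a, Next off x u → x'.lo u = x.hi u
  lt_hi : ∀ u < a, Next off x u → x.hi u < x'.hi u
  hi_le : ∀ u < a, Next off x u → x'.hi u ≤ off (u + 1)
  between : ∀ u < a, Next off x u → ∀ k, x.hi u < k → k < x'.hi u → mark k = 0
  mark_hi : ∀ u < a, Next off x u → x'.hi u = off (u + 1) ∨ mark (x'.hi u) ≠ 0
  st : ∀ u < a, Next off x u → x'.st u = 3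
  same : ∀ u < a, ¬ Next off x u → x'.lo u = x.lo u ∧ x'.hi u = x.hi u ∧ x'.st u = x.st u
  rej : x'.rej = x.rej
  ever : ∀ w : Fin b, x'.ever w ≠ 0 ↔ x.ever w ≠ 0 ∨
    ∃ u : Fin a, Next off x u ∧ x'.tie adj u w ∧ x.rej (u * b + w) = 0

/-- This covers a round in which only dummy women receive proposals. -/
theorem Proposes.refl (h : ∀ u < a, ¬ Next off x u) : Proposes a b off adj mark x x where
  lo u hu hn := (h u hu hn).elim
  lt_hi u hu hn := (h u hu hn).elim
  hi_le u hu hn := (h u hu hn).elim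
  between u hu hn := (h u hu hn).elim
  mark_hi u hu hn := (h u hu hn).elim
  st u hu hn := (h u hu hn).elim
  same _ _ _ := ⟨rfl, rfl, rfl⟩
  rej := rfl
  ever w := by
    rw [or_iff_left]
    rintro ⟨u, hu, -⟩
    exact h u u.2 hu

theorem proposed_iff_lt (hL : Layout I off adj mark) (hx : x.Simulates I off adj mark c)
    {u : Fin a} {w : Fin b} {i : ℕ} (h1 : off u ≤ i) (h2 : i < off (u + 1)) (h3 : adj i = w) :
    (u, Sum.inl w) ∈ c.proposed ↔ i < x.hi u := by
  rw [hx.proposed]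
  constructor
  · rintro ⟨j, h4, h5, h6⟩
    have := hx.hi_le u u.2
    have := hL.inj u u.2 i j h1 h2 h4 (by omega) (h3.trans h6.symm)
    omega
  · exact fun h => ⟨i, h1, h, h3⟩

/-- The list is sorted by preference, so the women without a proposal from `u` start at position `hi
u`, and the best of them extend to the next mark or to the end of the list. -/
theorem inl_mem_nextTie (hL : Layout I off adj mark) (hJ : I.withDummies.Ranked t Sum.inr)
    (hx : x.Simulates I off adj mark c) (hp : Proposes a b off adj mark x x')
    {u : Fin a} (hu : x.st u = 0) {w : Fin b} :
    Sum.inl w ∈ c.nextTie I.withDummies u ↔ Next off x u ∧ x'.tie adj u w := by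
  have h1 := hx.off_le_lo u u.2
  have h2 := hx.lo_le_hi u u.2
  rw [hJ.mem_nextTie]
  constructor
  · rintro ⟨he, hn, hmin⟩
    obtain ⟨i, h3, h4, h5⟩ := (hL.mem_iff u w).1 he
    rw [proposed_iff_lt hL hx h3 h4 h5] at hn
    have hnext : Next off x u := ⟨hu, by omega⟩
    refine ⟨hnext, i, (hp.lo u u.2 hnext).trans_le (by omega), ?_, h5⟩
    by_contra hlt
    have h6 := hp.lt_hi u u.2 hnext
    have h7 := hp.mark_hi u u.2 hnext
    have hb := hL.adj_lt u u.2 (x.hi u) (by omega) (by omega)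
    have hm : (u, Sum.inl ⟨adj (x.hi u), hb⟩) ∉ c.proposed := by
      rw [proposed_iff_lt hL hx (i := x.hi u) (by omega) (by omega) rfl]
      omega
    have h8 := hmin (Sum.inl ⟨adj (x.hi u), hb⟩)
      ((hL.mem_iff u _).2 ⟨x.hi u, by omega, by omega, rfl⟩) hm
    have h9 := hL.rank_lt hJ (u := u) (w := ⟨adj (x.hi u), hb⟩) (w' := w) (i := x.hi u) (j := i)
      (by omega) (by omega) h4 rfl h5 ⟨x'.hi u, h6, by omega, by omega⟩
    omega
  · rintro ⟨hnext, i, h3, h4, h5⟩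
    rw [hp.lo u u.2 hnext] at h3
    have h6 := hp.hi_le u u.2 hnext
    refine ⟨(hL.mem_iff u w).2 ⟨i, by omega, by omega, h5⟩, ?_, ?_⟩
    · rw [proposed_iff_lt hL hx (i := i) (by omega) (by omega) h5]
      omega
    · rintro (w' | v) he hn
      · obtain ⟨j, h7, h8, h9⟩ := (hL.mem_iff u w').1 he
        rw [proposed_iff_lt hL hx h7 h8 h9] at hn
        rcases le_or_gt i j with hij | hij
        · exact hL.rank_le hJ (by omega) hij h8 h5 h9
        · refine (hL.rank_eq hJ h7 hij (by omega) h9 h5 fun k hk hk' => ?_).ge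
          exact hp.between u u.2 hnext k (by omega) (by omega)
      · have hv : v = u := he
        subst hv
        exact (rank_dummy hJ ((hL.mem_iff v w).2 ⟨i, by omega, by omega, h5⟩)).le

theorem inr_mem_nextTie (hL : Layout I off adj mark) (hJ : I.withDummies.Ranked t Sum.inr)
    (hx : x.Simulates I off adj mark c) {u : Fin a} :
    Sum.inr u ∈ c.nextTie I.withDummies u ↔
      x.hi u = off (u + 1) ∧ (u, Sum.inr u) ∉ c.proposed := by
  have h1 := hx.off_le_lo u u.2
  have h2 := hx.lo_le_hi u u.2
  have h3 := hx.hi_le u u.2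
  rw [hJ.mem_nextTie]
  constructor
  · rintro ⟨-, hn, hmin⟩
    refine ⟨?_, hn⟩
    by_contra hne
    have hb := hL.adj_lt u u.2 (x.hi u) (by omega) (by omega)
    have hm : (u, Sum.inl ⟨adj (x.hi u), hb⟩) ∉ c.proposed := by
      rw [proposed_iff_lt hL hx (i := x.hi u) (by omega) (by omega) rfl]
      omega
    have he : (u, (⟨adj (x.hi u), hb⟩ : Fin b)) ∈ I.edges :=
      (hL.mem_iff u _).2 ⟨x.hi u, by omega, by omega, rfl⟩
    have h4 := hmin (Sum.inl ⟨adj (x.hi u), hb⟩) he hm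
    have h5 := rank_dummy hJ he
    omega
  · rintro ⟨h4, hn⟩
    refine ⟨rfl, hn, ?_⟩
    rintro (w | v) he hw
    · obtain ⟨j, h7, h8, h9⟩ := (hL.mem_iff u w).1 he
      rw [proposed_iff_lt hL hx h7 h8 h9] at hw
      omega
    · have hv : v = u := he
      subst hv
      exact le_rfl

/-- The event that the men without active edges propose. -/
theorem propose (hL : Layout I off adj mark) (hJ : I.withDummies.Ranked t Sum.inr)
    (hw : I.WomenAsymmetric)
    (hr : Reachable I c) (hl : c.Calm) (hx : x.Simulates I off adj mark c)
    (hs : Settled a b adj x) (hp : Proposes a b off adj mark x x')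
    (hunc : ∃ u, ¬ CoversMan c.active u) :
    ∃ c', Reachable I c' ∧ c'.Calm ∧ x'.Simulates I off adj mark c' ∧
      ∀ u : Fin a, x.st u = 0 → x.hi u = off (u + 1) → (u, Sum.inr u) ∈ c'.proposed := by
  have hc := Invariant.of_reachable hJ hr
  -- Since all men are settled, STRONG_REJECT can be left, and a proposal step becomes possible.
  have hr1 := exists_phase1 hr hl (hx.strongRejected_subset hL hJ hc hs)
  have hr2 := hr1.tail (Step.propose _ rfl hunc)
  have hnewl : ∀ (u : Fin a) (w : Fin b), (u, Sum.inl w) ∈ c.newProposals I.withDummies ↔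
      Next off x u ∧ x'.tie adj u w := by
    intro u w
    constructor
    · rintro ⟨h1, h2⟩
      exact (hx.inl_mem_nextTie hL hJ hp ((hx.not_coversMan_iff hL hJ hc hs u).1 h1).1).1 h2
    · intro h
      refine ⟨(hx.not_coversMan_iff hL hJ hc hs u).2 ⟨h.1.1, fun hd => ?_⟩,
        (hx.inl_mem_nextTie hL hJ hp h.1.1).2 h⟩
      have h1 := (hx.proposed_dummy u u hd).2
      have h2 := h.1.2
      omega
  have hnewr : ∀ (u v : Fin a), (u, Sum.inr v) ∈ c.newProposals I.withDummies →
      x.st u = 0 ∧ x.hi u = off (u + 1) := by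
    rintro u v ⟨h1, h2⟩
    have hv : v = u := h2.1
    subst hv
    exact ⟨((hx.not_coversMan_iff hL hJ hc hs v).1 h1).1, ((hx.inr_mem_nextTie hL hJ).1 h2).1⟩
  have hst3 : ∀ v < a, x'.st v = 3 ↔ Next off x v := by
    intro v hv
    constructor
    · intro h
      by_contra hn
      rw [(hp.same v hv hn).2.2] at h
      have := hs.st_le v hv
      omega
    · exact hp.st v hv
  have hst3' : ∀ v < a, x'.st v ≠ 3 → ¬ Next off x v := fun v hv h h' => h ((hst3 v hv).2 h')
  have htie : ∀ v < a, ¬ Next off x v → x'.tie adj v = x.tie adj v := by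
    intro v hv hn
    funext w
    obtain ⟨h1, h2, -⟩ := hp.same v hv hn
    simp only [tie, h1, h2]
  refine ⟨_, hr2, Or.inr ⟨_, rfl⟩, ?_, ?_⟩
  · refine ⟨?_, ?_, ?_, ?_, ?_, ?_, ?_, ?_, ?_, ?_, ?_, ?_, ?_, ?_, ?_⟩
    · intro u hu
      have h1 := hx.off_le_lo u hu
      have h2 := hx.lo_le_hi u hu
      by_cases hn : Next off x u
      · rw [hp.lo u hu hn]
        omega
      · rwa [(hp.same u hu hn).1]
    · intro u hu
      by_cases hn : Next off x u
      · rw [hp.lo u hu hn]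
        exact (hp.lt_hi u hu hn).le
      · rw [(hp.same u hu hn).1, (hp.same u hu hn).2.1]
        exact hx.lo_le_hi u hu
    · intro u hu
      by_cases hn : Next off x u
      · exact hp.hi_le u hu hn
      · rw [(hp.same u hu hn).2.1]
        exact hx.hi_le u hu
    · intro u hu
      by_cases hn : Next off x u
      · rw [hp.lo u hu hn]
        exact Or.inl (hp.lt_hi u hu hn)
      · rw [(hp.same u hu hn).1, (hp.same u hu hn).2.1]
        exact hx.lo_lt_hi u hu
    · intro u hu h
      by_cases hn : Next off x u
      · rw [hp.lo u hu hn]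
        exact hp.lt_hi u hu hn
      · rw [(hp.same u hu hn).1, (hp.same u hu hn).2.1]
        rw [(hp.same u hu hn).2.2] at h
        exact hx.lo_lt_hi_of_st u hu h
    · intro u hu
      by_cases hn : Next off x u
      · rw [hp.lo u hu hn]
        have h1 := hx.mark_hi u hu
        have h2 := hn.2
        omega
      · rw [(hp.same u hu hn).1]
        exact hx.mark_lo u hu
    · intro u hu
      by_cases hn : Next off x u
      · exact Or.inr (hp.mark_hi u hu hn)
      · rw [(hp.same u hu hn).2.1]
        exact hx.mark_hi u hu
    · intro u hu
      by_cases hn : Next off x u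
      · rw [hp.lo u hu hn]
        exact hp.between u hu hn
      · rw [(hp.same u hu hn).1, (hp.same u hu hn).2.1]
        exact hx.mark_between u hu
    · intro u hu
      by_cases hn : Next off x u
      · exact (hp.st u hu hn).le
      · rw [(hp.same u hu hn).2.2]
        exact hx.st_le u hu
    · intro u w
      simp only [Set.mem_union]
      rw [show (u, Sum.inl w) ∈ newProposals I.withDummies { c with loc := Loc.phase1 } ↔ _ from
        hnewl u w, hx.proposed]
      have h1 := hx.off_le_lo u u.2
      have h2 := hx.lo_le_hi u u.2
      by_cases hn : Next off x u
      · have h3 := hp.lo u u.2 hn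
        have h4 := hp.lt_hi u u.2 hn
        simp only [hn, true_and, tie, h3]
        constructor
        · rintro (⟨i, h5, h6, h7⟩ | ⟨i, h5, h6, h7⟩)
          · exact ⟨i, h5, by omega, h7⟩
          · exact ⟨i, by omega, h6, h7⟩
        · rintro ⟨i, h5, h6, h7⟩
          rcases Nat.lt_or_ge i (x.hi u) with h | h
          · exact Or.inl ⟨i, h5, h, h7⟩
          · exact Or.inr ⟨i, h, h6, h7⟩
      · simp only [hn, false_and, or_false, (hp.same u u.2 hn).2.1]
    · intro u v h
      have h1 : x.st u = 0 ∧ x.hi u = off (u + 1) := by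
        rcases h with h | h
        · exact hx.proposed_dummy u v h
        · exact hnewr u v h
      have hn : ¬ Next off x u := by
        rintro ⟨-, h2⟩
        omega
      rw [(hp.same u u.2 hn).2.1, (hp.same u u.2 hn).2.2]
      exact h1
    · intro u w he
      rw [hp.rej]
      refine or_congr (hx.rejected_iff hs.st_le he) ?_
      constructor
      · rintro ⟨-, v, h1, h2⟩
        obtain ⟨h3, h4⟩ := (hnewl v w).1 h1
        exact ⟨v, (hst3 v v.2).2 h3, h4, h2.1⟩
      · rintro ⟨v, h1, h2, h3⟩
        exact ⟨he, v, (hnewl v w).2 ⟨(hst3 v v.2).1 h1, h2⟩, (prec_prefW_iff hw).2 h3⟩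
    · intro w
      rw [hp.ever]
      refine or_congr (hx.ever w) ?_
      constructor
      · rintro ⟨u, h1, h2⟩
        obtain ⟨h3, h4⟩ := (hnewl u w).1 h1
        refine ⟨u, h3, h4, ?_⟩
        have h5 := (hx.rejected_iff hs.st_le (u := u) (w := w) h1.2.1).not.1 h2
        by_contra h6
        exact h5 h6
      · rintro ⟨u, h1, h2, h3⟩
        have h4 := (hnewl u w).2 ⟨h1, h2⟩
        refine ⟨u, h4, ?_⟩
        change (u, Sum.inl w) ∉ c.rejected
        rw [hx.rejected_iff hs.st_le h4.2.1]
        exact fun h5 => h5 h3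
    · intro u hu w h
      have hn := hst3' u u.2 (by omega)
      rw [htie u u.2 hn] at h
      rw [(hp.same u u.2 hn).2.2] at hu
      rw [hp.rej]
      obtain ⟨h1, h2⟩ := hx.st_zero u hu w h
      exact ⟨h1, fun v h3 h4 h5 => Or.inl (h2 v h3 h4 h5)⟩
    · intro u hu
      have hn := hst3' u u.2 (by omega)
      rw [(hp.same u u.2 hn).2.2] at hu
      rw [hp.rej, htie u u.2 hn]
      obtain ⟨w, h1, h2, h3⟩ := hx.st_one u hu
      exact ⟨w, h1, h2, fun v h4 h5 h6 => Or.inl (h3 v h4 h5 h6)⟩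
  · intro u h1 h2
    by_cases hd : (u, Sum.inr u) ∈ c.proposed
    · exact Or.inl hd
    · exact Or.inr ⟨(hx.not_coversMan_iff hL hJ hc hs u).2 ⟨h1, hd⟩,
        (hx.inr_mem_nextTie hL hJ).2 ⟨h2, hd⟩⟩

theorem with_loc (hx : x.Simulates I off adj mark c) (l : Loc (Fin a) (Fin b ⊕ Fin a)) :
    x.Simulates I off adj mark { c with loc := l } :=
  { hx with }

/-- If nothing is left to be done in the first phase, then an execution enters the second phase. -/
theorem exists_phase2 (hL : Layout I off adj mark) (hJ : I.withDummies.Ranked t Sum.inr)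
    (hw : I.WomenAsymmetric)
    (hr : Reachable I c) (hl : c.Calm) (hx : x.Simulates I off adj mark c)
    (hs : Settled a b adj x) (hn : ∀ u < a, ¬ Next off x u) :
    ∃ c', Reachable I c' ∧ c'.loc = Loc.phase2 ∧ x.Simulates I off adj mark c' ∧
      ∀ u : Fin a, (u, Sum.inr u) ∈ c'.active ↔ x.st u = 0 := by
  have key : ∀ {c}, Reachable I c → c.Calm → x.Simulates I off adj mark c →
      (∀ u, CoversMan c.active u) → ∃ c', Reachable I c' ∧ c'.loc = Loc.phase2 ∧
        x.Simulates I off adj mark c' ∧ ∀ u : Fin a, (u, Sum.inr u) ∈ c'.active ↔ x.st u = 0 := by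
    intro c hr hl hx hcov
    have hc := Invariant.of_reachable hJ hr
    have hr1 := exists_phase1 hr hl (hx.strongRejected_subset hL hJ hc hs)
    refine ⟨_, hr1.tail (Step.endPhase1 _ rfl hcov), rfl, hx.with_loc _, fun u => ?_⟩
    refine Iff.trans (active_dummy_iff hc) ⟨fun h => (hx.proposed_dummy u u h).1, fun h => ?_⟩
    by_contra hd
    exact (hx.not_coversMan_iff hL hJ hc hs u).2 ⟨h, hd⟩ (hcov u)
  -- Men without an active edge have exhausted their lists. One round of dummy proposals, under
  -- which the arrays stay the same, gives each of them an active edge.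
  by_cases hunc : ∃ u, ¬ CoversMan c.active u
  · obtain ⟨c', hr', hl', hx', hd⟩ := hx.propose hL hJ hw hr hl hs (Proposes.refl hn) hunc
    refine key hr' hl' hx' fun u => ?_
    by_contra hu
    obtain ⟨h1, h2⟩ := (hx'.not_coversMan_iff hL hJ (Invariant.of_reachable hJ hr') hs u).1 hu
    refine h2 (hd u h1 ?_)
    have h3 := hn u u.2
    have h4 := hx.hi_le u u.2
    by_contra h5
    exact h3 ⟨h1, by omega⟩
  · push Not at hunc
    exact key hr hl hx hunc

/-- The array `mm` describes a matching of active edges: `mm u` is the successor of the partner of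
`u`, if `u` is matched. -/
structure Matched (a b : ℕ) (adj : ℕ → ℕ) (x : Arrays) (mm : ℕ → ℕ) : Prop where
  tie : ∀ (u : Fin a) (w : Fin b), mm u = w + 1 → x.tie adj u w
  rej : ∀ (u : Fin a) (w : Fin b), mm u = w + 1 → x.rej (u * b + w) = 0
  st : ∀ (u : Fin a) (w : Fin b), mm u = w + 1 → x.st u ≠ 0
  inj : ∀ (u u' : Fin a) (w : Fin b), mm u = w + 1 → mm u' = w + 1 → u = u'

/-- The matching described by `mm`, where the men without active edges receive dummy women. -/
def extend {a : ℕ} (b : ℕ) (x : Arrays) (mm : ℕ → ℕ) : Set (Fin a × (Fin b ⊕ Fin a)) :=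
  {e | match e.2 with
    | Sum.inl w => mm e.1 = w + 1
    | Sum.inr v => v = e.1 ∧ x.st e.1 = 0}

variable {mm : ℕ → ℕ}

theorem isMatching_extend (hL : Layout I off adj mark) (hJ : I.withDummies.Ranked t Sum.inr)
    (hc : c.Invariant I.withDummies t Sum.inr)
    (hx : x.Simulates I off adj mark c) (hs : Settled a b adj x)
    (hd : ∀ u : Fin a, (u, Sum.inr u) ∈ c.active ↔ x.st u = 0) (hm : Matched a b adj x mm) :
    IsMatching c.active (extend b x mm) := by
  refine ⟨?_, ?_, ?_⟩
  · rintro ⟨u, w | v⟩ h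
    · exact (hx.active_iff hL hJ hc hs.st_le).2 ⟨hm.tie u w h, hm.rej u w h⟩
    · obtain ⟨rfl, h⟩ := h
      exact (hd _).2 h
  · rintro u (w | v) (w' | v') h h'
    · have h1 : mm u = w + 1 := h
      have h2 : mm u = w' + 1 := h'
      exact congrArg Sum.inl (Fin.ext (by omega))
    · exact (hm.st u w h h'.2).elim
    · exact (hm.st u w' h' h.2).elim
    · exact congrArg Sum.inr (h.1.trans h'.1.symm)
  · rintro u u' (w | v) h h'
    · exact hm.inj u u' w h h'
    · exact h.1.symm.trans h'.1

/-- The event that the edges of the critical set are rejected. -/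
theorem rejectCritical (hL : Layout I off adj mark) (hJ : I.withDummies.Ranked t Sum.inr)
    (hw : I.WomenAsymmetric)
    (hr : Reachable I c) (hl : c.Calm) (hx : x.Simulates I off adj mark c)
    (hs : Settled a b adj x) (hn : ∀ u < a, ¬ Next off x u) (hm : Matched a b adj x mm)
    {Z : Set (Fin a)} (hne : Z.Nonempty) (hst : ∀ u ∈ Z, x.st u ≠ 0)
    (hfree : ∀ u : Fin a, x.st u ≠ 0 → (∀ w : Fin b, mm u ≠ w + 1) → u ∈ Z)
    (hclosed : ∀ u ∈ Z, ∀ w : Fin b, x.tie adj u w → x.rej (u * b + w) = 0 →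
      ∃ u' ∈ Z, mm u' = w + 1)
    (hmin : ∀ X : Set (Fin a), (∀ u : Fin a, x.st u ≠ 0 → (∀ w : Fin b, mm u ≠ w + 1) → u ∈ X) →
      (∀ u ∈ X, ∀ (w : Fin b) (u' : Fin a), x.tie adj u w → x.rej (u * b + w) = 0 →
        mm u' = w + 1 → u' ∈ X) → Z ⊆ X)
    (hlo : x'.lo = x.lo) (hhi : x'.hi = x.hi) (hev : x'.ever = x.ever) (hst' : x'.st = x.st)
    (hrej : ∀ (v : Fin a) (w : Fin b), x'.rej (v * b + w) ≠ 0 ↔ x.rej (v * b + w) ≠ 0 ∨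
      v ∈ Z ∧ x.tie adj v w) :
    ∃ c', Reachable I c' ∧ c'.Calm ∧ x'.Simulates I off adj mark c' := by
  obtain ⟨c₂, hr₂, hl₂, hx₂, hd₂⟩ := hx.exists_phase2 hL hJ hw hr hl hs hn
  have hc₂ := Invariant.of_reachable hJ hr₂
  have hM := hx₂.isMatching_extend hL hJ hc₂ hs hd₂ hm
  have hcov : ∀ u : Fin a, ¬ CoversMan (extend b x mm) u ↔
      x.st u ≠ 0 ∧ ∀ w : Fin b, mm u ≠ w + 1 := by
    intro u
    constructor
    · intro h
      exact ⟨fun h' => h ⟨Sum.inr u, rfl, h'⟩, fun w h' => h ⟨Sum.inl w, h'⟩⟩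
    · rintro ⟨h1, h2⟩ ⟨w | v, h⟩
      · exact h2 w h
      · exact h1 h.2
  -- No member of `Z` has an active dummy edge, so the alternating paths involved use edges to real
  -- women only.
  have hcrit : criticalSet c₂.active = Z := by
    refine criticalSet_eq hM ?_ ?_ ?_
    · intro u hu
      rw [hcov] at hu
      exact hfree u hu.1 hu.2
    · rintro u hu (w | v) h
      · rw [hx₂.active_iff hL hJ hc₂ hs.st_le] at h
        exact hclosed u hu w h.1 h.2
      · have hv : v = u := hc₂.proposed_edges h.1
        subst hv
        exact (hst v hu ((hd₂ v).1 h)).elim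
    · intro X h1 h2
      refine hmin X (fun u h3 h4 => h1 u ((hcov u).2 ⟨h3, h4⟩)) fun u hu w u' h3 h4 h5 => ?_
      exact h2 u hu (Sum.inl w) u' ((hx₂.active_iff hL hJ hc₂ hs.st_le).2 ⟨h3, h4⟩) h5
  have hstep := Step.rejectCritical c₂ hl₂ (hcrit.symm ▸ hne) (J := I.withDummies)
  refine ⟨_, hr₂.tail hstep, Or.inr ⟨_, rfl⟩, hx₂.reject hs.st_le rfl rfl Set.subset_union_left
    hlo hhi hev (fun u _ => Or.inl (by rw [hst'])) (fun v w h => (hrej v w).2 (Or.inl h)) ?_ ?_ ?_⟩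
  · intro v w he
    rw [hrej]
    change _ ∈ c₂.rejected ∨ _ ↔ _
    rw [hx₂.rejected_iff hs.st_le he, hcrit]
    constructor
    · rintro (h | ⟨h1, h2⟩)
      · exact Or.inl h
      · exact Or.inr ⟨h2, ((hx₂.active_iff hL hJ hc₂ hs.st_le).1 h1).1⟩
    · rintro (h | ⟨h1, h2⟩)
      · exact Or.inl h
      · by_cases h3 : x.rej (v * b + w) = 0
        · exact Or.inr ⟨(hx₂.active_iff hL hJ hc₂ hs.st_le).2 ⟨h2, h3⟩, h1⟩
        · exact Or.inl h3
  · intro u h1 h2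
    rw [hst'] at h1
    exact (h2 h1).elim
  · intro u h1 h2
    rw [hst'] at h1
    exact (h2 h1).elim

/-- The final event, where all men with active edges are matched. -/
theorem finish (hm : I.MenTied) (hw : I.WomenAsymmetric) (hL : Layout I off adj mark)
    (hr : Reachable I c) (hl : c.Calm) (hx : x.Simulates I off adj mark c)
    (hs : Settled a b adj x) (hn : ∀ u < a, ¬ Next off x u) (hmm : Matched a b adj x mm)
    (hall : ∀ u : Fin a, x.st u ≠ 0 → ∃ w : Fin b, mm u = w + 1) :
    ((∀ w : Fin b, x.ever w ≠ 0 → ∃ u : Fin a, mm u = w + 1) →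
      ∃ c M, Reachable I c ∧ c.loc = Loc.output (some M) ∧ I.StronglyStable (restrict M) ∧
        ∀ (u : Fin a) (w : Fin b), (u, w) ∈ restrict M ↔ mm u = w + 1) ∧
    ((¬ ∀ w : Fin b, x.ever w ≠ 0 → ∃ u : Fin a, mm u = w + 1) →
      ∃ c, Reachable I c ∧ c.loc = Loc.output none ∧ ¬ ∃ M, I.StronglyStable M) := by
  obtain ⟨t, hJ⟩ := Market.withDummies_ranked hm hw
  obtain ⟨-, -, -, -, -, hout, -, hnone⟩ := execution_correct I hm hw
  obtain ⟨c₂, hr₂, hl₂, hx₂, hd₂⟩ := hx.exists_phase2 hL hJ hw hr hl hs hn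
  have hc₂ := Invariant.of_reachable hJ hr₂
  have hM := hx₂.isMatching_extend hL hJ hc₂ hs hd₂ hmm
  have hcov : ∀ u : Fin a, CoversMan (extend b x mm) u := by
    intro u
    by_cases h : x.st u = 0
    · exact ⟨Sum.inr u, rfl, h⟩
    · obtain ⟨w, hw⟩ := hall u h
      exact ⟨Sum.inl w, hw⟩
  have hmax : IsMaximumMatching c₂.active (extend b x mm) :=
    ⟨hM, fun N hN => hN.ncard_le.trans (ncard_eq_of_coversMan hM hcov).ge⟩
  have hcrit : criticalSet c₂.active = ∅ := by
    refine criticalSet_eq hM (fun u hu => (hu (hcov u)).elim) (fun u hu => hu.elim) ?_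
    exact fun X _ _ => Set.empty_subset X
  have hwomen : (∀ w ∈ c₂.everActive, CoversWoman (extend b x mm) w) ↔
      ∀ w : Fin b, x.ever w ≠ 0 → ∃ u : Fin a, mm u = w + 1 := by
    constructor
    · intro h w hw
      exact h (Sum.inl w) ((hx₂.ever w).2 hw)
    · rintro h (w | v) hw
      · exact h w ((hx₂.ever w).1 hw)
      -- A dummy woman who has been active belongs to a man in state `0`, and `extend` assigns her
      -- to him.
      · obtain ⟨u, hu⟩ := hc₂.proposed_of_ever hw
        have hv : v = u := hc₂.proposed_edges hu
        subst hv
        exact ⟨v, rfl, (hx₂.proposed_dummy v v hu).1⟩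
  constructor
  · intro h
    have hr₃ := hr₂.tail (Step.outputMatching c₂ _ hl₂ hcrit hmax (hwomen.2 h))
    exact ⟨_, _, hr₃, rfl, (hout _ hr₃ _ rfl).2, fun u w => Iff.rfl⟩
  · intro h
    have hr₃ := hr₂.tail (Step.outputNone c₂ _ hl₂ hcrit hmax (hwomen.not.2 h))
    refine ⟨_, hr₃, rfl, fun hex => ?_⟩
    obtain ⟨M, h1, -⟩ := hnone hex _ hr₃ none rfl
    cases h1

end Arrays.Simulates

end Events

end PairwiseMarket

namespace PairwiseMarket

/-! ## A structured language for the word RAM -/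

/-- The registers that programs refer to by name. -/
inductive Reg where
  | a | b | ans | u | v | w | i | f | k | x | y | z | qh | qt | go
  deriving DecidableEq

/-- The number of a register. -/
def Reg.idx : Reg → ℕ
  | a => 0 | b => 1 | ans => 2 | u => 3 | v => 4 | w => 5 | i => 6 | f => 7 | k => 8 | x => 9
  | y => 10 | z => 11 | qh => 12 | qt => 13 | go => 14

/-- The arrays that programs refer to by name. -/
inductive Arr where
  | off | adj | mark | coff | cfst | csnd | mm | lo | hi | rej | cmp | st | mw | ever | par | queue
  deriving DecidableEq

/-- The number of an array. -/
def Arr.idx : Arr → ℕ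
  | off => 0 | adj => 1 | mark => 2 | coff => 5 | cfst => 6 | csnd => 7 | mm => 8 | lo => 9
  | hi => 10 | rej => 11 | cmp => 12 | st => 13 | mw => 14 | ever => 15 | par => 16 | queue => 17

theorem Reg.idx_injective : Function.Injective Reg.idx := by
  intro r r' h
  cases r <;> cases r' <;> first | rfl | simp [Reg.idx] at h

/-- The registers from `32` on are thereby free for intermediate results. -/
theorem Reg.idx_lt (r : Reg) : r.idx < 32 := by cases r <;> decide

theorem Arr.idx_injective : Function.Injective Arr.idx := by
  intro r r' h
  cases r <;> cases r' <;> first | rfl | simp [Arr.idx] at h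

/-- The contents of the named registers and arrays. -/
structure Env where
  v : Reg → ℕ
  arr : Arr → ℕ → ℕ

/-- Write a register. -/
def Env.set (σ : Env) (r : Reg) (x : ℕ) : Env := { σ with v := Function.update σ.v r x }

/-- Write a cell of an array. -/
def Env.put (σ : Env) (A : Arr) (i x : ℕ) : Env :=
  { σ with arr := Function.update σ.arr A (Function.update (σ.arr A) i x) }

@[simp] theorem Env.set_v (σ : Env) (r : Reg) (x : ℕ) (r' : Reg) :
    (σ.set r x).v r' = if r' = r then x else σ.v r' := Function.update_apply ..

@[simp] theorem Env.set_arr (σ : Env) (r : Reg) (x : ℕ) : (σ.set r x).arr = σ.arr := rfl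

@[simp] theorem Env.put_v (σ : Env) (A : Arr) (i x : ℕ) : (σ.put A i x).v = σ.v := rfl

@[simp] theorem Env.put_arr (σ : Env) (A : Arr) (i x : ℕ) (A' : Arr) :
    (σ.put A i x).arr A' = if A' = A then Function.update (σ.arr A) i x else σ.arr A' := by
  by_cases h : A' = A
  · subst h
    simp [Env.put]
  · simp [Env.put, h]

/-- Expressions. -/
inductive Ex where
  | lit (k : ℕ) : Ex
  | var (r : Reg) : Ex
  | get (A : Arr) (e : Ex) : Ex
  | add (e e' : Ex) : Ex
  | sub (e e' : Ex) : Ex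
  | mul (e e' : Ex) : Ex

namespace Ex

/-- The value of an expression. -/
def eval : Ex → Env → ℕ
  | lit k, _ => k
  | var r, σ => σ.v r
  | get A e, σ => σ.arr A (e.eval σ)
  | add e e', σ => e.eval σ + e'.eval σ
  | sub e e', σ => e.eval σ - e'.eval σ
  | mul e e', σ => e.eval σ * e'.eval σ

/-- No intermediate result exceeds `B`. -/
def Fits (B : ℕ) : Ex → Env → Prop
  | lit k, _ => k ≤ B
  | var _, _ => True
  | get _ e, σ => e.Fits B σ
  | add e e', σ => e.Fits B σ ∧ e'.Fits B σ ∧ e.eval σ + e'.eval σ ≤ B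
  | sub e e', σ => e.Fits B σ ∧ e'.Fits B σ
  | mul e e', σ => e.Fits B σ ∧ e'.Fits B σ ∧ e.eval σ * e'.eval σ ≤ B

/-- The number of steps that the evaluation takes. -/
def cost : Ex → ℕ
  | lit _ => 1
  | var _ => 2
  | get _ e => e.cost + 1
  | add e e' => e.cost + (e'.cost + 1)
  | sub e e' => e.cost + (e'.cost + 1)
  | mul e e' => e.cost + (e'.cost + 1)

/-- The program that evaluates an expression into register `t`. -/
def compile : Ex → ℕ → Prog
  | lit k, t => .const t k
  -- There is no instruction that copies a register; subtraction of zero takes its place.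
  | var r, t => .seq (.const t 0) (.sub t r.idx t)
  | get A e, t => .seq (e.compile t) (.load t A.idx t)
  | add e e', t => .seq (e.compile t) (.seq (e'.compile (t + 1)) (.add t t (t + 1)))
  | sub e e', t => .seq (e.compile t) (.seq (e'.compile (t + 1)) (.sub t t (t + 1)))
  | mul e e', t => .seq (e.compile t) (.seq (e'.compile (t + 1)) (.mul t t (t + 1)))

end Ex

/-- The memory `s` holds the named registers and arrays. -/
def Env.Rep (σ : Env) (s : Memory) : Prop :=
  (∀ r, s.reg r.idx = σ.v r) ∧ ∀ A, s.arr A.idx = σ.arr A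

theorem Env.Rep.of_eq {σ : Env} {s s' : Memory} (h : σ.Rep s) {t : ℕ} (ht : 32 ≤ t)
    (hr : ∀ r < t, s'.reg r = s.reg r) (ha : s'.arr = s.arr) : σ.Rep s' :=
  ⟨fun r => (hr _ (r.idx_lt.trans_le ht)).trans (h.1 r), fun A => ha ▸ h.2 A⟩

/-- Intermediate results form a stack: an evaluation into register `t` leaves all lower registers
intact. The first operand thus survives the evaluation of the second one into `t + 1`. -/
theorem Ex.exec_compile {B : ℕ} (e : Ex) {σ : Env} {s : Memory} {t : ℕ} (ht : 32 ≤ t)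
    (hs : σ.Rep s) (hB : e.Fits B σ) : ∃ s', Exec B (e.compile t) s e.cost s' ∧
      s'.reg t = e.eval σ ∧ (∀ r < t, s'.reg r = s.reg r) ∧ s'.arr = s.arr := by
  have hne : ∀ (s : Memory) (t r x : ℕ), r < t → (s.setReg t x).reg r = s.reg r := by
    intro s t r x h
    simp only [Memory.setReg]
    exact Function.update_of_ne h.ne _ _
  have heq : ∀ (s : Memory) (t x : ℕ), (s.setReg t x).reg t = x := fun s t x => by
    simp [Memory.setReg]
  have bin : ∀ {e e' : Ex} {s : Memory} {t : ℕ}, 32 ≤ t → σ.Rep s →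
      (∀ {s : Memory} {t : ℕ}, 32 ≤ t → σ.Rep s → ∃ s', Exec B (e.compile t) s e.cost s' ∧
        s'.reg t = e.eval σ ∧ (∀ r < t, s'.reg r = s.reg r) ∧ s'.arr = s.arr) →
      (∀ {s : Memory} {t : ℕ}, 32 ≤ t → σ.Rep s → ∃ s', Exec B (e'.compile t) s e'.cost s' ∧
        s'.reg t = e'.eval σ ∧ (∀ r < t, s'.reg r = s.reg r) ∧ s'.arr = s.arr) →
      ∃ s₁ s₂, Exec B (e.compile t) s e.cost s₁ ∧ Exec B (e'.compile (t + 1)) s₁ e'.cost s₂ ∧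
        s₂.reg t = e.eval σ ∧ s₂.reg (t + 1) = e'.eval σ ∧ (∀ r < t, s₂.reg r = s.reg r) ∧
        s₂.arr = s.arr := by
    intro e e' s t ht hs h h'
    obtain ⟨s₁, h1, h2, h3, h4⟩ := h ht hs
    obtain ⟨s₂, h5, h6, h7, h8⟩ := h' (s := s₁) (t := t + 1) (by omega) (hs.of_eq ht h3 h4)
    exact ⟨s₁, s₂, h1, h5, (h7 t (by omega)).trans h2, h6,
      fun r hr => (h7 r (by omega)).trans (h3 r hr), h8.trans h4⟩
  induction e generalizing s t with
  | lit k => exact ⟨_, Exec.const s t k hB, heq .., fun r hr => hne _ _ _ _ hr, rfl⟩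
  | var r =>
    refine ⟨_, Exec.seq _ _ _ _ _ 1 1 (Exec.const s t 0 (Nat.zero_le _)) (Exec.sub _ t r.idx t),
      ?_, ?_, rfl⟩
    · rw [heq, heq, hne _ _ _ _ (r.idx_lt.trans_le ht), hs.1, Nat.sub_zero]
      rfl
    · intro r' hr'
      rw [hne _ _ _ _ hr', hne _ _ _ _ hr']
  | get A e ih =>
    obtain ⟨s₁, h1, h2, h3, h4⟩ := ih ht hs hB
    refine ⟨_, Exec.seq _ _ _ _ _ _ _ h1 (Exec.load _ t A.idx t), ?_, ?_, h4⟩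
    · rw [heq, h2, h4, hs.2]
      rfl
    · intro r hr
      rw [hne _ _ _ _ hr, h3 r hr]
  | add e e' ih ih' =>
    obtain ⟨s₁, s₂, h1, h2, h3, h4, h5, h6⟩ :=
      bin ht hs (fun h h' => ih h h' hB.1) (fun h h' => ih' h h' hB.2.1)
    refine ⟨_, Exec.seq _ _ _ _ _ _ _ h1 (Exec.seq _ _ _ _ _ _ _ h2 (Exec.add _ t t (t + 1) ?_)),
      ?_, ?_, h6⟩
    · rw [h3, h4]
      exact hB.2.2
    · rw [heq, h3, h4]
      rfl
    · intro r hr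
      rw [hne _ _ _ _ hr, h5 r hr]
  | sub e e' ih ih' =>
    obtain ⟨s₁, s₂, h1, h2, h3, h4, h5, h6⟩ :=
      bin ht hs (fun h h' => ih h h' hB.1) (fun h h' => ih' h h' hB.2)
    refine ⟨_, Exec.seq _ _ _ _ _ _ _ h1 (Exec.seq _ _ _ _ _ _ _ h2 (Exec.sub _ t t (t + 1))),
      ?_, ?_, h6⟩
    · rw [heq, h3, h4]
      rfl
    · intro r hr
      rw [hne _ _ _ _ hr, h5 r hr]
  | mul e e' ih ih' =>
    obtain ⟨s₁, s₂, h1, h2, h3, h4, h5, h6⟩ :=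
      bin ht hs (fun h h' => ih h h' hB.1) (fun h h' => ih' h h' hB.2.1)
    refine ⟨_, Exec.seq _ _ _ _ _ _ _ h1 (Exec.seq _ _ _ _ _ _ _ h2 (Exec.mul _ t t (t + 1) ?_)),
      ?_, ?_, h6⟩
    · rw [h3, h4]
      exact hB.2.2
    · rw [heq, h3, h4]
      rfl
    · intro r hr
      rw [hne _ _ _ _ hr, h5 r hr]

/-- Commands. -/
inductive Cmd where
  | skip : Cmd
  | assign (r : Reg) (e : Ex) : Cmd
  | store (A : Arr) (e e' : Ex) : Cmd
  | seq (p q : Cmd) : Cmd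
  | ite (e e' : Ex) (p q : Cmd) : Cmd
  | while (e e' : Ex) (p : Cmd) : Cmd

namespace Cmd

/-- The program of a command. -/
def compile : Cmd → Prog
  | skip => .skip
  | assign r e => .seq (e.compile 32) (.seq (.const 33 0) (.sub r.idx 32 33))
  | store A e e' => .seq (e.compile 32) (.seq (e'.compile 33) (.store A.idx 32 33))
  | seq p q => .seq p.compile q.compile
  | ite e e' p q => .seq (.seq (e.compile 32) (e'.compile 33)) (.ifLt 32 33 p.compile q.compile)
  -- The machine compares registers, so both sides of the condition are evaluated before the loop
  -- and again at the end of each body.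
  | .while e e' p => .seq (.seq (e.compile 32) (e'.compile 33))
      (.whileLt 32 33 (.seq p.compile (.seq (e.compile 32) (e'.compile 33))))

/-- The registers that a command may change. -/
def Writes : Cmd → Reg → Prop
  | skip, _ => False
  | assign r _, r' => r' = r
  | store _ _ _, _ => False
  | seq p q, r' => p.Writes r' ∨ q.Writes r'
  | ite _ _ p q, r' => p.Writes r' ∨ q.Writes r'
  | .while _ _ p, r' => p.Writes r'

/-- The arrays that a command may change. -/
def Stores : Cmd → Arr → Prop
  | skip, _ => False
  | assign _ _, _ => False
  | store A _ _, A' => A' = A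
  | seq p q, A' => p.Stores A' ∨ q.Stores A'
  | ite _ _ p q, A' => p.Stores A' ∨ q.Stores A'
  | .while _ _ p, A' => p.Stores A'

/-- Execution of a command with its number of steps. -/
inductive Runs (B : ℕ) : Cmd → Env → ℕ → Env → Prop
  | skip (σ : Env) : Runs B skip σ 1 σ
  | assign (σ : Env) (r : Reg) (e : Ex) (h : e.Fits B σ) :
      Runs B (assign r e) σ (e.cost + 2) (σ.set r (e.eval σ))
  | store (σ : Env) (A : Arr) (e e' : Ex) (h : e.Fits B σ) (h' : e'.Fits B σ) :
      Runs B (store A e e') σ (e.cost + (e'.cost + 1)) (σ.put A (e.eval σ) (e'.eval σ))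
  | seq (p q : Cmd) (σ σ₁ σ₂ : Env) (t₁ t₂ : ℕ) (h₁ : Runs B p σ t₁ σ₁)
      (h₂ : Runs B q σ₁ t₂ σ₂) : Runs B (seq p q) σ (t₁ + t₂) σ₂
  | iteTrue (e e' : Ex) (p q : Cmd) (σ σ' : Env) (t : ℕ) (h : e.Fits B σ) (h' : e'.Fits B σ)
      (hlt : e.eval σ < e'.eval σ) (hp : Runs B p σ t σ') :
      Runs B (ite e e' p q) σ (e.cost + e'.cost + (1 + t)) σ'
  | iteFalse (e e' : Ex) (p q : Cmd) (σ σ' : Env) (t : ℕ) (h : e.Fits B σ) (h' : e'.Fits B σ)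
      (hlt : ¬ e.eval σ < e'.eval σ) (hq : Runs B q σ t σ') :
      Runs B (ite e e' p q) σ (e.cost + e'.cost + (1 + t)) σ'
  | whileTrue (e e' : Ex) (p : Cmd) (σ σ₁ σ₂ : Env) (t₁ t₂ : ℕ) (h : e.Fits B σ)
      (h' : e'.Fits B σ) (hlt : e.eval σ < e'.eval σ) (h₁ : Runs B p σ t₁ σ₁)
      (h₂ : Runs B (.while e e' p) σ₁ t₂ σ₂) :
      Runs B (.while e e' p) σ (e.cost + e'.cost + (1 + t₁ + t₂)) σ₂
  | whileFalse (e e' : Ex) (p : Cmd) (σ : Env) (h : e.Fits B σ) (h' : e'.Fits B σ)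
      (hlt : ¬ e.eval σ < e'.eval σ) : Runs B (.while e e' p) σ (e.cost + e'.cost + 1) σ

end Cmd

theorem exec_compile_pair {B : ℕ} {e e' : Ex} {σ : Env} {s : Memory}
    (hs : σ.Rep s) (h : e.Fits B σ) (h' : e'.Fits B σ) :
    ∃ s₁ s₂, Exec B (e.compile 32) s e.cost s₁ ∧ Exec B (e'.compile 33) s₁ e'.cost s₂ ∧
      s₂.reg 32 = e.eval σ ∧ s₂.reg 33 = e'.eval σ ∧ σ.Rep s₂ := by
  obtain ⟨s₁, h1, h2, h3, h4⟩ := e.exec_compile le_rfl hs h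
  have hs₁ := hs.of_eq le_rfl h3 h4
  obtain ⟨s₂, h5, h6, h7, h8⟩ := e'.exec_compile (t := 33) (by decide) hs₁ h'
  exact ⟨s₁, s₂, h1, h5, (h7 32 (by decide)).trans h2, h6, hs₁.of_eq (by decide) h7 h8⟩

theorem Cmd.Runs.exec {B : ℕ} {p : Cmd} {σ τ : Env} {t : ℕ} (h : p.Runs B σ t τ) {s : Memory}
    (hs : σ.Rep s) : ∃ s', Exec B p.compile s t s' ∧ τ.Rep s' := by
  induction h generalizing s with
  | skip σ => exact ⟨s, Exec.skip s, hs⟩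
  | assign σ r e h =>
    obtain ⟨s₁, h1, h2, h3, h4⟩ := e.exec_compile le_rfl hs h
    have hs₁ := hs.of_eq le_rfl h3 h4
    refine ⟨_, Exec.seq _ _ _ _ _ _ _ h1 (Exec.seq _ _ _ _ _ 1 1
      (Exec.const s₁ 33 0 (Nat.zero_le _)) (Exec.sub _ r.idx 32 33)), ?_, ?_⟩
    · intro r'
      by_cases hr : r' = r
      · subst hr
        simp [Memory.setReg, h2]
      · have h5 : r'.idx ≠ r.idx := fun h => hr (Reg.idx_injective h)
        have h6 : r'.idx ≠ 33 := fun h => by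
          have := r'.idx_lt
          omega
        simp [Memory.setReg, h5, h6, hr, hs₁.1]
    · exact hs₁.2
  | store σ A e e' h h' =>
    obtain ⟨s₁, s₂, h1, h2, h3, h4, h5⟩ := exec_compile_pair hs h h'
    refine ⟨_, Exec.seq _ _ _ _ _ _ _ h1 (Exec.seq _ _ _ _ _ _ _ h2 (Exec.store _ A.idx 32 33)),
      h5.1, fun A' => ?_⟩
    by_cases hA : A' = A
    · subst hA
      simp [Memory.setArr, h3, h4, h5.2]
    · have h6 : A'.idx ≠ A.idx := fun h => hA (Arr.idx_injective h)
      simp [Memory.setArr, h6, hA, h5.2]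
  | seq p q σ σ₁ σ₂ t₁ t₂ h₁ h₂ ih₁ ih₂ =>
    obtain ⟨s₁, h1, h2⟩ := ih₁ hs
    obtain ⟨s₂, h3, h4⟩ := ih₂ h2
    exact ⟨s₂, Exec.seq _ _ _ _ _ _ _ h1 h3, h4⟩
  | iteTrue e e' p q σ σ' t h h' hlt hp ih =>
    obtain ⟨s₁, s₂, h1, h2, h3, h4, h5⟩ := exec_compile_pair hs h h'
    obtain ⟨s₃, h6, h7⟩ := ih h5
    exact ⟨s₃, Exec.seq _ _ _ _ _ _ _ (Exec.seq _ _ _ _ _ _ _ h1 h2)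
      (Exec.ifTrue _ _ _ _ _ _ _ (by rwa [h3, h4]) h6), h7⟩
  | iteFalse e e' p q σ σ' t h h' hlt hp ih =>
    obtain ⟨s₁, s₂, h1, h2, h3, h4, h5⟩ := exec_compile_pair hs h h'
    obtain ⟨s₃, h6, h7⟩ := ih h5
    exact ⟨s₃, Exec.seq _ _ _ _ _ _ _ (Exec.seq _ _ _ _ _ _ _ h1 h2)
      (Exec.ifFalse _ _ _ _ _ _ _ (by rwa [h3, h4]) h6), h7⟩
  | whileTrue e e' p σ σ₁ σ₂ t₁ t₂ h h' hlt h₁ h₂ ih₁ ih₂ =>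
    obtain ⟨s₁, s₂, h1, h2, h3, h4, h5⟩ := exec_compile_pair hs h h'
    obtain ⟨s₃, h6, h7⟩ := ih₁ h5
    obtain ⟨s₄, h8, h9⟩ := ih₂ h7
    refine ⟨s₄, Exec.seq _ _ _ _ _ _ _ (Exec.seq _ _ _ _ _ _ _ h1 h2) ?_, h9⟩
    -- The compiled rest of the loop starts by evaluating the condition. This prefix is shifted to
    -- the end of the current body, where the machine program performs it; the total number of steps
    -- is the same.
    cases h8 with
    | seq _ _ _ s₅ _ k r hk hr =>
      have := Exec.whileTrue _ _ _ _ _ _ _ _ (by rwa [h3, h4]) (Exec.seq _ _ _ _ _ _ _ h6 hk) hr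
      rwa [show 1 + (t₁ + k) + r = 1 + t₁ + (k + r) by omega] at this
  | whileFalse e e' p σ h h' hlt =>
    obtain ⟨s₁, s₂, h1, h2, h3, h4, h5⟩ := exec_compile_pair hs h h'
    exact ⟨s₂, Exec.seq _ _ _ _ _ _ _ (Exec.seq _ _ _ _ _ _ _ h1 h2)
      (Exec.whileFalse _ _ _ _ (by rwa [h3, h4])), h5⟩

/-- `τ` agrees with `σ` except for the registers and arrays that `p` may change. -/
def Cmd.Frame (p : Cmd) (σ τ : Env) : Prop :=
  (∀ r, ¬ p.Writes r → τ.v r = σ.v r) ∧ ∀ A, ¬ p.Stores A → τ.arr A = σ.arr A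

theorem Cmd.Runs.frame {B : ℕ} {p : Cmd} {σ τ : Env} {t : ℕ} (h : p.Runs B σ t τ) :
    p.Frame σ τ := by
  induction h with
  | skip σ => exact ⟨fun _ _ => rfl, fun _ _ => rfl⟩
  | assign σ r e h =>
    refine ⟨fun r' hr' => ?_, fun _ _ => rfl⟩
    have : r' ≠ r := hr'
    simp [this]
  | store σ A e e' h h' =>
    refine ⟨fun _ _ => rfl, fun A' hA' => ?_⟩
    have : A' ≠ A := hA'
    simp [this]
  | seq p q σ σ₁ σ₂ t₁ t₂ h₁ h₂ ih₁ ih₂ =>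
    simp only [Cmd.Frame, Cmd.Writes, Cmd.Stores, not_or] at *
    exact ⟨fun r hr => (ih₂.1 r hr.2).trans (ih₁.1 r hr.1),
      fun A hA => (ih₂.2 A hA.2).trans (ih₁.2 A hA.1)⟩
  | iteTrue e e' p q σ σ' t h h' hlt hp ih =>
    simp only [Cmd.Frame, Cmd.Writes, Cmd.Stores, not_or] at *
    exact ⟨fun r hr => ih.1 r hr.1, fun A hA => ih.2 A hA.1⟩
  | iteFalse e e' p q σ σ' t h h' hlt hp ih =>
    simp only [Cmd.Frame, Cmd.Writes, Cmd.Stores, not_or] at *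
    exact ⟨fun r hr => ih.1 r hr.2, fun A hA => ih.2 A hA.2⟩
  | whileTrue e e' p σ σ₁ σ₂ t₁ t₂ h h' hlt h₁ h₂ ih₁ ih₂ =>
    exact ⟨fun r hr => (ih₂.1 r hr).trans (ih₁.1 r hr),
      fun A hA => (ih₂.2 A hA).trans (ih₁.2 A hA)⟩
  | whileFalse e e' p σ h h' hlt => exact ⟨fun _ _ => rfl, fun _ _ => rfl⟩

/-- Started in `σ`, the command `p` halts after a number of steps and in a state that satisfy
`Q`. -/
def WP (B : ℕ) (p : Cmd) (σ : Env) (Q : ℕ → Env → Prop) : Prop := ∃ t τ, p.Runs B σ t τ ∧ Q t τ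

namespace WP

variable {B : ℕ} {p q : Cmd} {σ : Env} {Q Q' : ℕ → Env → Prop} {e e' : Ex}

/-- The frame is available to the new postcondition, so specifications need not mention what a
command leaves unchanged. -/
theorem mono (h : WP B p σ Q) (hQ : ∀ t τ, p.Frame σ τ → Q t τ → Q' t τ) : WP B p σ Q' := by
  obtain ⟨t, τ, h1, h2⟩ := h
  exact ⟨t, τ, h1, hQ t τ h1.frame h2⟩

theorem skip_iff : WP B .skip σ Q ↔ Q 1 σ := by
  constructor
  · rintro ⟨t, τ, ⟨⟩, h⟩
    exact h
  · exact fun h => ⟨_, _, .skip σ, h⟩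

theorem assign_iff {r : Reg} :
    WP B (.assign r e) σ Q ↔ e.Fits B σ ∧ Q (e.cost + 2) (σ.set r (e.eval σ)) := by
  constructor
  · rintro ⟨t, τ, ⟨⟩, h⟩
    exact ⟨by assumption, h⟩
  · exact fun h => ⟨_, _, .assign σ r e h.1, h.2⟩

theorem store_iff {A : Arr} :
    WP B (.store A e e') σ Q ↔ e.Fits B σ ∧ e'.Fits B σ ∧
      Q (e.cost + (e'.cost + 1)) (σ.put A (e.eval σ) (e'.eval σ)) := by
  constructor
  · rintro ⟨t, τ, ⟨⟩, h⟩
    exact ⟨by assumption, by assumption, h⟩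
  · exact fun h => ⟨_, _, .store σ A e e' h.1 h.2.1, h.2.2⟩

theorem seq_iff : WP B (.seq p q) σ Q ↔
    WP B p σ fun t τ => WP B q τ fun t' τ' => Q (t + t') τ' := by
  constructor
  · rintro ⟨t, τ, h, hQ⟩
    cases h with
    | seq _ _ _ σ₁ _ t₁ t₂ h₁ h₂ => exact ⟨_, _, h₁, _, _, h₂, hQ⟩
  · rintro ⟨_, _, h₁, _, _, h₂, hQ⟩
    exact ⟨_, _, .seq _ _ _ _ _ _ _ h₁ h₂, hQ⟩

theorem ite_iff : WP B (.ite e e' p q) σ Q ↔ e.Fits B σ ∧ e'.Fits B σ ∧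
    (e.eval σ < e'.eval σ → WP B p σ fun t τ => Q (e.cost + e'.cost + (1 + t)) τ) ∧
    (¬ e.eval σ < e'.eval σ → WP B q σ fun t τ => Q (e.cost + e'.cost + (1 + t)) τ) := by
  constructor
  · rintro ⟨t, τ, h, hQ⟩
    cases h with
    | iteTrue _ _ _ _ _ _ t h h' hlt hp =>
      exact ⟨h, h', fun _ => ⟨_, _, hp, hQ⟩, fun hn => (hn hlt).elim⟩
    | iteFalse _ _ _ _ _ _ t h h' hlt hp =>
      exact ⟨h, h', fun hn => (hlt hn).elim, fun _ => ⟨_, _, hp, hQ⟩⟩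
  · rintro ⟨h, h', h1, h2⟩
    by_cases hlt : e.eval σ < e'.eval σ
    · obtain ⟨t, τ, h3, h4⟩ := h1 hlt
      exact ⟨_, _, .iteTrue _ _ _ _ _ _ _ h h' hlt h3, h4⟩
    · obtain ⟨t, τ, h3, h4⟩ := h2 hlt
      exact ⟨_, _, .iteFalse _ _ _ _ _ _ _ h h' hlt h3, h4⟩

/-- A loop whose bodies need at most `T` steps per unit by which `μ` decreases. -/
theorem while_rule {Inv : Env → Prop} {μ : Env → ℕ} {T : ℕ} (h0 : Inv σ)
    (hfits : ∀ τ, p.Frame σ τ → Inv τ → e.Fits B τ ∧ e'.Fits B τ)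
    (hstep : ∀ τ, p.Frame σ τ → Inv τ → e.eval τ < e'.eval τ →
      WP B p τ fun t τ' => Inv τ' ∧ μ τ' < μ τ ∧ t ≤ T * (μ τ - μ τ'))
    (hQ : ∀ t τ, p.Frame σ τ → Inv τ → ¬ e.eval τ < e'.eval τ →
      t ≤ (T + (e.cost + e'.cost + 1)) * (μ σ - μ τ) + (e.cost + e'.cost + 1) → μ τ ≤ μ σ →
      Q t τ) :
    WP B (.while e e' p) σ Q := by
  have hrefl : p.Frame σ σ := ⟨fun _ _ => rfl, fun _ _ => rfl⟩
  have key : ∀ n τ, p.Frame σ τ → Inv τ → μ τ = n → ∃ t τ', Cmd.Runs B (.while e e' p) τ t τ' ∧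
      Inv τ' ∧ ¬ e.eval τ' < e'.eval τ' ∧ μ τ' ≤ μ τ ∧
      t ≤ (T + (e.cost + e'.cost + 1)) * (μ τ - μ τ') + (e.cost + e'.cost + 1) := by
    intro n
    induction n using Nat.strong_induction_on with
    | _ n ih =>
      intro τ hf hi hn
      obtain ⟨h1, h2⟩ := hfits τ hf hi
      by_cases hlt : e.eval τ < e'.eval τ
      · obtain ⟨t₁, τ₁, hr, hi₁, hμ, ht⟩ := hstep τ hf hi hlt
        have hf' := hr.frame
        have hf₁ : p.Frame σ τ₁ := ⟨fun r h => (hf'.1 r h).trans (hf.1 r h),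
          fun A h => (hf'.2 A h).trans (hf.2 A h)⟩
        obtain ⟨t₂, τ₂, hr₂, hi₂, hlt₂, hμ₂, ht₂⟩ := ih _ (hn ▸ hμ) τ₁ hf₁ hi₁ rfl
        refine ⟨_, τ₂, .whileTrue _ _ _ _ _ _ _ _ h1 h2 hlt hr hr₂, hi₂, hlt₂, by omega, ?_⟩
        set c := e.cost + e'.cost + 1
        have h3 : μ τ - μ τ₂ = (μ τ - μ τ₁) + (μ τ₁ - μ τ₂) := by omega
        -- Each round lowers `μ` by at least one, which pays for the evaluation of the condition.
        have h4 : c ≤ c * (μ τ - μ τ₁) := Nat.le_mul_of_pos_right _ (by omega)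
        rw [h3, mul_add, add_mul T c (μ τ - μ τ₁)]
        omega
      · refine ⟨_, τ, .whileFalse _ _ _ _ h1 h2 hlt, hi, hlt, le_rfl, ?_⟩
        omega
  obtain ⟨t, τ', hr, hi, hlt, hμ, ht⟩ := key _ σ hrefl h0 rfl
  exact ⟨t, τ', hr, hQ t τ' hr.frame hi hlt ht hμ⟩

end WP

/-- `for r = lo, …, hi - 1 do p` -/
def Cmd.for (r : Reg) (lo hi : Ex) (p : Cmd) : Cmd :=
  .seq (.assign r lo) (.while (.var r) hi (.seq p (.assign r (.add (.var r) (.lit 1)))))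

theorem Cmd.writes_for {r : Reg} {lo hi : Ex} {p : Cmd} {r' : Reg} :
    (Cmd.for r lo hi p).Writes r' ↔ r' = r ∨ p.Writes r' := by
  simp only [Cmd.for, Cmd.Writes]
  tauto

theorem Cmd.stores_for {r : Reg} {lo hi : Ex} {p : Cmd} {A : Arr} :
    (Cmd.for r lo hi p).Stores A ↔ p.Stores A := by
  simp only [Cmd.for, Cmd.Stores]
  tauto

/-- The upper bound is evaluated anew in each round, so its value must be stable under the loop. The
invariant is indexed by the counter and is required after the increment. -/
theorem WP.for_rule {B : ℕ} {p : Cmd} {σ : Env} {Q : ℕ → Env → Prop} {r : Reg} {lo hi : Ex}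
    {l h T : ℕ} (Inv : ℕ → Env → Prop) (hlo : lo.Fits B σ) (hl : lo.eval σ = l) (hlh : l ≤ h)
    (hB : h ≤ B) (hB1 : 1 ≤ B)
    (hhi : ∀ τ, (Cmd.for r lo hi p).Frame σ τ → hi.Fits B τ ∧ hi.eval τ = h)
    (hr : ¬ p.Writes r)
    (h0 : Inv l (σ.set r l))
    (hstep : ∀ k τ, l ≤ k → k < h → (Cmd.for r lo hi p).Frame σ τ → τ.v r = k → Inv k τ →
      WP B p τ fun t τ' => t ≤ T ∧ Inv (k + 1) (τ'.set r (k + 1)))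
    (hQ : ∀ t τ, (Cmd.for r lo hi p).Frame σ τ → τ.v r = h → Inv h τ →
      t ≤ (T + (hi.cost + 10)) * (h - l) + (hi.cost + lo.cost + 5) → Q t τ) :
    WP B (.for r lo hi p) σ Q := by
  have hfr : ∀ {τ}, (Cmd.seq p (.assign r (.add (.var r) (.lit 1)))).Frame (σ.set r l) τ →
      (Cmd.for r lo hi p).Frame σ τ := by
    intro τ hf
    refine ⟨fun r' hr' => ?_, fun A hA => ?_⟩
    · rw [Cmd.writes_for, not_or] at hr'
      have := hf.1 r' (by simp only [Cmd.Writes]; tauto)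
      simpa [hr'.1] using this
    · rw [Cmd.stores_for] at hA
      exact hf.2 A (by simp only [Cmd.Stores]; tauto)
  rw [Cmd.for, WP.seq_iff, WP.assign_iff, hl]
  refine ⟨hlo, ?_⟩
  -- The increment of the counter takes six steps.
  refine WP.while_rule (T := T + 6) (μ := fun τ => h - τ.v r)
    (Inv := fun τ => l ≤ τ.v r ∧ τ.v r ≤ h ∧ Inv (τ.v r) τ) ?_ ?_ ?_ ?_
  · simpa using ⟨hlh, h0⟩
  · intro τ hf hi
    exact ⟨trivial, (hhi τ (hfr hf)).1⟩
  · rintro τ hf ⟨h1, h2, h3⟩ hlt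
    rw [(hhi τ (hfr hf)).2] at hlt
    change τ.v r < h at hlt
    rw [WP.seq_iff]
    refine (hstep (τ.v r) τ h1 hlt (hfr hf) rfl h3).mono ?_
    rintro t τ' hf' ⟨ht, hi⟩
    have hr' := hf'.1 r hr
    rw [WP.assign_iff]
    refine ⟨⟨trivial, hB1, ?_⟩, ?_⟩
    · simp only [Ex.eval]
      omega
    · simp only [Ex.eval, Env.set_v, if_true, hr', Ex.cost]
      refine ⟨⟨by omega, by omega, hi⟩, by omega, ?_⟩
      rw [show h - τ.v r - (h - (τ.v r + 1)) = 1 by omega]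
      omega
  · rintro t τ hf ⟨h1, h2, h3⟩ hlt ht -
    rw [(hhi τ (hfr hf)).2] at hlt
    have h4 : τ.v r = h := by
      change ¬ τ.v r < h at hlt
      omega
    refine hQ _ τ (hfr hf) h4 (h4 ▸ h3) ?_
    simp only [Ex.cost, Env.set_v, if_true, h4, Nat.sub_self, Nat.sub_zero] at ht
    rw [show T + (hi.cost + 10) = T + 6 + (2 + hi.cost + 1) + 1 by omega, add_mul _ 1]
    omega

end PairwiseMarket

namespace PairwiseMarket

/-! ## The program -/

/-- The position of the pair `(p, q)` in a table with rows of length `n`. -/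
def Ex.pair (p n q : Ex) : Ex := .add (.mul p n) q

/-- The entry of the comparison table for `q` and `r` on the list of `p`. -/
def Ex.cmp (p q r : Reg) : Ex :=
  .get .cmp (.pair (.pair (.var p) (.var .a) (.var q)) (.var .a) (.var r))

/-- The mark of the edge `pq`. -/
def Ex.rej (p q : Reg) : Ex := .get .rej (.pair (.var p) (.var .b) (.var q))

namespace Cmd

/-- Set `f` to a man to whose proposals the women have not reacted, or to `a`. -/
def findReact : Cmd :=
  .seq (.assign .f (.var .a)) <|
  .for .u (.lit 0) (.var .a) <|
    .ite (.lit 2) (.get .st (.var .u)) (.assign .f (.var .u)) .skip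

/-- For each `w` in the proposal tie of `f` with `g < 1`, all `v` with `c < 1` are rejected. -/
def rejectLoop (g c : Ex) : Cmd :=
  .for .i (.get .lo (.var .f)) (.get .hi (.var .f)) <|
    .seq (.assign .w (.get .adj (.var .i))) <|
    -- Conditions are coded by numbers, and zero means that the condition holds.
    .ite g (.lit 1)
      (.for .v (.lit 0) (.var .a) <|
        .ite c (.lit 1) (.store .rej (.pair (.var .v) (.var .b) (.var .w)) (.lit 1)) .skip)
      .skip

/-- The women react to the proposals of `f`. -/
def react : Cmd :=
  -- The truncated difference vanishes exactly if the table entry is nonzero, that is, if `w`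
  -- prefers `f` to `v`.
  .seq (.rejectLoop (.lit 0) (.sub (.lit 1) (.cmp .w .f .v))) (.store .st (.var .f) (.lit 2))

/-- Set `f` to a man who has to be examined by STRONG_REJECT and `k` to the number of his active
edges, or `f` to `a`. -/
def findExamine : Cmd :=
  .seq (.assign .f (.var .a)) <|
  .for .u (.lit 0) (.var .a) <|
    .seq (.assign .x (.lit 0)) <|
    .seq (.for .i (.get .lo (.var .u)) (.get .hi (.var .u)) <|
      .seq (.assign .w (.get .adj (.var .i))) <|
      .ite (.rej .u .w) (.lit 1) (.assign .x (.add (.var .x) (.lit 1))) .skip) <|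
    -- If fewer active edges are left than the state indicates, the last examination is out of date.
    .ite (.var .x) (.get .st (.var .u))
      (.seq (.assign .f (.var .u)) (.assign .k (.var .x))) .skip

/-- STRONG_REJECT examines the man `f`, who has `k ≤ 1` active edges. -/
def examine : Cmd :=
  -- For `k ≤ 1` the first expression vanishes if `k = 0` or `fw` is not rejected. The second one
  -- vanishes if both table entries are zero and `v ≠ f`; its last summand is `1` for `v = f` and
  -- `0` otherwise.
  .seq (.rejectLoop (.sub (.var .k) (.sub (.lit 1) (.rej .f .w)))
      (.add (.sub (.lit 1) (.sub (.sub (.lit 1) (.cmp .w .v .f)) (.cmp .w .f .v))) (.sub (.lit 1)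
        (.add (.sub (.var .v) (.var .f)) (.sub (.var .f) (.var .v))))))
    (.store .st (.var .f) (.var .k))

/-- Remove the rejected edges from the matching. -/
def clean : Cmd :=
  .for .u (.lit 0) (.var .a) <|
    .seq (.assign .w (.sub (.get .mm (.var .u)) (.lit 1))) <|
    .ite (.lit 0) (.get .mm (.var .u))
      (.ite (.lit 0) (.rej .u .w)
        (.seq (.store .mm (.var .u) (.lit 0)) (.store .mw (.var .w) (.lit 0))) .skip) .skip

/-- Reject the edges in the proposal ties of the men in the queue. -/
def rejectQueue : Cmd :=
  .for .k (.lit 0) (.var .qt) <|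
    .seq (.assign .u (.get .queue (.var .k))) <|
    .for .i (.get .lo (.var .u)) (.get .hi (.var .u)) <|
      .seq (.assign .w (.get .adj (.var .i))) <|
      .store .rej (.pair (.var .u) (.var .b) (.var .w)) (.lit 1)

/-- Decide the answer. -/
def finish : Cmd :=
  .seq (.assign .ans (.lit 1)) <|
  .seq (.for .w (.lit 0) (.var .b) <|
    .ite (.lit 0) (.get .ever (.var .w))
      (.ite (.get .mw (.var .w)) (.lit 1) (.assign .ans (.lit 0)) .skip) .skip)
    (.assign .go (.lit 0))

end Cmd

theorem pair_lt {u w n k : ℕ} (hu : u < k) (hw : w < n) : u * n + w < k * n := by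
  calc u * n + w < u * n + n := by omega
    _ = (u + 1) * n := by ring
    _ ≤ k * n := Nat.mul_le_mul_right n hu

theorem pair_inj {u w u' w' n : ℕ} (hw : w < n) (hw' : w' < n) :
    u * n + w = u' * n + w' ↔ u = u' ∧ w = w' := by
  constructor
  · intro h
    have h1 : u = u' := by
      rcases lt_trichotomy u u' with hlt | h | hlt
      · have := pair_lt hlt hw
        omega
      · exact h
      · have := pair_lt hlt hw'
        omega
    subst h1
    exact ⟨rfl, by omega⟩
  · rintro ⟨rfl, rfl⟩
    rfl

/-- The bound `B` admits all values that occur. -/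
structure Big (a b B : ℕ) : Prop where
  eight : 8 ≤ B
  men : a + 1 ≤ B
  women : b + 1 ≤ B
  edges : a * b ≤ B
  triples : b * a * a ≤ B

theorem Big.pair {a b B u w : ℕ} (h : Big a b B) (hu : u < a) (hw : w < b) :
    u * b ≤ B ∧ u * b + w ≤ B := by
  have h1 := pair_lt hu hw
  have h2 := h.edges
  omega

theorem Big.triple {a b B w u v : ℕ} (h : Big a b B) (hw : w < b) (hu : u < a) (hv : v < a) :
    w * a ≤ B ∧ w * a + u ≤ B ∧ (w * a + u) * a ≤ B ∧ (w * a + u) * a + v ≤ B := by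
  have h1 := pair_lt hw hu
  have h2 := pair_lt h1 hv
  have h3 := h.triples
  have h4 := Nat.le_mul_of_pos_right (w * a + u) (show 0 < a by omega)
  omega

/-! ### Reactions of the women and examinations -/

section Specifications

variable {a b B : ℕ} {I : Market (Fin a) (Fin b)} {off adj mark : ℕ → ℕ} {σ : Env}

/-- The fixed part of the memory. -/
structure Env.Base (I : Market (Fin a) (Fin b)) (off adj mark : ℕ → ℕ) (σ : Env) : Prop where
  men : σ.v .a = a
  women : σ.v .b = b
  off : σ.arr .off = off
  adj : σ.arr .adj = adj
  mark : σ.arr .mark = mark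
  cmp : ∀ (w : Fin b) (u v : Fin a), σ.arr .cmp ((w * a + u) * a + v) ≠ 0 ↔ I.prefW w u v

/-- The variable arrays in the memory. -/
def Env.arrays (σ : Env) : Arrays := ⟨σ.arr .lo, σ.arr .hi, σ.arr .st, σ.arr .rej, σ.arr .ever⟩

theorem Env.Base.of_frame (h : σ.Base I off adj mark) {p : Cmd} {τ : Env} (hf : p.Frame σ τ)
    (hp : ¬ p.Writes .a ∧ ¬ p.Writes .b ∧ ¬ p.Stores .off ∧ ¬ p.Stores .adj ∧ ¬ p.Stores .mark ∧
      ¬ p.Stores .cmp) : τ.Base I off adj mark := by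
  obtain ⟨h1, h2, h3, h4, h5, h6⟩ := hp
  exact ⟨(hf.1 _ h1).trans h.men, (hf.1 _ h2).trans h.women, (hf.2 _ h3).trans h.off,
    (hf.2 _ h4).trans h.adj, (hf.2 _ h5).trans h.mark, by rw [hf.2 _ h6]; exact h.cmp⟩

/-- The proposal ties lie within the adjacency lists. -/
def Arrays.Bounded (a b B : ℕ) (adj : ℕ → ℕ) (x : Arrays) : Prop :=
  ∀ u < a, x.lo u ≤ x.hi u ∧ x.hi u ≤ B ∧ x.hi u - x.lo u ≤ b ∧
    ∀ i, x.lo u ≤ i → i < x.hi u → adj i < b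

theorem wp_findReact (hB : Big a b B) (h : σ.Base I off adj mark) :
    WP B .findReact σ fun t τ => t ≤ 100 * (a + 1) ∧
      ((τ.v .f = a ∧ ∀ u < a, σ.arr .st u ≤ 2) ∨ (τ.v .f < a ∧ 2 < σ.arr .st (τ.v .f))) := by
  rw [Cmd.findReact, WP.seq_iff, WP.assign_iff]
  refine ⟨trivial, WP.for_rule (l := 0) (h := a) (T := 20) (fun k τ =>
    (τ.v .f = a ∧ ∀ u < k, σ.arr .st u ≤ 2) ∨ (τ.v .f < a ∧ 2 < σ.arr .st (τ.v .f)))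
    (Nat.zero_le _) rfl (Nat.zero_le _) (by have := hB.men; omega) (by have := hB.eight; omega)
    ?_ ?_ ?_ ?_ ?_⟩
  · intro τ hf
    refine ⟨trivial, ?_⟩
    rw [Ex.eval, hf.1 _ (by simp [Cmd.writes_for, Cmd.Writes])]
    simp [h.men]
  · simp [Cmd.Writes]
  · simp [h.men, Ex.eval]
  · intro k τ _ hk hf hv hi
    have hst : τ.arr .st = σ.arr .st := hf.2 _ (by simp [Cmd.stores_for, Cmd.Stores])
    simp only [WP.ite_iff, WP.assign_iff, WP.skip_iff, Ex.Fits, Ex.eval, Ex.cost, hst, hv,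
      Env.set_v, reduceCtorEq, if_false, if_true]
    have := hB.eight
    refine ⟨by omega, trivial, fun hlt => ⟨trivial, by omega, Or.inr ⟨hk, hlt⟩⟩, fun hlt =>
      ⟨by omega, ?_⟩⟩
    rcases hi with ⟨h1, h2⟩ | hi
    · refine Or.inl ⟨h1, fun u hu => ?_⟩
      rcases (Nat.lt_succ_iff_lt_or_eq.1 hu) with hu | rfl
      · exact h2 u hu
      · omega
    · exact Or.inr hi
  · intro t τ hf hv hi ht
    refine ⟨?_, hi⟩
    simp only [Ex.cost] at ht ⊢
    omega

/-- `τ` agrees with `σ` except for the variables of `Cmd.rejectLoop`. -/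
def Env.Agree (σ τ : Env) : Prop :=
  (∀ r, r ≠ .i → r ≠ .w → r ≠ .v → τ.v r = σ.v r) ∧ ∀ A, A ≠ .rej → τ.arr A = σ.arr A

/-- The guard `g` may read the row of `f` in the table that the loop modifies. By `hne` this row
never changes, so the guard can be stated in terms of the initial table. -/
theorem wp_rejectLoop (hB : Big a b B) (h : σ.Base I off adj mark)
    (hx : σ.arrays.Bounded a b B adj) (hf : σ.v .f < a) {g c : Ex} {G : ℕ → Prop}
    {C : ℕ → ℕ → Prop}
    (hg : ∀ τ, σ.Agree τ → τ.v .w < b →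
      (∀ w < b, τ.arr .rej (σ.v .f * b + w) = σ.arr .rej (σ.v .f * b + w)) →
      g.Fits B τ ∧ (g.eval τ < 1 ↔ G (τ.v .w)))
    (hc : ∀ τ, σ.Agree τ → τ.v .w < b → τ.v .v < a →
      c.Fits B τ ∧ (c.eval τ < 1 ↔ C (τ.v .w) (τ.v .v)))
    (hne : ∀ w < b, ¬ C w (σ.v .f)) :
    WP B (.rejectLoop g c) σ fun t τ => t ≤ (g.cost + c.cost + 60) * (a + 1) * (b + 1) ∧
      ∀ (v : Fin a) (w : Fin b), τ.arr .rej (v * b + w) ≠ 0 ↔ σ.arr .rej (v * b + w) ≠ 0 ∨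
        σ.arrays.tie adj (σ.v .f) w ∧ G w ∧ C w v := by
  obtain ⟨h1, h2, h3, h4⟩ := hx _ hf
  set f := σ.v .f with hfdef
  have h8 := hB.eight
  refine WP.for_rule (l := σ.arr .lo f) (h := σ.arr .hi f) (T := (g.cost + c.cost + 42) * (a + 1))
    (fun k τ => (∀ w < b, τ.arr .rej (f * b + w) = σ.arr .rej (f * b + w)) ∧
      ∀ (v : Fin a) (w : Fin b), τ.arr .rej (v * b + w) ≠ 0 ↔ σ.arr .rej (v * b + w) ≠ 0 ∨
        (∃ i, σ.arr .lo f ≤ i ∧ i < k ∧ adj i = w) ∧ G w ∧ C w v)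
    trivial rfl h1 h2 (by omega) ?_ ?_ ?_ ?_ ?_
  · intro τ hf
    refine ⟨trivial, ?_⟩
    simp only [Ex.eval]
    rw [hf.1 _ (by simp [Cmd.writes_for, Cmd.Writes]),
      hf.2 _ (by simp [Cmd.stores_for, Cmd.Stores])]
  · simp [Cmd.Writes, Cmd.writes_for]
  · refine ⟨fun _ _ => rfl, fun v w => ?_⟩
    rw [or_iff_left]
    · rfl
    · rintro ⟨⟨i, h5, h6, -⟩, -⟩
      omega
  · rintro k τ hk hk' hfr hv ⟨hi₀, hi⟩
    have hag : σ.Agree τ := by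
      refine ⟨fun r h1 h2 h3 => hfr.1 r ?_, fun A hA => hfr.2 A ?_⟩
      · simp [Cmd.writes_for, Cmd.Writes, h1, h2, h3]
      · simp [Cmd.stores_for, Cmd.Stores, hA]
    have hb : τ.Base I off adj mark :=
      h.of_frame hfr (by simp [Cmd.writes_for, Cmd.Writes, Cmd.stores_for, Cmd.Stores])
    have hw := h4 k hk hk'
    have hag' : σ.Agree (τ.set .w (adj k)) := by
      refine ⟨fun r h1 h2 h3 => ?_, hag.2⟩
      rw [Env.set_v, if_neg h2, hag.1 r h1 h2 h3]
    obtain ⟨hg1, hg2⟩ := hg (τ.set .w (adj k)) hag' (by simpa using hw) hi₀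
    simp only [Env.set_v, if_true] at hg2
    have hcost : (g.cost + c.cost + 42) * (a + 1) =
      (g.cost + c.cost + 42) * a + (g.cost + c.cost + 42) := by ring
    rw [WP.seq_iff, WP.assign_iff]
    simp only [Ex.Fits, Ex.eval, Ex.cost, hb.adj, hv, true_and, WP.ite_iff, hg1, WP.skip_iff,
      show 1 ≤ B by omega, hg2]
    refine ⟨fun hG => ?_, fun hG => ⟨by omega, hi₀, fun v w => ?_⟩⟩
    · refine WP.for_rule (l := 0) (h := a) (T := c.cost + 30) (fun j τ' =>
        (∀ w < b, τ'.arr .rej (f * b + w) = σ.arr .rej (f * b + w)) ∧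
        ∀ (v : Fin a) (w : Fin b), τ'.arr .rej (v * b + w) ≠ 0 ↔ τ.arr .rej (v * b + w) ≠ 0 ∨
          ((v : ℕ) < j ∧ adj k = w) ∧ C w v)
        (Nat.zero_le _) rfl (Nat.zero_le _) (by have := hB.men; omega) (by omega) ?_ ?_ ?_ ?_ ?_
      · intro τ' hf
        refine ⟨trivial, ?_⟩
        rw [Ex.eval, hf.1 _ (by simp [Cmd.writes_for, Cmd.Writes])]
        simp [hb.men]
      · simp [Cmd.Writes]
      · refine ⟨hi₀, by simp⟩
      · rintro j τ' _ hj hfr' hv' ⟨hi₁, hi'⟩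
        have e1 : τ'.v .w = adj k := by
          rw [hfr'.1 _ (by simp [Cmd.writes_for, Cmd.Writes])]; simp
        have e2 : τ'.v .b = b := by
          rw [hfr'.1 _ (by simp [Cmd.writes_for, Cmd.Writes])]; simp [hb.women]
        have hag₂ : σ.Agree τ' := by
          refine ⟨fun r h1 h2 h3 => ?_, fun A hA => ?_⟩
          · rw [hfr'.1 r (by simp [Cmd.writes_for, Cmd.Writes, h3])]
            exact hag'.1 r h1 h2 h3
          · rw [hfr'.2 A (by simp [Cmd.stores_for, Cmd.Stores, hA])]
            exact hag'.2 A hA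
        obtain ⟨hc1, hc2⟩ := hc τ' hag₂ (by rw [e1]; exact hw) (by rw [hv']; exact hj)
        rw [e1, hv'] at hc2
        have b1 := hB.pair hj hw
        simp only [WP.ite_iff, WP.store_iff, WP.skip_iff, Ex.Fits, Ex.eval, Ex.cost, Ex.pair,
          Env.set_arr, Env.put_arr, e1, e2, hv', if_true, true_and, hc1, hc2,
          show 1 ≤ B by omega]
        refine ⟨fun hlt => ⟨by omega, by omega, ?_, ?_⟩, fun hlt => ⟨by omega, hi₁, ?_⟩⟩
        · intro w hwb
          rw [Function.update_of_ne, hi₁ w hwb]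
          rw [Ne, pair_inj hwb hw]
          rintro ⟨rfl, rfl⟩
          exact hne _ hwb hlt
        · intro v w
          rw [Function.update_apply]
          by_cases hc : (v : ℕ) * b + w = j * b + adj k
          · rw [if_pos hc]
            obtain ⟨h5, h6⟩ := (pair_inj w.2 hw).1 hc
            simp only [h5, h6]
            exact ⟨fun _ => Or.inr ⟨⟨by omega, trivial⟩, hlt⟩, fun _ => one_ne_zero⟩
          · rw [if_neg hc, hi' v w]
            rw [pair_inj w.2 hw] at hc
            refine or_congr_right (and_congr_left fun _ => ?_)
            constructor
            · rintro ⟨h5, h6⟩; exact ⟨by omega, h6⟩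
            · rintro ⟨h5, h6⟩
              refine ⟨?_, h6⟩
              have : (v : ℕ) ≠ j := fun h => hc ⟨h, h6.symm⟩
              omega
        · intro v w
          rw [hi' v w]
          refine or_congr_right ⟨?_, ?_⟩
          · rintro ⟨⟨h5, h6⟩, h7⟩; exact ⟨⟨by omega, h6⟩, h7⟩
          · rintro ⟨⟨h5, h6⟩, h7⟩
            refine ⟨⟨?_, h6⟩, h7⟩
            have : (v : ℕ) ≠ j := by
              rintro rfl
              rw [h6] at hlt
              exact hlt h7
            omega
      · rintro t τ' hf _ ⟨hi₁, hi'⟩ ht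
        simp only [Ex.cost, Nat.sub_zero] at ht
        have h5 : (g.cost + c.cost + 42) * a = (c.cost + 30 + (2 + 10)) * a + g.cost * a := by ring
        refine ⟨by omega, hi₁, fun v w => ?_⟩
        rw [Env.set_arr, hi' v w, hi v w, or_assoc]
        refine or_congr_right ?_
        constructor
        · rintro (⟨⟨i, h5, h6, h7⟩, h8⟩ | ⟨⟨-, h5⟩, h6⟩)
          · exact ⟨⟨i, h5, by omega, h7⟩, h8⟩
          · exact ⟨⟨k, hk, by omega, h5⟩, h5 ▸ hG, h6⟩
        · rintro ⟨⟨i, h5, h6, h7⟩, h8, h9⟩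
          rcases Nat.lt_succ_iff_lt_or_eq.1 h6 with h6 | rfl
          · exact Or.inl ⟨⟨i, h5, h6, h7⟩, h8, h9⟩
          · exact Or.inr ⟨⟨v.2, h7⟩, h9⟩
    · rw [Env.set_arr, Env.set_arr, hi v w]
      refine or_congr_right (and_congr_left ?_)
      rintro ⟨h5, -⟩
      constructor
      · rintro ⟨i, h6, h7, h8⟩
        exact ⟨i, h6, by omega, h8⟩
      · rintro ⟨i, h6, h7, h8⟩
        refine ⟨i, h6, ?_, h8⟩
        have : i ≠ k := by
          rintro rfl
          exact hG (h8 ▸ h5)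
        omega
  · rintro t τ hfr hv ⟨-, hi⟩ ht
    refine ⟨?_, hi⟩
    simp only [Ex.cost] at ht
    have h5 : ((g.cost + c.cost + 42) * (a + 1) + (2 + 1 + 10)) * (σ.arr .hi f - σ.arr .lo f) ≤
        ((g.cost + c.cost + 42) * (a + 1) + 13) * b := Nat.mul_le_mul le_rfl h3
    have h6 : (g.cost + c.cost + 60) * (a + 1) * (b + 1) =
      ((g.cost + c.cost + 42) * (a + 1) + 13) * b + 5 * b + 18 * a * b +
        (g.cost + c.cost + 60) * (a + 1) := by ring
    have h7 : (g.cost + c.cost + 60) * (a + 1) = (g.cost + c.cost + 60) * a + g.cost + c.cost + 60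
      := by ring
    omega

theorem wp_react (hB : Big a b B) (h : σ.Base I off adj mark) (hI : I.WomenAsymmetric)
    (hx : σ.arrays.Bounded a b B adj) {f : Fin a} (hf : σ.v .f = f) :
    WP B .react σ fun t τ => t ≤ 200 * (a + 1) * (b + 1) ∧
      τ.arr .st = Function.update (σ.arr .st) f 2 ∧
      ∀ (v : Fin a) (w : Fin b), τ.arr .rej (v * b + w) ≠ 0 ↔ σ.arr .rej (v * b + w) ≠ 0 ∨
        σ.arrays.tie adj f w ∧ I.prefW w f v := by
  have h8 := hB.eight
  have hfa : σ.v .f < a := hf ▸ f.2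
  rw [Cmd.react, WP.seq_iff]
  refine (wp_rejectLoop hB h hx hfa (G := fun _ => True)
    (C := fun w v => σ.arr .cmp ((w * a + f) * a + v) ≠ 0) ?_ ?_ ?_).mono ?_
  · intro τ _ _ _
    simp [Ex.Fits, Ex.eval]
  · intro τ hag hw hv
    have b2 := hB.triple hw f.2 hv
    simp only [Ex.Fits, Ex.eval, Ex.cmp, Ex.pair, hag.1 .a (by simp) (by simp) (by simp), h.men,
      hag.1 .f (by simp) (by simp) (by simp), hf, hag.2 .cmp (by simp), true_and]
    refine ⟨by omega, by omega⟩
  -- By asymmetry `f` is not preferred to himself, so the row of `f` is not touched.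
  · intro w hw hc
    have := (h.cmp ⟨w, hw⟩ f f).1 (by rwa [hf] at hc)
    exact hI _ _ _ ⟨this, this⟩
  · rintro t τ hfr ⟨ht, hr⟩
    have e1 : τ.v .f = f := by
      rw [hfr.1 _ (by simp [Cmd.rejectLoop, Cmd.writes_for, Cmd.Writes]), hf]
    have e2 : τ.arr .st = σ.arr .st :=
      hfr.2 _ (by simp [Cmd.rejectLoop, Cmd.stores_for, Cmd.Stores])
    simp only [WP.store_iff, Ex.Fits, Ex.eval, Ex.cost, Ex.cmp, Ex.pair, Env.put_arr, if_true,
      true_and, e1, e2, reduceCtorEq, if_false] at ht ⊢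
    refine ⟨by omega, by nlinarith, fun v w => ?_⟩
    rw [hr v w, hf, true_and, h.cmp]

theorem wp_examine (hB : Big a b B) (h : σ.Base I off adj mark)
    (hx : σ.arrays.Bounded a b B adj) {f : Fin a} (hf : σ.v .f = f) {k : ℕ} (hk : σ.v .k = k)
    (hk1 : k ≤ 1) :
    WP B .examine σ fun t τ => t ≤ 200 * (a + 1) * (b + 1) ∧
      τ.arr .st = Function.update (σ.arr .st) f k ∧
      ∀ (v : Fin a) (w : Fin b), τ.arr .rej (v * b + w) ≠ 0 ↔ σ.arr .rej (v * b + w) ≠ 0 ∨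
        σ.arrays.tie adj f w ∧ (k = 0 ∨ σ.arr .rej (f * b + w) = 0) ∧ v ≠ f ∧
          Incomp (I.prefW w) v f := by
  have h8 := hB.eight
  have hfa : σ.v .f < a := hf ▸ f.2
  rw [Cmd.examine, WP.seq_iff]
  refine (wp_rejectLoop hB h hx hfa (G := fun w => k = 0 ∨ σ.arr .rej (f * b + w) = 0)
    (C := fun w v => v ≠ f ∧ σ.arr .cmp ((w * a + v) * a + f) = 0 ∧
      σ.arr .cmp ((w * a + f) * a + v) = 0) ?_ ?_ ?_).mono ?_
  · intro τ hag hw hrej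
    have b1 := hB.pair f.2 hw
    rw [hf] at hrej
    simp only [Ex.Fits, Ex.eval, Ex.rej, Ex.pair, hag.1 .b (by simp) (by simp) (by simp), h.women,
      hag.1 .f (by simp) (by simp) (by simp), hf, hag.1 .k (by simp) (by simp) (by simp), hk,
      hrej _ hw, true_and]
    refine ⟨by omega, by omega⟩
  · intro τ hag hw hv
    have b2 := hB.triple hw f.2 hv
    have b3 := hB.triple hw hv f.2
    have h3 := hB.men
    simp only [Ex.Fits, Ex.eval, Ex.cmp, Ex.pair, hag.1 .a (by simp) (by simp) (by simp), h.men,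
      hag.1 .f (by simp) (by simp) (by simp), hf, hag.2 .cmp (by simp), true_and]
    have := f.2
    refine ⟨by omega, by omega⟩
  · intro w hw hc
    exact hc.1 hf
  · rintro t τ hfr ⟨ht, hr⟩
    have e1 : τ.v .f = f := by
      rw [hfr.1 _ (by simp [Cmd.rejectLoop, Cmd.writes_for, Cmd.Writes]), hf]
    have e2 : τ.arr .st = σ.arr .st :=
      hfr.2 _ (by simp [Cmd.rejectLoop, Cmd.stores_for, Cmd.Stores])
    have e3 : τ.v .k = k := by
      rw [hfr.1 _ (by simp [Cmd.rejectLoop, Cmd.writes_for, Cmd.Writes]), hk]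
    simp only [WP.store_iff, Ex.Fits, Ex.eval, Ex.cost, Ex.cmp, Ex.pair, Ex.rej, Env.put_arr,
      if_true, true_and, e1, e2, e3, reduceCtorEq, if_false] at ht ⊢
    refine ⟨by nlinarith, fun v w => ?_⟩
    rw [hr v w, hf]
    refine or_congr_right (and_congr_right fun _ => and_congr_right fun _ => ?_)
    rw [Incomp, ← h.cmp, ← h.cmp, not_not, not_not]
    refine and_congr_left fun _ => not_congr ?_
    exact ⟨fun h => Fin.ext h, fun h => h ▸ rfl⟩

end Specifications

end PairwiseMarket

namespace PairwiseMarket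

/-! ### Counting active edges, rejecting a queue, cleaning the matching, deciding the answer -/

section Specifications

variable {a b B : ℕ} {I : Market (Fin a) (Fin b)} {off adj mark : ℕ → ℕ} {σ : Env}

/-- The number of edges in the proposal tie of `u` that are not rejected. -/
def Arrays.count (b : ℕ) (adj : ℕ → ℕ) (x : Arrays) (u : ℕ) : ℕ :=
  ((Finset.Ico (x.lo u) (x.hi u)).filter fun i => x.rej (u * b + adj i) = 0).card

theorem wp_findExamine (hB : Big a b B) (h : σ.Base I off adj mark)
    (hx : σ.arrays.Bounded a b B adj) :
    WP B .findExamine σ fun t τ => t ≤ 200 * (a + 1) * (b + 1) ∧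
      ((τ.v .f = a ∧ ∀ u < a, σ.arr .st u ≤ σ.arrays.count b adj u) ∨
        (τ.v .f < a ∧ τ.v .k = σ.arrays.count b adj (τ.v .f) ∧
          σ.arrays.count b adj (τ.v .f) < σ.arr .st (τ.v .f))) := by
  have h8 := hB.eight
  rw [Cmd.findExamine, WP.seq_iff, WP.assign_iff]
  refine ⟨trivial, WP.for_rule (l := 0) (h := a) (T := 100 * (b + 1)) (fun j τ =>
    (τ.v .f = a ∧ ∀ u < j, σ.arr .st u ≤ σ.arrays.count b adj u) ∨
        (τ.v .f < a ∧ τ.v .k = σ.arrays.count b adj (τ.v .f) ∧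
          σ.arrays.count b adj (τ.v .f) < σ.arr .st (τ.v .f)))
    (Nat.zero_le _) rfl (Nat.zero_le _) (by have := hB.men; omega) (by omega)
    ?_ ?_ ?_ ?_ ?_⟩
  · intro τ hf
    refine ⟨trivial, ?_⟩
    rw [Ex.eval, hf.1 _ (by simp [Cmd.writes_for, Cmd.Writes])]
    simp [h.men]
  · simp [Cmd.Writes, Cmd.writes_for]
  · simp [h.men, Ex.eval]
  · intro u τ _ hu hf hv hi
    have harr : τ.arr = σ.arr := by
      funext A
      exact hf.2 A (by simp [Cmd.stores_for, Cmd.Stores])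
    have hvb : τ.v .b = b := by
      rw [hf.1 _ (by simp [Cmd.writes_for, Cmd.Writes])]
      simp [h.women]
    obtain ⟨h1, h2, h3, h4⟩ := hx u hu
    rw [WP.seq_iff, WP.assign_iff]
    refine ⟨Nat.zero_le _, ?_⟩
    rw [WP.seq_iff]
    refine WP.for_rule (l := σ.arr .lo u) (h := σ.arr .hi u) (T := 50) (fun j τ' =>
      τ'.v .x = ((Finset.Ico (σ.arr .lo u) j).filter
        fun i => σ.arr .rej (u * b + adj i) = 0).card)
      trivial (by simp [Ex.eval, hv, harr]) h1 h2 (by omega) ?_ ?_ ?_ ?_ ?_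
    · intro τ' hf'
      refine ⟨trivial, ?_⟩
      simp only [Ex.eval]
      rw [hf'.1 _ (by simp [Cmd.writes_for, Cmd.Writes]),
        hf'.2 _ (by simp [Cmd.stores_for, Cmd.Stores])]
      simp [hv, harr]
    · simp [Cmd.Writes]
    · simp [Ex.eval]
    · intro j τ' hj hj' hf' hv' hi'
      have harr' : τ'.arr = σ.arr := by
        funext A
        rw [hf'.2 A (by simp [Cmd.stores_for, Cmd.Stores]), Env.set_arr, harr]
      have e1 : τ'.v .b = b := by
        rw [hf'.1 _ (by simp [Cmd.writes_for, Cmd.Writes])]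
        simp [hvb]
      have e2 : τ'.v .u = u := by
        rw [hf'.1 _ (by simp [Cmd.writes_for, Cmd.Writes])]
        simp [hv]
      have hw := h4 j hj hj'
      have b1 := hB.pair hu hw
      have hle : τ'.v .x ≤ j - σ.arr .lo u := by
        rw [hi', ← Nat.card_Ico]
        exact Finset.card_filter_le _ _
      simp only [WP.seq_iff, WP.assign_iff, WP.ite_iff, WP.skip_iff, Ex.Fits, Ex.eval, Ex.rej,
        Ex.pair, Ex.cost, harr', e1, e2, hv', h.adj, Env.set_v, Env.set_arr, reduceCtorEq,
        if_true, if_false, true_and]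
      have hins : Finset.Ico (σ.arr .lo u) (j + 1) = insert j (Finset.Ico (σ.arr .lo u) j) := by
        ext i
        simp only [Finset.mem_Ico, Finset.mem_insert]
        omega
      rw [hins, Finset.filter_insert]
      refine ⟨by omega, by omega, fun hlt => ⟨⟨by omega, by
        change σ.arr .hi u ≤ B at h2; omega⟩, by omega, ?_⟩, fun hlt => ⟨by omega, ?_⟩⟩
      · rw [if_pos (by omega), Finset.card_insert_of_notMem (by simp), hi']
      · rw [if_neg (by omega), hi']
    · intro t τ' hf' _ hi' ht
      have harr' : τ'.arr = σ.arr := by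
        funext A
        rw [hf'.2 A (by simp [Cmd.stores_for, Cmd.Stores]), Env.set_arr, harr]
      have e2 : τ'.v .u = u := by
        rw [hf'.1 _ (by simp [Cmd.writes_for, Cmd.Writes])]
        simp [hv]
      have e3 : τ'.v .f = τ.v .f := by
        rw [hf'.1 _ (by simp [Cmd.writes_for, Cmd.Writes])]
        simp
      have e4 : τ'.v .k = τ.v .k := by
        rw [hf'.1 _ (by simp [Cmd.writes_for, Cmd.Writes])]
        simp
      have h5 : (50 + (3 + 10)) * (σ.arr .hi u - σ.arr .lo u) ≤ 63 * b :=
        Nat.mul_le_mul le_rfl h3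
      change τ'.v .x = σ.arrays.count b adj u at hi'
      simp only [WP.ite_iff, WP.seq_iff, WP.assign_iff, WP.skip_iff, Ex.Fits, Ex.eval, Ex.cost,
        harr', e2, hi', Env.set_v, reduceCtorEq, if_true, if_false, true_and, e3, e4] at ht ⊢
      refine ⟨fun hlt => ⟨by omega, Or.inr ⟨hu, hlt⟩⟩, fun hlt => ⟨by omega, ?_⟩⟩
      rcases hi with ⟨h1, h2⟩ | hi
      · refine Or.inl ⟨h1, fun v hv => ?_⟩
        rcases (Nat.lt_succ_iff_lt_or_eq.1 hv) with hv | rfl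
        · exact h2 v hv
        · omega
      · exact Or.inr hi
  · intro t τ hf hv hi ht
    refine ⟨?_, hi⟩
    simp only [Ex.cost, Nat.sub_zero] at ht ⊢
    nlinarith

theorem wp_rejectQueue (hB : Big a b B) (h : σ.Base I off adj mark)
    (hx : σ.arrays.Bounded a b B adj) {n : ℕ} (hn : σ.v .qt = n) (hna : n ≤ a)
    (hq : ∀ j < n, σ.arr .queue j < a) :
    WP B .rejectQueue σ fun t τ => t ≤ 200 * (a + 1) * (b + 1) ∧
      ∀ (v : Fin a) (w : Fin b), τ.arr .rej (v * b + w) ≠ 0 ↔ σ.arr .rej (v * b + w) ≠ 0 ∨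
        (∃ j < n, σ.arr .queue j = v) ∧ σ.arrays.tie adj v w := by
  have h8 := hB.eight
  rw [Cmd.rejectQueue]
  refine WP.for_rule (l := 0) (h := n) (T := 100 * (b + 1)) (fun k τ =>
    ∀ (v : Fin a) (w : Fin b), τ.arr .rej (v * b + w) ≠ 0 ↔ σ.arr .rej (v * b + w) ≠ 0 ∨
        (∃ j < k, σ.arr .queue j = v) ∧ σ.arrays.tie adj v w)
    (Nat.zero_le _) rfl (Nat.zero_le _) (by have := hB.men; omega) (by omega)
    ?_ ?_ ?_ ?_ ?_
  · intro τ hf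
    refine ⟨trivial, ?_⟩
    rw [Ex.eval, hf.1 _ (by simp [Cmd.writes_for, Cmd.Writes]), hn]
  · simp [Cmd.Writes, Cmd.writes_for]
  · simp
  · intro k τ _ hk hf hv hi
    have hb : τ.Base I off adj mark :=
      h.of_frame hf (by simp [Cmd.writes_for, Cmd.Writes, Cmd.stores_for, Cmd.Stores])
    have e1 : τ.arr .queue = σ.arr .queue := hf.2 _ (by simp [Cmd.stores_for, Cmd.Stores])
    have e2 : τ.arr .lo = σ.arr .lo := hf.2 _ (by simp [Cmd.stores_for, Cmd.Stores])
    have e3 : τ.arr .hi = σ.arr .hi := hf.2 _ (by simp [Cmd.stores_for, Cmd.Stores])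
    have hu := hq k hk
    set u := σ.arr .queue k with hudef
    obtain ⟨h1, h2, h3, h4⟩ := hx u hu
    rw [WP.seq_iff, WP.assign_iff]
    refine ⟨trivial, ?_⟩
    simp only [Ex.eval, e1, hv, ← hudef]
    refine WP.for_rule (l := σ.arr .lo u) (h := σ.arr .hi u) (T := 50) (fun j τ' =>
      ∀ (v : Fin a) (w : Fin b), τ'.arr .rej (v * b + w) ≠ 0 ↔ τ.arr .rej (v * b + w) ≠ 0 ∨
        u = v ∧ ∃ i, σ.arr .lo u ≤ i ∧ i < j ∧ adj i = w)
      trivial (by simp [Ex.eval, e2]) h1 h2 (by omega) ?_ ?_ ?_ ?_ ?_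
    · intro τ' hf'
      refine ⟨trivial, ?_⟩
      simp only [Ex.eval]
      rw [hf'.1 _ (by simp [Cmd.writes_for, Cmd.Writes]),
        hf'.2 _ (by simp [Cmd.stores_for, Cmd.Stores])]
      simp [e3]
    · simp [Cmd.Writes]
    · intro v w
      rw [or_iff_left]
      · rfl
      · rintro ⟨-, i, h5, h6, -⟩
        omega
    · intro j τ' hj hj' hf' hv' hi'
      have e1 : τ'.v .b = b := by
        rw [hf'.1 _ (by simp [Cmd.writes_for, Cmd.Writes])]
        simp [hb.women]
      have e2 : τ'.v .u = u := by
        rw [hf'.1 _ (by simp [Cmd.writes_for, Cmd.Writes])]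
        simp
      have e3 : τ'.arr .adj = adj := by
        rw [hf'.2 _ (by simp [Cmd.stores_for, Cmd.Stores])]
        simp [hb.adj]
      have hw := h4 j hj hj'
      have b1 := hB.pair hu hw
      simp only [WP.seq_iff, WP.assign_iff, WP.store_iff, Ex.Fits, Ex.eval, Ex.pair, Ex.cost,
        e1, e2, e3, hv', Env.set_v, Env.set_arr, Env.put_arr, reduceCtorEq,
        if_true, if_false, true_and]
      refine ⟨by omega, by omega, by omega, fun v w => ?_⟩
      rw [Function.update_apply]
      by_cases hc : (v : ℕ) * b + w = u * b + adj j
      · rw [if_pos hc]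
        obtain ⟨h5, h6⟩ := (pair_inj w.2 hw).1 hc
        exact ⟨fun _ => Or.inr ⟨h5.symm, j, hj, by omega, h6.symm⟩, fun _ => one_ne_zero⟩
      · rw [if_neg hc, hi' v w]
        rw [pair_inj w.2 hw] at hc
        refine or_congr_right (and_congr_right fun huv => ?_)
        constructor
        · rintro ⟨i, h5, h6, h7⟩
          exact ⟨i, h5, by omega, h7⟩
        · rintro ⟨i, h5, h6, h7⟩
          refine ⟨i, h5, ?_, h7⟩
          have : i ≠ j := by
            rintro rfl
            exact hc ⟨huv.symm, h7.symm⟩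
          omega
    · intro t τ' hf' _ hi' ht
      have h5 : (50 + (3 + 10)) * (σ.arr .hi u - σ.arr .lo u) ≤ 63 * b :=
        Nat.mul_le_mul le_rfl h3
      simp only [Ex.cost] at ht ⊢
      refine ⟨by omega, fun v w => ?_⟩
      rw [Env.set_arr, hi' v w, hi v w, or_assoc]
      refine or_congr_right ?_
      constructor
      · rintro (⟨⟨j, h6, h7⟩, h8⟩ | ⟨h6, h7⟩)
        · exact ⟨⟨j, by omega, h7⟩, h8⟩
        · exact ⟨⟨k, by omega, h6⟩, h6 ▸ h7⟩
      · rintro ⟨⟨j, h6, h7⟩, h8⟩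
        rcases Nat.lt_succ_iff_lt_or_eq.1 h6 with h6 | rfl
        · exact Or.inl ⟨⟨j, h6, h7⟩, h8⟩
        · refine Or.inr ⟨h7, ?_⟩
          rw [hudef, h7]
          exact h8
  · intro t τ hf hv hi ht
    refine ⟨?_, hi⟩
    simp only [Ex.cost] at ht ⊢
    have : (100 * (b + 1) + (2 + 10)) * (n - 0) ≤ (100 * (b + 1) + (2 + 10)) * a :=
      Nat.mul_le_mul le_rfl (by omega)
    nlinarith

/-- The arrays `mm` and `mw` describe the same matching. -/
structure Consistent (a b : ℕ) (mm mw : ℕ → ℕ) : Prop where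
  men : ∀ u < a, mm u ≤ b
  women : ∀ w < b, mw w ≤ a
  iff : ∀ u < a, ∀ w < b, mm u = w + 1 ↔ mw w = u + 1

theorem wp_clean (hB : Big a b B) (h : σ.Base I off adj mark)
    (hc : Consistent a b (σ.arr .mm) (σ.arr .mw)) :
    WP B .clean σ fun t τ => t ≤ 200 * (a + 1) ∧
      Consistent a b (τ.arr .mm) (τ.arr .mw) ∧
      ∀ u < a, ∀ w < b, τ.arr .mm u = w + 1 ↔
        σ.arr .mm u = w + 1 ∧ σ.arr .rej (u * b + w) = 0 := by
  have h8 := hB.eight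
  rw [Cmd.clean]
  refine WP.for_rule (l := 0) (h := a) (T := 100) (fun k τ =>
    Consistent a b (τ.arr .mm) (τ.arr .mw) ∧
      ∀ u < a, ∀ w < b, τ.arr .mm u = w + 1 ↔
        σ.arr .mm u = w + 1 ∧ (u < k → σ.arr .rej (u * b + w) = 0))
    (Nat.zero_le _) rfl (Nat.zero_le _) (by have := hB.men; omega) (by omega)
    ?_ ?_ ?_ ?_ ?_
  · intro τ hf
    refine ⟨trivial, ?_⟩
    rw [Ex.eval, hf.1 _ (by simp [Cmd.writes_for, Cmd.Writes]), h.men]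
  · simp [Cmd.Writes]
  · exact ⟨hc, by simp⟩
  · rintro u τ _ hu hf hv ⟨hi₁, hi₂⟩
    have e1 : τ.v .b = b := by
      rw [hf.1 _ (by simp [Cmd.writes_for, Cmd.Writes]), h.women]
    have e2 : τ.arr .rej = σ.arr .rej := hf.2 _ (by simp [Cmd.stores_for, Cmd.Stores])
    have hmb := hi₁.men u hu
    simp only [WP.seq_iff, WP.assign_iff, WP.ite_iff, WP.store_iff, WP.skip_iff, Ex.Fits, Ex.eval,
      Ex.rej, Ex.pair, Ex.cost, hv, e1, e2, Env.set_v, Env.set_arr, Env.put_arr, Env.put_v,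
      reduceCtorEq, if_true, if_false, true_and]
    refine ⟨by omega, by omega, fun hlt => ?_, fun hlt => ⟨by omega, hi₁, fun v hva w hw => ?_⟩⟩
    · obtain ⟨w, hw⟩ : ∃ w, τ.arr .mm u = w + 1 := ⟨τ.arr .mm u - 1, by omega⟩
      rw [hw, Nat.add_sub_cancel]
      have hwb : w < b := by omega
      have b1 := hB.pair hu hwb
      refine ⟨by omega, by omega, fun hrej => ⟨by omega, by omega, by omega, ?_⟩,
        fun hrej => ⟨by omega, hi₁, fun v hva w' hw' => ?_⟩⟩
      · refine ⟨⟨?_, ?_, ?_⟩, ?_⟩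
        · intro v hva
          rw [Function.update_apply]
          split_ifs
          · omega
          · exact hi₁.men v hva
        · intro w' hw'
          rw [Function.update_apply]
          split_ifs
          · omega
          · exact hi₁.women w' hw'
        · intro v hva w' hw'
          have h1 := hi₁.iff v hva w' hw'
          have h2 := hi₁.iff u hu w' hw'
          have h3 := hi₁.iff v hva w hwb
          have h4 := hi₁.iff u hu w hwb
          simp only [Function.update_apply]
          by_cases hvu : v = u
          · subst hvu
            by_cases hww : w' = w
            · simp [hww]
            · rw [if_pos rfl, if_neg hww]
              omega
          · by_cases hww : w' = w
            · subst hww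
              rw [if_pos rfl, if_neg hvu]
              omega
            · rw [if_neg hww, if_neg hvu]
              exact h1
        · intro v hva w' hw'
          have h1 := hi₂ v hva w' hw'
          rw [Function.update_apply]
          by_cases hvu : v = u
          · subst hvu
            rw [if_pos rfl]
            refine iff_of_false (by omega) ?_
            rintro ⟨h5, h6⟩
            have h7 := h1.2 ⟨h5, by omega⟩
            have h9 : w' = w := by omega
            rw [h9] at h6
            have := h6 (by omega)
            omega
          · rw [if_neg hvu, h1]
            refine and_congr_right fun _ => ?_
            rw [show v < u + 1 ↔ v < u by omega]
      · rw [hi₂ v hva w' hw']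
        refine and_congr_right fun h5 => ⟨fun h6 h7 => ?_, fun h6 h7 => h6 (by omega)⟩
        rcases Nat.lt_succ_iff_lt_or_eq.1 h7 with h7 | rfl
        · exact h6 h7
        · have h10 := (hi₂ v hva w' hw').2 ⟨h5, h6⟩
          have h9 : w' = w := by omega
          rw [h9]
          omega
    · rw [hi₂ v hva w hw]
      refine and_congr_right fun h5 => ⟨fun h6 h7 => ?_, fun h6 h7 => h6 (by omega)⟩
      rcases Nat.lt_succ_iff_lt_or_eq.1 h7 with h7 | rfl
      · exact h6 h7
      · have h10 := (hi₂ v hva w hw).2 ⟨h5, h6⟩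
        omega
  · rintro t τ hf hv ⟨hi₁, hi₂⟩ ht
    simp only [Ex.cost] at ht ⊢
    refine ⟨by omega, hi₁, fun u hu w hw => ?_⟩
    rw [hi₂ u hu w hw]
    simp [hu]

theorem wp_finish (hB : Big a b B) (h : σ.Base I off adj mark) :
    WP B .finish σ fun t τ => t ≤ 200 * (b + 1) ∧ τ.v .go = 0 ∧
      ((τ.v .ans = 1 ∧ ∀ w < b, σ.arr .ever w ≠ 0 → σ.arr .mw w ≠ 0) ∨
        (τ.v .ans = 0 ∧ ¬ ∀ w < b, σ.arr .ever w ≠ 0 → σ.arr .mw w ≠ 0)) := by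
  have h8 := hB.eight
  rw [Cmd.finish, WP.seq_iff, WP.assign_iff]
  refine ⟨show 1 ≤ B by omega, ?_⟩
  rw [WP.seq_iff]
  refine WP.for_rule (l := 0) (h := b) (T := 100) (fun k τ =>
    (τ.v .ans = 1 ∧ ∀ w < k, σ.arr .ever w ≠ 0 → σ.arr .mw w ≠ 0) ∨
        (τ.v .ans = 0 ∧ ¬ ∀ w < b, σ.arr .ever w ≠ 0 → σ.arr .mw w ≠ 0))
    (Nat.zero_le _) rfl (Nat.zero_le _) (by have := hB.women; omega) (by omega)
    ?_ ?_ ?_ ?_ ?_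
  · intro τ hf
    refine ⟨trivial, ?_⟩
    rw [Ex.eval, hf.1 _ (by simp [Cmd.writes_for, Cmd.Writes])]
    simp [h.women]
  · simp [Cmd.Writes]
  · simp [Ex.eval]
  · rintro w τ _ hw hf hv hi
    have harr : τ.arr = σ.arr := by
      funext A
      exact hf.2 A (by simp [Cmd.stores_for, Cmd.Stores])
    simp only [WP.ite_iff, WP.assign_iff, WP.skip_iff, Ex.Fits, Ex.eval, Ex.cost, harr, hv,
      Env.set_v, reduceCtorEq, if_true, if_false, true_and]
    refine ⟨by omega, fun h1 => ⟨by omega, fun h2 => ⟨by omega, by omega, Or.inr fun h3 => ?_⟩,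
      fun h2 => ⟨by omega, ?_⟩⟩, fun h1 => ⟨by omega, ?_⟩⟩
    · have := h3 w hw (by omega)
      omega
    · refine hi.imp_left fun ⟨h3, h4⟩ => ⟨h3, fun w' hw' h5 => ?_⟩
      rcases Nat.lt_succ_iff_lt_or_eq.1 hw' with h6 | rfl
      · exact h4 w' h6 h5
      · omega
    · refine hi.imp_left fun ⟨h3, h4⟩ => ⟨h3, fun w' hw' h5 => ?_⟩
      rcases Nat.lt_succ_iff_lt_or_eq.1 hw' with h6 | rfl
      · exact h4 w' h6 h5
      · omega
  · rintro t τ hf hv hi ht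
    simp only [WP.assign_iff, Ex.Fits, Ex.eval, Ex.cost, Env.set_v, reduceCtorEq, if_true,
      if_false] at ht ⊢
    exact ⟨Nat.zero_le _, by omega, trivial, hi⟩

end Specifications

end PairwiseMarket

namespace PairwiseMarket

/-! ### Proposals along the next ties -/

namespace Cmd

/-- All men without active edges propose along the next ties; `f` is one of them, or `a`. -/
def propose : Cmd :=
  .seq (.assign .f (.var .a)) <|
  .for .u (.lit 0) (.var .a) <|
    -- The sum vanishes exactly if the state is `0` and `hi u` lies before the end of the list.
    .ite (.add (.get .st (.var .u)) (.sub (.add (.get .hi (.var .u)) (.lit 1))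
        (.get .off (.add (.var .u) (.lit 1))))) (.lit 1)
      (.seq (.store .lo (.var .u) (.get .hi (.var .u))) <|
      .seq (.assign .y (.lit 0)) <|
      .seq (.for .i (.get .lo (.var .u)) (.get .off (.add (.var .u) (.lit 1))) <|
        -- The mark at the first position of the tie must not end it. After `y` is set, the loop
        -- idles to the end of the list, which the time allowed for an event can bear.
        .seq (.ite (.get .lo (.var .u)) (.var .i)
          (.ite (.lit 0) (.get .mark (.var .i)) (.assign .y (.lit 1)) .skip) .skip) <|
        .ite (.var .y) (.lit 1)
          (.seq (.assign .w (.get .adj (.var .i))) <|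
          .seq (.ite (.rej .u .w) (.lit 1) (.store .ever (.var .w) (.lit 1)) .skip) <|
          .store .hi (.var .u) (.add (.var .i) (.lit 1)))
          .skip) <|
      .seq (.store .st (.var .u) (.lit 3)) (.assign .f (.var .u)))
      .skip

end Cmd

section Specifications

variable {a b B : ℕ} {I : Market (Fin a) (Fin b)} {off adj mark : ℕ → ℕ} {σ : Env}

theorem Layout.length_le (hL : Layout I off adj mark) {u : ℕ} (hu : u < a) :
    off (u + 1) - off u ≤ b := by
  have h := Finset.card_le_card_of_injOn (s := Finset.Ico (off u) (off (u + 1)))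
    (t := Finset.range b) adj ?_ ?_
  · simpa using h
  · intro i hi
    simp only [Finset.coe_Ico, Set.mem_Ico] at hi
    simpa using hL.adj_lt u hu i hi.1 hi.2
  · intro i hi j hj h
    simp only [Finset.coe_Ico, Set.mem_Ico] at hi hj
    exact hL.inj u hu i j hi.1 hi.2 hj.1 hj.2 h

theorem Layout.off_le_ncard (hL : Layout I off adj mark) {u : ℕ} (hu : u ≤ a) :
    off u ≤ I.edges.ncard := by
  rw [← hL.off_last]
  induction hn : a - u generalizing u with
  | zero =>
    have : u = a := by omega
    rw [this]
  | succ n ih =>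
    exact (hL.off_le u (by omega)).trans (ih (u := u + 1) (by omega) (by omega))

/-- The adjacency list of `u` is scanned from `l` to `j`, and the tie found ends at `e`. -/
def TieScan (mark : ℕ → ℕ) (l j e y : ℕ) : Prop :=
  (∀ k, l < k → k < e → mark k = 0) ∧
    ((y = 0 ∧ e = j) ∨ (y ≠ 0 ∧ l < e ∧ e ≤ j ∧ mark e ≠ 0))

theorem wp_propose (hB : Big a b B) (h : σ.Base I off adj mark) (hL : Layout I off adj mark)
    (hm : I.edges.ncard + 1 ≤ B) (hlo : ∀ u < a, off u ≤ σ.arr .hi u)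
    (hhi : ∀ u < a, σ.arr .hi u ≤ off (u + 1)) (hst : ∀ u < a, σ.arr .st u ≤ 3) :
    WP B .propose σ fun t τ => t ≤ 300 * (a + 1) * (b + 1) ∧
      Arrays.Simulates.Proposes a b off adj mark σ.arrays τ.arrays ∧
      ((τ.v .f = a ∧ (∀ u < a, ¬ Arrays.Simulates.Next off σ.arrays u) ∧ τ.arr = σ.arr) ∨
        (τ.v .f < a ∧ Arrays.Simulates.Next off σ.arrays (τ.v .f))) := by
  have h8 := hB.eight
  have hBa := hB.men
  have hoff : ∀ u < a, off (u + 1) + 1 ≤ B := fun u hu => by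
    have := hL.off_le_ncard (u := u + 1) hu
    omega
  set N : ℕ → Prop := Arrays.Simulates.Next off σ.arrays with hN
  have hNiff : ∀ u, N u ↔ σ.arr .st u = 0 ∧ σ.arr .hi u < off (u + 1) := fun u => Iff.rfl
  rw [Cmd.propose, WP.seq_iff, WP.assign_iff]
  refine ⟨trivial, WP.for_rule (l := 0) (h := a) (T := 150 * (b + 1)) (fun j τ =>
    (∀ u < a, N u → u < j → τ.arr .lo u = σ.arr .hi u ∧ σ.arr .hi u < τ.arr .hi u ∧
      τ.arr .hi u ≤ off (u + 1) ∧ (∀ k, σ.arr .hi u < k → k < τ.arr .hi u → mark k = 0) ∧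
      (τ.arr .hi u = off (u + 1) ∨ mark (τ.arr .hi u) ≠ 0) ∧ τ.arr .st u = 3) ∧
    (∀ u < a, ¬ (N u ∧ u < j) → τ.arr .lo u = σ.arr .lo u ∧ τ.arr .hi u = σ.arr .hi u ∧
      τ.arr .st u = σ.arr .st u) ∧
    (∀ w : Fin b, τ.arr .ever w ≠ 0 ↔ σ.arr .ever w ≠ 0 ∨ ∃ u < a, u < j ∧ N u ∧
      τ.arrays.tie adj u w ∧ σ.arr .rej (u * b + w) = 0) ∧
    ((τ.v .f = a ∧ (∀ u < j, ¬ N u) ∧ τ.arr = σ.arr) ∨ (τ.v .f < a ∧ N (τ.v .f))))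
    (Nat.zero_le _) rfl (Nat.zero_le _) (by omega) (by omega) ?_ ?_ ?_ ?_ ?_⟩
  · intro τ hf
    refine ⟨trivial, ?_⟩
    rw [Ex.eval, hf.1 _ (by simp [Cmd.writes_for, Cmd.Writes])]
    simp [h.men]
  · simp [Cmd.Writes, Cmd.writes_for]
  · refine ⟨fun u hu _ h => by omega, fun _ _ _ => ⟨rfl, rfl, rfl⟩, fun w => ?_,
      Or.inl ⟨?_, fun u hu => by omega, rfl⟩⟩
    · rw [or_iff_left]
      · rfl
      · rintro ⟨u, -, h, -⟩
        omega
    · simp [Ex.eval, h.men]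
  · rintro u τ _ hu hf hv ⟨hi₁, hi₂, hi₃, hi₄⟩
    have f1 : ∀ A, A ≠ .lo → A ≠ .hi → A ≠ .st → A ≠ .ever → τ.arr A = σ.arr A := by
      intro A h1 h2 h3 h4
      exact hf.2 A (by simp [Cmd.stores_for, Cmd.Stores, h1, h2, h3, h4])
    have eoff : τ.arr .off = off := by rw [f1] <;> simp [h.off]
    have eadj : τ.arr .adj = adj := by rw [f1] <;> simp [h.adj]
    have emark : τ.arr .mark = mark := by rw [f1] <;> simp [h.mark]
    have erej : τ.arr .rej = σ.arr .rej := by rw [f1] <;> simp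
    have evb : τ.v .b = b := by
      rw [hf.1 _ (by simp [Cmd.writes_for, Cmd.Writes])]
      simp [h.women]
    obtain ⟨c1, c2, c3⟩ := hi₂ u hu (by omega)
    have d1 := hst u hu
    have d2 := hoff u hu
    have d3 := hhi u hu
    have d4 := hlo u hu
    have d5 := hL.length_le hu
    simp only [WP.seq_iff, WP.assign_iff, WP.ite_iff, WP.store_iff, WP.skip_iff, Ex.Fits, Ex.eval,
      Ex.cost, hv, eoff, Env.put_v, true_and, c2, c3]
    refine ⟨by omega, by omega, fun hlt => ?_, fun hlt => ⟨by omega, ?_, ?_, fun w => ?_, ?_⟩⟩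
    rotate_left
    · intro u' hu' h1 h2
      refine hi₁ u' hu' h1 ?_
      have : u' ≠ u := by
        rintro rfl
        rw [hNiff] at h1
        omega
      omega
    · intro u' hu' h1
      exact hi₂ u' hu' fun h2 => h1 ⟨h2.1, by omega⟩
    · refine (hi₃ w).trans (or_congr_right ⟨?_, ?_⟩)
      · rintro ⟨u', h1, h2, h3⟩
        exact ⟨u', h1, by omega, h3⟩
      · rintro ⟨u', h1, h2, h3⟩
        refine ⟨u', h1, ?_, h3⟩
        have : u' ≠ u := by
          rintro rfl
          have := h3.1
          rw [hNiff] at this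
          omega
        omega
    · refine hi₄.imp_left fun ⟨h1, h2, h4⟩ => ⟨h1, fun u' hu' h3 => ?_, h4⟩
      rcases Nat.lt_succ_iff_lt_or_eq.1 hu' with h4 | rfl
      · exact h2 u' h4 h3
      · rw [hNiff] at h3
        omega
    have hNu : N u := (hNiff u).2 ⟨by omega, by omega⟩
    refine ⟨by omega, ?_⟩
    refine WP.for_rule (l := σ.arr .hi u) (h := off (u + 1)) (T := 100) (fun j τ' =>
      TieScan mark (σ.arr .hi u) j (τ'.arr .hi u) (τ'.v .y) ∧
      (j ≠ σ.arr .hi u → σ.arr .hi u < τ'.arr .hi u) ∧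
      (∀ u', u' ≠ u → τ'.arr .hi u' = τ.arr .hi u') ∧
      ∀ w : Fin b, τ'.arr .ever w ≠ 0 ↔ τ.arr .ever w ≠ 0 ∨
        (∃ i, σ.arr .hi u ≤ i ∧ i < τ'.arr .hi u ∧ adj i = w) ∧ σ.arr .rej (u * b + w) = 0)
      trivial ?_ d3 (by omega) (by omega) ?_ ?_ ?_ ?_ ?_
    · simp [Ex.eval, hv]
    · intro τ' hf'
      simp only [Ex.Fits, Ex.eval]
      rw [hf'.1 _ (by simp [Cmd.writes_for, Cmd.Writes]),
        hf'.2 _ (by simp [Cmd.stores_for, Cmd.Stores])]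
      simp only [Env.set_v, reduceCtorEq, if_false, Env.put_v, Env.set_arr, Env.put_arr, eoff, hv,
        and_true, true_and]
      omega
    · simp [Cmd.Writes]
    · simp only [Env.set_v, reduceCtorEq, if_false, Env.put_v, Env.set_arr, Env.put_arr, c2,
        if_true]
      refine ⟨⟨fun k h1 h2 => by omega, Or.inl ⟨rfl, rfl⟩⟩, fun h => (h rfl).elim,
        fun _ _ => trivial, fun w => ?_⟩
      rw [or_iff_left]
      rintro ⟨⟨i, h1, h2, -⟩, -⟩
      omega
    · rintro j τ' hj hj' hf' hv' ⟨hs, hs₂, hs₃, hs₄⟩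
      have g1 : ∀ A, A ≠ .hi → A ≠ .ever → A ≠ .lo → τ'.arr A = τ.arr A := by
        intro A h1 h2 h3
        rw [hf'.2 A (by simp [Cmd.stores_for, Cmd.Stores, h1, h2])]
        simp [h3]
      have g2 : τ'.arr .adj = adj := by rw [g1] <;> simp [eadj]
      have g3 : τ'.arr .mark = mark := by rw [g1] <;> simp [emark]
      have g4 : τ'.arr .rej = σ.arr .rej := by rw [g1] <;> simp [erej]
      have g5 : τ'.v .u = u := by
        rw [hf'.1 _ (by simp [Cmd.writes_for, Cmd.Writes])]
        simp [hv]
      have g6 : τ'.v .b = b := by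
        rw [hf'.1 _ (by simp [Cmd.writes_for, Cmd.Writes])]
        simp [evb]
      have g7 : τ'.arr .lo u = σ.arr .hi u := by
        rw [hf'.2 _ (by simp [Cmd.stores_for, Cmd.Stores])]
        simp
      have hw := hL.adj_lt u hu j (by omega) hj'
      have b1 := hB.pair hu hw
      have hB1 : 1 ≤ B := by omega
      have hjB : j + 1 ≤ B := by omega
      -- The second half of the body, for any outcome of the test for a mark: position `j` joins the
      -- tie as long as `y = 0`, and nothing happens afterwards.
      have main : ∀ τ'' : Env, τ''.arr = τ'.arr → (∀ r, r ≠ .y → τ''.v r = τ'.v r) →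
          (τ''.v .y = 0 → j = σ.arr .hi u ∨ mark j = 0) →
          (τ''.v .y = 0 → τ'.arr .hi u = j) →
          (τ''.v .y ≠ 0 → TieScan mark (σ.arr .hi u) (j + 1) (τ'.arr .hi u) (τ''.v .y) ∧
            σ.arr .hi u < τ'.arr .hi u) →
          WP B (.ite (.var .y) (.lit 1)
            (.seq (.assign .w (.get .adj (.var .i))) <|
            .seq (.ite (.rej .u .w) (.lit 1) (.store .ever (.var .w) (.lit 1)) .skip) <|
            .store .hi (.var .u) (.add (.var .i) (.lit 1)))
            .skip) τ'' fun t τ₂ => t ≤ 50 ∧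
              TieScan mark (σ.arr .hi u) (j + 1) (τ₂.arr .hi u) (τ₂.v .y) ∧
              σ.arr .hi u < τ₂.arr .hi u ∧
              (∀ u', u' ≠ u → τ₂.arr .hi u' = τ.arr .hi u') ∧
              ∀ w : Fin b, τ₂.arr .ever w ≠ 0 ↔ τ.arr .ever w ≠ 0 ∨
                (∃ i, σ.arr .hi u ≤ i ∧ i < τ₂.arr .hi u ∧ adj i = w) ∧
                  σ.arr .rej (u * b + w) = 0 := by
        intro τ'' harr hreg hy0 hyj hy1
        simp only [WP.seq_iff, WP.assign_iff, WP.ite_iff, WP.store_iff, WP.skip_iff, Ex.Fits,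
          Ex.eval, Ex.rej, Ex.pair, Ex.cost, harr, hreg .i (by simp), hreg .u (by simp),
          hreg .b (by simp), hv', g2, g4, g5, g6, Env.put_arr, Env.put_v,
          Env.set_v, Env.set_arr, if_true, reduceCtorEq, if_false, true_and, hB1, hjB, b1, and_true]
        have hscan : τ''.v .y = 0 → TieScan mark (σ.arr .hi u) (j + 1) (j + 1) 0 := by
          intro hy
          refine ⟨fun k h1 h2 => ?_, Or.inl ⟨rfl, rfl⟩⟩
          have h3 := hyj hy
          rcases Nat.lt_succ_iff_lt_or_eq.1 h2 with h4 | rfl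
          · exact hs.1 k h1 (by omega)
          · rcases hy0 hy with h5 | h5
            · omega
            · exact h5
        have hevery : τ''.v .y = 0 → ∀ w : Fin b, w ≠ (⟨adj j, hw⟩ : Fin b) →
            (τ'.arr .ever w ≠ 0 ↔ τ.arr .ever w ≠ 0 ∨
                (∃ i, σ.arr .hi u ≤ i ∧ i < j + 1 ∧ adj i = w) ∧
                  σ.arr .rej (u * b + w) = 0) := by
          intro hy w hne
          rw [hs₄ w, hyj hy]
          refine or_congr_right (and_congr_left fun _ => ⟨?_, ?_⟩)
          · rintro ⟨i, h1, h2, h3⟩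
            exact ⟨i, h1, by omega, h3⟩
          · rintro ⟨i, h1, h2, h3⟩
            refine ⟨i, h1, ?_, h3⟩
            have : i ≠ j := by
              rintro rfl
              exact hne (Fin.ext h3.symm)
            omega
        refine ⟨fun hy => ⟨fun hr => ?_, fun hr => ?_⟩, fun hy => ?_⟩
        · have hy : τ''.v .y = 0 := by omega
          refine ⟨by omega, ?_, by simp only [Function.update_self]; omega, ?_, ?_⟩
          · rw [Function.update_self, hy]
            exact hscan hy
          · intro u' hu'
            rw [Function.update_of_ne hu', hs₃ u' hu']
          · intro w
            rw [Function.update_self]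
            by_cases hww : w = (⟨adj j, hw⟩ : Fin b)
            · subst hww
              simp only [Function.update_self]
              exact iff_of_true one_ne_zero (Or.inr ⟨⟨j, hj, by omega, rfl⟩, by omega⟩)
            · rw [Function.update_of_ne (fun h => hww (Fin.ext h))]
              exact hevery hy w hww
        · have hy : τ''.v .y = 0 := by omega
          refine ⟨by omega, ?_, by simp only [Function.update_self]; omega, ?_, ?_⟩
          · rw [Function.update_self, hy]
            exact hscan hy
          · intro u' hu'
            rw [Function.update_of_ne hu', hs₃ u' hu']
          · intro w
            rw [Function.update_self]
            by_cases hww : w = (⟨adj j, hw⟩ : Fin b)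
            · subst hww
              rw [hs₄]
              refine or_congr_right ⟨fun h => ?_, fun h => ?_⟩
              · have := h.2
                simp only at this
                omega
              · have := h.2
                simp only at this
                omega
            · exact hevery hy w hww
        · obtain ⟨h1, h2⟩ := hy1 (by omega)
          exact ⟨by omega, h1, h2, hs₃, hs₄⟩
      have close : ∀ {τ₂ : Env} {t t' : ℕ}, (t ≤ 50 → t' ≤ 100) → (t ≤ 50 ∧
              TieScan mark (σ.arr .hi u) (j + 1) (τ₂.arr .hi u) (τ₂.v .y) ∧
              σ.arr .hi u < τ₂.arr .hi u ∧
              (∀ u', u' ≠ u → τ₂.arr .hi u' = τ.arr .hi u') ∧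
              ∀ w : Fin b, τ₂.arr .ever w ≠ 0 ↔ τ.arr .ever w ≠ 0 ∨
                (∃ i, σ.arr .hi u ≤ i ∧ i < τ₂.arr .hi u ∧ adj i = w) ∧
                  σ.arr .rej (u * b + w) = 0) → t' ≤ 100 ∧
            TieScan mark (σ.arr .hi u) (j + 1) ((τ₂.set .i (j + 1)).arr .hi u)
              ((τ₂.set .i (j + 1)).v .y) ∧
            (j + 1 ≠ σ.arr .hi u → σ.arr .hi u < (τ₂.set .i (j + 1)).arr .hi u) ∧
            (∀ u', u' ≠ u → (τ₂.set .i (j + 1)).arr .hi u' = τ.arr .hi u') ∧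
            ∀ w : Fin b, (τ₂.set .i (j + 1)).arr .ever w ≠ 0 ↔ τ.arr .ever w ≠ 0 ∨
              (∃ i, σ.arr .hi u ≤ i ∧ i < (τ₂.set .i (j + 1)).arr .hi u ∧ adj i = w) ∧
                σ.arr .rej (u * b + w) = 0 := by
        rintro τ₂ t t' ht' ⟨h1, h2, h3, h4, h5⟩
        refine ⟨ht' h1, ?_, fun _ => h3, h4, h5⟩
        simpa using h2
      have hyold : τ'.v .y ≠ 0 → TieScan mark (σ.arr .hi u) (j + 1) (τ'.arr .hi u) (τ'.v .y) ∧
            σ.arr .hi u < τ'.arr .hi u := by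
        intro hy
        obtain ⟨h1, ⟨h2, -⟩ | ⟨h2, h3, h4, h5⟩⟩ := hs
        · exact (hy h2).elim
        · exact ⟨⟨h1, Or.inr ⟨h2, h3, by omega, h5⟩⟩, h3⟩
      have hyj : τ'.v .y = 0 → τ'.arr .hi u = j := by
        intro hy
        obtain ⟨h1, ⟨h2, h3⟩ | ⟨h2, -⟩⟩ := hs
        · exact h3
        · exact (h2 hy).elim
      rw [WP.seq_iff]
      generalize Cmd.ite (.var .y) (.lit 1) _ .skip = q at main ⊢
      simp only [WP.ite_iff, WP.assign_iff, WP.skip_iff, Ex.Fits, Ex.eval, Ex.cost, hv', g3, g5, g7,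
        true_and, Nat.zero_le]
      refine ⟨fun h1 => ⟨fun h2 => ⟨by omega, ?_⟩, fun h2 => ?_⟩, fun h1 => ?_⟩
      · refine (main (τ'.set .y 1) rfl (fun r hr => by simp [hr]) (by simp) (by simp) ?_).mono
          fun t τ₂ _ h => close (fun _ => by omega) h
        intro _
        by_cases hy : τ'.v .y = 0
        · have h3 := hyj hy
          refine ⟨⟨hs.1, Or.inr ⟨by simp, by omega, by omega, by rw [h3]; omega⟩⟩, by omega⟩
        · obtain ⟨⟨h3, ⟨h4, -⟩ | ⟨-, h4⟩⟩, h5⟩ := hyold hy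
          · exact (hy h4).elim
          · exact ⟨⟨h3, Or.inr ⟨by simp, h4⟩⟩, h5⟩
      · exact (main τ' rfl (fun _ _ => rfl) (fun _ => Or.inr (by omega)) hyj hyold)
          |>.mono fun t τ₂ _ h => close (fun _ => by omega) h
      · exact (main τ' rfl (fun _ _ => rfl) (fun _ => Or.inl (by omega)) hyj hyold)
          |>.mono fun t τ₂ _ h => close (fun _ => by omega) h
    · rintro t τ' hf' - ⟨hs, hs₂, hs₃, hs₄⟩ ht
      have g5 : τ'.v .u = u := by
        rw [hf'.1 _ (by simp [Cmd.writes_for, Cmd.Writes])]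
        simp [hv]
      have g6 : τ'.v .f = τ.v .f := by
        rw [hf'.1 _ (by simp [Cmd.writes_for, Cmd.Writes])]
        simp
      have g7 : τ'.arr .lo = Function.update (τ.arr .lo) u (σ.arr .hi u) := by
        rw [hf'.2 _ (by simp [Cmd.stores_for, Cmd.Stores])]
        simp
      have g8 : τ'.arr .st = τ.arr .st := by
        rw [hf'.2 _ (by simp [Cmd.stores_for, Cmd.Stores])]
        simp
      have htime : (100 + ((2 + (1 + 1) + 1) + 10)) * (off (u + 1) - σ.arr .hi u) ≤ 115 * b :=
        Nat.mul_le_mul le_rfl (by omega)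
      have hlt' := hs₂ (by omega)
      simp only [Ex.cost, g5, g6, g7, g8, Env.put_arr, Env.put_v, Env.set_v, Env.set_arr, if_true,
        reduceCtorEq, if_false] at ht ⊢
      refine ⟨by omega, by omega, ?_, ?_, ?_, Or.inr ⟨hu, hNu⟩⟩
      · intro u' hu' h1 h2
        by_cases huu : u' = u
        · subst huu
          simp only [Function.update_self]
          refine ⟨trivial, hlt', ?_, hs.1, ?_, trivial⟩
          · obtain ⟨-, ⟨-, h3⟩ | ⟨-, -, h3, -⟩⟩ := hs <;> omega
          · obtain ⟨-, ⟨-, h3⟩ | ⟨-, -, -, h3⟩⟩ := hs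
            · exact Or.inl h3
            · exact Or.inr h3
        · simp only [Function.update_of_ne huu, hs₃ u' huu]
          exact hi₁ u' hu' h1 (by omega)
      · intro u' hu' h1
        have huu : u' ≠ u := by
          rintro rfl
          exact h1 ⟨hNu, by omega⟩
        simp only [Function.update_of_ne huu, hs₃ u' huu]
        exact hi₂ u' hu' fun h2 => h1 ⟨h2.1, by omega⟩
      · intro w
        have htie : ∀ u', u' ≠ u →
            ((((τ'.put .st u 3).set .f u).set .u (u + 1)).arrays.tie adj u' w ↔
              τ.arrays.tie adj u' w) := by
          intro u' huu
          simp [Arrays.tie, Env.arrays, g7, hs₃ u' huu, Function.update_of_ne huu]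
        have htie' : (((τ'.put .st u 3).set .f u).set .u (u + 1)).arrays.tie adj u w ↔
            ∃ i, σ.arr .hi u ≤ i ∧ i < τ'.arr .hi u ∧ adj i = w := by
          simp [Arrays.tie, Env.arrays, g7]
        rw [hs₄ w, hi₃ w, or_assoc]
        refine or_congr_right ⟨?_, ?_⟩
        · rintro (⟨u', h1, h2, h3, h4, h5⟩ | ⟨h1, h2⟩)
          · exact ⟨u', h1, by omega, h3, (htie u' (by omega)).2 h4, h5⟩
          · exact ⟨u, hu, by omega, hNu, htie'.2 h1, h2⟩
        · rintro ⟨u', h1, h2, h3, h4, h5⟩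
          rcases Nat.lt_succ_iff_lt_or_eq.1 h2 with h6 | rfl
          · exact Or.inl ⟨u', h1, h6, h3, (htie u' (by omega)).1 h4, h5⟩
          · exact Or.inr ⟨htie'.1 h4, h5⟩
  · rintro t τ hf hv ⟨hi₁, hi₂, hi₃, hi₄⟩ ht
    simp only [Ex.cost, Nat.sub_zero] at ht ⊢
    refine ⟨by nlinarith, ⟨?_, ?_, ?_, ?_, ?_, ?_, ?_, ?_, ?_⟩, hi₄⟩
    · exact fun u hu hn => (hi₁ u hu hn hu).1
    · exact fun u hu hn => (hi₁ u hu hn hu).2.1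
    · exact fun u hu hn => (hi₁ u hu hn hu).2.2.1
    · exact fun u hu hn => (hi₁ u hu hn hu).2.2.2.1
    · exact fun u hu hn => (hi₁ u hu hn hu).2.2.2.2.1
    · exact fun u hu hn => (hi₁ u hu hn hu).2.2.2.2.2
    · exact fun u hu hn => hi₂ u hu fun h => hn h.1
    · exact hf.2 _ (by simp [Cmd.stores_for, Cmd.Stores])
    · intro w
      refine (hi₃ w).trans (or_congr_right ⟨?_, ?_⟩)
      · rintro ⟨u, h1, -, h2⟩
        exact ⟨⟨u, h1⟩, h2⟩
      · rintro ⟨u, h2⟩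
        exact ⟨u, u.2, u.2, h2⟩

end Specifications

end PairwiseMarket

/-! ### Breadth-first search for alternating paths -/

namespace PairwiseMarket

/-- A stage of the search for alternating paths from the unmatched men in `S`, along edges in `A`:
the queue `q 0, …, q (n - 1)` consists of the men reached, `par w` is the successor of the man from
whom `w` has been reached, and `z < b` is an unmatched woman reached, if there is one. -/
structure Search (a b : ℕ) (S : ℕ → Prop) (A : ℕ → ℕ → Prop) (mm mw q par : ℕ → ℕ) (n z : ℕ) :
    Prop where
  lt : ∀ j < n, q j < a ∧ S (q j)
  inj : ∀ i < n, ∀ j < n, q i = q j → i = j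
  free : ∀ u < a, S u → mm u = 0 → ∃ j < n, q j = u
  origin : ∀ w < b, par w ≠ 0 → ∃ j < n, par w = q j + 1 ∧ A (q j) w
  partner : ∀ w < b, par w ≠ 0 → mw w ≠ 0 → ∃ j < n, q j + 1 = mw w
  -- A matched man enters the queue only through his partner, from a man before him. Both the
  -- termination of the exchange and the minimality of the set of men reached rest on this order.
  pred : ∀ j < n, mm (q j) ≠ 0 → ∃ i < j, par (mm (q j) - 1) = q i + 1
  end_eq : (z = b ∧ ∀ w < b, par w ≠ 0 → mw w ≠ 0) ∨ (z < b ∧ par z ≠ 0 ∧ mw z = 0)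

namespace Search

variable {a b : ℕ} {S : ℕ → Prop} {A : ℕ → ℕ → Prop} {mm mw q par : ℕ → ℕ} {n z : ℕ}

theorem le (h : Search a b S A mm mw q par n z) : n ≤ a := by
  have := Finset.card_le_card_of_injOn (s := Finset.range n) (t := Finset.range a) q ?_ ?_
  · simpa using this
  · intro j hj
    simpa using (h.lt j (by simpa using hj)).1
  · intro i hi j hj hij
    exact h.inj i (by simpa using hi) j (by simpa using hj) hij

/-- As `w` is nobody's partner, no predecessor is read off from `par w`. Any unmatched woman reached
serves the purpose, so an earlier `z` may be overwritten. -/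
theorem found (h : Search a b S A mm mw q par n z) (hc : Consistent a b mm mw) {j w : ℕ}
    (hj : j < n) (hw : w < b) (hA : A (q j) w) (hp : par w = 0) (hmw : mw w = 0) :
    Search a b S A mm mw q (Function.update par w (q j + 1)) n w where
  lt := h.lt
  inj := h.inj
  free := h.free
  origin w' hw' hp' := by
    by_cases hww : w' = w
    · subst hww
      exact ⟨j, hj, by simp, hA⟩
    · rw [Function.update_of_ne hww] at hp' ⊢
      exact h.origin w' hw' hp'
  partner w' hw' hp' hm := by
    have hww : w' ≠ w := by
      rintro rfl
      exact hm hmw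
    rw [Function.update_of_ne hww] at hp'
    exact h.partner w' hw' hp' hm
  pred i hi hm := by
    obtain ⟨i', h1, h2⟩ := h.pred i hi hm
    refine ⟨i', h1, ?_⟩
    rw [Function.update_of_ne, h2]
    intro h3
    have := (hc.iff (q i) (h.lt i hi).1 w hw).1 (by omega)
    omega
  end_eq := Or.inr ⟨hw, by simp, hmw⟩

/-- The partner of a woman who has not been reached is not yet in the queue, because he could have
entered it only through her. -/
theorem push (h : Search a b S A mm mw q par n z) (hc : Consistent a b mm mw)
    (hS : ∀ u < a, mm u ≠ 0 → S u) {j w : ℕ}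
    (hj : j < n) (hw : w < b) (hA : A (q j) w) (hp : par w = 0) (hmw : mw w ≠ 0) :
    Search a b S A mm mw (Function.update q n (mw w - 1)) (Function.update par w (q j + 1))
      (n + 1) z := by
  have hva := hc.women w hw
  have hmm : mm (mw w - 1) = w + 1 := (hc.iff _ (by omega) w hw).2 (by omega)
  have hnew : ∀ i < n, q i ≠ mw w - 1 := by
    intro i hi he
    obtain ⟨i', -, h2⟩ := h.pred i hi (by rw [he]; omega)
    rw [he, hmm, Nat.add_sub_cancel] at h2
    omega
  have hold : ∀ i < n, Function.update q n (mw w - 1) i = q i := fun i hi =>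
    Function.update_of_ne hi.ne _ _
  have hlast : Function.update q n (mw w - 1) n = mw w - 1 := Function.update_self ..
  refine ⟨?_, ?_, ?_, ?_, ?_, ?_, ?_⟩
  · intro i hi
    rcases Nat.lt_succ_iff_lt_or_eq.1 hi with hi | rfl
    · rw [hold i hi]
      exact h.lt i hi
    · rw [hlast]
      exact ⟨by omega, hS _ (by omega) (by omega)⟩
  · intro i hi i' hi' he
    rcases Nat.lt_succ_iff_lt_or_eq.1 hi with hi | rfl <;>
      rcases Nat.lt_succ_iff_lt_or_eq.1 hi' with hi' | rfl
    · rw [hold i hi, hold i' hi'] at he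
      exact h.inj i hi i' hi' he
    · rw [hold i hi, hlast] at he
      exact (hnew i hi he).elim
    · rw [hold i' hi', hlast] at he
      exact (hnew i' hi' he.symm).elim
    · rfl
  · intro u hu hs hm
    obtain ⟨i, hi, he⟩ := h.free u hu hs hm
    exact ⟨i, by omega, by rw [hold i hi, he]⟩
  · intro w' hw' hp'
    by_cases hww : w' = w
    · subst hww
      exact ⟨j, by omega, by rw [hold j hj, Function.update_self], by rwa [hold j hj]⟩
    · rw [Function.update_of_ne hww] at hp' ⊢
      obtain ⟨i, hi, h1, h2⟩ := h.origin w' hw' hp'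
      exact ⟨i, by omega, by rw [hold i hi, h1], by rwa [hold i hi]⟩
  · intro w' hw' hp' hm
    by_cases hww : w' = w
    · subst hww
      exact ⟨n, by omega, by rw [hlast]; omega⟩
    · rw [Function.update_of_ne hww] at hp'
      obtain ⟨i, hi, h1⟩ := h.partner w' hw' hp' hm
      exact ⟨i, by omega, by rw [hold i hi, h1]⟩
  · intro i hi hm
    rcases Nat.lt_succ_iff_lt_or_eq.1 hi with hi | rfl
    · rw [hold i hi] at hm ⊢
      obtain ⟨i', h1, h2⟩ := h.pred i hi hm
      refine ⟨i', h1, ?_⟩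
      rw [hold i' (by omega), Function.update_of_ne, h2]
      intro h3
      rw [h3] at h2
      omega
    · refine ⟨j, hj, ?_⟩
      rw [hlast, hmm, Nat.add_sub_cancel, Function.update_self, hold j hj]
  · refine h.end_eq.imp (fun ⟨h1, h2⟩ => ⟨h1, fun w' hw' hp' => ?_⟩)
      fun ⟨h1, h2, h3⟩ => ⟨h1, ?_, h3⟩
    · by_cases hww : w' = w
      · rwa [hww]
      · rw [Function.update_of_ne hww] at hp'
        exact h2 w' hw' hp'
    · rw [Function.update_of_ne]
      · exact h2
      · rintro rfl
        exact hmw h3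

end Search

namespace Cmd

/-- Put the unmatched men with active edges into an empty queue. -/
def startSearch : Cmd :=
  .seq (.for .w (.lit 0) (.var .b) (.store .par (.var .w) (.lit 0))) <|
  .seq (.assign .qt (.lit 0)) <|
  .seq (.for .u (.lit 0) (.var .a) <|
    .ite (.lit 0) (.get .st (.var .u))
      (.ite (.get .mm (.var .u)) (.lit 1)
        (.seq (.store .queue (.var .qt) (.var .u)) (.assign .qt (.add (.var .qt) (.lit 1))))
        .skip) .skip) <|
  .seq (.assign .z (.var .b)) (.assign .qh (.lit 0))

/-- Scan the active edges of `u`. -/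
def scan : Cmd :=
  .for .i (.get .lo (.var .u)) (.get .hi (.var .u)) <|
    .seq (.assign .w (.get .adj (.var .i))) <|
    .ite (.rej .u .w) (.lit 1)
      (.ite (.get .par (.var .w)) (.lit 1)
        (.seq (.store .par (.var .w) (.add (.var .u) (.lit 1))) <|
        .ite (.lit 0) (.get .mw (.var .w))
          (.seq (.store .queue (.var .qt) (.sub (.get .mw (.var .w)) (.lit 1)))
            (.assign .qt (.add (.var .qt) (.lit 1))))
          (.assign .z (.var .w)))
        .skip) .skip

/-- Search for alternating paths. -/
def search : Cmd :=
  .seq .startSearch <|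
  .while (.var .qh) (.var .qt) <|
    .seq (.assign .u (.get .queue (.var .qh))) <|
    .seq .scan (.assign .qh (.add (.var .qh) (.lit 1)))

end Cmd

section Specifications

variable {a b B : ℕ} {I : Market (Fin a) (Fin b)} {off adj mark : ℕ → ℕ} {σ : Env}

/-- The edge `uw` belongs to the proposal tie of `u` and is not marked as rejected. -/
def Arrays.live (b : ℕ) (adj : ℕ → ℕ) (x : Arrays) (u w : ℕ) : Prop :=
  x.tie adj u w ∧ x.rej (u * b + w) = 0

theorem wp_startSearch (hB : Big a b B) (h : σ.Base I off adj mark)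
    (A : ℕ → ℕ → Prop) :
    WP B .startSearch σ fun t τ => t ≤ 200 * (a + 1) * (b + 1) ∧ τ.v .qh = 0 ∧
      Search a b (σ.arr .st · ≠ 0) A (σ.arr .mm) (σ.arr .mw) (τ.arr .queue)
        (τ.arr .par) (τ.v .qt) (τ.v .z) := by
  have h8 := hB.eight
  have hBa := hB.men
  have hBb := hB.women
  rw [Cmd.startSearch, WP.seq_iff]
  refine WP.for_rule (l := 0) (h := b) (T := 20) (fun k τ => ∀ w < k, τ.arr .par w = 0)
    (Nat.zero_le _) rfl (Nat.zero_le _) (by omega) (by omega) ?_ ?_ ?_ ?_ ?_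
  · intro τ hf
    refine ⟨trivial, ?_⟩
    rw [Ex.eval, hf.1 _ (by simp [Cmd.writes_for, Cmd.Writes]), h.women]
  · simp [Cmd.Writes]
  · simp
  · intro k τ _ hk hf hv hi
    simp only [WP.store_iff, Ex.Fits, Ex.eval, Ex.cost, hv, Env.set_arr, Env.put_arr, if_true,
      true_and]
    refine ⟨by omega, by omega, fun w hw => ?_⟩
    rw [Function.update_apply]
    split_ifs with hwk
    · rfl
    · exact hi w (by omega)
  intro t τ hf _ hi ht
  have hb : τ.Base I off adj mark :=
    h.of_frame hf (by simp [Cmd.writes_for, Cmd.Writes, Cmd.stores_for, Cmd.Stores])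
  have e1 : τ.arr .st = σ.arr .st := hf.2 _ (by simp [Cmd.stores_for, Cmd.Stores])
  have e2 : τ.arr .mm = σ.arr .mm := hf.2 _ (by simp [Cmd.stores_for, Cmd.Stores])
  rw [WP.seq_iff, WP.assign_iff]
  refine ⟨Nat.zero_le _, ?_⟩
  rw [WP.seq_iff]
  refine WP.for_rule (l := 0) (h := a) (T := 50) (fun k τ' =>
    τ'.v .qt ≤ k ∧ (∀ j < τ'.v .qt, τ'.arr .queue j < k ∧ σ.arr .st (τ'.arr .queue j) ≠ 0 ∧
      σ.arr .mm (τ'.arr .queue j) = 0) ∧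
    (∀ i < τ'.v .qt, ∀ j < τ'.v .qt, τ'.arr .queue i = τ'.arr .queue j → i = j) ∧
    ∀ u < k, σ.arr .st u ≠ 0 → σ.arr .mm u = 0 → ∃ j < τ'.v .qt, τ'.arr .queue j = u)
    (Nat.zero_le _) rfl (Nat.zero_le _) (by omega) (by omega) ?_ ?_ ?_ ?_ ?_
  · intro τ' hf'
    refine ⟨trivial, ?_⟩
    rw [Ex.eval, hf'.1 _ (by simp [Cmd.writes_for, Cmd.Writes])]
    simp [hb.men]
  · simp [Cmd.Writes]
  · simp [Ex.eval]
  · rintro k τ' _ hk hf' hv ⟨h1, h2, h3, h4⟩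
    have e3 : τ'.arr .st = σ.arr .st := by
      rw [hf'.2 _ (by simp [Cmd.stores_for, Cmd.Stores]), Env.set_arr, e1]
    have e4 : τ'.arr .mm = σ.arr .mm := by
      rw [hf'.2 _ (by simp [Cmd.stores_for, Cmd.Stores]), Env.set_arr, e2]
    have stay : σ.arr .st k = 0 ∨ σ.arr .mm k ≠ 0 → τ'.v .qt ≤ k + 1 ∧
        (∀ j < τ'.v .qt, τ'.arr .queue j < k + 1 ∧ σ.arr .st (τ'.arr .queue j) ≠ 0 ∧
          σ.arr .mm (τ'.arr .queue j) = 0) ∧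
        (∀ i < τ'.v .qt, ∀ j < τ'.v .qt, τ'.arr .queue i = τ'.arr .queue j → i = j) ∧
        ∀ u < k + 1, σ.arr .st u ≠ 0 → σ.arr .mm u = 0 →
          ∃ j < τ'.v .qt, τ'.arr .queue j = u := by
      intro hk'
      refine ⟨by omega, fun j hj => ⟨by have := (h2 j hj).1; omega, (h2 j hj).2⟩, h3,
        fun u hu hs hm => ?_⟩
      rcases Nat.lt_succ_iff_lt_or_eq.1 hu with hu | rfl
      · exact h4 u hu hs hm
      · omega
    simp only [WP.seq_iff, WP.assign_iff, WP.ite_iff, WP.store_iff, WP.skip_iff, Ex.Fits, Ex.eval,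
      Ex.cost, hv, e3, e4, Env.set_v, Env.set_arr, Env.put_arr, Env.put_v, reduceCtorEq, if_true,
      if_false, true_and]
    refine ⟨by omega, fun hs => ⟨by omega, fun hm => ⟨by omega, by omega, by omega, ?_, ?_, ?_⟩,
      fun hm => ⟨by omega, stay (by omega)⟩⟩, fun hs => ⟨by omega, stay (by omega)⟩⟩
    · intro j hj
      rw [Function.update_apply]
      split_ifs with hjk
      · exact ⟨by omega, by omega, by omega⟩
      · have := h2 j (by omega)
        exact ⟨by omega, this.2⟩
    · intro i hi j hj
      rw [Function.update_apply, Function.update_apply]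
      split_ifs with hik hjk hjk
      · omega
      · have := h2 j (by omega)
        omega
      · have := h2 i (by omega)
        omega
      · exact h3 i (by omega) j (by omega)
    · intro u hu hs' hm'
      rcases Nat.lt_succ_iff_lt_or_eq.1 hu with hu | rfl
      · obtain ⟨j, hj, he⟩ := h4 u hu hs' hm'
        exact ⟨j, by omega, by rw [Function.update_of_ne hj.ne, he]⟩
      · exact ⟨_, Nat.lt_succ_self _, Function.update_self ..⟩
  · rintro t' τ' hf' - ⟨h1, h2, h3, h4⟩ ht'
    have e3 : τ'.arr .par = τ.arr .par := by
      rw [hf'.2 _ (by simp [Cmd.stores_for, Cmd.Stores]), Env.set_arr]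
    have e4 : τ'.v .b = b := by
      rw [hf'.1 _ (by simp [Cmd.writes_for, Cmd.Writes])]
      simp [hb.women]
    simp only [WP.seq_iff, WP.assign_iff, Ex.Fits, Ex.eval, Ex.cost, Env.set_v, Env.set_arr,
      reduceCtorEq, if_true, if_false, true_and, Nat.sub_zero, Nat.zero_le, e3, e4] at ht ht' ⊢
    refine ⟨by nlinarith, fun j hj => ⟨(h2 j hj).1, (h2 j hj).2.1⟩, h3, h4, ?_, ?_, ?_,
      Or.inl ⟨rfl, ?_⟩⟩
    · intro w hw hp
      exact (hp (hi w hw)).elim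
    · intro w hw hp
      exact (hp (hi w hw)).elim
    · intro j hj hm
      exact (hm (h2 j hj).2.2).elim
    · intro w hw hp
      exact (hp (hi w hw)).elim

theorem wp_scan (hB : Big a b B) (h : σ.Base I off adj mark)
    (hx : σ.arrays.Bounded a b B adj) (hc : Consistent a b (σ.arr .mm) (σ.arr .mw))
    (hS : ∀ u < a, σ.arr .mm u ≠ 0 → σ.arr .st u ≠ 0)
    (hs : Search a b (σ.arr .st · ≠ 0) (σ.arrays.live b adj) (σ.arr .mm) (σ.arr .mw)
      (σ.arr .queue) (σ.arr .par) (σ.v .qt) (σ.v .z)) {j : ℕ} (hj : j < σ.v .qt)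
    (hu : σ.v .u = σ.arr .queue j) :
    WP B .scan σ fun t τ => t ≤ 100 * (b + 1) ∧
      Search a b (σ.arr .st · ≠ 0) (σ.arrays.live b adj) (σ.arr .mm) (σ.arr .mw)
        (τ.arr .queue) (τ.arr .par) (τ.v .qt) (τ.v .z) ∧ σ.v .qt ≤ τ.v .qt ∧
      (∀ i < σ.v .qt, τ.arr .queue i = σ.arr .queue i) ∧
      (∀ w, σ.arr .par w ≠ 0 → τ.arr .par w ≠ 0) ∧
      ∀ w, σ.arrays.live b adj (σ.arr .queue j) w → τ.arr .par w ≠ 0 := by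
  have h8 := hB.eight
  have hBa := hB.men
  have hBb := hB.women
  have hua := (hs.lt j hj).1
  set u := σ.arr .queue j with hudef
  obtain ⟨h1, h2, h3, h4⟩ := hx u hua
  rw [Cmd.scan]
  refine WP.for_rule (l := σ.arr .lo u) (h := σ.arr .hi u) (T := 80) (fun k τ =>
      Search a b (σ.arr .st · ≠ 0) (σ.arrays.live b adj) (σ.arr .mm) (σ.arr .mw)
        (τ.arr .queue) (τ.arr .par) (τ.v .qt) (τ.v .z) ∧ σ.v .qt ≤ τ.v .qt ∧
      (∀ i < σ.v .qt, τ.arr .queue i = σ.arr .queue i) ∧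
      (∀ w, σ.arr .par w ≠ 0 → τ.arr .par w ≠ 0) ∧
      ∀ i, σ.arr .lo u ≤ i → i < k → σ.arr .rej (u * b + adj i) = 0 → τ.arr .par (adj i) ≠ 0)
    trivial (by simp only [Ex.eval, hu]) h1 h2 (by omega) ?_ ?_ ?_ ?_ ?_
  · intro τ hf
    refine ⟨trivial, ?_⟩
    simp only [Ex.eval]
    rw [hf.1 _ (by simp [Cmd.writes_for, Cmd.Writes]),
      hf.2 _ (by simp [Cmd.stores_for, Cmd.Stores]), hu]
  · simp [Cmd.Writes]
  · simp only [Env.set_arr, Env.set_v, reduceCtorEq, if_false]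
    refine ⟨hs, le_rfl, fun _ _ => trivial, fun _ h => h, fun i h5 h6 => ?_⟩
    omega
  · rintro k τ hk hk' hf hv ⟨i1, i2, i3, i4, i5⟩
    have hb : τ.Base I off adj mark :=
      h.of_frame hf (by simp [Cmd.writes_for, Cmd.Writes, Cmd.stores_for, Cmd.Stores])
    have e1 : τ.v .u = u := by
      rw [hf.1 _ (by simp [Cmd.writes_for, Cmd.Writes]), hu]
    have e2 : τ.arr .rej = σ.arr .rej := hf.2 _ (by simp [Cmd.stores_for, Cmd.Stores])
    have e3 : τ.arr .mw = σ.arr .mw := hf.2 _ (by simp [Cmd.stores_for, Cmd.Stores])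
    have hw := h4 k hk hk'
    have b1 := hB.pair hua hw
    have hn := i1.le
    have hja : j < τ.v .qt := by omega
    have hqj : τ.arr .queue j = u := i3 j hj
    have hmw := hc.women _ hw
    simp only [WP.seq_iff, WP.assign_iff, WP.ite_iff, WP.store_iff, WP.skip_iff, Ex.Fits, Ex.eval,
      Ex.rej, Ex.pair, Ex.cost, hv, e1, e2, e3, hb.women, hb.adj, Env.set_v, Env.set_arr,
      Env.put_arr, Env.put_v, reduceCtorEq, if_true, if_false, true_and]
    refine ⟨by omega, by omega, fun hr => ⟨by omega, fun hp => ⟨by omega, by omega, fun hm =>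
      ⟨by omega, by omega, by omega, ?_, by omega, ?_, ?_, ?_⟩, fun hm => ⟨by omega, ?_, i2, i3,
      ?_, ?_⟩⟩, fun hp => ⟨by omega, i1, i2, i3, i4, ?_⟩⟩, fun hr => ⟨by omega, i1, i2, i3, i4, ?_⟩⟩
    · have := i1.push hc hS hja hw (hqj ▸ ⟨⟨k, hk, hk', rfl⟩, Nat.lt_one_iff.1 hr⟩)
        (by omega) (by omega)
      rwa [hqj] at this
    · intro i hi
      rw [Function.update_of_ne (by omega), i3 i hi]
    · intro w hw
      rw [Function.update_apply]
      split_ifs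
      · omega
      · exact i4 w hw
    · intro i h5 h6 h7
      rw [Function.update_apply]
      split_ifs with hik
      · omega
      · refine i5 i h5 ?_ h7
        have : i ≠ k := by
          rintro rfl
          exact hik rfl
        omega
    · have := i1.found hc hja hw (hqj ▸ ⟨⟨k, hk, hk', rfl⟩, Nat.lt_one_iff.1 hr⟩)
        (by omega) (by omega)
      rwa [hqj] at this
    · intro w hw
      rw [Function.update_apply]
      split_ifs
      · omega
      · exact i4 w hw
    · intro i h5 h6 h7
      rw [Function.update_apply]
      split_ifs with hik
      · omega
      · refine i5 i h5 ?_ h7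
        have : i ≠ k := by
          rintro rfl
          exact hik rfl
        omega
    · intro i h5 h6 h7
      rcases Nat.lt_succ_iff_lt_or_eq.1 h6 with h6 | rfl
      · exact i5 i h5 h6 h7
      · omega
    · intro i h5 h6 h7
      rcases Nat.lt_succ_iff_lt_or_eq.1 h6 with h6 | rfl
      · exact i5 i h5 h6 h7
      · omega
  · rintro t τ hf - ⟨i1, i2, i3, i4, i5⟩ ht
    simp only [Ex.cost] at ht
    have h5 : (80 + (2 + 1 + 10)) * (σ.arr .hi u - σ.arr .lo u) ≤ 93 * b :=
      Nat.mul_le_mul le_rfl h3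
    refine ⟨by omega, i1, i2, i3, i4, ?_⟩
    rintro w ⟨⟨i, h5, h6, rfl⟩, h7⟩
    exact i5 i h5 h6 h7

theorem wp_search (hB : Big a b B) (h : σ.Base I off adj mark)
    (hx : σ.arrays.Bounded a b B adj) (hc : Consistent a b (σ.arr .mm) (σ.arr .mw))
    (hS : ∀ u < a, σ.arr .mm u ≠ 0 → σ.arr .st u ≠ 0) :
    WP B .search σ fun t τ => t ≤ 400 * (a + 1) * (b + 1) ∧
      Search a b (σ.arr .st · ≠ 0) (σ.arrays.live b adj) (σ.arr .mm) (σ.arr .mw)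
        (τ.arr .queue) (τ.arr .par) (τ.v .qt) (τ.v .z) ∧
      ∀ j < τ.v .qt, ∀ w, σ.arrays.live b adj (τ.arr .queue j) w → τ.arr .par w ≠ 0 := by
  have h8 := hB.eight
  have hBa := hB.men
  rw [Cmd.search, WP.seq_iff]
  refine (wp_startSearch hB h (σ.arrays.live b adj)).mono ?_
  rintro t₀ σ₁ hf₁ ⟨ht₀, hqh, hs⟩
  have frame : ∀ {τ : Env}, (∀ A, A ≠ .par → A ≠ .queue → τ.arr A = σ₁.arr A) →
      τ.v .a = σ₁.v .a → τ.v .b = σ₁.v .b →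
      (∀ A, A ≠ .par → A ≠ .queue → τ.arr A = σ.arr A) ∧ τ.Base I off adj mark ∧
        τ.arrays = σ.arrays := by
    intro τ hA ha hb
    have hA' : ∀ A, A ≠ .par → A ≠ .queue → τ.arr A = σ.arr A := by
      intro A h1 h2
      rw [hA A h1 h2]
      exact hf₁.2 A (by simp [Cmd.startSearch, Cmd.stores_for, Cmd.Stores, h1, h2])
    refine ⟨hA', ⟨?_, ?_, ?_, ?_, ?_, ?_⟩, ?_⟩
    · rw [ha, hf₁.1 _ (by simp [Cmd.startSearch, Cmd.writes_for, Cmd.Writes]), h.men]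
    · rw [hb, hf₁.1 _ (by simp [Cmd.startSearch, Cmd.writes_for, Cmd.Writes]), h.women]
    · rw [hA' _ (by simp) (by simp), h.off]
    · rw [hA' _ (by simp) (by simp), h.adj]
    · rw [hA' _ (by simp) (by simp), h.mark]
    · rw [hA' _ (by simp) (by simp)]
      exact h.cmp
    · rw [Env.arrays, Env.arrays, hA' _ (by simp) (by simp), hA' _ (by simp) (by simp),
        hA' _ (by simp) (by simp), hA' _ (by simp) (by simp), hA' _ (by simp) (by simp)]
  -- The men in the queue are distinct, so the head advances at most `a` times.
  refine WP.while_rule (T := 100 * (b + 1) + 20) (μ := fun τ => a - τ.v .qh) (Inv := fun τ =>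
    τ.v .qh ≤ τ.v .qt ∧
    Search a b (σ.arr .st · ≠ 0) (σ.arrays.live b adj) (σ.arr .mm) (σ.arr .mw)
      (τ.arr .queue) (τ.arr .par) (τ.v .qt) (τ.v .z) ∧
    ∀ j < τ.v .qh, ∀ w, σ.arrays.live b adj (τ.arr .queue j) w → τ.arr .par w ≠ 0)
    ⟨by omega, hs, by omega⟩ (fun τ _ _ => ⟨trivial, trivial⟩) ?_ ?_
  · rintro τ hf ⟨h1, h2, h3⟩ hlt
    obtain ⟨hA, hb, hxx⟩ := frame (τ := τ)
      (fun A h1 h2 => hf.2 A (by simp [Cmd.scan, Cmd.stores_for, Cmd.Stores, h1, h2]))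
      (hf.1 _ (by simp [Cmd.scan, Cmd.writes_for, Cmd.Writes]))
      (hf.1 _ (by simp [Cmd.scan, Cmd.writes_for, Cmd.Writes]))
    simp only [Ex.eval] at hlt
    have hn := h2.le
    rw [WP.seq_iff, WP.assign_iff]
    refine ⟨trivial, ?_⟩
    rw [WP.seq_iff]
    have hb' : (τ.set .u (τ.arr .queue (τ.v .qh))).Base I off adj mark :=
      ⟨by simpa using hb.men, by simpa using hb.women, hb.off, hb.adj, hb.mark, hb.cmp⟩
    have e1 : (τ.set .u (τ.arr .queue (τ.v .qh))).arrays = σ.arrays := hxx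
    refine (wp_scan (j := τ.v .qh) hB hb' (by rwa [e1]) ?_ ?_ ?_ ?_ ?_).mono ?_
    · rw [Env.set_arr, hA _ (by simp) (by simp), hA _ (by simp) (by simp)]
      exact hc
    · rw [Env.set_arr, hA _ (by simp) (by simp), hA _ (by simp) (by simp)]
      exact hS
    · rw [e1]
      simp only [Env.set_arr, hA .mm (by simp) (by simp), hA .mw (by simp) (by simp),
        hA .st (by simp) (by simp), Env.set_v, reduceCtorEq, if_false]
      exact h2
    · simpa using hlt
    · simp
    · rintro t τ' hf' ⟨ht, i1, i2, i3, i4, i5⟩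
      rw [e1] at i1 i5
      have e2 : τ'.v .qh = τ.v .qh := by
        rw [hf'.1 _ (by simp [Cmd.scan, Cmd.writes_for, Cmd.Writes])]
        simp
      simp only [Env.set_arr, hA .mm (by simp) (by simp), hA .mw (by simp) (by simp),
        hA .st (by simp) (by simp), Env.set_v, reduceCtorEq, if_false] at i1 i2 i3 i4 i5
      simp only [WP.assign_iff, Ex.Fits, Ex.eval, Ex.cost, Env.set_v, Env.set_arr, reduceCtorEq,
        if_true, if_false, true_and, e2]
      refine ⟨by omega, ⟨by omega, i1, ?_⟩, by omega, ?_⟩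
      · intro j hj w hw
        rw [i3 j (by omega)] at hw
        rcases Nat.lt_succ_iff_lt_or_eq.1 hj with hj | rfl
        · exact i4 w (h3 j hj w hw)
        · exact i5 w hw
      · rw [show a - τ.v .qh - (a - (τ.v .qh + 1)) = 1 by omega]
        omega
  · rintro t τ hf ⟨h1, h2, h3⟩ hlt ht hμ
    simp only [Ex.eval] at hlt
    simp only [Ex.cost, hqh, Nat.sub_zero] at ht
    have e1 : τ.v .qh = τ.v .qt := by omega
    rw [e1] at h3
    refine ⟨?_, h2, h3⟩
    have : (100 * (b + 1) + 20 + (2 + 2 + 1)) * (a - (a - τ.v .qh)) ≤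
        (100 * (b + 1) + 20 + (2 + 2 + 1)) * a := Nat.mul_le_mul le_rfl (by omega)
    have : (100 * (b + 1) + 20 + (2 + 2 + 1)) * (a - τ.v .qh) ≤
        (100 * (b + 1) + 20 + (2 + 2 + 1)) * a := Nat.mul_le_mul le_rfl (by omega)
    nlinarith

end Specifications

end PairwiseMarket

/-! ### Augmentation along an alternating path -/

namespace PairwiseMarket

/-- A stage of the exchange along an alternating path that ends at the man `q r` before `w`; the
woman `w` has lost her partner, and everyone else is matched consistently. -/
structure Augmenting (a b : ℕ) (A : ℕ → ℕ → Prop) (mm₀ q par mm mw : ℕ → ℕ) (w r : ℕ) : Prop where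
  lt : w < b
  men : ∀ u < a, mm u ≤ b
  women : ∀ w < b, mw w ≤ a
  notMatched : ∀ u < a, mm u ≠ w + 1
  iff : ∀ u < a, ∀ w' < b, w' ≠ w → (mm u = w' + 1 ↔ mw w' = u + 1)
  adm : ∀ u < a, ∀ w' < b, mm u = w' + 1 → A u w'
  origin : par w = q r + 1
  same : ∀ j ≤ r, mm (q j) = mm₀ (q j)
  matched : ∀ u < a, mm u ≠ 0 ↔ mm₀ u ≠ 0

/-- `mm` and `mw` describe a matching of edges in `A` that covers one more man than `mm₀`. -/
def Augmented (a b : ℕ) (A : ℕ → ℕ → Prop) (mm₀ mm mw : ℕ → ℕ) : Prop :=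
  Consistent a b mm mw ∧ (∀ u < a, ∀ w < b, mm u = w + 1 → A u w) ∧
    ∃ u₀ < a, mm₀ u₀ = 0 ∧ ∀ u < a, mm u ≠ 0 ↔ mm₀ u ≠ 0 ∨ u = u₀

namespace Search

variable {a b : ℕ} {S : ℕ → Prop} {A : ℕ → ℕ → Prop} {mm₀ mw₀ q par mm mw : ℕ → ℕ} {n z w r : ℕ}

theorem augmenting (h : Search a b S A mm₀ mw₀ q par n z) (hc : Consistent a b mm₀ mw₀)
    (hA : ∀ u < a, ∀ w < b, mm₀ u = w + 1 → A u w) (hz : z < b) :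
    ∃ r < n, Augmenting a b A mm₀ q par mm₀ mw₀ z r := by
  obtain ⟨h1, -⟩ | ⟨-, h1, h2⟩ := h.end_eq
  · omega
  obtain ⟨r, hr, h3, -⟩ := h.origin z hz h1
  exact ⟨r, hr, hz, hc.men, hc.women, fun u hu h4 => by have := (hc.iff u hu z hz).1 h4; omega,
    fun u hu w hw _ => hc.iff u hu w hw, hA, h3, fun _ _ => rfl, fun _ _ => Iff.rfl⟩

theorem origin_adm (h : Search a b S A mm₀ mw₀ q par n z) (hw : w < b) (hp : par w = q r + 1) :
    A (q r) w := by
  obtain ⟨j, -, h1, h2⟩ := h.origin w hw (by omega)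
  rwa [show q r = q j by omega]

/-- The man `q r` receives `w` and releases his partner, who takes over the role of `w`. His
predecessor stands earlier in the queue, so no man is met twice, and the men still to come have
their original partners. -/
theorem step (h : Search a b S A mm₀ mw₀ q par n z) (hr : r < n)
    (hg : Augmenting a b A mm₀ q par mm mw w r) (hm : mm (q r) ≠ 0) :
    ∃ i < r, Augmenting a b A mm₀ q par (Function.update mm (q r) (w + 1))
      (Function.update mw w (q r + 1)) (mm (q r) - 1) i := by
  have hq := (h.lt r hr).1
  have hs := hg.same r le_rfl
  obtain ⟨i, hi, hp⟩ := h.pred r hr (by omega)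
  rw [← hs] at hp
  have h1 := hg.men _ hq
  have h2 := hg.notMatched _ hq
  refine ⟨i, hi, by omega, ?_, ?_, ?_, ?_, ?_, hp, ?_, ?_⟩
  · intro u hu
    have := hg.lt
    rw [Function.update_apply]
    split_ifs
    · omega
    · exact hg.men u hu
  · intro w' hw'
    rw [Function.update_apply]
    split_ifs
    · omega
    · exact hg.women w' hw'
  · intro u hu
    rw [Function.update_apply]
    split_ifs with huq
    · omega
    · intro h3
      have h4 := (hg.iff u hu _ (by omega) (by omega)).1 h3
      have h5 := (hg.iff _ hq (mm (q r) - 1) (by omega) (by omega)).1 (by omega)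
      omega
  · intro u hu w' hw' hne
    have h3 := hg.notMatched u hu
    by_cases hu' : u = q r <;> by_cases hww : w' = w
    · subst hu'
      subst hww
      simp
    · subst hu'
      have := hg.iff _ hu w' hw' hww
      rw [Function.update_self, Function.update_of_ne hww]
      omega
    · subst hww
      rw [Function.update_of_ne hu', Function.update_self]
      omega
    · rw [Function.update_of_ne hu', Function.update_of_ne hww]
      exact hg.iff u hu w' hw' hww
  · intro u hu w' hw'
    rw [Function.update_apply]
    split_ifs with huq
    · intro h3
      rw [huq, show w' = w by omega]
      exact h.origin_adm hg.lt hg.origin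
    · exact hg.adm u hu w' hw'
  · intro j hj
    rw [Function.update_of_ne]
    · exact hg.same j (by omega)
    · intro h3
      have := h.inj j (by omega) r hr h3
      omega
  · intro u hu
    rw [Function.update_apply]
    split_ifs with huq
    · rw [huq, ← hs]
      exact iff_of_true (by omega) hm
    · exact hg.matched u hu

/-- The path ends at a man without a partner; giving him `w` makes the two arrays consistent again.
-/
theorem last (h : Search a b S A mm₀ mw₀ q par n z) (hr : r < n)
    (hg : Augmenting a b A mm₀ q par mm mw w r) (hm : mm (q r) = 0) :
    Augmented a b A mm₀ (Function.update mm (q r) (w + 1)) (Function.update mw w (q r + 1)) := by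
  have hq := (h.lt r hr).1
  have hs := hg.same r le_rfl
  refine ⟨⟨?_, ?_, ?_⟩, ?_, q r, hq, by omega, ?_⟩
  · intro u hu
    have := hg.lt
    rw [Function.update_apply]
    split_ifs
    · omega
    · exact hg.men u hu
  · intro w' hw'
    rw [Function.update_apply]
    split_ifs
    · omega
    · exact hg.women w' hw'
  · intro u hu w' hw'
    have h3 := hg.notMatched u hu
    by_cases hu' : u = q r <;> by_cases hww : w' = w
    · subst hu'
      subst hww
      simp
    · subst hu'
      have := hg.iff _ hu w' hw' hww
      rw [Function.update_self, Function.update_of_ne hww]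
      omega
    · subst hww
      rw [Function.update_of_ne hu', Function.update_self]
      omega
    · rw [Function.update_of_ne hu', Function.update_of_ne hww]
      exact hg.iff u hu w' hw' hww
  · intro u hu w' hw'
    rw [Function.update_apply]
    split_ifs with huq
    · intro h3
      rw [huq, show w' = w by omega]
      exact h.origin_adm hg.lt hg.origin
    · exact hg.adm u hu w' hw'
  · intro u hu
    rw [Function.update_apply]
    split_ifs with huq
    · exact iff_of_true (by omega) (Or.inr huq)
    · rw [or_iff_left huq]
      exact hg.matched u hu

/-- The position in the queue. -/
noncomputable def position (q : ℕ → ℕ) (n u : ℕ) : ℕ := sInf {j | j < n ∧ q j = u}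

theorem position_eq (h : Search a b S A mm₀ mw₀ q par n z) (hr : r < n) :
    position q n (q r) = r := by
  have := Nat.sInf_mem (s := {j | j < n ∧ q j = q r}) ⟨r, hr, rfl⟩
  exact h.inj _ this.1 r hr this.2

end Search

/-- Exchange the matching along the alternating path to `z`. -/
def Cmd.augment : Cmd :=
  .seq (.assign .w (.var .z)) <|
  .seq (.assign .y (.lit 1)) <|
  .while (.lit 0) (.var .y) <|
    .seq (.assign .u (.sub (.get .par (.var .w)) (.lit 1))) <|
    .seq (.assign .y (.get .mm (.var .u))) <|
    .seq (.store .mm (.var .u) (.add (.var .w) (.lit 1))) <|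
    .seq (.store .mw (.var .w) (.add (.var .u) (.lit 1)))
      (.assign .w (.sub (.var .y) (.lit 1)))

section Specifications

variable {a b B : ℕ} {S : ℕ → Prop} {A : ℕ → ℕ → Prop} {σ : Env}

theorem wp_augment (hB : Big a b B) (hc : Consistent a b (σ.arr .mm) (σ.arr .mw))
    (hs : Search a b S A (σ.arr .mm) (σ.arr .mw) (σ.arr .queue) (σ.arr .par) (σ.v .qt) (σ.v .z))
    (hA : ∀ u < a, ∀ w < b, σ.arr .mm u = w + 1 → A u w) (hz : σ.v .z < b) :
    WP B .augment σ fun t τ => t ≤ 100 * (a + 1) ∧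
      Augmented a b A (σ.arr .mm) (τ.arr .mm) (τ.arr .mw) := by
  have h8 := hB.eight
  have hBa := hB.men
  have hBb := hB.women
  rw [Cmd.augment]
  simp only [WP.seq_iff, WP.assign_iff, Ex.Fits, Ex.eval, true_and]
  refine ⟨by omega, ?_⟩
  refine WP.while_rule (T := 50)
    -- The queue position of the man to be rematched decreases along the path. The register `y`
    -- holds the code of his former partner and becomes zero at the unmatched end.
    (μ := fun τ => if τ.v .y = 0 then 0 else
      Search.position (σ.arr .queue) (σ.v .qt) (τ.arr .par (τ.v .w) - 1) + 1)
    (Inv := fun τ => (τ.v .y ≠ 0 ∧ ∃ r < σ.v .qt, Augmenting a b A (σ.arr .mm) (σ.arr .queue)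
        (σ.arr .par) (τ.arr .mm) (τ.arr .mw) (τ.v .w) r) ∨
      (τ.v .y = 0 ∧ Augmented a b A (σ.arr .mm) (τ.arr .mm) (τ.arr .mw)))
    ?_ (fun _ _ _ => ⟨Nat.zero_le _, trivial⟩) ?_ ?_
  · simpa using hs.augmenting hc hA hz
  · intro τ hf hi hlt
    simp only [Ex.eval] at hlt
    have e1 : τ.arr .par = σ.arr .par := by
      rw [hf.2 _ (by simp [Cmd.Stores])]
      simp
    obtain ⟨hy, r, hr, hg⟩ | ⟨hy, -⟩ := hi
    swap
    · omega
    have e2 : σ.arr .par (τ.v .w) - 1 = σ.arr .queue r := by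
      rw [hg.origin, Nat.add_sub_cancel]
    have hq := (hs.lt r hr).1
    have hw := hg.lt
    simp only [WP.seq_iff, WP.assign_iff, WP.store_iff, Ex.Fits, Ex.eval, Ex.cost, Env.set_v,
      Env.set_arr, Env.put_v, Env.put_arr, reduceCtorEq, if_true, if_false, true_and, e1, e2, hy,
      hs.position_eq hr]
    refine ⟨by omega, by omega, by omega, by omega, ?_⟩
    by_cases hm : τ.arr .mm (σ.arr .queue r) = 0
    · rw [if_pos hm]
      exact ⟨Or.inr ⟨hm, hs.last hr hg hm⟩, by omega, by omega⟩
    · rw [if_neg hm]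
      obtain ⟨i, hi, hg'⟩ := hs.step hr hg hm
      rw [hg'.origin, Nat.add_sub_cancel, hs.position_eq (by omega)]
      exact ⟨Or.inl ⟨hm, i, by omega, hg'⟩, by omega, by omega⟩
  · intro t τ hf hi hlt ht hμ
    simp only [Ex.eval] at hlt
    obtain ⟨hy, -⟩ | ⟨hy, hg⟩ := hi
    · omega
    obtain ⟨r, hr, hg₀⟩ := hs.augmenting hc hA hz
    have hn := hs.le
    simp only [Env.set_v, Env.set_arr, reduceCtorEq, if_true, if_false, hy, one_ne_zero, Ex.cost,
      hg₀.origin, Nat.add_sub_cancel, hs.position_eq hr] at ht ⊢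
    exact ⟨by omega, hg⟩

end Specifications

/-! ### Failed searches and counts of active edges -/

section Events

variable {a b : ℕ} {I : Market (Fin a) (Fin b)} {off adj mark : ℕ → ℕ}
  {c : Config (Fin a) (Fin b ⊕ Fin a)} {x x' : Arrays} {t : Fin a → Fin b ⊕ Fin a → ℕ}
  {mm mw q par : ℕ → ℕ} {n : ℕ}

theorem matched_of_consistent (hc : Consistent a b mm mw)
    (hA : ∀ u < a, ∀ w < b, mm u = w + 1 → x.live b adj u w)
    (hS : ∀ u < a, mm u ≠ 0 → x.st u ≠ 0) : Arrays.Simulates.Matched a b adj x mm where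
  tie u w h := (hA u u.2 w w.2 h).1
  rej u w h := (hA u u.2 w w.2 h).2
  st u w h := hS u u.2 (by omega)
  inj u u' w h h' := by
    have h1 := (hc.iff u u.2 w w.2).1 h
    have h2 := (hc.iff u' u'.2 w w.2).1 h'
    exact Fin.ext (by omega)

/-- The event that a search without success leads to the rejection of the edges of the critical
set. -/
theorem Arrays.Simulates.reject_search (hL : Layout I off adj mark)
    (hJ : I.withDummies.Ranked t Sum.inr) (hw : I.WomenAsymmetric)
    (hr : Reachable I c) (hl : c.Calm) (hx : x.Simulates I off adj mark c)
    (hs : Settled a b adj x) (hn : ∀ u < a, ¬ Next off x u) (hc : Consistent a b mm mw)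
    (hA : ∀ u < a, ∀ w < b, mm u = w + 1 → x.live b adj u w)
    (hS : ∀ u < a, mm u ≠ 0 → x.st u ≠ 0)
    (h : Search a b (x.st · ≠ 0) (x.live b adj) mm mw q par n b)
    (hproc : ∀ j < n, ∀ w, x.live b adj (q j) w → par w ≠ 0) (hpos : 0 < n)
    (hlo : x'.lo = x.lo) (hhi : x'.hi = x.hi) (hev : x'.ever = x.ever) (hst' : x'.st = x.st)
    (hrej : ∀ (v : Fin a) (w : Fin b), x'.rej (v * b + w) ≠ 0 ↔ x.rej (v * b + w) ≠ 0 ∨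
      (∃ j < n, q j = v) ∧ x.tie adj v w) :
    ∃ c', Reachable I c' ∧ c'.Calm ∧ x'.Simulates I off adj mark c' := by
  have hzero : ∀ u : Fin a, (∀ w : Fin b, mm u ≠ w + 1) → mm u = 0 := by
    intro u hu
    by_contra hne
    have h1 := hc.men u u.2
    exact hu ⟨mm u - 1, by omega⟩ (by simp only; omega)
  refine rejectCritical (Z := {u | ∃ j < n, q j = u}) hL hJ hw hr hl hx hs hn
    (matched_of_consistent hc hA hS) ?_ ?_ ?_ ?_ ?_ hlo hhi hev hst' hrej
  · exact ⟨⟨q 0, (h.lt 0 hpos).1⟩, 0, hpos, rfl⟩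
  · rintro u ⟨j, hj, hju⟩
    rw [← hju]
    exact (h.lt j hj).2
  · exact fun u hu hm => h.free u u.2 hu (hzero u hm)
  · rintro u ⟨j, hj, hju⟩ w h1 h2
    have h3 := hproc j hj w (by rw [hju]; exact ⟨h1, h2⟩)
    obtain ⟨-, h4⟩ | ⟨h4, -⟩ := h.end_eq
    · obtain ⟨i, hi, he⟩ := h.partner w w.2 h3 (h4 w w.2 h3)
      have hlt := (h.lt i hi).1
      exact ⟨⟨q i, hlt⟩, ⟨i, hi, rfl⟩, (hc.iff _ hlt w w.2).2 he.symm⟩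
    · omega
  · rintro X hX hX' u ⟨j, hj, hju⟩
    -- Minimality of the set of men in the queue: each is unmatched, or has been reached through his
    -- partner by an active edge from an earlier man.
    induction j using Nat.strong_induction_on generalizing u with
    | _ j ih =>
      by_cases hm : mm (q j) = 0
      · refine hX u ?_ fun w hw => ?_
        · rw [← hju]
          exact (h.lt j hj).2
        · rw [← hju] at hw
          omega
      · obtain ⟨i, hi, hp⟩ := h.pred j hj hm
        have h1 := hc.men _ (h.lt j hj).1
        have hA := h.origin_adm (w := mm (q j) - 1) (by omega) hp
        have hin : i < n := by omega
        refine hX' ⟨q i, (h.lt i hin).1⟩ (ih i hi hin rfl) ⟨mm (q j) - 1, by omega⟩ u hA.1 hA.2 ?_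
        rw [← hju]
        simp only
        omega

/-- Positions are counted; different positions of a list hold different women, so a count of two
yields two active edges. -/
theorem settled_of_count (hL : Layout I off adj mark)
    (hx : x.Simulates I off adj mark c) (hst : ∀ u < a, x.st u ≤ 2)
    (h : ∀ u < a, x.st u ≤ x.count b adj u) : Arrays.Simulates.Settled a b adj x := by
  have hmem : ∀ u < a, ∀ i, i ∈ (Finset.Ico (x.lo u) (x.hi u)).filter
      (fun i => x.rej (u * b + adj i) = 0) → adj i < b ∧ off u ≤ i ∧ i < off (u + 1) ∧
        x.tie adj u (adj i) ∧ x.rej (u * b + adj i) = 0 := by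
    intro u hu i hi
    simp only [Finset.mem_filter, Finset.mem_Ico] at hi
    have h1 := hx.off_le_lo u hu
    have h2 := hx.hi_le u hu
    exact ⟨hL.adj_lt u hu i (by omega) (by omega), by omega, by omega, ⟨i, hi.1.1, hi.1.2, rfl⟩,
      hi.2⟩
  refine ⟨hst, fun u hu => ?_, fun u hu => ?_⟩
  · have h1 := h u u.2
    rw [hu, Arrays.count, Nat.one_le_iff_ne_zero, ← Nat.pos_iff_ne_zero, Finset.card_pos] at h1
    obtain ⟨i, hi⟩ := h1
    obtain ⟨h2, -, -, h3, h4⟩ := hmem u u.2 i hi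
    exact ⟨⟨adj i, h2⟩, h3, h4⟩
  · have h1 := h u u.2
    rw [hu, Arrays.count] at h1
    obtain ⟨i, hi, j, hj, hij⟩ := Finset.one_lt_card.1 h1
    obtain ⟨h2, h3, h4, h5, h6⟩ := hmem u u.2 i hi
    obtain ⟨h7, h8, h9, h10, h11⟩ := hmem u u.2 j hj
    refine ⟨⟨adj i, h2⟩, ⟨adj j, h7⟩, fun he => hij ?_, h5, h10, h6, h11⟩
    exact hL.inj u u.2 i j h3 h4 h8 h9 (by simpa using he)

theorem count_cases (hL : Layout I off adj mark)
    (hx : x.Simulates I off adj mark c) {u : Fin a} (h : x.count b adj u ≤ 1) :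
    (x.count b adj u = 0 ∧ ∀ w : Fin b, x.tie adj u w → x.rej (u * b + w) ≠ 0) ∨
      (x.count b adj u = 1 ∧ ∃ w : Fin b, x.tie adj u w ∧ x.rej (u * b + w) = 0 ∧
        ∀ w' : Fin b, x.tie adj u w' → x.rej (u * b + w') = 0 → w' = w) := by
  have hmem : ∀ w : Fin b, x.tie adj u w → x.rej (u * b + w) = 0 → ∃ i,
      i ∈ (Finset.Ico (x.lo u) (x.hi u)).filter (fun i => x.rej (u * b + adj i) = 0) ∧
        adj i = w := by
    rintro w ⟨i, h1, h2, h3⟩ h4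
    refine ⟨i, ?_, h3⟩
    simp only [Finset.mem_filter, Finset.mem_Ico]
    exact ⟨⟨h1, h2⟩, by rw [h3, h4]⟩
  rcases Nat.le_one_iff_eq_zero_or_eq_one.1 h with h0 | h1
  · refine Or.inl ⟨h0, fun w hw hrej => ?_⟩
    obtain ⟨i, hi, -⟩ := hmem w hw hrej
    rw [Arrays.count, Finset.card_eq_zero] at h0
    rw [h0] at hi
    simp at hi
  · refine Or.inr ⟨h1, ?_⟩
    rw [Arrays.count, Finset.card_eq_one] at h1
    obtain ⟨i, hi⟩ := h1
    have hi' : i ∈ (Finset.Ico (x.lo u) (x.hi u)).filter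
      (fun i => x.rej (u * b + adj i) = 0) := by rw [hi]; simp
    simp only [Finset.mem_filter, Finset.mem_Ico] at hi'
    have h1 := hx.off_le_lo u u.2
    have h2 := hx.hi_le u u.2
    refine ⟨⟨adj i, hL.adj_lt u u.2 i (by omega) (by omega)⟩, ⟨i, hi'.1.1, hi'.1.2, rfl⟩, hi'.2,
      fun w' h3 h4 => ?_⟩
    obtain ⟨j, hj, hjw⟩ := hmem w' h3 h4
    rw [hi, Finset.mem_singleton] at hj
    exact Fin.ext (by rw [← hjw, hj])

end Events

end PairwiseMarket

namespace PairwiseMarket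

/-! ### The arrays of the input -/

section Lists

variable {k : ℕ} {α : Type*} (L : Fin k → List α)

theorem offsets_getD {i : ℕ} (hi : i ≤ k) :
    (offsets L).getD i 0 = (((List.finRange k).take i).flatMap L).length := by
  rw [offsets, List.getD_eq_getElem _ _ (by simp; omega)]
  simp

theorem offsets_getD_zero : (offsets L).getD 0 0 = 0 := by
  rw [offsets_getD L (Nat.zero_le _)]
  simp

theorem offsets_getD_succ (i : Fin k) :
    (offsets L).getD (i + 1) 0 = (offsets L).getD i 0 + (L i).length := by
  rw [offsets_getD L (by omega), offsets_getD L (by omega), List.take_add_one]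
  simp

theorem offsets_getD_last : (offsets L).getD k 0 = ∑ i, (L i).length := by
  rw [offsets_getD L le_rfl, List.take_of_length_le (by simp), List.length_flatMap,
    Fin.sum_univ_def]

theorem offsets_congr {β : Type*} {L' : Fin k → List β} (h : ∀ i, (L i).length = (L' i).length) :
    offsets L = offsets L' := by
  simp [offsets, List.length_flatMap, h]

theorem concat_getElem? (i : Fin k) {j : ℕ} (hj : j < (L i).length) :
    (concat L)[(offsets L).getD i 0 + j]? = (L i)[j]? := by
  have h1 : List.finRange k = (List.finRange k).take i ++ i :: (List.finRange k).drop (i + 1) := by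
    conv_lhs => rw [← List.take_append_drop (i : ℕ) (List.finRange k)]
    rw [List.drop_eq_getElem_cons (by simp)]
    simp
  rw [concat, offsets_getD L i.2.le]
  conv_lhs => rw [h1]
  rw [List.flatMap_append, List.flatMap_cons, List.getElem?_append_right (by simp),
    List.getElem?_append_left (by simpa using hj)]
  congr 1
  simp

theorem sum_length_eq_ncard (h : ∀ i, (L i).Nodup) :
    ∑ i, (L i).length = {e : Fin k × α | e.2 ∈ L e.1}.ncard := by
  classical
  have : {e : Fin k × α | e.2 ∈ L e.1} =
      ↑(Finset.univ.biUnion fun i => (L i).toFinset.image fun x => (i, x)) := by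
    ext ⟨i, x⟩
    simp
  rw [this, Set.ncard_coe_finset, Finset.card_biUnion]
  · refine Finset.sum_congr rfl fun i _ => ?_
    rw [Finset.card_image_of_injective _ (Prod.mk_right_injective i),
      List.toFinset_card_of_nodup (h i)]
  · intro i _ j _ hij
    rw [Function.onFun, Finset.disjoint_left]
    rintro ⟨i', x⟩ h1 h2
    simp only [Finset.mem_image, Prod.mk.injEq] at h1 h2
    obtain ⟨-, -, h3, -⟩ := h1
    obtain ⟨-, -, h4, -⟩ := h2
    exact hij (h3.trans h4.symm)

theorem length_tieMarks (T : List (List α)) : (tieMarks T).length = T.flatten.length := by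
  simp [tieMarks, List.length_flatMap, List.length_flatten]

theorem tieMarks_zero : ∀ T : List (List α), T.flatten ≠ [] → (tieMarks T).getD 0 0 = 1
  | [], h => (h rfl).elim
  | [] :: T, h => by
    rw [List.flatten_cons, List.nil_append] at h
    simpa [tieMarks] using tieMarks_zero T h
  | (x :: t) :: T, _ => by simp [tieMarks, List.range_succ_eq_map]

/-- Two positions belong to different ties exactly if a tie starts after the first and not after the
second. The mark at `i` itself is therefore left out and the one at `j` included. -/
theorem tieMarks_spec {P Q : α → α → Prop} (T : List (List α))
    (hQ : ∀ t ∈ T, ∀ x ∈ t, ∀ y ∈ t, Q x y)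
    (hP : T.Pairwise fun t t' => ∀ x ∈ t, ∀ y ∈ t', P x y) {i j : ℕ} {x y : α} (hij : i < j)
    (hi : T.flatten[i]? = some x) (hj : T.flatten[j]? = some y) :
    ((∃ l, i < l ∧ l ≤ j ∧ (tieMarks T).getD l 0 ≠ 0) → P x y) ∧
      ((∀ l, i < l → l ≤ j → (tieMarks T).getD l 0 = 0) → Q x y) := by
  induction T generalizing i j with
  | nil => simp at hi
  | cons t T ih =>
    rw [List.pairwise_cons] at hP
    have hm : tieMarks (t :: T) =
        ((List.range t.length).map fun i => if i = 0 then 1 else 0) ++ tieMarks T := rfl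
    have hlen : ((List.range t.length).map fun i => if i = 0 then 1 else 0).length = t.length := by
      simp
    have hlow : ∀ l, 0 < l → l < t.length → (tieMarks (t :: T)).getD l 0 = 0 := by
      intro l h1 h2
      rw [hm, List.getD_append _ _ _ _ (by simpa using h2), List.getD_eq_getElem _ _ (by simpa)]
      simp
      omega
    have hhigh : ∀ l, t.length ≤ l →
        (tieMarks (t :: T)).getD l 0 = (tieMarks T).getD (l - t.length) 0 := by
      intro l h1
      rw [hm, List.getD_append_right _ _ _ _ (by simpa using h1), hlen]
    rw [List.flatten_cons] at hi hj
    by_cases hjt : j < t.length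
    · rw [List.getElem?_append_left (by omega)] at hi hj
      refine ⟨?_, fun _ => hQ t (by simp) x (List.mem_of_getElem? hi) y (List.mem_of_getElem? hj)⟩
      rintro ⟨l, h1, h2, h3⟩
      exact (h3 (hlow l (by omega) (by omega))).elim
    rw [List.getElem?_append_right (by omega)] at hj
    by_cases hit : i < t.length
    · rw [List.getElem?_append_left hit] at hi
      refine ⟨fun _ => ?_, fun h => ?_⟩
      · obtain ⟨t', ht', hy⟩ := List.mem_flatten.1 (List.mem_of_getElem? hj)
        exact hP.1 t' ht' x (List.mem_of_getElem? hi) y hy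
      -- The position right after the first tie carries a mark, so the assumption that no mark lies
      -- in between fails.
      · have h1 := h t.length hit (by omega)
        rw [hhigh _ le_rfl, Nat.sub_self, tieMarks_zero] at h1
        · omega
        · intro h2
          simp [h2] at hj
    · rw [List.getElem?_append_right (by omega)] at hi
      obtain ⟨h1, h2⟩ := ih (fun t ht => hQ t (by simp [ht])) hP.2
        (show i - t.length < j - t.length by omega) hi hj
      refine ⟨fun ⟨l, h3, h4, h5⟩ => h1 ⟨l - t.length, by omega, by omega, ?_⟩,
        fun h => h2 fun l h3 h4 => ?_⟩
      · rwa [← hhigh l (by omega)]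
      · have := h (l + t.length) (by omega) (by omega)
        rwa [hhigh _ (by omega), Nat.add_sub_cancel] at this

end Lists

/-- The arrays list the comparisons of the women. -/
structure CompLayout {a b : ℕ} (I : Market (Fin a) (Fin b)) (off fst snd : ℕ → ℕ) : Prop where
  off_le : ∀ w < b, off w ≤ off (w + 1)
  off_zero : off 0 = 0
  off_last : off b ≤ I.edges.ncard * a
  lt : ∀ w < b, ∀ i, off w ≤ i → i < off (w + 1) → fst i < a ∧ snd i < a
  mem_iff : ∀ (w : Fin b) (u v : Fin a), I.prefW w u v ↔
    ∃ i, off w ≤ i ∧ i < off (w + 1) ∧ fst i = u ∧ snd i = v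

namespace Presentation

variable {a b : ℕ} {I : Market (Fin a) (Fin b)} (P : Presentation I)

theorem adj_eq (u : Fin a) {i : ℕ} {w : Fin b} (h : (P.ties u).flatten[i]? = some w) :
    P.memory.arr 1 (P.memory.arr 0 u + i) = w := by
  obtain ⟨hi, -⟩ := List.getElem?_eq_some_iff.1 h
  have := concat_getElem? (fun u => (P.ties u).flatten) u hi
  simp only [memory, List.getD_eq_getElem?_getD, bind_pure_comp, List.map_eq_map, List.map_id',
    List.getElem?_map] at this ⊢
  rw [this, h]
  simp

theorem mark_eq (u : Fin a) {i : ℕ} (hi : i < (P.ties u).flatten.length) :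
    P.memory.arr 2 (P.memory.arr 0 u + i) = (tieMarks (P.ties u)).getD i 0 := by
  have h1 := concat_getElem? (fun u => tieMarks (P.ties u)) u (j := i)
    (by rwa [length_tieMarks])
  rw [offsets_congr (L' := fun u => (P.ties u).flatten) _ fun u => length_tieMarks _] at h1
  simp only [memory, List.getD_eq_getElem?_getD] at h1 ⊢
  rw [h1]

theorem layout : Layout I (P.memory.arr 0) (P.memory.arr 1) (P.memory.arr 2) := by
  have hsucc : ∀ u : Fin a,
      P.memory.arr 0 (u + 1) = P.memory.arr 0 u + (P.ties u).flatten.length :=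
    fun u => offsets_getD_succ (fun u => (P.ties u).flatten) u
  have hadj : ∀ u : Fin a, ∀ i, P.memory.arr 0 u ≤ i → i < P.memory.arr 0 (u + 1) →
      ∃ w : Fin b, (P.ties u).flatten[i - P.memory.arr 0 u]? = some w ∧
        P.memory.arr 1 i = w := by
    intro u i h1 h2
    have h3 := hsucc u
    have h4 : i - P.memory.arr 0 u < (P.ties u).flatten.length := by omega
    have h5 := List.getElem?_eq_getElem h4
    refine ⟨_, h5, ?_⟩
    have := P.adj_eq u h5
    rwa [show P.memory.arr 0 u + (i - P.memory.arr 0 u) = i by omega] at this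
  have hmark : ∀ u : Fin a, ∀ l, P.memory.arr 0 u ≤ l → l < P.memory.arr 0 (u + 1) →
      P.memory.arr 2 l = (tieMarks (P.ties u)).getD (l - P.memory.arr 0 u) 0 := by
    intro u l h1 h2
    have h3 := hsucc u
    have := P.mark_eq u (i := l - P.memory.arr 0 u) (by omega)
    rwa [show P.memory.arr 0 u + (l - P.memory.arr 0 u) = l by omega] at this
  have spec : ∀ (u : Fin a) (w w' : Fin b) i j, P.memory.arr 0 u ≤ i → i < j →
      j < P.memory.arr 0 (u + 1) → P.memory.arr 1 i = w → P.memory.arr 1 j = w' →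
      ((∃ l, i < l ∧ l ≤ j ∧ P.memory.arr 2 l ≠ 0) → Prec (I.prefM u) w w') ∧
      ((∀ l, i < l → l ≤ j → P.memory.arr 2 l = 0) → Incomp (I.prefM u) w w') := by
    intro u w w' i j h1 h2 h3 hi hj
    obtain ⟨x, hx, hx'⟩ := hadj u i h1 (by omega)
    obtain ⟨y, hy, hy'⟩ := hadj u j (by omega) h3
    obtain rfl : x = w := Fin.ext (hx'.symm.trans hi)
    obtain rfl : y = w' := Fin.ext (hy'.symm.trans hj)
    obtain ⟨h4, h5⟩ := tieMarks_spec (P := Prec (I.prefM u)) (Q := Incomp (I.prefM u)) (P.ties u)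
      (P.ties_same u) (P.ties_lt u) (show i - P.memory.arr 0 u < j - P.memory.arr 0 u by omega)
      hx hy
    refine ⟨fun ⟨l, h6, h7, h8⟩ => h4 ⟨l - P.memory.arr 0 u, by omega, by omega, ?_⟩,
      fun h => h5 fun l h6 h7 => ?_⟩
    · rwa [← hmark u l (by omega) (by omega)]
    · have := h (l + P.memory.arr 0 u) (by omega) (by omega)
      rwa [hmark u _ (by omega) (by omega), Nat.add_sub_cancel] at this
  constructor
  · intro u hu
    have := hsucc ⟨u, hu⟩
    simp only at this
    omega
  · exact offsets_getD_zero _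
  · refine (offsets_getD_last _).trans ?_
    rw [sum_length_eq_ncard _ P.ties_nodup]
    congr 1
    ext ⟨u, w⟩
    exact P.mem_ties u w
  · intro u hu i h1 h2
    obtain ⟨w, -, h3⟩ := hadj ⟨u, hu⟩ i h1 h2
    rw [h3]
    exact w.2
  · intro u w
    rw [← P.mem_ties]
    constructor
    · intro h
      obtain ⟨i, hi⟩ := List.mem_iff_getElem?.1 h
      obtain ⟨h1, -⟩ := List.getElem?_eq_some_iff.1 hi
      have := hsucc u
      exact ⟨P.memory.arr 0 u + i, by omega, by omega, P.adj_eq u hi⟩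
    · rintro ⟨i, h1, h2, h3⟩
      obtain ⟨w', h4, h5⟩ := hadj u i h1 h2
      obtain rfl : w' = w := Fin.ext (h5.symm.trans h3)
      exact List.mem_of_getElem? h4
  · intro u hu i j h1 h2 h3 h4 he
    obtain ⟨x, hx, hx'⟩ := hadj ⟨u, hu⟩ i h1 h2
    obtain ⟨y, hy, hy'⟩ := hadj ⟨u, hu⟩ j h3 h4
    obtain rfl : x = y := Fin.ext (hx'.symm.trans (he.trans hy'))
    obtain ⟨hlt, -⟩ := List.getElem?_eq_some_iff.1 hx
    have := (List.getElem?_inj hlt (P.ties_nodup ⟨u, hu⟩)).1 (hx.trans hy.symm)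
    simp only at this
    omega
  · exact fun u w w' i j h1 h2 h3 hi hj => (spec u w w' i j h1 h2 h3 hi hj).1
  · exact fun u w w' i j h1 h2 h3 hi hj => (spec u w w' i j h1 h2 h3 hi hj).2

theorem sum_length_nbrs : ∑ w, (P.nbrs w).length = I.edges.ncard := by
  rw [sum_length_eq_ncard _ P.nbrs_nodup,
    ← Set.ncard_image_of_injective I.edges (Equiv.prodComm _ _).injective]
  congr 1
  ext ⟨w, u⟩
  simp [P.mem_nbrs]

/-- The first component of a comparison is a neighbour of `w`; for the second the crude count `a`
suffices. Summed over the women, the table can be filled within the time allowed. -/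
theorem length_comps_le (w : Fin b) : (P.comps w).length ≤ (P.nbrs w).length * a := by
  have h : P.comps w ⊆ (P.nbrs w) ×ˢ (List.finRange a) := by
    rintro ⟨u, v⟩ h
    refine List.mem_product.2 ⟨?_, List.mem_finRange v⟩
    rw [P.mem_nbrs]
    exact (I.prefW_edges w u v ((P.mem_comps w u v).1 h)).1
  have := (List.subperm_of_subset (P.comps_nodup w) h).length_le
  simpa [List.length_product] using this

theorem compLayout :
    CompLayout I (P.memory.arr 5) (P.memory.arr 6) (P.memory.arr 7) := by
  have hsucc : ∀ w : Fin b, P.memory.arr 5 (w + 1) = P.memory.arr 5 w + (P.comps w).length :=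
    fun w => offsets_getD_succ P.comps w
  have heq : ∀ (w : Fin b) {i : ℕ} {p : Fin a × Fin a}, (P.comps w)[i]? = some p →
      P.memory.arr 6 (P.memory.arr 5 w + i) = p.1 ∧
        P.memory.arr 7 (P.memory.arr 5 w + i) = p.2 := by
    intro w i p h
    obtain ⟨hi, -⟩ := List.getElem?_eq_some_iff.1 h
    have := concat_getElem? P.comps w hi
    simp only [memory, List.getD_eq_getElem?_getD, List.getElem?_map] at this ⊢
    rw [this, h]
    simp
  have hget : ∀ w : Fin b, ∀ i, P.memory.arr 5 w ≤ i → i < P.memory.arr 5 (w + 1) →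
      ∃ p ∈ P.comps w, P.memory.arr 6 i = p.1 ∧ P.memory.arr 7 i = p.2 := by
    intro w i h1 h2
    have h3 := hsucc w
    have h4 : i - P.memory.arr 5 w < (P.comps w).length := by omega
    have h5 := List.getElem?_eq_getElem h4
    refine ⟨_, List.mem_of_getElem? h5, ?_⟩
    have := heq w h5
    rwa [show P.memory.arr 5 w + (i - P.memory.arr 5 w) = i by omega] at this
  constructor
  · intro w hw
    have := hsucc ⟨w, hw⟩
    simp only at this
    omega
  · exact offsets_getD_zero _
  · refine (offsets_getD_last _).trans_le ?_
    rw [← P.sum_length_nbrs, Finset.sum_mul]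
    exact Finset.sum_le_sum fun w _ => P.length_comps_le w
  · intro w hw i h1 h2
    obtain ⟨p, -, h3, h4⟩ := hget ⟨w, hw⟩ i h1 h2
    rw [h3, h4]
    exact ⟨p.1.2, p.2.2⟩
  · intro w u v
    rw [← P.mem_comps]
    constructor
    · intro h
      obtain ⟨i, hi⟩ := List.mem_iff_getElem?.1 h
      obtain ⟨h1, -⟩ := List.getElem?_eq_some_iff.1 hi
      have := hsucc w
      exact ⟨P.memory.arr 5 w + i, by omega, by omega, heq w hi⟩
    · rintro ⟨i, h1, h2, h3, h4⟩
      obtain ⟨⟨u', v'⟩, hp, h5, h6⟩ := hget w i h1 h2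
      obtain rfl : u' = u := Fin.ext (h5.symm.trans h3)
      obtain rfl : v' = v := Fin.ext (h6.symm.trans h4)
      exact hp

end Presentation

end PairwiseMarket

namespace PairwiseMarket

/-! ### Initialization of the lists and of the comparison table -/

namespace Cmd

/-- No man has proposed. -/
def initLists : Cmd :=
  .for .u (.lit 0) (.var .a) <|
    .seq (.store .lo (.var .u) (.get .off (.var .u))) (.store .hi (.var .u) (.get .off (.var .u)))

/-- Fill the comparison table. -/
def initTable : Cmd :=
  .seq (.assign .w (.lit 0)) <|
  -- A plain loop is used because the lists have different lengths: a bound per round would be too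
  -- weak, and the rule for such loops allows amortization.
  .while (.var .w) (.var .b) <|
    .seq (.for .i (.get .coff (.var .w)) (.get .coff (.add (.var .w) (.lit 1))) <|
      .store .cmp (.pair (.pair (.var .w) (.var .a) (.get .cfst (.var .i))) (.var .a)
        (.get .csnd (.var .i))) (.lit 1))
      (.assign .w (.add (.var .w) (.lit 1)))

end Cmd

section Specifications

variable {a b B : ℕ} {I : Market (Fin a) (Fin b)} {coff cfst csnd : ℕ → ℕ} {σ : Env}

theorem wp_initLists (hB : Big a b B) (ha : σ.v .a = a) :
    WP B .initLists σ fun t τ => t ≤ 100 * (a + 1) ∧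
      ∀ u < a, τ.arr .lo u = σ.arr .off u ∧ τ.arr .hi u = σ.arr .off u := by
  have h8 := hB.eight
  have hBa := hB.men
  rw [Cmd.initLists]
  refine WP.for_rule (l := 0) (h := a) (T := 20) (fun k τ =>
    ∀ u < k, τ.arr .lo u = σ.arr .off u ∧ τ.arr .hi u = σ.arr .off u)
    (Nat.zero_le _) rfl (Nat.zero_le _) (by omega) (by omega) ?_ ?_ ?_ ?_ ?_
  · intro τ hf
    refine ⟨trivial, ?_⟩
    rw [Ex.eval, hf.1 _ (by simp [Cmd.writes_for, Cmd.Writes]), ha]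
  · simp [Cmd.Writes]
  · simp
  · intro k τ _ hk hf hv hi
    have e1 : τ.arr .off = σ.arr .off := hf.2 _ (by simp [Cmd.stores_for, Cmd.Stores])
    simp only [WP.seq_iff, WP.store_iff, Ex.Fits, Ex.eval, Ex.cost, hv, e1, Env.set_arr,
      Env.put_arr, Env.put_v, reduceCtorEq, if_true, if_false, true_and]
    refine ⟨by omega, fun u hu => ?_⟩
    rcases Nat.lt_succ_iff_lt_or_eq.1 hu with hu | rfl
    · rw [Function.update_of_ne hu.ne, Function.update_of_ne hu.ne]
      exact hi u hu
    · simp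
  · intro t τ hf _ hi ht
    simp only [Ex.cost] at ht
    exact ⟨by omega, hi⟩

theorem CompLayout.mono (hC : CompLayout I coff cfst csnd) {w : ℕ} (hw : w ≤ b) :
    coff w ≤ coff b := by
  induction hn : b - w generalizing w with
  | zero => rw [show w = b by omega]
  | succ n ih => exact (hC.off_le w (by omega)).trans (ih (w := w + 1) (by omega) (by omega))

theorem triple_inj {w u v w' u' v' : ℕ} (hu : u < a) (hv : v < a) (hu' : u' < a) (hv' : v' < a) :
    (w * a + u) * a + v = (w' * a + u') * a + v' ↔ w = w' ∧ u = u' ∧ v = v' := by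
  rw [pair_inj hv hv', pair_inj hu hu', and_assoc]

theorem wp_initTable (hB : Big a b B) (ha : σ.v .a = a) (hb : σ.v .b = b)
    (h1 : σ.arr .coff = coff) (h2 : σ.arr .cfst = cfst) (h3 : σ.arr .csnd = csnd)
    (hC : CompLayout I coff cfst csnd) (hm : I.edges.ncard * a ≤ B)
    (hzero : σ.arr .cmp = fun _ => 0) :
    WP B .initTable σ fun t τ => t ≤ 100 * (b + I.edges.ncard * a + 1) ∧
      ∀ (w : Fin b) (u v : Fin a), τ.arr .cmp ((w * a + u) * a + v) ≠ 0 ↔ I.prefW w u v := by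
  have h8 := hB.eight
  have hBb := hB.women
  have hlast := hC.off_last
  have frame : ∀ {τ : Env}, (∀ r, r ≠ .w → r ≠ .i → τ.v r = σ.v r) →
      (∀ A, A ≠ .cmp → τ.arr A = σ.arr A) → τ.v .a = a ∧ τ.v .b = b ∧ τ.arr .coff = coff ∧
        τ.arr .cfst = cfst ∧ τ.arr .csnd = csnd := by
    intro τ hr hA
    exact ⟨by rw [hr] <;> simp [ha], by rw [hr] <;> simp [hb], by rw [hA] <;> simp [h1],
      by rw [hA] <;> simp [h2], by rw [hA] <;> simp [h3]⟩
  simp only [Cmd.initTable, WP.seq_iff, WP.assign_iff, Ex.Fits, Ex.eval, Nat.zero_le, true_and]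
  -- The remaining women and the remaining comparisons together pay for the loop.
  refine WP.while_rule (T := 80) (μ := fun τ => (b - τ.v .w) + (coff b - coff (τ.v .w)))
    (Inv := fun τ => τ.v .w ≤ b ∧ ∀ (w : Fin b) (u v : Fin a),
      τ.arr .cmp ((w * a + u) * a + v) ≠ 0 ↔ w < τ.v .w ∧ I.prefW w u v)
    ?_ (fun _ _ _ => ⟨trivial, trivial⟩) ?_ ?_
  · simp [hzero]
  · rintro τ hf ⟨i1, i2⟩ hlt
    obtain ⟨ea, eb, e1, e2, e3⟩ := frame (τ := τ)
      (fun r hr hr' => by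
        rw [hf.1 r (by simp [Cmd.writes_for, Cmd.Writes, hr, hr'])]
        simp [hr])
      (fun A hA => by
        rw [hf.2 A (by simp [Cmd.stores_for, Cmd.Stores, hA])]
        simp)
    simp only [Ex.eval, eb] at hlt
    generalize hwk : τ.v .w = k at *
    have hk1 := hC.off_le k hlt
    have hk2 := hC.mono (w := k) (by omega)
    have hk3 := hC.mono (w := k + 1) (by omega)
    rw [WP.seq_iff]
    refine WP.for_rule (l := coff k) (h := coff (k + 1)) (T := 50) (fun j τ' =>
      ∀ (w : Fin b) (u v : Fin a), τ'.arr .cmp ((w * a + u) * a + v) ≠ 0 ↔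
        (w < k ∧ I.prefW w u v) ∨ (w = k ∧ ∃ i, coff k ≤ i ∧ i < j ∧ cfst i = u ∧ csnd i = v))
      trivial (by simp [Ex.eval, e1, hwk]) hk1 (by omega) (by omega) ?_ ?_ ?_ ?_ ?_
    · intro τ' hf'
      simp only [Ex.Fits, Ex.eval]
      rw [hf'.1 _ (by simp [Cmd.writes_for, Cmd.Writes]),
        hf'.2 _ (by simp [Cmd.stores_for, Cmd.Stores]), e1, hwk]
      exact ⟨⟨trivial, by omega, by omega⟩, rfl⟩
    · simp [Cmd.Writes]
    · intro w u v
      rw [Env.set_arr, i2, or_iff_left]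
      rintro ⟨-, i, h4, h5, -⟩
      omega
    · intro j τ' hj hj' hf' hv' hi'
      obtain ⟨ea', eb', e1', e2', e3'⟩ : τ'.v .a = a ∧ τ'.v .w = k ∧ τ'.arr .coff = coff ∧
          τ'.arr .cfst = cfst ∧ τ'.arr .csnd = csnd := by
        refine ⟨?_, ?_, ?_, ?_, ?_⟩
        · rw [hf'.1 _ (by simp [Cmd.writes_for, Cmd.Writes]), ea]
        · rw [hf'.1 _ (by simp [Cmd.writes_for, Cmd.Writes]), hwk]
        · rw [hf'.2 _ (by simp [Cmd.stores_for, Cmd.Stores]), e1]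
        · rw [hf'.2 _ (by simp [Cmd.stores_for, Cmd.Stores]), e2]
        · rw [hf'.2 _ (by simp [Cmd.stores_for, Cmd.Stores]), e3]
      obtain ⟨h4, h5⟩ := hC.lt k hlt j hj hj'
      have b1 := hB.triple hlt h4 h5
      simp only [WP.store_iff, Ex.Fits, Ex.eval, Ex.pair, Ex.cost, ea', eb', e2', e3', hv',
        Env.set_arr, Env.put_arr, if_true, true_and]
      refine ⟨by omega, by omega, by omega, fun w u v => ?_⟩
      rw [Function.update_apply]
      split_ifs with hc
      · rw [triple_inj u.2 v.2 h4 h5] at hc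
        exact iff_of_true one_ne_zero (Or.inr ⟨hc.1, j, hj, by omega, hc.2.1.symm, hc.2.2.symm⟩)
      · rw [triple_inj u.2 v.2 h4 h5] at hc
        rw [hi' w u v]
        refine or_congr_right (and_congr_right fun hwk => ?_)
        constructor
        · rintro ⟨i, h6, h7, h8⟩
          exact ⟨i, h6, by omega, h8⟩
        · rintro ⟨i, h6, h7, h8, h9⟩
          refine ⟨i, h6, ?_, h8, h9⟩
          have : i ≠ j := by
            rintro rfl
            exact hc ⟨hwk, h8.symm, h9.symm⟩
          omega
    · intro t τ' hf' _ hi' ht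
      have e4 : τ'.v .w = k := by
        rw [hf'.1 _ (by simp [Cmd.writes_for, Cmd.Writes]), hwk]
      simp only [WP.assign_iff, Ex.Fits, Ex.eval, Ex.cost, Env.set_v, Env.set_arr, if_true,
        true_and, e4] at ht ⊢
      refine ⟨by omega, ⟨by omega, fun w u v => ?_⟩, by omega, ?_⟩
      · rw [hi' w u v]
        constructor
        · rintro (⟨h4, h5⟩ | ⟨h4, h5⟩)
          · exact ⟨by omega, h5⟩
          · refine ⟨by omega, (hC.mem_iff w u v).2 ?_⟩
            rwa [h4]
        · rintro ⟨h4, h5⟩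
          rcases Nat.lt_succ_iff_lt_or_eq.1 h4 with h4 | h4
          · exact Or.inl ⟨h4, h5⟩
          · refine Or.inr ⟨h4, ?_⟩
            rw [← h4]
            exact (hC.mem_iff w u v).1 h5
      · rw [show b - k + (coff b - coff k) - (b - (k + 1) + (coff b - coff (k + 1))) =
          coff (k + 1) - coff k + 1 by omega]
        omega
  · rintro t τ hf ⟨i1, i2⟩ hlt ht -
    obtain ⟨ea, eb, -⟩ := frame (τ := τ)
      (fun r hr hr' => by
        rw [hf.1 r (by simp [Cmd.writes_for, Cmd.Writes, hr, hr'])]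
        simp [hr])
      (fun A hA => by
        rw [hf.2 A (by simp [Cmd.stores_for, Cmd.Stores, hA])]
        simp)
    simp only [Ex.eval, eb] at hlt
    have e4 : τ.v .w = b := by omega
    simp only [Ex.cost, Env.set_v, if_true, e4, hC.off_zero, Nat.sub_zero, Nat.sub_self] at ht ⊢
    refine ⟨by omega, fun w u v => ?_⟩
    rw [i2, e4]
    simp

end Specifications

end PairwiseMarket

/-! ### The potential that bounds the number of events -/

namespace PairwiseMarket

open scoped Classical in
/-- The edges that are not marked as rejected and not in the matching. -/
noncomputable def freeEdges {a b : ℕ} (I : Market (Fin a) (Fin b)) (rej mm : ℕ → ℕ) :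
    Finset (Fin a × Fin b) :=
  Finset.univ.filter fun e => e ∈ I.edges ∧ rej (e.1 * b + e.2) = 0 ∧ mm e.1 ≠ e.2 + 1

/-- The potential of the men: the number of events that they can still cause. -/
def menPotential (a : ℕ) (off hi st : ℕ → ℕ) : ℕ :=
  -- A proposal raises the state from `0` to `3` and shortens the rest of the list by at least one
  -- entry, hence the factor `4`.
  ∑ u ∈ Finset.range a, (4 * (off (u + 1) - hi u) + st u)

/-- A bound for the number of events that are still possible. -/
noncomputable def Env.potential {a b : ℕ} (I : Market (Fin a) (Fin b)) (off : ℕ → ℕ) (σ : Env) :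
    ℕ :=
  menPotential a off (σ.arr .hi) (σ.arr .st) + (freeEdges I (σ.arr .rej) (σ.arr .mm)).card

section Potential

variable {a b : ℕ} {I : Market (Fin a) (Fin b)} {off hi hi' st st' rej rej' mm mm' mw mw' : ℕ → ℕ}

theorem menPotential_lt
    (h : ∀ u < a, 4 * (off (u + 1) - hi' u) + st' u ≤ 4 * (off (u + 1) - hi u) + st u) {u : ℕ}
    (hu : u < a) (hlt : 4 * (off (u + 1) - hi' u) + st' u < 4 * (off (u + 1) - hi u) + st u) :
    menPotential a off hi' st' < menPotential a off hi st :=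
  Finset.sum_lt_sum (fun u hu => h u (Finset.mem_range.1 hu)) ⟨u, Finset.mem_range.2 hu, hlt⟩

theorem mem_freeEdges {e : Fin a × Fin b} : e ∈ freeEdges I rej mm ↔
    e ∈ I.edges ∧ rej (e.1 * b + e.2) = 0 ∧ mm e.1 ≠ e.2 + 1 := by
  simp [freeEdges]

theorem freeEdges_mono
    (h : ∀ (u : Fin a) (w : Fin b), rej (u * b + w) ≠ 0 → rej' (u * b + w) ≠ 0) :
    freeEdges I rej' mm ⊆ freeEdges I rej mm := by
  rintro ⟨u, w⟩ he
  rw [mem_freeEdges] at he ⊢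
  exact ⟨he.1, by_contra fun h1 => h u w h1 he.2.1, he.2.2⟩

/-- Rejected edges are not free in any case, so removing them from the matching does not change the
potential. -/
theorem freeEdges_congr (h : ∀ (u : Fin a) (w : Fin b), rej (u * b + w) = 0 →
    (mm u = w + 1 ↔ mm' u = w + 1)) : freeEdges I rej mm = freeEdges I rej mm' := by
  ext ⟨u, w⟩
  rw [mem_freeEdges, mem_freeEdges]
  exact and_congr_right fun _ => and_congr_right fun h1 => not_congr (h u w h1)

open scoped Classical in
-- The unrejected edges split into the free ones and those of the matching, and the latter are
-- counted by their men.
theorem card_freeEdges (hc : Consistent a b mm mw)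
    (hA : ∀ (u : Fin a) (w : Fin b), mm u = w + 1 → (u, w) ∈ I.edges ∧ rej (u * b + w) = 0) :
    (freeEdges I rej mm).card + (Finset.univ.filter fun u : Fin a => mm u ≠ 0).card =
      (Finset.univ.filter fun e : Fin a × Fin b =>
        e ∈ I.edges ∧ rej (e.1 * b + e.2) = 0).card := by
  have h1 : (Finset.univ.filter fun u : Fin a => mm u ≠ 0).card =
      (Finset.univ.filter fun e : Fin a × Fin b => mm e.1 = e.2 + 1).card := by
    symm
    refine Finset.card_bij (fun e _ => e.1) ?_ ?_ ?_
    · rintro ⟨u, w⟩ h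
      simp only [Finset.mem_filter, Finset.mem_univ, true_and] at h ⊢
      omega
    · rintro ⟨u, w⟩ h ⟨u', w'⟩ h' he
      simp only [Finset.mem_filter, Finset.mem_univ, true_and] at h h' he
      subst he
      exact Prod.ext rfl (Fin.ext (by simp only; omega))
    · intro u h
      simp only [Finset.mem_filter, Finset.mem_univ, true_and] at h
      have := hc.men u u.2
      exact ⟨(u, ⟨mm u - 1, by omega⟩), by simp; omega, rfl⟩
  rw [h1, ← Finset.card_union_of_disjoint]
  · congr 1
    ext ⟨u, w⟩
    simp only [Finset.mem_union, mem_freeEdges, Finset.mem_filter, Finset.mem_univ, true_and]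
    have := hA u w
    tauto
  · rw [Finset.disjoint_left]
    rintro ⟨u, w⟩ h h'
    simp only [mem_freeEdges, Finset.mem_filter, Finset.mem_univ, true_and] at h h'
    exact h.2.2 h'

/-- An augmentation leaves the unrejected edges as they are and matches one more man. -/
theorem card_freeEdges_lt {A : ℕ → ℕ → Prop} (hc : Consistent a b mm mw)
    (hA : ∀ u < a, ∀ w < b, mm u = w + 1 → A u w)
    (h : Augmented a b A mm mm' mw')
    (hE : ∀ (u : Fin a) (w : Fin b), A u w → (u, w) ∈ I.edges ∧ rej (u * b + w) = 0) :
    (freeEdges I rej mm').card < (freeEdges I rej mm).card := by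
  classical
  obtain ⟨hc', hA', u₀, hu₀, h1, h2⟩ := h
  have e1 := card_freeEdges (I := I) (rej := rej) hc fun u w h => hE u w (hA u u.2 w w.2 h)
  have e2 := card_freeEdges (I := I) (rej := rej) hc' fun u w h => hE u w (hA' u u.2 w w.2 h)
  have hlt : (Finset.univ.filter fun u : Fin a => mm u ≠ 0).card <
      (Finset.univ.filter fun u : Fin a => mm' u ≠ 0).card := by
    refine Finset.card_lt_card ⟨fun u hu => ?_, fun hsub => ?_⟩
    · simp only [Finset.mem_filter, Finset.mem_univ, true_and] at hu ⊢
      exact (h2 u u.2).2 (Or.inl hu)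
    · have := @hsub ⟨u₀, hu₀⟩ (by
        simpa using (h2 u₀ hu₀).2 (Or.inr rfl))
      simp only [Finset.mem_filter, Finset.mem_univ, true_and] at this
      exact this h1
  omega

end Potential

/-! ### The loop invariant under reactions, examinations and proposals -/

section Loop

variable {a b B : ℕ} {I : Market (Fin a) (Fin b)} {off adj mark : ℕ → ℕ} {σ τ : Env}

/-- The memory describes a configuration that an execution can reach, and a matching. -/
structure Env.Running (I : Market (Fin a) (Fin b)) (off adj mark : ℕ → ℕ) (σ : Env) : Prop where
  base : σ.Base I off adj mark
  config : ∃ c, Reachable I c ∧ c.Calm ∧ σ.arrays.Simulates I off adj mark c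
  consistent : Consistent a b (σ.arr .mm) (σ.arr .mw)
  -- The matching is not updated when edges are rejected. Only its unrejected edges have to belong
  -- to the current proposal ties.
  tie : ∀ u < a, ∀ w < b, σ.arr .mm u = w + 1 → σ.arr .rej (u * b + w) = 0 →
    σ.arrays.tie adj u w

/-- The memory holds the output of an execution. -/
def Env.Answered (I : Market (Fin a) (Fin b)) (σ : Env) : Prop :=
  ∃ c, Reachable I c ∧
    ((∃ M, c.loc = Loc.output (some M) ∧ I.StronglyStable (restrict M) ∧ σ.v .ans = 1 ∧
      ∀ u : Fin a, (∀ w : Fin b, (u, w) ∈ restrict M ↔ σ.arr .mm u = w + 1) ∧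
        (¬ CoversMan (restrict M) u → σ.arr .mm u = 0)) ∨
      (c.loc = Loc.output none ∧ (¬ ∃ M, I.StronglyStable M) ∧ σ.v .ans = 0))

theorem Env.Running.congr (h : σ.Running I off adj mark) (harr : τ.arr = σ.arr)
    (ha : τ.v .a = σ.v .a) (hb : τ.v .b = σ.v .b) : τ.Running I off adj mark := by
  have e : τ.arrays = σ.arrays := by simp only [Env.arrays, harr]
  obtain ⟨h1, h2, h3, h4⟩ := h
  refine ⟨⟨ha.trans h1.men, hb.trans h1.women, ?_, ?_, ?_, ?_⟩, ?_, ?_, ?_⟩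
  · rw [harr, h1.off]
  · rw [harr, h1.adj]
  · rw [harr, h1.mark]
  · rw [harr]
    exact h1.cmp
  · rwa [e]
  · rwa [harr]
  · rwa [harr, e]

theorem Env.potential_congr (harr : τ.arr = σ.arr) : τ.potential I off = σ.potential I off := by
  simp only [Env.potential, harr]

theorem Env.Running.bounded (h : σ.Running I off adj mark) (hL : Layout I off adj mark)
    (hm : I.edges.ncard + 1 ≤ B) : σ.arrays.Bounded a b B adj := by
  obtain ⟨c, -, -, hx⟩ := h.config
  intro u hu
  have h1 := hx.off_le_lo u hu
  have h2 := hx.hi_le u hu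
  have h3 := hL.off_le_ncard (u := u + 1) hu
  have h4 := hL.length_le hu
  exact ⟨hx.lo_le_hi u hu, by omega, by omega, fun i hi hi' => hL.adj_lt u hu i (by omega)
    (by omega)⟩

variable {t : Fin a → Fin b ⊕ Fin a → ℕ}

theorem wp_react_running (hB : Big a b B) (h : σ.Running I off adj mark)
    (hL : Layout I off adj mark) (hm : I.edges.ncard + 1 ≤ B) (hw : I.WomenAsymmetric)
    (hf : σ.v .f < a) (hst : 2 < σ.arr .st (σ.v .f)) :
    WP B .react σ fun t τ => t ≤ 200 * (a + 1) * (b + 1) ∧ τ.Running I off adj mark ∧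
      τ.potential I off < σ.potential I off := by
  refine (wp_react hB h.base hw (h.bounded hL hm) (f := ⟨σ.v .f, hf⟩) rfl).mono ?_
  rintro t τ hfr ⟨ht, h1, h2⟩
  obtain ⟨c, hr, hl, hx⟩ := h.config
  have hA : ∀ A, A ≠ .rej → A ≠ .st → τ.arr A = σ.arr A := fun A h3 h4 =>
    hfr.2 A (by simp [Cmd.react, Cmd.rejectLoop, Cmd.stores_for, Cmd.Stores, h3, h4])
  have e1 := hA .lo (by simp) (by simp)
  have e2 := hA .hi (by simp) (by simp)
  have e3 := hA .mm (by simp) (by simp)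
  have e4 := hA .mw (by simp) (by simp)
  have hst3 := hx.st_le _ hf
  change σ.arr .st (σ.v .f) ≤ 3 at hst3
  refine ⟨ht, ⟨?_, ⟨c, hr, hl, ?_⟩, ?_, ?_⟩, ?_⟩
  · exact h.base.of_frame hfr (by
      simp [Cmd.react, Cmd.rejectLoop, Cmd.writes_for, Cmd.Writes, Cmd.stores_for, Cmd.Stores])
  · exact hx.react (f := ⟨σ.v .f, hf⟩) (x' := τ.arrays) (show σ.arr .st (σ.v .f) = 3 by omega)
      e1 e2 (hA .ever (by simp) (by simp)) h1 h2
  · rw [e3, e4]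
    exact h.consistent
  · intro u hu w hwb h5 h6
    rw [e3] at h5
    have h7 := h.tie u hu w hwb h5 (by_contra fun h7 => (h2 ⟨u, hu⟩ ⟨w, hwb⟩).2 (Or.inl h7) h6)
    simpa only [Arrays.tie, Env.arrays, e1, e2] using h7
  · have hp : menPotential a off (τ.arr .hi) (τ.arr .st) <
        menPotential a off (σ.arr .hi) (σ.arr .st) := by
      rw [e2, h1]
      refine menPotential_lt (u := σ.v .f) (fun u hu => ?_) hf ?_
      · rw [Function.update_apply]
        split_ifs with huf
        · simp only at huf
          rw [huf]
          omega
        · exact le_rfl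
      · simp only [Function.update_self]
        omega
    have hfree := Finset.card_le_card (freeEdges_mono (I := I) (mm := σ.arr .mm)
      fun u w h3 => (h2 u w).2 (Or.inl h3))
    simp only [Env.potential, e3]
    omega

theorem wp_examine_running (hB : Big a b B) (h : σ.Running I off adj mark)
    (hL : Layout I off adj mark) (hJ : I.withDummies.Ranked t Sum.inr)
    (hm : I.edges.ncard + 1 ≤ B) (hst2 : ∀ u < a, σ.arr .st u ≤ 2) (hf : σ.v .f < a)
    (hk : σ.v .k = σ.arrays.count b adj (σ.v .f))
    (hlt : σ.arrays.count b adj (σ.v .f) < σ.arr .st (σ.v .f)) :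
    WP B .examine σ fun t τ => t ≤ 200 * (a + 1) * (b + 1) ∧ τ.Running I off adj mark ∧
      τ.potential I off < σ.potential I off := by
  have hk1 : σ.arrays.count b adj (σ.v .f) ≤ 1 := by
    have := hst2 _ hf
    omega
  obtain ⟨c, hr, hl, hx⟩ := h.config
  have hcnt := count_cases hL hx (u := ⟨σ.v .f, hf⟩) hk1
  simp only at hcnt
  generalize hkk : σ.arrays.count b adj (σ.v .f) = k at *
  refine (wp_examine hB h.base (h.bounded hL hm) (f := ⟨σ.v .f, hf⟩) rfl hk hk1).mono ?_
  rintro t τ hfr ⟨ht, h1, h2⟩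
  have hA : ∀ A, A ≠ .rej → A ≠ .st → τ.arr A = σ.arr A := fun A h3 h4 =>
    hfr.2 A (by simp [Cmd.examine, Cmd.rejectLoop, Cmd.stores_for, Cmd.Stores, h3, h4])
  have e1 := hA .lo (by simp) (by simp)
  have e2 := hA .hi (by simp) (by simp)
  have e3 := hA .mm (by simp) (by simp)
  have e4 := hA .mw (by simp) (by simp)
  refine ⟨ht, ⟨?_, ?_, ?_, ?_⟩, ?_⟩
  · exact h.base.of_frame hfr (by
      simp [Cmd.examine, Cmd.rejectLoop, Cmd.writes_for, Cmd.Writes, Cmd.stores_for, Cmd.Stores])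
  · exact hx.examine hL hJ hr hl (f := ⟨σ.v .f, hf⟩) (x' := τ.arrays) hst2 hlt hcnt
      e1 e2 (hA .ever (by simp) (by simp)) h1 h2
  · rw [e3, e4]
    exact h.consistent
  · intro u hu w hwb h5 h6
    rw [e3] at h5
    have h7 := h.tie u hu w hwb h5 (by_contra fun h7 => (h2 ⟨u, hu⟩ ⟨w, hwb⟩).2 (Or.inl h7) h6)
    simpa only [Arrays.tie, Env.arrays, e1, e2] using h7
  · have hp : menPotential a off (τ.arr .hi) (τ.arr .st) <
        menPotential a off (σ.arr .hi) (σ.arr .st) := by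
      rw [e2, h1]
      refine menPotential_lt (u := σ.v .f) (fun u hu => ?_) hf ?_
      · rw [Function.update_apply]
        split_ifs with huf
        · simp only at huf
          rw [huf]
          omega
        · exact le_rfl
      · simp only [Function.update_self]
        omega
    have hfree := Finset.card_le_card (freeEdges_mono (I := I) (mm := σ.arr .mm)
      fun u w h3 => (h2 u w).2 (Or.inl h3))
    simp only [Env.potential, e3]
    omega

theorem wp_propose_running (hB : Big a b B) (h : σ.Running I off adj mark)
    (hL : Layout I off adj mark) (hJ : I.withDummies.Ranked t Sum.inr) (hw : I.WomenAsymmetric)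
    (hm : I.edges.ncard + 1 ≤ B) (hs : Arrays.Simulates.Settled a b adj σ.arrays) :
    WP B .propose σ fun t τ => t ≤ 300 * (a + 1) * (b + 1) ∧ τ.Running I off adj mark ∧
      ((τ.v .f = a ∧ (∀ u < a, ¬ Arrays.Simulates.Next off σ.arrays u) ∧ τ.arr = σ.arr) ∨
        (τ.v .f < a ∧ τ.potential I off < σ.potential I off)) := by
  obtain ⟨c, hr, hl, hx⟩ := h.config
  refine (wp_propose hB h.base hL hm ?_ hx.hi_le hx.st_le).mono ?_
  · intro u hu
    have h1 := hx.off_le_lo u hu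
    have h2 := hx.lo_le_hi u hu
    exact h1.trans h2
  rintro k τ hfr ⟨ht, hp, hn⟩
  refine ⟨ht, ?_⟩
  have hwr : ∀ r, r = .a ∨ r = .b → τ.v r = σ.v r := fun r h1 =>
    hfr.1 r (by rcases h1 with rfl | rfl <;> simp [Cmd.propose, Cmd.writes_for, Cmd.Writes])
  obtain ⟨hf, hn, harr⟩ | ⟨hf, hn⟩ := hn
  · exact ⟨h.congr harr (hwr _ (by simp)) (hwr _ (by simp)), Or.inl ⟨hf, hn, harr⟩⟩
  have hA : ∀ A, A ≠ .lo → A ≠ .hi → A ≠ .st → A ≠ .ever → τ.arr A = σ.arr A :=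
    fun A h1 h2 h3 h4 =>
      hfr.2 A (by simp [Cmd.propose, Cmd.stores_for, Cmd.Stores, h1, h2, h3, h4])
  have e3 : τ.arr .mm = σ.arr .mm := by rw [hA] <;> simp
  have e4 : τ.arr .mw = σ.arr .mw := by rw [hA] <;> simp
  have e5 : τ.arr .rej = σ.arr .rej := by rw [hA] <;> simp
  refine ⟨⟨?_, ?_, ?_, ?_⟩, Or.inr ⟨hf, ?_⟩⟩
  · exact h.base.of_frame hfr (by
      simp [Cmd.propose, Cmd.writes_for, Cmd.Writes, Cmd.stores_for, Cmd.Stores])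
  · have hc := Config.Invariant.of_reachable hJ hr
    obtain ⟨c', h1, h2, h3, -⟩ := hx.propose hL hJ hw hr hl hs hp ⟨⟨τ.v .f, hf⟩, by
      rw [hx.not_coversMan_iff hL hJ hc hs]
      refine ⟨hn.1, fun hd => ?_⟩
      have h1 := (hx.proposed_dummy _ _ hd).2
      have h2 := hn.2
      simp only at h1
      omega⟩
    exact ⟨c', h1, h2, h3⟩
  · rw [e3, e4]
    exact h.consistent
  · intro u hu w hwb h5 h6
    rw [e3] at h5
    rw [e5] at h6
    have h7 := h.tie u hu w hwb h5 h6
    -- All edges in the tie of a proposing man are rejected. A man with an unrejected edge in the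
    -- matching therefore keeps his tie.
    have h8 : ¬ Arrays.Simulates.Next off σ.arrays u := fun h8 =>
      (hx.st_zero ⟨u, hu⟩ h8.1 ⟨w, hwb⟩ h7).1 h6
    obtain ⟨h9, h10, -⟩ := hp.same u hu h8
    simpa only [Arrays.tie, h9, h10] using h7
  · have hlt : menPotential a off (τ.arr .hi) (τ.arr .st) <
        menPotential a off (σ.arr .hi) (σ.arr .st) := by
      have key : ∀ u < a, Arrays.Simulates.Next off σ.arrays u →
          4 * (off (u + 1) - τ.arr .hi u) + τ.arr .st u <
            4 * (off (u + 1) - σ.arr .hi u) + σ.arr .st u := by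
        intro u hu hn
        have h1 := hp.lt_hi u hu hn
        have h2 := hp.hi_le u hu hn
        have h3 := hp.st u hu hn
        simp only [Env.arrays] at h1 h2 h3
        omega
      refine menPotential_lt (u := τ.v .f) (fun u hu => ?_) hf (key _ hf hn)
      by_cases hu' : Arrays.Simulates.Next off σ.arrays u
      · exact (key u hu hu').le
      · obtain ⟨-, h1, h2⟩ := hp.same u hu hu'
        simp only [Env.arrays] at h1 h2
        rw [h1, h2]
    simp only [Env.potential, e3, e5]
    omega

end Loop

end PairwiseMarket

namespace PairwiseMarket

/-! ### One event of the program: correctness and progress -/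

namespace Cmd

/-- Search for an alternating path after the first phase; use it to enlarge the matching, or reject
the edges of the critical set, or decide the answer. -/
def improve : Cmd :=
  .seq .clean <| .seq .search <|
  .ite (.var .z) (.var .b) .augment <|
  .ite (.lit 0) (.var .qt) .rejectQueue .finish

/-- One event of the algorithm. -/
def event : Cmd :=
  .seq .findReact <| .ite (.var .f) (.var .a) .react <|
  .seq .findExamine <| .ite (.var .f) (.var .a) .examine <|
  .seq .propose <| .ite (.var .f) (.var .a) .skip .improve

end Cmd

section Loop

variable {a b B : ℕ} {I : Market (Fin a) (Fin b)} {off adj mark : ℕ → ℕ} {σ τ : Env}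
  {t : Fin a → Fin b ⊕ Fin a → ℕ}

theorem wp_clean_running (hB : Big a b B) (h : σ.Running I off adj mark) :
    WP B .clean σ fun t τ => t ≤ 200 * (a + 1) ∧ τ.Running I off adj mark ∧
      τ.arrays = σ.arrays ∧ τ.v .go = σ.v .go ∧ τ.potential I off = σ.potential I off ∧
      ∀ u < a, ∀ w < b, τ.arr .mm u = w + 1 → τ.arrays.live b adj u w := by
  refine (wp_clean hB h.base h.consistent).mono ?_
  rintro t τ hfr ⟨ht, hc, hmm⟩
  have hA : ∀ A, A ≠ .mm → A ≠ .mw → τ.arr A = σ.arr A := fun A h1 h2 =>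
    hfr.2 A (by simp [Cmd.clean, Cmd.stores_for, Cmd.Stores, h1, h2])
  have e : τ.arrays = σ.arrays := by
    rw [Env.arrays, Env.arrays, hA _ (by simp) (by simp), hA _ (by simp) (by simp),
      hA _ (by simp) (by simp), hA _ (by simp) (by simp), hA _ (by simp) (by simp)]
  have hlive : ∀ u < a, ∀ w < b, τ.arr .mm u = w + 1 → τ.arrays.live b adj u w := by
    intro u hu w hw h1
    obtain ⟨h2, h3⟩ := (hmm u hu w hw).1 h1
    rw [e]
    exact ⟨h.tie u hu w hw h2 h3, h3⟩
  refine ⟨ht, ⟨?_, ?_, hc, fun u hu w hw h1 _ => (hlive u hu w hw h1).1⟩, e, ?_, ?_, hlive⟩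
  · exact h.base.of_frame hfr (by
      simp [Cmd.clean, Cmd.writes_for, Cmd.Writes, Cmd.stores_for, Cmd.Stores])
  · rw [e]
    exact h.config
  · exact hfr.1 _ (by simp [Cmd.clean, Cmd.writes_for, Cmd.Writes])
  · rw [Env.potential, Env.potential, hA .hi (by simp) (by simp), hA .st (by simp) (by simp),
      hA .rej (by simp) (by simp), freeEdges_congr (mm' := σ.arr .mm)]
    intro u w h1
    rw [hmm u u.2 w w.2]
    exact and_iff_left h1

theorem wp_search_running (hB : Big a b B) (h : σ.Running I off adj mark)
    (hL : Layout I off adj mark) (hm : I.edges.ncard + 1 ≤ B)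
    (hS : ∀ u < a, σ.arr .mm u ≠ 0 → σ.arr .st u ≠ 0) :
    WP B .search σ fun t τ => t ≤ 400 * (a + 1) * (b + 1) ∧ τ.Running I off adj mark ∧
      (∀ A, A ≠ .par → A ≠ .queue → τ.arr A = σ.arr A) ∧
      τ.arrays = σ.arrays ∧ τ.v .go = σ.v .go ∧ τ.potential I off = σ.potential I off ∧
      Search a b (σ.arr .st · ≠ 0) (σ.arrays.live b adj) (σ.arr .mm) (σ.arr .mw)
        (τ.arr .queue) (τ.arr .par) (τ.v .qt) (τ.v .z) ∧
      ∀ j < τ.v .qt, ∀ w, σ.arrays.live b adj (τ.arr .queue j) w → τ.arr .par w ≠ 0 := by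
  refine (wp_search hB h.base (h.bounded hL hm) h.consistent hS).mono ?_
  rintro t τ hfr ⟨ht, hs, hp⟩
  have hA : ∀ A, A ≠ .par → A ≠ .queue → τ.arr A = σ.arr A := fun A h1 h2 =>
    hfr.2 A (by simp [Cmd.search, Cmd.startSearch, Cmd.scan, Cmd.stores_for, Cmd.Stores, h1, h2])
  have e : τ.arrays = σ.arrays := by
    rw [Env.arrays, Env.arrays, hA _ (by simp) (by simp), hA _ (by simp) (by simp),
      hA _ (by simp) (by simp), hA _ (by simp) (by simp), hA _ (by simp) (by simp)]
  refine ⟨ht, ⟨?_, ?_, ?_, ?_⟩, hA, e, ?_, ?_, hs, hp⟩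
  · exact h.base.of_frame hfr (by simp [Cmd.search, Cmd.startSearch, Cmd.scan, Cmd.writes_for,
      Cmd.Writes, Cmd.stores_for, Cmd.Stores])
  · rw [e]
    exact h.config
  · rw [hA _ (by simp) (by simp), hA _ (by simp) (by simp)]
    exact h.consistent
  · rw [hA .mm (by simp) (by simp), hA .rej (by simp) (by simp), e]
    exact h.tie
  · exact hfr.1 _ (by simp [Cmd.search, Cmd.startSearch, Cmd.scan, Cmd.writes_for, Cmd.Writes])
  · rw [Env.potential, Env.potential, hA .hi (by simp) (by simp), hA .st (by simp) (by simp),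
      hA .rej (by simp) (by simp), hA .mm (by simp) (by simp)]

/-- The memory describes the end of the first phase, with a matching of active edges. -/
structure Env.Phase2 (I : Market (Fin a) (Fin b)) (off adj mark : ℕ → ℕ) (σ : Env) : Prop where
  running : σ.Running I off adj mark
  settled : Arrays.Simulates.Settled a b adj σ.arrays
  notNext : ∀ u < a, ¬ Arrays.Simulates.Next off σ.arrays u
  live : ∀ u < a, ∀ w < b, σ.arr .mm u = w + 1 → σ.arrays.live b adj u w

theorem Env.Phase2.st_ne (h : σ.Phase2 I off adj mark) {u : ℕ} (hu : u < a)
    (hm : σ.arr .mm u ≠ 0) : σ.arr .st u ≠ 0 := by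
  obtain ⟨c, -, -, hx⟩ := h.running.config
  intro h0
  have h1 := h.running.consistent.men u hu
  obtain ⟨h2, h3⟩ := h.live u hu (σ.arr .mm u - 1) (by omega) (by omega)
  exact (hx.st_zero ⟨u, hu⟩ h0 ⟨σ.arr .mm u - 1, by omega⟩ h2).1 h3

theorem wp_augment_running (hB : Big a b B) (h : σ.Phase2 I off adj mark)
    (hL : Layout I off adj mark)
    (hs : Search a b (σ.arr .st · ≠ 0) (σ.arrays.live b adj) (σ.arr .mm) (σ.arr .mw)
      (σ.arr .queue) (σ.arr .par) (σ.v .qt) (σ.v .z)) (hz : σ.v .z < b) :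
    WP B .augment σ fun t τ => t ≤ 100 * (a + 1) ∧ τ.v .go = σ.v .go ∧
      τ.Running I off adj mark ∧ τ.potential I off < σ.potential I off := by
  refine (wp_augment hB h.running.consistent hs h.live hz).mono ?_
  rintro t τ hfr ⟨ht, hg⟩
  obtain ⟨c, -, -, hx⟩ := h.running.config
  have hA : ∀ A, A ≠ .mm → A ≠ .mw → τ.arr A = σ.arr A := fun A h1 h2 =>
    hfr.2 A (by simp [Cmd.augment, Cmd.Stores, h1, h2])
  have e : τ.arrays = σ.arrays := by
    rw [Env.arrays, Env.arrays, hA _ (by simp) (by simp), hA _ (by simp) (by simp),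
      hA _ (by simp) (by simp), hA _ (by simp) (by simp), hA _ (by simp) (by simp)]
  refine ⟨ht, ?_, ⟨?_, ?_, hg.1, fun u hu w hw h1 _ => ?_⟩, ?_⟩
  · exact hfr.1 _ (by simp [Cmd.augment, Cmd.Writes])
  · exact h.running.base.of_frame hfr (by simp [Cmd.augment, Cmd.Writes, Cmd.Stores])
  · rw [e]
    exact h.running.config
  · rw [e]
    exact (hg.2.1 u hu w hw h1).1
  · have := card_freeEdges_lt (I := I) (rej := σ.arr .rej) h.running.consistent h.live hg
      fun u w h1 => ⟨hx.tie_edges hL h1.1, h1.2⟩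
    simp only [Env.potential, hA .hi (by simp) (by simp), hA .st (by simp) (by simp),
      hA .rej (by simp) (by simp)]
    omega

theorem wp_rejectQueue_running (hB : Big a b B) (h : σ.Phase2 I off adj mark)
    (hL : Layout I off adj mark) (hJ : I.withDummies.Ranked t Sum.inr) (hw : I.WomenAsymmetric)
    (hm : I.edges.ncard + 1 ≤ B)
    (hs : Search a b (σ.arr .st · ≠ 0) (σ.arrays.live b adj) (σ.arr .mm) (σ.arr .mw)
      (σ.arr .queue) (σ.arr .par) (σ.v .qt) b)
    (hp : ∀ j < σ.v .qt, ∀ w, σ.arrays.live b adj (σ.arr .queue j) w → σ.arr .par w ≠ 0)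
    (hpos : 0 < σ.v .qt) :
    WP B .rejectQueue σ fun t τ => t ≤ 200 * (a + 1) * (b + 1) ∧ τ.v .go = σ.v .go ∧
      τ.Running I off adj mark ∧ τ.potential I off < σ.potential I off := by
  refine (wp_rejectQueue hB h.running.base (h.running.bounded hL hm) rfl hs.le
    fun j hj => (hs.lt j hj).1).mono ?_
  rintro k τ hfr ⟨ht, hrej⟩
  obtain ⟨c, hr, hl, hx⟩ := h.running.config
  have hA : ∀ A, A ≠ .rej → τ.arr A = σ.arr A := fun A h1 =>
    hfr.2 A (by simp [Cmd.rejectQueue, Cmd.stores_for, Cmd.Stores, h1])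
  refine ⟨ht, ?_, ⟨?_, ?_, ?_, fun u hu w hwb h1 h2 => ?_⟩, ?_⟩
  · exact hfr.1 _ (by simp [Cmd.rejectQueue, Cmd.writes_for, Cmd.Writes])
  · exact h.running.base.of_frame hfr (by
      simp [Cmd.rejectQueue, Cmd.writes_for, Cmd.Writes, Cmd.stores_for, Cmd.Stores])
  · exact hx.reject_search hL hJ hw hr hl h.settled h.notNext h.running.consistent h.live
      (fun u hu => h.st_ne hu) hs hp hpos (hA _ (by simp)) (hA _ (by simp)) (hA _ (by simp))
      (hA _ (by simp)) hrej
  · rw [hA _ (by simp), hA _ (by simp)]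
    exact h.running.consistent
  · rw [hA .mm (by simp)] at h1
    have := (h.live u hu w hwb h1).1
    simpa only [Arrays.tie, Env.arrays, hA .lo (by simp), hA .hi (by simp)] using this
  · obtain ⟨hu, hst⟩ := hs.lt 0 hpos
    -- The first man in the queue has no predecessor, so he is unmatched. Being settled in a nonzero
    -- state he has an unrejected edge, which is free, and its rejection lowers the potential.
    have hfree : σ.arr .mm (σ.arr .queue 0) = 0 := by
      by_contra h1
      obtain ⟨i, hi, -⟩ := hs.pred 0 hpos h1
      omega
    obtain ⟨w, h1, h2⟩ : ∃ w : Fin b, σ.arrays.tie adj (σ.arr .queue 0) w ∧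
        σ.arr .rej (σ.arr .queue 0 * b + w) = 0 := by
      have h1 := h.settled.st_le _ hu
      simp only [Env.arrays] at h1
      rcases (show σ.arr .st (σ.arr .queue 0) = 1 ∨ σ.arr .st (σ.arr .queue 0) = 2 by omega)
        with h2 | h2
      · exact h.settled.of_one ⟨_, hu⟩ h2
      · obtain ⟨w, -, -, h3, -, h4, -⟩ := h.settled.of_two ⟨_, hu⟩ h2
        exact ⟨w, h3, h4⟩
    have hlt : (freeEdges I (τ.arr .rej) (σ.arr .mm)).card <
        (freeEdges I (σ.arr .rej) (σ.arr .mm)).card := by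
      refine Finset.card_lt_card ⟨freeEdges_mono fun u w h3 => (hrej u w).2 (Or.inl h3),
        fun hsub => ?_⟩
      have h3 : ((⟨σ.arr .queue 0, hu⟩, w) : Fin a × Fin b) ∈
          freeEdges I (σ.arr .rej) (σ.arr .mm) := by
        rw [mem_freeEdges]
        refine ⟨hx.tie_edges hL h1, h2, ?_⟩
        simp only [hfree]
        omega
      have h4 := hsub h3
      rw [mem_freeEdges] at h4
      exact (hrej ⟨σ.arr .queue 0, hu⟩ w).2 (Or.inr ⟨⟨0, hpos, rfl⟩, h1⟩) h4.2.1
    simp only [Env.potential, hA .hi (by simp), hA .st (by simp), hA .mm (by simp)]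
    omega

theorem wp_finish_running (hB : Big a b B) (h : σ.Phase2 I off adj mark)
    (hL : Layout I off adj mark) (hm : I.MenTied) (hw : I.WomenAsymmetric)
    (hs : Search a b (σ.arr .st · ≠ 0) (σ.arrays.live b adj) (σ.arr .mm) (σ.arr .mw)
      (σ.arr .queue) (σ.arr .par) 0 (σ.v .z)) :
    WP B .finish σ fun t τ => t ≤ 200 * (b + 1) ∧ τ.v .go = 0 ∧ τ.Answered I ∧
      τ.potential I off = σ.potential I off := by
  refine (wp_finish hB h.running.base).mono ?_
  rintro t τ hfr ⟨ht, hgo, hans⟩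
  obtain ⟨c, hr, hl, hx⟩ := h.running.config
  have hc := h.running.consistent
  have harr : τ.arr = σ.arr := by
    funext A
    exact hfr.2 A (by simp [Cmd.finish, Cmd.stores_for, Cmd.Stores])
  have hsome : ∀ u : Fin a, σ.arr .mm u ≠ 0 → ∃ w : Fin b, σ.arr .mm u = w + 1 := by
    intro u hu
    have := hc.men u u.2
    exact ⟨⟨σ.arr .mm u - 1, by omega⟩, by simp only; omega⟩
  -- The search puts every unmatched man with an active edge to a real woman into the queue; an
  -- empty queue means that there is none.
  have hall : ∀ u : Fin a, σ.arrays.st u ≠ 0 → ∃ w : Fin b, σ.arr .mm u = w + 1 := by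
    intro u hu
    refine hsome u fun h0 => ?_
    obtain ⟨j, hj, -⟩ := hs.free u u.2 hu h0
    omega
  have hever : (∀ w < b, σ.arr .ever w ≠ 0 → σ.arr .mw w ≠ 0) ↔
      ∀ w : Fin b, σ.arrays.ever w ≠ 0 → ∃ u : Fin a, σ.arr .mm u = w + 1 := by
    constructor
    · intro h1 w h2
      have h3 := h1 w w.2 h2
      have h4 := hc.women w w.2
      refine ⟨⟨σ.arr .mw w - 1, by omega⟩, (hc.iff _ (by simp only; omega) w w.2).2 ?_⟩
      simp only
      omega
    · intro h1 w hw h2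
      obtain ⟨u, hu⟩ := h1 ⟨w, hw⟩ h2
      have := (hc.iff u u.2 w hw).1 hu
      omega
  obtain ⟨hpos, hneg⟩ := hx.finish hm hw hL hr hl h.settled h.notNext
    (matched_of_consistent hc h.live fun u hu => h.st_ne hu) hall
  refine ⟨ht, hgo, ?_, Env.potential_congr harr⟩
  rw [hever] at hans
  obtain ⟨h1, h2⟩ | ⟨h1, h2⟩ := hans
  · obtain ⟨c', M, h3, h4, h5, h6⟩ := hpos h2
    refine ⟨c', h3, Or.inl ⟨M, h4, h5, h1, fun u => ⟨fun w => ?_, fun h7 => ?_⟩⟩⟩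
    · rw [harr]
      exact h6 u w
    · rw [harr]
      by_contra h8
      obtain ⟨w, hw⟩ := hsome u h8
      exact h7 ⟨w, (h6 u w).2 hw⟩
  · obtain ⟨c', h3, h4, h5⟩ := hneg h2
    exact ⟨c', h3, Or.inr ⟨h4, h5, h1⟩⟩

/-- The effect of an event: progress, or the answer. -/
def Env.Advances (I : Market (Fin a) (Fin b)) (off adj mark : ℕ → ℕ) (σ τ : Env) : Prop :=
  (τ.v .go = σ.v .go ∧ τ.Running I off adj mark ∧ τ.potential I off < σ.potential I off) ∨
    (τ.v .go = 0 ∧ τ.Answered I ∧ τ.potential I off ≤ σ.potential I off)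

/-- If the search reaches an unmatched woman, the matching grows. If it does not but the queue is
nonempty, the queue is the critical set. If the queue is empty, all men with active edges to real
women are matched and the algorithm is at its output. -/
theorem wp_improve (hB : Big a b B) (h : σ.Running I off adj mark)
    (hL : Layout I off adj mark) (hJ : I.withDummies.Ranked t Sum.inr)
    (hmt : I.MenTied) (hw : I.WomenAsymmetric) (hm : I.edges.ncard + 1 ≤ B)
    (hs : Arrays.Simulates.Settled a b adj σ.arrays)
    (hn : ∀ u < a, ¬ Arrays.Simulates.Next off σ.arrays u) :
    WP B .improve σ fun t τ => t ≤ 1000 * (a + 1) * (b + 1) ∧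
      Env.Advances I off adj mark σ τ := by
  rw [Cmd.improve, WP.seq_iff]
  refine (wp_clean_running hB h).mono ?_
  rintro t₁ σ₁ - ⟨ht₁, h₁, e₁, hgo₁, hp₁, hlive₁⟩
  have hph : σ₁.Phase2 I off adj mark := ⟨h₁, by rwa [e₁], by rwa [e₁], hlive₁⟩
  rw [WP.seq_iff]
  refine (wp_search_running hB h₁ hL hm fun u hu => hph.st_ne hu).mono ?_
  rintro t₂ σ₂ - ⟨ht₂, h₂, hA, e₂, hgo₂, hp₂, hsearch, hproc⟩
  rw [← e₂, ← hA .mm (by simp) (by simp), ← hA .mw (by simp) (by simp),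
    ← hA .st (by simp) (by simp)] at hsearch
  rw [← e₂] at hproc
  have hph₂ : σ₂.Phase2 I off adj mark := ⟨h₂, by rwa [e₂, e₁], by rwa [e₂, e₁], by
    rw [hA .mm (by simp) (by simp), e₂]
    exact hlive₁⟩
  have q1 : a + 1 ≤ (a + 1) * (b + 1) := Nat.le_mul_of_pos_right _ (by omega)
  have q2 : b + 1 ≤ (a + 1) * (b + 1) := Nat.le_mul_of_pos_left _ (by omega)
  simp only [mul_assoc] at ht₂ ⊢
  simp only [WP.ite_iff, Ex.Fits, Ex.eval, Ex.cost, true_and, Nat.zero_le, h₂.base.women]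
  refine ⟨fun hz => ?_, fun hz => ⟨fun hq => ?_, fun hq => ?_⟩⟩
  · refine (wp_augment_running hB hph₂ hL hsearch hz).mono ?_
    rintro t₃ τ - ⟨ht₃, h1, h2, h3⟩
    exact ⟨by omega, Or.inl ⟨by omega, h2, by omega⟩⟩
  · have hzb : σ₂.v .z = b := by
      obtain ⟨h1, -⟩ | ⟨h1, -⟩ := hsearch.end_eq <;> omega
    rw [hzb] at hsearch
    refine (wp_rejectQueue_running hB hph₂ hL hJ hw hm hsearch hproc hq).mono ?_
    rintro t₃ τ - ⟨ht₃, h1, h2, h3⟩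
    simp only [mul_assoc] at ht₃
    exact ⟨by omega, Or.inl ⟨by omega, h2, by omega⟩⟩
  · rw [show σ₂.v .qt = 0 by omega] at hsearch
    refine (wp_finish_running hB hph₂ hL hmt hw hsearch).mono ?_
    rintro t₃ τ - ⟨ht₃, h1, h2, h3⟩
    exact ⟨by omega, Or.inr ⟨h1, h2, by omega⟩⟩

/-- The order matters: examinations presuppose that no reaction is pending, and proposals and the
second phase presuppose that all men are settled as well. -/
theorem wp_event (hB : Big a b B) (h : σ.Running I off adj mark)
    (hL : Layout I off adj mark) (hJ : I.withDummies.Ranked t Sum.inr)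
    (hmt : I.MenTied) (hw : I.WomenAsymmetric) (hm : I.edges.ncard + 1 ≤ B) :
    WP B .event σ fun t τ => t ≤ 3000 * ((a + 1) * (b + 1)) ∧
      Env.Advances I off adj mark σ τ := by
  have q1 : a + 1 ≤ (a + 1) * (b + 1) := Nat.le_mul_of_pos_right _ (by omega)
  rw [Cmd.event, WP.seq_iff]
  refine (wp_findReact hB h.base).mono ?_
  rintro t₁ σ₁ hf₁ ⟨ht₁, hc₁⟩
  have harr₁ : σ₁.arr = σ.arr := by
    funext A
    exact hf₁.2 A (by simp [Cmd.findReact, Cmd.stores_for, Cmd.Stores])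
  have hv₁ : ∀ r, r = .a ∨ r = .b ∨ r = .go → σ₁.v r = σ.v r := fun r h1 => hf₁.1 r (by
    rcases h1 with rfl | rfl | rfl <;> simp [Cmd.findReact, Cmd.writes_for, Cmd.Writes])
  have h₁ := h.congr harr₁ (hv₁ _ (by simp)) (hv₁ _ (by simp))
  have hp₁ := Env.potential_congr (I := I) (off := off) harr₁
  have hg₁ := hv₁ .go (by simp)
  rw [WP.ite_iff]
  simp only [Ex.Fits, Ex.eval, Ex.cost, true_and, h₁.base.men]
  refine ⟨fun hlt => ?_, fun hlt => ?_⟩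
  · have hst : 2 < σ₁.arr .st (σ₁.v .f) := by
      obtain ⟨h1, -⟩ | ⟨-, h1⟩ := hc₁
      · omega
      · rwa [harr₁]
    refine (wp_react_running hB h₁ hL hm hw hlt hst).mono ?_
    rintro t₂ τ hf ⟨ht₂, h1, h2⟩
    have hg : τ.v .go = σ₁.v .go := hf.1 _ (by
      simp [Cmd.react, Cmd.rejectLoop, Cmd.writes_for, Cmd.Writes])
    simp only [mul_assoc] at ht₂
    exact ⟨by omega, Or.inl ⟨by omega, h1, by omega⟩⟩
  have hst2 : ∀ u < a, σ.arr .st u ≤ 2 := by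
    obtain ⟨-, h1⟩ | ⟨h1, -⟩ := hc₁
    · exact h1
    · omega
  rw [WP.seq_iff]
  refine (wp_findExamine hB h₁.base (h₁.bounded hL hm)).mono ?_
  rintro t₂ σ₂ hf₂ ⟨ht₂, hc₂⟩
  have harr₂ : σ₂.arr = σ₁.arr := by
    funext A
    exact hf₂.2 A (by simp [Cmd.findExamine, Cmd.stores_for, Cmd.Stores])
  have hv₂ : ∀ r, r = .a ∨ r = .b ∨ r = .go → σ₂.v r = σ₁.v r := fun r h1 => hf₂.1 r (by
    rcases h1 with rfl | rfl | rfl <;> simp [Cmd.findExamine, Cmd.writes_for, Cmd.Writes])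
  have h₂ := h₁.congr harr₂ (hv₂ _ (by simp)) (hv₂ _ (by simp))
  have hp₂ := Env.potential_congr (I := I) (off := off) harr₂
  have hg₂ := hv₂ .go (by simp)
  have e₂ : σ₂.arrays = σ₁.arrays := by simp only [Env.arrays, harr₂]
  rw [← e₂, ← harr₂] at hc₂
  rw [← harr₁, ← harr₂] at hst2
  simp only [mul_assoc] at ht₂
  rw [WP.ite_iff]
  simp only [Ex.Fits, Ex.eval, Ex.cost, true_and, h₂.base.men]
  refine ⟨fun hlt₂ => ?_, fun hlt₂ => ?_⟩
  · obtain ⟨h1, -⟩ | ⟨-, h1, h2⟩ := hc₂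
    · omega
    refine (wp_examine_running hB h₂ hL hJ hm hst2 hlt₂ h1 h2).mono ?_
    rintro t₃ τ hf ⟨ht₃, h1, h2⟩
    have hg : τ.v .go = σ₂.v .go := hf.1 _ (by
      simp [Cmd.examine, Cmd.rejectLoop, Cmd.writes_for, Cmd.Writes])
    simp only [mul_assoc] at ht₃
    exact ⟨by omega, Or.inl ⟨by omega, h1, by omega⟩⟩
  have hs : Arrays.Simulates.Settled a b adj σ₂.arrays := by
    obtain ⟨c, -, -, hx⟩ := h₂.config
    obtain ⟨-, h1⟩ | ⟨h1, -⟩ := hc₂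
    · exact settled_of_count hL hx hst2 h1
    · omega
  rw [WP.seq_iff]
  refine (wp_propose_running hB h₂ hL hJ hw hm hs).mono ?_
  rintro t₃ σ₃ hf₃ ⟨ht₃, h₃, hc₃⟩
  have hg₃ : σ₃.v .go = σ₂.v .go := hf₃.1 _ (by
    simp [Cmd.propose, Cmd.writes_for, Cmd.Writes])
  simp only [mul_assoc] at ht₃
  rw [WP.ite_iff]
  simp only [Ex.Fits, Ex.eval, Ex.cost, true_and, h₃.base.men, WP.skip_iff]
  obtain ⟨hfa, hn, harr⟩ | ⟨hfa, hp₃⟩ := hc₃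
  · refine ⟨fun h1 => by omega, fun _ => ?_⟩
    have e₃ : σ₃.arrays = σ₂.arrays := by simp only [Env.arrays, harr]
    have hp₃ := Env.potential_congr (I := I) (off := off) harr
    refine (wp_improve hB h₃ hL hJ hmt hw hm (by rwa [e₃]) (by rwa [e₃])).mono ?_
    rintro t₄ τ - ⟨ht₄, had⟩
    simp only [mul_assoc] at ht₄
    refine ⟨by omega, had.imp (fun ⟨h1, h2, h3⟩ => ⟨by omega, h2, by omega⟩)
      fun ⟨h1, h2, h3⟩ => ⟨h1, h2, by omega⟩⟩
  · refine ⟨fun _ => ⟨by omega, Or.inl ⟨by omega, h₃, by omega⟩⟩, fun h1 => by omega⟩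

end Loop

end PairwiseMarket

namespace PairwiseMarket

/-! ### The complete program and its running time -/

namespace Cmd

/-- The loop of the algorithm. -/
def loop : Cmd := .while (.lit 0) (.var .go) .event

/-- The whole program. An instance without edges is answered at once. -/
def main : Cmd :=
  .seq (.assign .y (.get .off (.var .a))) <|
  -- Without edges the time bound is a constant, so not even a loop over the men is affordable. The
  -- value in `y` is the end of the last adjacency list, that is, the number of edges.
  .ite (.lit 0) (.var .y)
    (.seq .initLists <| .seq .initTable <| .seq (.assign .go (.lit 1)) .loop)
    (.assign .ans (.lit 1))

end Cmd

/-- The named registers and arrays of a memory. -/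
def Memory.env (s : Memory) : Env := ⟨fun r => s.reg r.idx, fun A => s.arr A.idx⟩

theorem Memory.rep_env (s : Memory) : s.env.Rep s := ⟨fun _ => rfl, fun _ => rfl⟩

section Main

variable {a b B : ℕ} {I : Market (Fin a) (Fin b)} {off adj mark : ℕ → ℕ} {σ : Env}
  {t : Fin a → Fin b ⊕ Fin a → ℕ}

/-- The final event need not lower the potential. Adding the register `go`, which drops from `1` to
`0` with the answer, makes every event decrease the measure. -/
theorem wp_loop (hB : Big a b B) (h : σ.Running I off adj mark) (hgo : σ.v .go = 1)
    (hL : Layout I off adj mark) (hJ : I.withDummies.Ranked t Sum.inr)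
    (hmt : I.MenTied) (hw : I.WomenAsymmetric) (hm : I.edges.ncard + 1 ≤ B) :
    WP B .loop σ fun t τ =>
      t ≤ (3000 * ((a + 1) * (b + 1)) + 4) * (σ.potential I off + 1) + 4 ∧ τ.Answered I := by
  rw [Cmd.loop]
  refine WP.while_rule (T := 3000 * ((a + 1) * (b + 1)))
    (μ := fun τ => τ.potential I off + τ.v .go)
    (Inv := fun τ => (τ.v .go = 1 ∧ τ.Running I off adj mark) ∨ (τ.v .go = 0 ∧ τ.Answered I))
    (Or.inl ⟨hgo, h⟩) (fun _ _ _ => ⟨Nat.zero_le _, trivial⟩) ?_ ?_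
  · intro τ _ hi hlt
    simp only [Ex.eval] at hlt
    obtain ⟨h1, h2⟩ | ⟨h1, -⟩ := hi
    swap
    · omega
    refine (wp_event hB h2 hL hJ hmt hw hm).mono ?_
    rintro k τ' - ⟨hk, had⟩
    have hle : τ'.potential I off + τ'.v .go < τ.potential I off + τ.v .go := by
      obtain ⟨h3, -, h4⟩ | ⟨h3, -, h4⟩ := had <;> omega
    refine ⟨had.imp (fun ⟨h3, h4, _⟩ => ⟨by omega, h4⟩) fun ⟨h3, h4, _⟩ => ⟨h3, h4⟩, hle,
      hk.trans (Nat.le_mul_of_pos_right _ (by omega))⟩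
  · intro k τ _ hi hlt hk _
    simp only [Ex.eval] at hlt
    obtain ⟨h1, -⟩ | ⟨-, h1⟩ := hi
    · omega
    refine ⟨hk.trans ?_, h1⟩
    simp only [Ex.cost, hgo]
    exact Nat.add_le_add_right (Nat.mul_le_mul le_rfl (Nat.sub_le _ _)) _

theorem simulates_initial {x : Arrays} (hlo : ∀ u < a, x.lo u = off u)
    (hhi : ∀ u < a, x.hi u = off u) (hL : Layout I off adj mark) (hst : x.st = fun _ => 0) (hrej : x.rej = fun _ => 0)
    (hever : x.ever = fun _ => 0) :
    x.Simulates I off adj mark (Config.initial (Fin a) (Fin b ⊕ Fin a)) := by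
  have htie : ∀ (u : Fin a) (w : Fin b), ¬ x.tie adj u w := by
    rintro u w ⟨i, h1, h2, -⟩
    rw [hlo u u.2] at h1
    rw [hhi u u.2] at h2
    omega
  constructor
  · exact fun u hu => (hlo u hu).ge
  · exact fun u hu => by rw [hlo u hu, hhi u hu]
  · exact fun u hu => (hhi u hu).trans_le (hL.off_le u hu)
  · exact fun u hu => Or.inr (hhi u hu)
  · exact fun u _ h => (h (by rw [hst])).elim
  · exact fun u hu => Or.inl (hlo u hu)
  · exact fun u hu => Or.inl (hhi u hu)
  · intro u hu k h1 h2
    rw [hlo u hu] at h1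
    rw [hhi u hu] at h2
    omega
  · simp [hst]
  · intro u w
    rw [hhi u u.2]
    refine iff_of_false (fun h => h) ?_
    rintro ⟨i, h1, h2, -⟩
    omega
  · exact fun u v h => h.elim
  · intro u w _
    refine iff_of_false (fun h => h) ?_
    simp [hst, hrej]
  · intro w
    refine iff_of_false (fun h => h) ?_
    simp [hever]
  · exact fun u _ w h => (htie u w h).elim
  · intro u h
    simp [hst] at h

theorem card_freeEdges_le {rej mm : ℕ → ℕ} : (freeEdges I rej mm).card ≤ I.edges.ncard := by
  rw [← Set.ncard_coe_finset]
  exact Set.ncard_le_ncard fun e he => (mem_freeEdges.1 (Finset.mem_coe.1 he)).1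

theorem Layout.menPotential_eq (hL : Layout I off adj mark) {hi st : ℕ → ℕ}
    (hhi : ∀ u < a, hi u = off u) (hst : st = fun _ => 0) :
    menPotential a off hi st = 4 * I.edges.ncard := by
  have key : ∀ k ≤ a, ∑ u ∈ Finset.range k, (4 * (off (u + 1) - hi u) + st u) = 4 * off k := by
    intro k hk
    induction k with
    | zero => simp [hL.off_zero]
    | succ k ih =>
      have h1 := hL.off_le k (by omega)
      rw [Finset.sum_range_succ, ih (by omega), hhi k (by omega), hst]
      simp only
      omega
  rw [menPotential, key a le_rfl, hL.off_last]

theorem Market.ncard_edges_le (I : Market (Fin a) (Fin b)) : I.edges.ncard ≤ a * b := by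
  refine (Set.ncard_le_ncard (Set.subset_univ _)).trans_eq ?_
  simp [Set.ncard_univ]

/-- The empty matching is strongly stable here, so the correctness of the algorithm applies: some
execution has an output, and its restriction can only be empty. The zero array represents it. -/
theorem answered_of_ncard_eq_zero (hm : I.MenTied) (hw : I.WomenAsymmetric)
    (h0 : I.edges.ncard = 0) (hans : σ.v .ans = 1) (hmm : σ.arr .mm = fun _ => 0) :
    σ.Answered I := by
  have he : I.edges = ∅ := (Set.ncard_eq_zero (Set.toFinite _)).1 h0
  obtain ⟨t, hJ⟩ := Market.withDummies_ranked hm hw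
  obtain ⟨c, o, hc, hloc⟩ := Config.exists_output hJ Relation.ReflTransGen.refl
  have hss : I.StronglyStable ∅ := by
    refine ⟨⟨Set.empty_subset _, fun _ _ _ h => h.elim, fun _ _ _ h => h.elim⟩, ?_⟩
    rintro u w ⟨h, -⟩
    rw [he] at h
    exact h
  obtain ⟨-, -, -, -, -, -, -, h8⟩ := execution_correct I hm hw
  obtain ⟨M, rfl, hM⟩ := h8 ⟨∅, hss⟩ c hc o hloc
  refine ⟨c, hc, Or.inl ⟨M, hloc, hM, hans, fun u => ⟨fun w => ?_, fun _ => by rw [hmm]⟩⟩⟩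
  refine iff_of_false (fun h => ?_) (by simp [hmm])
  have := hM.1.1 h
  rw [he] at this
  exact this

/-- The cube in the bound for the words accommodates the indices of the comparison table. There are
at most `5 * m + 1` events for `m` edges, each within a multiple of `(a + 1) * (b + 1)` steps, so
the term with the squared number of edges is not needed in the estimate. -/
theorem wp_main (P : Presentation I) (hB : (a + b + 2) ^ 3 ≤ B) (hm : I.MenTied)
    (hw : I.WomenAsymmetric) :
    WP B .main P.memory.env fun t τ =>
      t ≤ 30000 * (I.edges.ncard * (a + b) ^ 2 + I.edges.ncard ^ 2 + 1) ∧ τ.Answered I := by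
  have hmab := I.ncard_edges_le
  have hcube : (a + b + 2) * ((a + b + 2) * (a + b + 2)) ≤ B := by
    refine le_trans (le_of_eq ?_) hB
    ring
  have hsq : (a + b + 2) * 2 ≤ (a + b + 2) * (a + b + 2) := Nat.mul_le_mul le_rfl (by omega)
  have hsq' : (a + b + 2) * (a + b + 2) * 2 ≤ (a + b + 2) * ((a + b + 2) * (a + b + 2)) := by
    rw [mul_comm]
    exact Nat.mul_le_mul (by omega) le_rfl
  have hab : a * b + 1 ≤ (a + b + 2) * (a + b + 2) := by nlinarith
  have hma : I.edges.ncard * a ≤ B := by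
    refine le_trans ?_ hcube
    rw [mul_comm]
    exact Nat.mul_le_mul (by omega) (by omega)
  have hbig : Big a b B := by
    refine ⟨by omega, by omega, by omega, by omega, le_trans ?_ hcube⟩
    rw [mul_assoc]
    exact Nat.mul_le_mul (by omega) (Nat.mul_le_mul (by omega) (by omega))
  have hL := P.layout
  obtain ⟨t, hJ⟩ := Market.withDummies_ranked hm hw
  generalize hmdef : I.edges.ncard = m at *
  have e0 : P.memory.env.arr .off (P.memory.env.v .a) = m := by
    rw [← hmdef]
    exact hL.off_last
  rw [Cmd.main, WP.seq_iff, WP.assign_iff]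
  refine ⟨trivial, ?_⟩
  rw [WP.ite_iff]
  simp only [Ex.Fits, Ex.eval, Ex.cost, Env.set_v, if_true, Nat.zero_le, true_and, e0]
  refine ⟨fun hpos => ?_, fun hpos => ?_⟩
  swap
  · rw [WP.assign_iff]
    refine ⟨by simp only [Ex.Fits]; omega, by simp only [Ex.cost]; omega, ?_⟩
    refine answered_of_ncard_eq_zero hm hw (by omega) ?_ ?_
    · simp [Ex.eval]
    · rfl
  rw [WP.seq_iff]
  refine (wp_initLists hbig (by simp; rfl)).mono ?_
  rintro t₁ σ₁ hf₁ ⟨ht₁, hlist⟩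
  have hA₁ : ∀ A, A ≠ .lo → A ≠ .hi → σ₁.arr A = P.memory.env.arr A := fun A h1 h2 =>
    hf₁.2 A (by simp [Cmd.initLists, Cmd.stores_for, Cmd.Stores, h1, h2])
  have hv₁ : ∀ r, r = .a ∨ r = .b → σ₁.v r = P.memory.env.v r := fun r h1 => by
    rw [hf₁.1 r (by
      rcases h1 with rfl | rfl <;> simp [Cmd.initLists, Cmd.writes_for, Cmd.Writes])]
    rcases h1 with rfl | rfl <;> simp
  rw [WP.seq_iff]
  refine (wp_initTable hbig (hv₁ .a (by simp)) (hv₁ .b (by simp)) (hA₁ .coff (by simp) (by simp))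
    (hA₁ .cfst (by simp) (by simp)) (hA₁ .csnd (by simp) (by simp)) P.compLayout
    (by rw [hmdef]; exact hma) (hA₁ .cmp (by simp) (by simp))).mono ?_
  rintro t₂ σ₂ hf₂ ⟨ht₂, hcmp⟩
  have hA₂ : ∀ A, A ≠ .cmp → σ₂.arr A = σ₁.arr A := fun A h1 =>
    hf₂.2 A (by simp [Cmd.initTable, Cmd.stores_for, Cmd.Stores, h1])
  have hv₂ : ∀ r, r = .a ∨ r = .b → σ₂.v r = σ₁.v r := fun r h1 => hf₂.1 r (by
      rcases h1 with rfl | rfl <;> simp [Cmd.initTable, Cmd.writes_for, Cmd.Writes])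
  have hA : ∀ A, A ≠ .lo → A ≠ .hi → A ≠ .cmp → σ₂.arr A = P.memory.env.arr A :=
    fun A h1 h2 h3 => (hA₂ A h3).trans (hA₁ A h1 h2)
  have hmm : σ₂.arr .mm = fun _ => 0 := hA .mm (by simp) (by simp) (by simp)
  have hmw : σ₂.arr .mw = fun _ => 0 := hA .mw (by simp) (by simp) (by simp)
  have hst : σ₂.arr .st = fun _ => 0 := hA .st (by simp) (by simp) (by simp)
  have hhi : ∀ u < a, σ₂.arr .hi u = P.memory.arr 0 u := fun u hu => by
    rw [hA₂ _ (by simp)]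
    exact (hlist u hu).2
  have hrun : (σ₂.set .go 1).Running I (P.memory.arr 0) (P.memory.arr 1) (P.memory.arr 2) := by
    refine ⟨⟨?_, ?_, ?_, ?_, ?_, hcmp⟩, ⟨_, Relation.ReflTransGen.refl, Or.inl rfl,
      simulates_initial ?_ hhi hL hst (hA .rej (by simp) (by simp) (by simp))
        (hA .ever (by simp) (by simp) (by simp))⟩, ?_, ?_⟩
    · exact (hv₂ .a (by simp)).trans (hv₁ .a (by simp))
    · exact (hv₂ .b (by simp)).trans (hv₁ .b (by simp))
    · exact hA .off (by simp) (by simp) (by simp)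
    · exact hA .adj (by simp) (by simp) (by simp)
    · exact hA .mark (by simp) (by simp) (by simp)
    · intro u hu
      exact (congrFun (hA₂ .lo (by simp)) u).trans (hlist u hu).1
    · rw [Env.set_arr, hmm, hmw]
      exact ⟨fun _ _ => Nat.zero_le _, fun _ _ => Nat.zero_le _, fun _ _ _ _ => by simp⟩
    · intro u _ w _ h
      rw [Env.set_arr, hmm] at h
      exact (Nat.succ_ne_zero w h.symm).elim
  rw [WP.seq_iff, WP.assign_iff]
  refine ⟨show 1 ≤ B by omega, (wp_loop hbig hrun (by simp) hL hJ hm hw ?_).mono ?_⟩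
  · rw [hmdef]
    omega
  rintro t₃ τ - ⟨ht₃, hans⟩
  have hpot : (σ₂.set .go 1).potential I (P.memory.arr 0) ≤ 5 * m := by
    have h1 := hL.menPotential_eq hhi hst
    have h2 := card_freeEdges_le (I := I) (rej := σ₂.arr .rej) (mm := σ₂.arr .mm)
    rw [hmdef] at h1 h2
    rw [Env.potential, Env.set_arr, h1]
    omega
  refine ⟨?_, hans⟩
  -- An edge exists, so both sides are nonempty; this makes `(a + 1) * (b + 1)` at most `(a + b) ^
  -- 2`.
  have ha : 1 ≤ a := Nat.pos_of_ne_zero (by rintro rfl; omega)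
  have hb : 1 ≤ b := Nat.pos_of_ne_zero (by rintro rfl; omega)
  rw [hmdef] at ht₂
  obtain ⟨N, hN⟩ : ∃ N, N = (a + b) ^ 2 := ⟨_, rfl⟩
  have hN1 : (a + 1) * (b + 1) ≤ N := by rw [hN]; nlinarith
  have hN2 : a + 1 ≤ N := le_trans (Nat.le_mul_of_pos_right _ (by omega)) hN1
  have hN3 : b + 1 ≤ N := le_trans (Nat.le_mul_of_pos_left _ (by omega)) hN1
  have h1 : N ≤ m * N := Nat.le_mul_of_pos_left _ hpos
  have h2 : m * a ≤ m * N := Nat.mul_le_mul le_rfl (by omega)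
  have h3 : (3000 * ((a + 1) * (b + 1)) + 4) * ((σ₂.set .go 1).potential I (P.memory.arr 0) + 1) ≤
      (3004 * N) * (6 * m) := Nat.mul_le_mul (by omega) (by omega)
  have h4 : (3004 * N) * (6 * m) = 18024 * (m * N) := by ring
  simp only [Ex.cost]
  rw [← hN]
  omega

end Main

end PairwiseMarket

theorem mainTheorem1 :
    -- the algorithm, on every finite market with ties on one side and asymmetric preferences on
    -- the other side
    (∀ (U W : Type*) [Finite U] [Finite W] (I : PairwiseMarket.Market U W),
      I.MenTied → I.WomenAsymmetric →
      -- the role of the dummy women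
      (∀ M, PairwiseMarket.IsMatching I.withDummies.edges M →
        (I.withDummies.StronglyStable M ↔
          I.StronglyStable (PairwiseMarket.restrict M) ∧
            ∀ u, PairwiseMarket.CoversMan M u)) ∧
      -- no infinite execution, and an execution cannot get stuck before the output
      (¬ ∃ f : ℕ → PairwiseMarket.Config U (W ⊕ U),
        f 0 = PairwiseMarket.Config.initial U (W ⊕ U) ∧
          ∀ i, PairwiseMarket.Config.Step I.withDummies (f i) (f (i + 1))) ∧
      (∀ c, PairwiseMarket.Reachable I c →
        (∃ c', PairwiseMarket.Config.Step I.withDummies c c') ∨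
          ∃ o, c.loc = PairwiseMarket.Loc.output o) ∧
      -- no edge of a strongly stable matching is ever rejected
      (∀ c, PairwiseMarket.Reachable I c → ∀ M, I.withDummies.StronglyStable M →
        ∀ e ∈ c.rejected, e ∉ M) ∧
      -- women who have ever had an active edge are matched in all strongly stable matchings
      (∀ c, PairwiseMarket.Reachable I c → ∀ M, I.withDummies.StronglyStable M →
        ∀ w ∈ c.everActive, PairwiseMarket.CoversWoman M w) ∧
      -- a matching that is output is strongly stable
      (∀ c, PairwiseMarket.Reachable I c → ∀ M, c.loc = PairwiseMarket.Loc.output (some M) →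
        I.withDummies.StronglyStable M ∧ I.StronglyStable (PairwiseMarket.restrict M)) ∧
      -- if there is a strongly stable matching, then each maximum matching in the final graph of
      -- active edges covers all women who have ever held a proposal
      ((∃ M, I.withDummies.StronglyStable M) →
        ∀ c, PairwiseMarket.Reachable I c → ∀ o, c.loc = PairwiseMarket.Loc.output o →
          ∀ M, PairwiseMarket.IsMaximumMatching c.active M →
            ∀ u w, (u, w) ∈ c.proposed → PairwiseMarket.CoversWoman M w) ∧
      -- if there is a strongly stable matching, then one is output
      ((∃ M, I.StronglyStable M) →
        ∀ c, PairwiseMarket.Reachable I c → ∀ o, c.loc = PairwiseMarket.Loc.output o →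
          ∃ M, o = some M ∧ I.StronglyStable (PairwiseMarket.restrict M))) ∧
    -- the running time: one program decides for all instances whether a strongly stable matching
    -- exists, and finds one if it does; its answer is the output of an execution of the algorithm
    (∃ (p : PairwiseMarket.Prog) (C : ℕ),
      ∀ (a b : ℕ) (I : PairwiseMarket.Market (Fin a) (Fin b)),
        I.MenTied → I.WomenAsymmetric → ∀ P : PairwiseMarket.Presentation I,
          ∃ (t : ℕ) (s : PairwiseMarket.Memory) (c : PairwiseMarket.Config (Fin a) (Fin b ⊕ Fin a)),
            PairwiseMarket.Exec ((a + b + 2) ^ C) p P.memory t s ∧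
            t ≤ C * (I.edges.ncard * (a + b) ^ 2 + I.edges.ncard ^ 2 + 1) ∧
            PairwiseMarket.Reachable I c ∧
            ((∃ M, c.loc = PairwiseMarket.Loc.output (some M) ∧
                I.StronglyStable (PairwiseMarket.restrict M) ∧
                PairwiseMarket.AnswersMatching s (PairwiseMarket.restrict M)) ∨
              (c.loc = PairwiseMarket.Loc.output none ∧
                (¬ ∃ M, I.StronglyStable M) ∧ PairwiseMarket.AnswersNone s))) := by
  -- One constant serves both as the exponent of the word bound, for which `3` would do, and as the
  -- factor of the running time.
  obtain ⟨C, hC₃, hC⟩ : ∃ C, 3 ≤ C ∧ 30000 ≤ C := ⟨30000, by norm_num, le_rfl⟩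
  refine ⟨fun U W _ _ I hm hw => PairwiseMarket.execution_correct I hm hw,
    PairwiseMarket.Cmd.main.compile, C, fun a b I hm hw P => ?_⟩
  obtain ⟨t, τ, hrun, ht, c, hc, hans⟩ := PairwiseMarket.wp_main P
    (B := (a + b + 2) ^ C) (Nat.pow_le_pow_right (by omega) hC₃) hm hw
  obtain ⟨s, hs, hrep⟩ := hrun.exec P.memory.rep_env
  refine ⟨t, s, c, hs, ht.trans (Nat.mul_le_mul_right _ hC), hc, ?_⟩
  obtain ⟨M, h1, h2, h3, h4⟩ | ⟨h1, h2, h3⟩ := hans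
  · refine Or.inl ⟨M, h1, h2, (hrep.1 .ans).trans h3, fun u => ?_⟩
    have := congrFun (hrep.2 .mm) u
    change s.arr 8 u = _ at this
    rw [this]
    exact h4 u
  · exact Or.inr ⟨h1, h2, (hrep.1 .ans).trans h3⟩
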